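/- **Setting.** Let $F$ be a field of characteristic $0$ and $k$ a nonzero semisimple ring containing $F$ in its centre such that $k^e=k\otimes_F k^{op}$ is semisimple. Let $V$ be a $k$-bimodule on which the left and the right actions of $F$ agree, and let $N\ge 2$. All unadorned tensor products are over $k$; $TV=\bigoplus_n V^{\otimes n}$ is the tensor algebra of $V$, $F^n=\bigoplus_{i\le n}V^{\otimes i}$, and $\pi_N:TV\to V^{\otimes N}$ is the projection. For a sub-bimodule $R\subseteq V^{\otimes N}$ the graded algebra $A=TV/\langle R\rangle$ is called *$N$-homogeneous*, and $A/k$ is identified with $I_+=\bigoplus_{n>0}A_n$; for $\alpha\in TV$, $\bar\alpha$ denotes its class in $A/k$. For a $k^e$-linear map $f:W\to X$ into an $A$-bimodule, $f^{\sim}:A\otimes W\otimes A\to X$ is its $A^e$-linear extension. For $\alpha=v_1\cdots v_n$ put $\alpha_{(1)}\otimes\bar\alpha_{(2)}\otimes\alpha_{(3)}=\sum_{i=1}^n v_1\cdots v_{i-1}\otimes v_i\otimes v_{i+1}\cdots v_n$, extended linearly to $TV$ (it is $0$ for $n=0$). *Complexes.* $\bar C_n=A\otimes(A/k)^{\otimes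 n}\otimes A$ with the reduced Hochschild differentials $\bar b_n(1|a_1|\cdots|a_n|1)=a_1|a_2|\cdots|a_n|1+\sum_{0<i<n}(-1)^i1|a_1|\cdots|a_ia_{i+1}|\cdots|a_n|1+(-1)^n1|a_1|\cdots|a_n$; and $K_0=A\otimes A$, $K_1=A\otimes V\otimes A$, $K_2=A\otimes R\otimes A$ with $d_1(1|v|1)=v|1-1|v$ and $d_2(1|r|1)=r_{(1)}|\bar r_{(2)}|r_{(3)}$. Put $\bar\sigma_0=\mathrm{id}$, $\bar\sigma_1(1|v|1)=1|v|1$, $\bar\sigma_2(1|r|1)=1|r_{(1)}|\bar r_{(2)}|r_{(3)}$. A *relation decomposition* is a finite sum $\sum_i\alpha_i\otimes\beta_i$ of tensors of homogeneous elements of $TV$ of positive degrees, with $\deg\alpha_i+\deg\beta_i=N$ and $\sum_i\alpha_i\beta_i\in R$. A *comparison datum* consists of homogeneous $A^e$-linear maps of degree $0$, $\bar\tau_n:\bar C_n\to K_n$ and $s_n:\bar C_n\to\bar C_{n+1}$ ($n=1,2$), such that, with $\bar\tau_0=\mathrm{id}$ and $s_0=0$, one has $d_n\bar\tau_n=\bar\tau_{n-1}\bar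 b_n$ and $\bar b_{n+1}s_n+s_{n-1}\bar b_n=\mathrm{id}-\bar\sigma_n\bar\tau_n$ for $n=1,2$, and which take the following values: * for homogeneous $\alpha\in TV$ with $\deg\alpha<N$: $\bar\tau_1(1|\bar\alpha|1)=\alpha_{(1)}|\bar\alpha_{(2)}|\alpha_{(3)}$ and $s_1(1|\bar\alpha|1)=-1|\alpha_{(1)}|\bar\alpha_{(2)}|\alpha_{(3)}$; * for homogeneous $\alpha,\beta\in TV$ with $\deg\alpha+\deg\beta<N$: $\bar\tau_2(1|\bar\alpha|\bar\beta|1)=0$ and $s_2(1|\bar\alpha|\bar\beta|1)=1|\alpha|\beta_{(1)}|\bar\beta_{(2)}|\beta_{(3)}$; * for every relation decomposition $\sum_i\alpha_i\otimes\beta_i$, with $r=\sum_i\alpha_i\beta_i$: $\bar\tau_2(\sum_i1|\bar\alpha_i|\bar\beta_i|1)=1|r|1$ and $s_2(\sum_i1|\bar\alpha_i|\bar\beta_i|1)=\sum_i1|\alpha_i|\beta_{i,(1)}|\bar\beta_{i,(2)}|\beta_{i,(3)}$. *Deformations.* A graded deformation $A_t$ of $A$ (preserving the unit) is a graded $k[t]$-algebra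 structure on the $k[t]$-bimodule $A[t]$ ($\deg t=1$), with unit $1_A$, reducing to $A$ modulo $t$. Its product is given on $A$ by $a\times b=ab+\sum_{j\ge1}\psi_j(a,b)t^j$ with $k^e$-linear maps $\psi_j:(A/k)^{\otimes2}\to A$. The maps $\psi_j$ are *normalized* if $\psi_j(a,b)=0$ for all homogeneous $a,b\in I_+$ with $\deg a+\deg b<N$. *Rees algebras.* For $P\subseteq TV$ let $U=TV/\langle P\rangle$, with the filtration $F^\bullet U$ induced by $F^\bullet$. Then $R(U)=\bigoplus_nF^nU\,t^n\subseteq U[t]$ is a graded $k[t]$-algebra. There is a canonical map $A\to \mathrm{gr}(U)\simeq R(U)/\langle t\rangle$ sending the class of $\alpha\in V^{\otimes n}$ to the class of $\alpha t^n$ (whenever it is well defined). *Weak PBW-deformations.* Let $P\subseteq F^N$ be a sub-bimodule, $R=\pi_N(P)$ and $A=TV/\langle R\rangle$. Then $U=TV/\langle P\rangle$ is a *weak PBW-deformation* of $A$ if $P\cap F^{N-1}=0$, so that $P=\{r-\sum_{j=0}^{N-1}\varphi_j(r):r\in R\}$ for unique $k^e$-linear maps $\varphi_j:R\to V^{\otimes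 j}$, and if the maps $\theta_j=\varphi_j\otimes1_V-1_V\otimes\varphi_j$ on $R_{N+1}=(R\otimes V)\cap(V\otimes R)$ satisfy $\theta_{N-1}(R_{N+1})\subseteq R$, $\varphi_j\circ\theta_{N-1}+\theta_{j-1}=0$ for $0<j<N$, and $\varphi_0\circ\theta_{N-1}=0$. **Theorem.** (1) Let $A=TV/\langle R\rangle$ be an $N$-homogeneous algebra such that $\mathrm{Tor}_3^A(k,k)$ is concentrated in degree $N+1$, and let $A_t$ be a graded deformation of $A$ given by normalized maps $\psi_j$, $j\ge1$. For $0\le j<N$ let $\varphi_j:R\to A_j\simeq V^{\otimes j}$ be given by $\varphi_j^{\sim}=\psi_{N-j}^{\sim}\circ\bar\sigma_2$, let $P=\{r-\sum_{j=0}^{N-1}\varphi_j(r):r\in R\}$ and $U=TV/\langle P\rangle$. Then the canonical map $A\to R(U)/\langle t\rangle$ is a well defined isomorphism, and there is an isomorphism of graded $k[t]$-algebras $R(U)\to A_t$ for which the composition $A\simeq R(U)/\langle t\rangle\to A_t/\langle t\rangle\simeq A$ is the identity. (2) Conversely, let $P\subseteq F^N$ be a sub-bimodule, $R=\pi_N(P)$,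 $A=TV/\langle R\rangle$, suppose that $U=TV/\langle P\rangle$ is a weak PBW-deformation of $A$, with maps $\varphi_j$, and that $\mathrm{Tor}_3^A(k,k)$ is concentrated in degree $N+1$. Then comparison data exist. For each of them define $k^e$-linear maps $(A/k)^{\otimes 2}\to A$ by $(\psi'_j)^{\sim}=\varphi_{N-j}^{\sim}\circ\bar\tau_2$ for $1\le j\le N$, $\psi'_j=0$ for $j>N$, $\psi_1=\psi'_1$ and, for $j\ge1$, $$\psi_{j+1}=\psi'_{j+1}-\eta_{j+1},\qquad \eta_{j+1}^{\sim}=(\psi'_{j+1})^{\sim}\circ\bar b_3\circ s_2+\mathrm{sq}(\psi_1,\dots,\psi_j)^{\sim}\circ s_2,$$ where $\mathrm{sq}(\psi_1,\dots,\psi_j)(a,b,c)=\sum_{i=1}^{j}\big(\psi_i(a,\psi_{j+1-i}(b,c))-\psi_i(\psi_{j+1-i}(a,b),c)\big)$. Then the maps $\psi_j$ are normalized, $a\times b=ab+\sum_{j\ge1}\psi_j(a,b)t^j$ defines a graded deformation $A_t$ of $A$, the canonical map $A\to R(U)/\langle t\rangle$ is a well defined isomorphism, and there is an isomorphism of graded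 $k[t]$-algebras $R(U)\to A_t$ for which the composition $A\simeq R(U)/\langle t\rangle\to A_t/\langle t\rangle\simeq A$ is the identity. -/

import Mathlib

open MulOpposite
open scoped TensorProduct Polynomial

noncomputable section

namespace PBW

universe u v w

/-! ### Bimodules and their homomorphisms

A bimodule over a (not necessarily commutative) ring `k` is an additive group `M` with commuting
actions of `k` (on the left) and of `kᵐᵒᵖ` (on the right): `m · c` is `op c • m`. -/

section Bimodules

variable (k : Type*) [Ring k]

/-- The additive group of homomorphisms of `k`-bimodules from `M` to `N`. -/
def biHoms (M N : Type*) [AddCommGroup M] [Module k M] [Module kᵐᵒᵖ M]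
    [AddCommGroup N] [Module k N] [Module kᵐᵒᵖ N] : AddSubgroup (M →+ N) where
  carrier := {f | (∀ (c : k) (m : M), f (c • m) = c • f m) ∧
    ∀ (c : k) (m : M), f (op c • m) = op c • f m}
  zero_mem' := by constructor <;> intros <;> simp
  add_mem' := by
    rintro f g ⟨hf, hf2⟩ ⟨hg, hg2⟩
    constructor <;> intros <;> simp [*]
  neg_mem' := by
    rintro f ⟨hf, hf2⟩
    constructor <;> intros <;> simp [*]

/-- Homomorphisms of `k`-bimodules. -/
abbrev BiHom (M N : Type*) [AddCommGroup M] [Module k M] [Module kᵐᵒᵖ M]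
    [AddCommGroup N] [Module k N] [Module kᵐᵒᵖ N] : Type _ := biHoms k M N

variable {k} {M N L : Type*} [AddCommGroup M] [Module k M] [Module kᵐᵒᵖ M]
  [AddCommGroup N] [Module k N] [Module kᵐᵒᵖ N] [AddCommGroup L] [Module k L] [Module kᵐᵒᵖ L]

instance : CoeFun (BiHom k M N) (fun _ => M → N) := ⟨fun f => f.1⟩

theorem BiHom.map_smul (f : BiHom k M N) (c : k) (m : M) : f (c • m) = c • f m := f.2.1 c m

theorem BiHom.map_op_smul (f : BiHom k M N) (c : k) (m : M) : f (op c • m) = op c • f m :=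
  f.2.2 c m

theorem BiHom.map_add (f : BiHom k M N) (x y : M) : f (x + y) = f x + f y := f.1.map_add x y

/-- Composition of bimodule homomorphisms. -/
def BiHom.comp (g : BiHom k N L) (f : BiHom k M N) : BiHom k M L :=
  ⟨g.1.comp f.1, by
    constructor <;> intros <;> simp [BiHom.map_smul, BiHom.map_op_smul]⟩

/-- The identity homomorphism. -/
def BiHom.id (k : Type*) [Ring k] (M : Type*) [AddCommGroup M] [Module k M] [Module kᵐᵒᵖ M] :
    BiHom k M M := ⟨AddMonoidHom.id M, by constructor <;> intros <;> simp⟩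

/-- Sub-bimodules of a `k`-bimodule. -/
structure SubBimod (k : Type*) [Ring k] (M : Type*) [AddCommGroup M] [Module k M]
    [Module kᵐᵒᵖ M] extends AddSubgroup M where
  smul_mem' : ∀ (c : k) {m : M}, m ∈ carrier → c • m ∈ carrier
  op_smul_mem' : ∀ (c : k) {m : M}, m ∈ carrier → op c • m ∈ carrier

instance : SetLike (SubBimod k M) M where
  coe S := S.carrier
  coe_injective := by
    rintro ⟨⟨⟨⟨_, _⟩, _⟩, _⟩, _, _⟩ ⟨⟨⟨⟨_, _⟩, _⟩, _⟩, _, _⟩ h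
    cases h
    rfl

instance : AddSubgroupClass (SubBimod k M) M where
  add_mem {S} _ _ ha hb := S.add_mem' ha hb
  zero_mem S := S.zero_mem'
  neg_mem {S} _ ha := S.neg_mem' ha

instance (S : SubBimod k M) : Module k S where
  smul c x := ⟨c • x.1, S.smul_mem' c x.2⟩
  one_smul x := Subtype.ext (one_smul k x.1)
  mul_smul c d x := Subtype.ext (mul_smul c d x.1)
  smul_zero c := Subtype.ext (smul_zero c)
  smul_add c x y := Subtype.ext (smul_add c x.1 y.1)
  add_smul c d x := Subtype.ext (add_smul c d x.1)
  zero_smul x := Subtype.ext (zero_smul k x.1)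

instance (S : SubBimod k M) : Module kᵐᵒᵖ S where
  smul c x := ⟨c • x.1, S.op_smul_mem' c.unop x.2⟩
  one_smul x := Subtype.ext (one_smul kᵐᵒᵖ x.1)
  mul_smul c d x := Subtype.ext (mul_smul c d x.1)
  smul_zero c := Subtype.ext (smul_zero c)
  smul_add c x y := Subtype.ext (smul_add c x.1 y.1)
  add_smul c d x := Subtype.ext (add_smul c d x.1)
  zero_smul x := Subtype.ext (zero_smul kᵐᵒᵖ x.1)

theorem SubBimod.coe_smul (S : SubBimod k M) (c : k) (x : S) : ((c • x : S) : M) = c • (x : M) :=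
  rfl

theorem SubBimod.coe_op_smul (S : SubBimod k M) (c : kᵐᵒᵖ) (x : S) :
    ((c • x : S) : M) = c • (x : M) := rfl

instance [SMulCommClass k kᵐᵒᵖ M] (S : SubBimod k M) : SMulCommClass k kᵐᵒᵖ S where
  smul_comm c d x := Subtype.ext (smul_comm c d x.1)

end Bimodules

/-! ### Tensor products over a noncommutative ring -/

section BalancedTensor

variable (k : Type*) [Ring k] (M N : Type*) [AddCommGroup M] [Module kᵐᵒᵖ M]
  [AddCommGroup N] [Module k N]

/-- The subgroup of `M ⊗_ℤ N` generated by the elements `m c ⊗ n - m ⊗ c n`. -/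
def balRel : AddSubgroup (M ⊗[ℤ] N) :=
  AddSubgroup.closure {z | ∃ (m : M) (c : k) (n : N), z = (op c • m) ⊗ₜ[ℤ] n - m ⊗ₜ[ℤ] (c • n)}

/-- The tensor product `M ⊗_k N` of a right `k`-module `M` and a left `k`-module `N`. -/
def BT : Type _ := (M ⊗[ℤ] N) ⧸ balRel k M N

instance : AddCommGroup (BT k M N) := inferInstanceAs (AddCommGroup ((M ⊗[ℤ] N) ⧸ balRel k M N))

namespace BT

variable {M N}

/-- The quotient map from the tensor product over `ℤ`. -/
def mk : M ⊗[ℤ] N →+ BT k M N := QuotientAddGroup.mk' (balRel k M N)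

/-- The pure tensor `m ⊗ n`. -/
def tmul (m : M) (n : N) : BT k M N := mk k (m ⊗ₜ[ℤ] n)

theorem add_tmul (m m' : M) (n : N) : tmul k (m + m') n = tmul k m n + tmul k m' n := by
  rw [tmul, TensorProduct.add_tmul, map_add]; rfl

theorem tmul_add (m : M) (n n' : N) : tmul k m (n + n') = tmul k m n + tmul k m n' := by
  rw [tmul, TensorProduct.tmul_add, map_add]; rfl

theorem smul_tmul (m : M) (c : k) (n : N) : tmul k (op c • m) n = tmul k m (c • n) := by
  rw [← sub_eq_zero, tmul, tmul, ← map_sub]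
  exact (QuotientAddGroup.eq_zero_iff _).2 (AddSubgroup.subset_closure ⟨m, c, n, rfl⟩)

variable {k}

@[elab_as_elim]
theorem induction {p : BT k M N → Prop} (z : BT k M N) (zero : p 0)
    (tmul : ∀ m n, p (BT.tmul k m n)) (add : ∀ x y, p x → p y → p (x + y)) : p z := by
  obtain ⟨z, rfl⟩ : ∃ y, mk k y = z := QuotientAddGroup.mk'_surjective (balRel k M N) z
  induction z using TensorProduct.induction_on with
  | zero => rw [map_zero]; exact zero
  | tmul m n => exact tmul m n
  | add x y hx hy => rw [map_add]; exact add _ _ hx hy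

/-- The universal property of the tensor product over `k`. -/
def lift {X : Type*} [AddCommGroup X] (f : M → N → X)
    (hl : ∀ m m' n, f (m + m') n = f m n + f m' n) (hr : ∀ m n n', f m (n + n') = f m n + f m n')
    (hb : ∀ m (c : k) n, f (op c • m) n = f m (c • n)) : BT k M N →+ X :=
  QuotientAddGroup.lift (balRel k M N)
    (TensorProduct.liftAddHom (R := ℤ)
      (AddMonoidHom.mk' (fun m => AddMonoidHom.mk' (f m) (hr m))
        (fun m m' => AddMonoidHom.ext (hl m m')))
      (fun r m n => by rw [map_zsmul, map_zsmul]; rfl)) <| by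
    rw [balRel, AddSubgroup.closure_le]
    rintro _ ⟨m, c, n, rfl⟩
    rw [SetLike.mem_coe, AddMonoidHom.mem_ker, map_sub, sub_eq_zero]
    exact hb m c n

@[simp]
theorem lift_tmul {X : Type*} [AddCommGroup X] (f : M → N → X) (hl) (hr) (hb) (m : M) (n : N) :
    lift (k := k) f hl hr hb (tmul k m n) = f m n := rfl

@[ext]
theorem addHom_ext {X : Type*} [AddCommGroup X] {f g : BT k M N →+ X}
    (h : ∀ m n, f (tmul k m n) = g (tmul k m n)) : f = g := by
  ext z
  induction z using BT.induction with
  | zero => simp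
  | tmul m n => exact h m n
  | add x y hx hy => simp [hx, hy]

section Actions

variable {S T : Type*} [Ring S] [Ring T]

/-- Left multiplication by `s` on `M ⊗_k N`, for an `(S, k)`-bimodule `M`. -/
def lsmul [Module S M] [SMulCommClass S kᵐᵒᵖ M] (s : S) : BT k M N →+ BT k M N :=
  lift (fun m n => tmul k (s • m) n) (by intros; rw [smul_add, add_tmul])
    (by intros; rw [tmul_add]) (by intro m c n; rw [smul_comm, smul_tmul])

/-- Right multiplication by `t` on `M ⊗_k N`, for a `(k, T)`-bimodule `N`. -/
def rsmul [Module Tᵐᵒᵖ N] [SMulCommClass k Tᵐᵒᵖ N] (t : Tᵐᵒᵖ) : BT k M N →+ BT k M N :=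
  lift (fun m n => tmul k m (t • n)) (by intros; rw [add_tmul])
    (by intros; rw [smul_add, tmul_add]) (by intro m c n; rw [smul_tmul, smul_comm])

/-- The left module structure on `M ⊗_k N`: `s (m ⊗ n) = (s m) ⊗ n`. -/
instance (priority := low) leftModule [Module S M] [SMulCommClass S kᵐᵒᵖ M] :
    Module S (BT k M N) where
  smul s := lsmul s
  one_smul z := by
    change lsmul (1 : S) z = z
    induction z using BT.induction with
    | zero => simp
    | tmul m n => simp [lsmul]
    | add x y hx hy => simp [hx, hy]
  mul_smul s s' z := by
    change lsmul (s * s') z = lsmul s (lsmul s' z)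
    induction z using BT.induction with
    | zero => simp
    | tmul m n => simp [lsmul, mul_smul]
    | add x y hx hy => simp [hx, hy]
  smul_zero s := map_zero (lsmul s)
  smul_add s := map_add (lsmul s)
  add_smul s s' z := by
    change lsmul (s + s') z = lsmul s z + lsmul s' z
    induction z using BT.induction with
    | zero => simp
    | tmul m n => simp [lsmul, add_smul, add_tmul]
    | add x y hx hy => simp only [map_add, hx, hy]; abel
  zero_smul z := by
    change lsmul (0 : S) z = 0
    induction z using BT.induction with
    | zero => simp
    | tmul m n =>
      have := add_tmul k (0 : M) 0 n
      simp_all [lsmul]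
    | add x y hx hy => simp [hx, hy]

/-- The right module structure on `M ⊗_k N`: `(m ⊗ n) t = m ⊗ (n t)`. -/
instance (priority := low) rightModule [Module Tᵐᵒᵖ N] [SMulCommClass k Tᵐᵒᵖ N] :
    Module Tᵐᵒᵖ (BT k M N) where
  smul t := rsmul t
  one_smul z := by
    change rsmul (1 : Tᵐᵒᵖ) z = z
    induction z using BT.induction with
    | zero => simp
    | tmul m n => simp [rsmul]
    | add x y hx hy => simp [hx, hy]
  mul_smul s s' z := by
    change rsmul (s * s') z = rsmul s (rsmul s' z)
    induction z using BT.induction with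
    | zero => simp
    | tmul m n => simp [rsmul, mul_smul]
    | add x y hx hy => simp [hx, hy]
  smul_zero s := map_zero (rsmul s)
  smul_add s := map_add (rsmul s)
  add_smul s s' z := by
    change rsmul (s + s') z = rsmul s z + rsmul s' z
    induction z using BT.induction with
    | zero => simp
    | tmul m n => simp [rsmul, add_smul, tmul_add]
    | add x y hx hy => simp only [map_add, hx, hy]; abel
  zero_smul z := by
    change rsmul (0 : Tᵐᵒᵖ) z = 0
    induction z using BT.induction with
    | zero => simp
    | tmul m n =>
      have := tmul_add k m (0 : N) 0
      simp_all [rsmul]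
    | add x y hx hy => simp [hx, hy]

@[simp]
theorem smul_tmul_left [Module S M] [SMulCommClass S kᵐᵒᵖ M] (s : S) (m : M) (n : N) :
    s • tmul k m n = tmul k (s • m) n := rfl

@[simp]
theorem smul_tmul_right [Module Tᵐᵒᵖ N] [SMulCommClass k Tᵐᵒᵖ N] (t : T) (m : M) (n : N) :
    op t • tmul k m n = tmul k m (op t • n) := rfl

instance [Module S M] [SMulCommClass S kᵐᵒᵖ M] [Module Tᵐᵒᵖ N] [SMulCommClass k Tᵐᵒᵖ N] :
    SMulCommClass S Tᵐᵒᵖ (BT k M N) where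
  smul_comm s t z := by
    induction z using BT.induction with
    | zero => simp
    | tmul m n => rfl
    | add x y hx hy => simp only [smul_add, hx, hy]

end Actions

section Functoriality

variable {M N L M' N' : Type*}
  [AddCommGroup M] [Module k M] [Module kᵐᵒᵖ M] [SMulCommClass k kᵐᵒᵖ M]
  [AddCommGroup N] [Module k N] [Module kᵐᵒᵖ N] [SMulCommClass k kᵐᵒᵖ N]
  [AddCommGroup L] [Module k L] [Module kᵐᵒᵖ L] [SMulCommClass k kᵐᵒᵖ L]
  [AddCommGroup M'] [Module k M'] [Module kᵐᵒᵖ M'] [SMulCommClass k kᵐᵒᵖ M']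
  [AddCommGroup N'] [Module k N'] [Module kᵐᵒᵖ N'] [SMulCommClass k kᵐᵒᵖ N']

/-- A balanced biadditive map that is `k`-linear on the left in its first argument and on the right
in its second argument gives a homomorphism of bimodules on the tensor product. -/
def liftBi {X : Type*} [AddCommGroup X] [Module k X] [Module kᵐᵒᵖ X] (f : M → N → X)
    (al : ∀ m m' n, f (m + m') n = f m n + f m' n) (ar : ∀ m n n', f m (n + n') = f m n + f m n')
    (hb : ∀ m (c : k) n, f (op c • m) n = f m (c • n))
    (hl : ∀ (c : k) m n, f (c • m) n = c • f m n)
    (hr : ∀ (c : k) m n, f m (op c • n) = op c • f m n) : BiHom k (BT k M N) X :=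
  ⟨lift f al ar hb, by
    constructor <;> intro c z
    · induction z using BT.induction with
      | zero => simp
      | tmul m n => exact hl c m n
      | add x y hx hy => simp only [smul_add, map_add, hx, hy]
    · induction z using BT.induction with
      | zero => simp
      | tmul m n => exact hr c m n
      | add x y hx hy => simp only [smul_add, map_add, hx, hy]⟩

@[simp]
theorem liftBi_tmul {X : Type*} [AddCommGroup X] [Module k X] [Module kᵐᵒᵖ X] (f : M → N → X)
    (al) (ar) (hb) (hl) (hr) (m : M) (n : N) :
    liftBi (k := k) f al ar hb hl hr (tmul k m n) = f m n := rfl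

/-- The tensor product `f ⊗ g` of two homomorphisms of bimodules. -/
def map (f : BiHom k M M') (g : BiHom k N N') : BiHom k (BT k M N) (BT k M' N') :=
  liftBi (fun m n => tmul k (f m) (g n)) (by intros; rw [BiHom.map_add, add_tmul])
    (by intros; rw [BiHom.map_add, tmul_add])
    (by intros; rw [BiHom.map_op_smul, smul_tmul, BiHom.map_smul])
    (by intros; rw [BiHom.map_smul, smul_tmul_left])
    (by intros; rw [BiHom.map_op_smul, smul_tmul_right])

@[simp]
theorem map_tmul (f : BiHom k M M') (g : BiHom k N N') (m : M) (n : N) :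
    map f g (tmul k m n) = tmul k (f m) (g n) := rfl

/-- The reassociation `l ⊗ (m ⊗ n) ↦ (l ⊗ m) ⊗ n`. -/
def reassoc : BiHom k (BT k L (BT k M N)) (BT k (BT k L M) N) :=
  liftBi (fun l => lift (fun m n => tmul k (tmul k l m) n)
      (by intros; rw [tmul_add, add_tmul]) (by intros; rw [tmul_add])
      (by intros; rw [← smul_tmul_right, smul_tmul]))
    (by
      intro l l' z
      induction z using BT.induction with
      | zero => simp
      | tmul m n => simp [add_tmul]
      | add x y hx hy => simp only [map_add, hx, hy]; abel)
    (by intros; rw [map_add])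
    (by
      intro l c z
      induction z using BT.induction with
      | zero => simp
      | tmul m n => simp [smul_tmul]
      | add x y hx hy => simp only [smul_add, map_add, hx, hy])
    (by
      intro c l z
      induction z using BT.induction with
      | zero => simp
      | tmul m n => simp
      | add x y hx hy => simp only [smul_add, map_add, hx, hy])
    (by
      intro c l z
      induction z using BT.induction with
      | zero => simp
      | tmul m n => simp
      | add x y hx hy => simp only [smul_add, map_add, hx, hy])

@[simp]
theorem reassoc_tmul (l : L) (m : M) (n : N) :
    reassoc (tmul k l (tmul k m n)) = tmul k (tmul k l m) n := rfl

end Functoriality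

/-- The grading of `M ⊗_k N` induced by gradings of `M` and `N`: the component of degree `d` is
generated by the `m ⊗ n` with `m` and `n` homogeneous and `deg m + deg n = d`. -/
def grading (G : ℕ → AddSubgroup M) (H : ℕ → AddSubgroup N) (d : ℕ) : AddSubgroup (BT k M N) :=
  AddSubgroup.closure {z | ∃ i j, i + j = d ∧ ∃ m ∈ G i, ∃ n ∈ H j, z = tmul k m n}

end BT
end BalancedTensor

/-- The grading concentrated in the single degree `e`. -/
def concentrated (M : Type*) [AddCommGroup M] (e d : ℕ) : AddSubgroup M :=
  if d = e then ⊤ else ⊥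

/-! ### Algebras over a noncommutative ring -/

/-- A `k`-algebra: a ring `B` with a unital ring homomorphism `k → B`, whose image need not be
central. -/
class KAlg (k B : Type*) [Ring k] [Ring B] where
  unit : k →+* B

section KAlg

variable (k : Type*) {B : Type*} [Ring k] [Ring B] [KAlg k B]

/-- The left `k`-module structure of a `k`-algebra. -/
instance (priority := low) : Module k B := Module.compHom B (KAlg.unit (k := k) (B := B))

/-- The right `k`-module structure of a `k`-algebra. -/
instance (priority := low) : Module kᵐᵒᵖ B :=
  Module.compHom B (RingHom.op (KAlg.unit (k := k) (B := B)))

variable {k}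

theorem KAlg.smul_def (c : k) (b : B) : c • b = KAlg.unit (B := B) c * b := rfl

theorem KAlg.op_smul_def (c : k) (b : B) : op c • b = b * KAlg.unit (B := B) c := rfl

instance : SMulCommClass k kᵐᵒᵖ B where
  smul_comm c d b := (mul_assoc (KAlg.unit (B := B) c) b (KAlg.unit (B := B) d.unop)).symm

instance : SMulCommClass B kᵐᵒᵖ B where
  smul_comm c d b := (mul_assoc c b (KAlg.unit (B := B) d.unop)).symm

instance : SMulCommClass k Bᵐᵒᵖ B where
  smul_comm c d b := (mul_assoc (KAlg.unit (B := B) c) b d.unop).symm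

end KAlg

/-! ### Free bimodules `A ⊗ W ⊗ A` -/

section Free

variable (k A : Type*) [Ring k] [Ring A] [KAlg k A]

/-- The `A`-bimodule `A ⊗_k W ⊗_k A`. -/
abbrev FB (W : Type*) [AddCommGroup W] [Module k W] [Module kᵐᵒᵖ W] [SMulCommClass k kᵐᵒᵖ W] :
    Type _ := BT k A (BT k W A)

/-- `X` is an `A`-bimodule whose underlying `k`-bimodule structure is the one induced by
`k → A`. -/
class Compat (X : Type*) [AddCommGroup X] [Module k X] [Module kᵐᵒᵖ X] [Module A X]
    [Module Aᵐᵒᵖ X] : Prop where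
  unit_smul : ∀ (c : k) (x : X), (KAlg.unit c : A) • x = c • x
  op_unit_smul : ∀ (c : k) (x : X), op (KAlg.unit c : A) • x = op c • x

instance : Compat k A A := ⟨fun _ _ => rfl, fun _ _ => rfl⟩

instance {W : Type*} [AddCommGroup W] [Module k W] [Module kᵐᵒᵖ W] [SMulCommClass k kᵐᵒᵖ W] :
    Compat k A (FB k A W) where
  unit_smul c z := by
    induction z using BT.induction with
    | zero => simp
    | tmul m n => rfl
    | add x y hx hy => simp only [smul_add, hx, hy]
  op_unit_smul c z := by
    induction z using BT.induction with
    | zero => simp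
    | tmul m n =>
      rw [BT.smul_tmul_right, BT.smul_tmul_right]
      refine congrArg _ ?_
      induction n using BT.induction with
      | zero => simp
      | tmul m n => rfl
      | add x y hx hy => simp only [smul_add, hx, hy]
    | add x y hx hy => simp only [smul_add, hx, hy]

instance : Compat k A (BT k A A) where
  unit_smul c z := by
    induction z using BT.induction with
    | zero => simp
    | tmul m n => rfl
    | add x y hx hy => simp only [smul_add, hx, hy]
  op_unit_smul c z := by
    induction z using BT.induction with
    | zero => simp
    | tmul m n => rfl
    | add x y hx hy => simp only [smul_add, hx, hy]

variable {k A} {W X Y : Type*} [AddCommGroup W] [Module k W] [Module kᵐᵒᵖ W]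
  [SMulCommClass k kᵐᵒᵖ W]
  [AddCommGroup X] [Module k X] [Module kᵐᵒᵖ X] [Module A X] [Module Aᵐᵒᵖ X] [Compat k A X]
  [AddCommGroup Y] [Module k Y] [Module kᵐᵒᵖ Y] [Module A Y] [Module Aᵐᵒᵖ Y] [Compat k A Y]

/-- A homomorphism of `A`-bimodules is a homomorphism of `k`-bimodules. -/
def restrict (f : BiHom A X Y) : BiHom k X Y :=
  ⟨f.1, by
    constructor <;> intro c x
    · rw [← Compat.unit_smul (k := k) (A := A), ← Compat.unit_smul (k := k) (A := A)]
      exact f.map_smul _ _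
    · rw [← Compat.op_unit_smul (k := k) (A := A), ← Compat.op_unit_smul (k := k) (A := A)]
      exact f.map_op_smul _ _⟩

variable (k A W) in
/-- The homomorphism `w ↦ 1 ⊗ w`. -/
def oneL : BiHom k W (BT k A W) :=
  ⟨AddMonoidHom.mk' (fun w => BT.tmul k 1 w) (by intros; rw [BT.tmul_add]), by
    constructor <;> intro c w
    · change BT.tmul k 1 (c • w) = c • BT.tmul k 1 w
      rw [← BT.smul_tmul, BT.smul_tmul_left, KAlg.op_smul_def, KAlg.smul_def, one_mul, mul_one]
    · rfl⟩

variable (k A W) in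
/-- The homomorphism `w ↦ w ⊗ 1`. -/
def oneR : BiHom k W (BT k W A) :=
  ⟨AddMonoidHom.mk' (fun w => BT.tmul k w 1) (by intros; rw [BT.add_tmul]), by
    constructor <;> intro c w
    · rfl
    · change BT.tmul k (op c • w) 1 = op c • BT.tmul k w 1
      rw [BT.smul_tmul, BT.smul_tmul_right, KAlg.op_smul_def, KAlg.smul_def, one_mul, mul_one]⟩

variable (k A W) in
/-- The generator `1 ⊗ w ⊗ 1` of `A ⊗ W ⊗ A`. -/
def gen : BiHom k W (FB k A W) := (oneL k A (BT k W A)).comp (oneR k A W)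

/-- The homomorphism `W ⊗ A → X`, `w ⊗ b ↦ f(w) b`. -/
def extendRight [SMulCommClass A Aᵐᵒᵖ X] (f : BiHom k W X) : BT k W A →+ X :=
  BT.lift (fun w b => op b • f w)
    (by intros; rw [BiHom.map_add, smul_add])
    (by intros; rw [op_add, add_smul])
    (by
      intro w c b
      rw [BiHom.map_op_smul, ← Compat.op_unit_smul (k := k) (A := A), ← mul_smul, KAlg.smul_def,
        op_mul])

theorem extendRight_smul [SMulCommClass A Aᵐᵒᵖ X] (f : BiHom k W X) (c : k) (y : BT k W A) :
    extendRight f (c • y) = (KAlg.unit c : A) • extendRight f y := by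
  induction y using BT.induction with
  | zero => simp
  | tmul w b =>
    change op b • f (c • w) = (KAlg.unit c : A) • op b • f w
    rw [BiHom.map_smul, ← Compat.unit_smul (k := k) (A := A)]
    exact (smul_comm _ _ _).symm
  | add x y hx hy => simp only [smul_add, map_add, hx, hy]

theorem extendRight_op_smul [SMulCommClass A Aᵐᵒᵖ X] (f : BiHom k W X) (c : A) (y : BT k W A) :
    extendRight f (op c • y) = op c • extendRight f y := by
  induction y using BT.induction with
  | zero => simp
  | tmul w b =>
    change op (b * c) • f w = op c • op b • f w
    rw [op_mul, mul_smul]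
  | add x y hx hy => simp only [smul_add, map_add, hx, hy]

/-- The unique extension `a ⊗ w ⊗ b ↦ a f(w) b` of a homomorphism `f : W → X` of `k`-bimodules to a
homomorphism `A ⊗ W ⊗ A → X` of `A`-bimodules. -/
def extend [SMulCommClass A Aᵐᵒᵖ X] (f : BiHom k W X) : BiHom A (FB k A W) X :=
  ⟨BT.lift (fun a y => a • extendRight f y)
      (by intros; rw [add_smul]) (by intros; rw [map_add, smul_add])
      (by intro a c y; rw [KAlg.op_smul_def, mul_smul, extendRight_smul]), by
    constructor <;> intro c z
    · induction z using BT.induction with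
      | zero => simp
      | tmul a y => exact mul_smul c a _
      | add x y hx hy => rw [smul_add, map_add, hx, hy, map_add, smul_add]
    · induction z using BT.induction with
      | zero => simp
      | tmul a y =>
        change a • extendRight f (op c • y) = op c • a • extendRight f y
        rw [extendRight_op_smul, smul_comm]
      | add x y hx hy => rw [smul_add, map_add, hx, hy, map_add, smul_add]⟩

@[simp]
theorem extend_tmul [SMulCommClass A Aᵐᵒᵖ X] (f : BiHom k W X) (a b : A) (w : W) :
    extend f (BT.tmul k a (BT.tmul k w b)) = a • op b • f w := rfl

theorem extend_gen [SMulCommClass A Aᵐᵒᵖ X] (f : BiHom k W X) (w : W) :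
    extend f (gen k A W w) = f w := by
  change (1 : A) • (1 : Aᵐᵒᵖ) • f w = f w
  simp

end Free

/-! ### The tensor algebra of a bimodule -/

section TensorAlgebra

variable (k : Type u) [Ring k] (V : Type v) [AddCommGroup V] [Module k V] [Module kᵐᵒᵖ V]

/-- The relations imposed on the free ring on the additive group `k × V`. -/
inductive TV.Rel : TensorAlgebra ℤ (k × V) → TensorAlgebra ℤ (k × V) → Prop
  | one : TV.Rel (TensorAlgebra.ι ℤ (1, 0)) 1
  | mul (c d : k) : TV.Rel (TensorAlgebra.ι ℤ (c * d, 0))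
      (TensorAlgebra.ι ℤ (c, 0) * TensorAlgebra.ι ℤ (d, 0))
  | smul (c : k) (v : V) : TV.Rel (TensorAlgebra.ι ℤ (0, c • v))
      (TensorAlgebra.ι ℤ (c, 0) * TensorAlgebra.ι ℤ (0, v))
  | op_smul (c : k) (v : V) : TV.Rel (TensorAlgebra.ι ℤ (0, op c • v))
      (TensorAlgebra.ι ℤ (0, v) * TensorAlgebra.ι ℤ (c, 0))

/-- The tensor algebra `T_k V` of the `k`-bimodule `V`: the ring generated by `k` and `V`, subject
to the relations saying that `k → T_k V` is a ring homomorphism and that `V → T_k V` is a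
homomorphism of `k`-bimodules. -/
def TV : Type (max u v) := RingQuot (TV.Rel k V)

namespace TV

instance : Ring (TV k V) := inferInstanceAs (Ring (RingQuot (TV.Rel k V)))

variable {k V}

/-- The canonical additive map from `k × V`. -/
def base : k × V →+ TV k V :=
  (RingQuot.mkRingHom (TV.Rel k V)).toAddMonoidHom.comp
    (TensorAlgebra.ι ℤ (M := k × V)).toAddMonoidHom

instance : KAlg k (TV k V) where
  unit :=
    { toFun := fun c => base (c, 0)
      map_one' := (RingQuot.mkRingHom_rel (TV.Rel.one (V := V))).trans (map_one _)
      map_mul' := fun c d => (RingQuot.mkRingHom_rel (TV.Rel.mul (V := V) c d)).trans (map_mul _ _ _)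
      map_zero' := map_zero base
      map_add' := fun c d => by rw [← map_add]; simp }

/-- The inclusion of `V` into its tensor algebra. -/
def ι : BiHom k V (TV k V) :=
  ⟨AddMonoidHom.mk' (fun v => base (0, v)) (fun v w => by rw [← map_add]; simp), by
    constructor
    · intro c v
      exact (RingQuot.mkRingHom_rel (TV.Rel.smul c v)).trans (map_mul _ _ _)
    · intro c v
      exact (RingQuot.mkRingHom_rel (TV.Rel.op_smul c v)).trans (map_mul _ _ _)⟩

theorem base_eq (c : k) (v : V) : base (c, v) = (KAlg.unit c : TV k V) + ι v := by
  change _ = base (c, 0) + base (0, v)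
  rw [← map_add]; simp

/-- The universal property of the tensor algebra. -/
def lift {B : Type*} [Ring B] (j : k →+* B) (f : V →+ B) (hl : ∀ c v, f (c • v) = j c * f v)
    (hr : ∀ (c : k) v, f (op c • v) = f v * j c) : TV k V →+* B :=
  RingQuot.lift ⟨(TensorAlgebra.lift ℤ (j.toAddMonoidHom.coprod f).toIntLinearMap).toRingHom, by
    intro x y h
    cases h <;> simp [hl, hr]⟩

theorem lift_base {B : Type*} [Ring B] (j : k →+* B) (f : V →+ B) (hl) (hr) (x : k × V) :
    lift j f hl hr (base x) = j x.1 + f x.2 := by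
  change RingQuot.lift _ (RingQuot.mkRingHom (TV.Rel k V) _) = _
  rw [RingQuot.lift_mkRingHom_apply]
  simp

@[simp]
theorem lift_unit {B : Type*} [Ring B] (j : k →+* B) (f : V →+ B) (hl) (hr) (c : k) :
    lift j f hl hr (KAlg.unit c) = j c := by
  refine (lift_base j f hl hr (c, 0)).trans ?_
  simp

@[simp]
theorem lift_ι {B : Type*} [Ring B] (j : k →+* B) (f : V →+ B) (hl) (hr) (v : V) :
    lift j f hl hr (ι v) = f v := by
  refine (lift_base j f hl hr (0, v)).trans ?_
  simp

@[elab_as_elim]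
theorem induction {p : TV k V → Prop} (unit : ∀ c : k, p (KAlg.unit c)) (ι : ∀ v : V, p (ι v))
    (add : ∀ x y, p x → p y → p (x + y)) (mul : ∀ x y, p x → p y → p (x * y)) (x : TV k V) :
    p x := by
  obtain ⟨x, rfl⟩ := RingQuot.mkRingHom_surjective (TV.Rel k V) x
  induction x using TensorAlgebra.induction with
  | algebraMap r =>
    have h := unit (r : k)
    rw [map_intCast] at h
    rw [eq_intCast, map_intCast]
    exact h
  | ι x =>
    have := base_eq x.1 x.2
    change p (base x)
    rw [this]
    exact add _ _ (unit _) (ι _)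
  | mul x y hx hy => rw [map_mul]; exact mul _ _ hx hy
  | add x y hx hy => rw [map_add]; exact add _ _ hx hy

variable (k V)

/-- The tensor power `V^{⊗ n}`, as the subgroup of `T_k V` generated by the products of `n` elements
of `V` (for `n = 0`: the image of `k`). -/
def tpow : ℕ → AddSubgroup (TV k V)
  | 0 => (KAlg.unit (k := k) (B := TV k V)).toAddMonoidHom.range
  | n + 1 => AddSubgroup.closure {z | ∃ (v : V), ∃ x ∈ tpow n, z = ι v * x}

/-- The filtration `F^n = ⨁_{j ≤ n} V^{⊗ j}` of the tensor algebra. -/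
def fil (n : ℕ) : AddSubgroup (TV k V) := ⨆ j ∈ Finset.range (n + 1), tpow k V j

/-- The ring homomorphism `T_k V → (T_k V)[t]` multiplying every `v ∈ V` by `t`. -/
def gr : TV k V →+* (TV k V)[X] :=
  lift (Polynomial.C.comp KAlg.unit)
    ((Polynomial.monomial 1).toAddMonoidHom.comp (ι (k := k) (V := V)).1)
    (by
      intro c v
      simp [BiHom.map_smul, KAlg.smul_def, Polynomial.C_mul_monomial])
    (by
      intro c v
      simp [BiHom.map_op_smul, KAlg.op_smul_def, Polynomial.monomial_mul_C])

variable {k V}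

/-- The projection `π_n : T_k V → V^{⊗ n}`. -/
def proj (n : ℕ) (x : TV k V) : TV k V := (gr k V x).coeff n

theorem gr_of_mem {n : ℕ} {x : TV k V} (hx : x ∈ tpow k V n) :
    gr k V x = Polynomial.monomial n x := by
  induction n generalizing x with
  | zero =>
    obtain ⟨c, rfl⟩ := hx
    simp [gr, Polynomial.monomial_zero_left]
  | succ n ih =>
    refine AddSubgroup.closure_induction ?_ (by simp) ?_ ?_ hx
    · rintro _ ⟨v, x, hx, rfl⟩
      rw [map_mul, ih hx]
      simp [gr, Polynomial.monomial_mul_monomial, add_comm]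
    · intro x y _ _ hx hy
      rw [map_add, hx, hy, map_add]
    · intro x _ hx
      rw [map_neg, hx, map_neg]

theorem proj_of_mem {n : ℕ} {x : TV k V} (hx : x ∈ tpow k V n) (m : ℕ) :
    proj m x = if n = m then x else 0 := by
  rw [proj, gr_of_mem hx, Polynomial.coeff_monomial]

theorem unit_mul_mem (c : k) {n : ℕ} {x : TV k V} (hx : x ∈ tpow k V n) :
    KAlg.unit c * x ∈ tpow k V n := by
  cases n with
  | zero =>
    obtain ⟨d, rfl⟩ := hx
    exact ⟨c * d, by simp⟩
  | succ n =>
    refine AddSubgroup.closure_induction ?_ (by simp [zero_mem]) ?_ ?_ hx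
    · rintro _ ⟨v, x, hx, rfl⟩
      refine AddSubgroup.subset_closure ⟨c • v, x, hx, ?_⟩
      rw [BiHom.map_smul, KAlg.smul_def, mul_assoc]
    · intro x y _ _ hx hy
      rw [mul_add]; exact add_mem hx hy
    · intro x _ hx
      rw [mul_neg]; exact neg_mem hx

theorem mul_mem {m n : ℕ} {x y : TV k V} (hx : x ∈ tpow k V m) (hy : y ∈ tpow k V n) :
    x * y ∈ tpow k V (m + n) := by
  induction m generalizing x with
  | zero =>
    obtain ⟨c, rfl⟩ := hx
    rw [zero_add]
    exact unit_mul_mem c hy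
  | succ m ih =>
    refine AddSubgroup.closure_induction ?_ (by simp [zero_mem]) ?_ ?_ hx
    · rintro _ ⟨v, x, hx, rfl⟩
      rw [mul_assoc, Nat.add_right_comm]
      exact AddSubgroup.subset_closure ⟨v, x * y, ih hx, rfl⟩
    · intro x x' _ _ hx hx'
      rw [add_mul]; exact add_mem hx hx'
    · intro x _ hx
      rw [neg_mul]; exact neg_mem hx

theorem ι_mem (v : V) : ι v ∈ tpow k V 1 :=
  AddSubgroup.subset_closure ⟨v, 1, ⟨1, map_one (KAlg.unit (k := k) (B := TV k V))⟩,
    (mul_one _).symm⟩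

theorem proj_mem (n : ℕ) (x : TV k V) : proj n x ∈ tpow k V n := by
  induction x using TV.induction generalizing n with
  | unit c =>
    have h0 : (KAlg.unit c : TV k V) ∈ tpow k V 0 := ⟨c, rfl⟩
    rw [proj_of_mem h0]
    split_ifs with h
    · subst h; exact h0
    · exact zero_mem _
  | ι v =>
    rw [proj_of_mem (ι_mem v)]
    split_ifs with h
    · subst h; exact ι_mem v
    · exact zero_mem _
  | add x y hx hy =>
    rw [proj, map_add, Polynomial.coeff_add]
    exact add_mem (hx n) (hy n)
  | mul x y hx hy =>
    rw [proj, map_mul, Polynomial.coeff_mul]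
    refine sum_mem fun ij hij => ?_
    rw [← Finset.HasAntidiagonal.mem_antidiagonal.1 hij]
    exact mul_mem (hx _) (hy _)

/-- Every element of the tensor algebra is the sum of its homogeneous components. -/
theorem sum_proj (x : TV k V) : (gr k V x).sum (fun _ y => y) = x := by
  have h : ((Polynomial.eval₂RingHom' (RingHom.id (TV k V)) 1 (fun _ => Commute.one_right _)).comp
      (gr k V)) x = x := by
    induction x using TV.induction with
    | unit c => simp [gr]
    | ι v => simp [gr, Polynomial.eval₂_monomial]
    | add x y hx hy => rw [map_add, hx, hy]
    | mul x y hx hy => rw [map_mul, hx, hy]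
  conv_rhs => rw [← h]
  simp [Polynomial.eval₂_eq_sum]

/-- Elements of degree at most `n` are those whose components of degree `> n` vanish. -/
theorem mem_fil_iff {n : ℕ} {x : TV k V} : x ∈ fil k V n ↔ ∀ m, n < m → proj m x = 0 := by
  constructor
  · intro hx m hm
    have h : fil k V n ≤
        ((Polynomial.lcoeff (TV k V) m).toAddMonoidHom.comp (gr k V).toAddMonoidHom).ker := by
      refine iSup₂_le fun j hj x hx => ?_
      have := proj_of_mem hx m
      rw [if_neg (by rw [Finset.mem_range] at hj; omega)] at this
      exact this
    exact h hx
  · intro h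
    rw [← sum_proj x, Polynomial.sum]
    refine sum_mem fun m _ => ?_
    by_cases hm : n < m
    · change proj m x ∈ _
      rw [h m hm]; exact zero_mem _
    · exact (le_iSup₂_of_le (f := fun j (_ : j ∈ Finset.range (n + 1)) => tpow k V j) m
        (by rw [Finset.mem_range]; omega) le_rfl) (proj_mem m x)

/-- The projection `π_n` as a homomorphism of bimodules. -/
def projHom (n : ℕ) : BiHom k (TV k V) (TV k V) :=
  ⟨(Polynomial.lcoeff (TV k V) n).toAddMonoidHom.comp (gr k V).toAddMonoidHom, by
    constructor <;> intro c x
    · change (gr k V (KAlg.unit c * x)).coeff n = KAlg.unit c * (gr k V x).coeff n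
      rw [map_mul]; simp [gr]
    · change (gr k V (x * KAlg.unit c)).coeff n = (gr k V x).coeff n * KAlg.unit c
      rw [map_mul]; simp [gr]⟩

theorem projHom_apply (n : ℕ) (x : TV k V) : projHom n x = proj n x := rfl

/-- The augmentation `T_k V → k`. -/
def aug : TV k V →+* k := lift (RingHom.id k) 0 (by simp) (by simp)

theorem aug_of_mem {n : ℕ} (hn : n ≠ 0) {x : TV k V} (hx : x ∈ tpow k V n) : aug x = 0 := by
  cases n with
  | zero => exact absurd rfl hn
  | succ n =>
    refine AddSubgroup.closure_induction ?_ (by simp) ?_ ?_ hx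
    · rintro _ ⟨v, x, hx, rfl⟩
      rw [map_mul]; simp [aug]
    · intro x y _ _ hx hy
      rw [map_add, hx, hy, add_zero]
    · intro x _ hx
      rw [map_neg, hx, neg_zero]

end TV
end TensorAlgebra

/-! ### Quotients by two-sided ideals -/

/-- The two-sided ideal `⟨P⟩` generated by a set `P`. -/
def idealOf {B : Type*} [Ring B] (P : Set B) : Ideal B := (TwoSidedIdeal.span P).asIdeal

instance {B : Type*} [Ring B] (P : Set B) : (idealOf P).IsTwoSided :=
  inferInstanceAs (TwoSidedIdeal.asIdeal (TwoSidedIdeal.span P)).IsTwoSided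

theorem subset_idealOf {B : Type*} [Ring B] (P : Set B) {x : B} (hx : x ∈ P) : x ∈ idealOf P :=
  TwoSidedIdeal.mem_asIdeal.2 (TwoSidedIdeal.subset_span hx)

theorem map_eq_zero_of_mem_idealOf {B C : Type*} [Ring B] [Ring C] {P : Set B} (f : B →+* C)
    (h : ∀ x ∈ P, f x = 0) (x : B) (hx : x ∈ idealOf P) : f x = 0 := by
  have h1 : TwoSidedIdeal.span P ≤ TwoSidedIdeal.ker f :=
    TwoSidedIdeal.span_le.2 fun y hy => (TwoSidedIdeal.mem_ker f).2 (h y hy)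
  exact (TwoSidedIdeal.mem_ker f).1 (h1 (TwoSidedIdeal.mem_asIdeal.1 hx))

instance {k B : Type*} [Ring k] [Ring B] [KAlg k B] (I : Ideal B) [I.IsTwoSided] :
    KAlg k (B ⧸ I) := ⟨(Ideal.Quotient.mk I).comp KAlg.unit⟩

section Presented

variable {k : Type u} [Ring k] {V : Type v} [AddCommGroup V] [Module k V] [Module kᵐᵒᵖ V]

/-- The algebra `T_k V / ⟨P⟩`. -/
def PresAlg (P : Set (TV k V)) : Type (max u v) := TV k V ⧸ idealOf P

instance (P : Set (TV k V)) : Ring (PresAlg P) := inferInstanceAs (Ring (TV k V ⧸ idealOf P))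

instance (P : Set (TV k V)) : KAlg k (PresAlg P) := inferInstanceAs (KAlg k (TV k V ⧸ idealOf P))

/-- The projection `T_k V → T_k V / ⟨P⟩`. -/
def pmk (P : Set (TV k V)) : TV k V →+* PresAlg P := Ideal.Quotient.mk (idealOf P)

/-- The projection `T_k V → T_k V / ⟨P⟩` as a homomorphism of `k`-bimodules. -/
def pmkHom (P : Set (TV k V)) : BiHom k (TV k V) (PresAlg P) :=
  ⟨(pmk P).toAddMonoidHom, fun c x => map_mul (pmk P) (KAlg.unit c) x,
    fun c x => map_mul (pmk P) x (KAlg.unit c)⟩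

end Presented

/-! ### `N`-homogeneous algebras -/

section Homogeneous

variable (k : Type u) [Ring k] (V : Type v) [AddCommGroup V] [Module k V] [Module kᵐᵒᵖ V]

/-- Homogeneous relations of degree `N ≥ 2`: a sub-bimodule `R` of `V^{⊗ N}`. -/
structure HomRel (N : ℕ) where
  rel : SubBimod k (TV k V)
  two_le : 2 ≤ N
  le : ∀ x ∈ rel, x ∈ TV.tpow k V N

namespace HomRel

variable {k V} {N : ℕ} (R : HomRel k V N)

/-- The `N`-homogeneous algebra `A = T_k V / ⟨R⟩`. -/
abbrev Alg : Type (max u v) := PresAlg (R.rel : Set (TV k V))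

/-- The projection `T_k V → A`. -/
abbrev toAlg : TV k V →+* R.Alg := pmk (R.rel : Set (TV k V))

/-- The component `A_n` of the `N`-homogeneous algebra `A`. -/
def comp (n : ℕ) : AddSubgroup R.Alg := (TV.tpow k V n).map R.toAlg.toAddMonoidHom

/-- The augmentation `A → k`. -/
def aug : R.Alg →+* k :=
  Ideal.Quotient.lift _ TV.aug (map_eq_zero_of_mem_idealOf TV.aug fun x hx =>
    TV.aug_of_mem (by have := R.two_le; omega) (R.le x hx))

theorem aug_toAlg (x : TV k V) : R.aug (R.toAlg x) = TV.aug x := rfl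

theorem aug_unit (c : k) : R.aug (KAlg.unit c) = c := by
  change TV.aug (KAlg.unit c) = c
  simp [TV.aug]

/-- The sub-bimodule `I₊` of `A`, identified with `A / k`: the kernel of the augmentation. -/
def plus : SubBimod k R.Alg where
  toAddSubgroup := R.aug.toAddMonoidHom.ker
  smul_mem' c x hx := by
    have hx' : R.aug x = 0 := hx
    change R.aug (KAlg.unit c * x) = 0
    rw [map_mul, hx', mul_zero]
  op_smul_mem' c x hx := by
    have hx' : R.aug x = 0 := hx
    change R.aug (x * KAlg.unit c) = 0
    rw [map_mul, hx', zero_mul]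

theorem mem_plus {a : R.Alg} : a ∈ R.plus ↔ R.aug a = 0 := Iff.rfl

/-- `I₊` is spanned by the homogeneous elements of strictly positive degree. -/
theorem plus_eq : R.plus.toAddSubgroup = ⨆ n : ℕ, R.comp (n + 1) := by
  apply le_antisymm
  · intro a ha
    obtain ⟨x, rfl⟩ := Ideal.Quotient.mk_surjective a
    have hx : TV.aug x = 0 := ha
    have h0 : ∀ y : TV k V, TV.proj 0 y = KAlg.unit (TV.aug y) := by
      intro y
      induction y using TV.induction with
      | unit c => simp [TV.proj, TV.gr, TV.aug]
      | ι v => simp [TV.proj, TV.gr, TV.aug]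
      | add x y hx hy =>
        simp only [TV.proj, map_add, Polynomial.coeff_add] at *
        rw [hx, hy]
      | mul x y hx hy =>
        simp only [TV.proj, map_mul, Polynomial.mul_coeff_zero] at *
        rw [hx, hy]
    rw [← TV.sum_proj x, Polynomial.sum, map_sum]
    refine sum_mem fun n _ => ?_
    cases n with
    | zero =>
      change R.toAlg (TV.proj 0 x) ∈ _
      rw [h0, hx, map_zero, map_zero]
      exact zero_mem _
    | succ n => exact AddSubgroup.mem_iSup_of_mem n ⟨_, TV.proj_mem (n + 1) x, rfl⟩
  · refine iSup_le fun n => ?_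
    rintro _ ⟨x, hx, rfl⟩
    exact TV.aug_of_mem n.succ_ne_zero hx

/-- The grading of `I₊`. -/
def plusComp (n : ℕ) : AddSubgroup R.plus := (R.comp n).comap R.plus.toAddSubgroup.subtype

/-- The inclusion `I₊ → A`. -/
def incl : BiHom k R.plus R.Alg := ⟨R.plus.toAddSubgroup.subtype, fun _ _ => rfl, fun _ _ => rfl⟩

/-- The projection `A → A / k ≅ I₊`. -/
def bar : BiHom k R.Alg R.plus :=
  ⟨AddMonoidHom.mk' (fun a => ⟨a - KAlg.unit (R.aug a), by
      rw [mem_plus, map_sub, aug_unit, sub_self]⟩)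
      (by intro a b; apply Subtype.ext; simp only [map_add, AddMemClass.mk_add_mk]; abel), by
    constructor <;> intro c a <;> apply Subtype.ext
    · change KAlg.unit c * a - KAlg.unit (R.aug (KAlg.unit c * a)) =
        KAlg.unit c * (a - KAlg.unit (R.aug a))
      rw [map_mul, aug_unit, map_mul, mul_sub]
    · change a * KAlg.unit c - KAlg.unit (R.aug (a * KAlg.unit c)) =
        (a - KAlg.unit (R.aug a)) * KAlg.unit c
      rw [map_mul, aug_unit, map_mul, sub_mul]⟩

/-- The class in `A / k ≅ I₊` of an element of the tensor algebra. -/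
def cls (x : TV k V) : R.plus := R.bar (R.toAlg x)

/-- The multiplication `I₊ ⊗ I₊ → I₊`. -/
def mulPlus : BiHom k (BT k R.plus R.plus) R.plus :=
  BT.liftBi (fun a b => ⟨a.1 * b.1, by
      rw [mem_plus, map_mul, R.mem_plus.1 a.2, zero_mul]⟩)
    (by intros; apply Subtype.ext; exact add_mul _ _ _)
    (by intros; apply Subtype.ext; exact mul_add _ _ _)
    (by intros; apply Subtype.ext; exact mul_assoc _ _ _)
    (by intros; apply Subtype.ext; exact mul_assoc _ _ _)
    (by intros; apply Subtype.ext; exact (mul_assoc _ _ _).symm)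

/-- The tensor powers of `A / k ≅ I₊`. -/
abbrev plus2 : Type _ := BT k R.plus R.plus
abbrev plus3 : Type _ := BT k R.plus R.plus2
abbrev plus4 : Type _ := BT k R.plus R.plus3

/-- The gradings of the tensor powers of `I₊`. -/
def plus2Comp : ℕ → AddSubgroup R.plus2 := BT.grading R.plusComp R.plusComp
def plus3Comp : ℕ → AddSubgroup R.plus3 := BT.grading R.plusComp R.plus2Comp

/-! #### `Tor₃^A(k, k)`, computed by the reduced bar complex -/

/-- The multiplication of the first two factors, `a ⊗ b ⊗ c ↦ a b ⊗ c`. -/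
def mulFst : BiHom k R.plus3 R.plus2 := (BT.map R.mulPlus (BiHom.id k _)).comp BT.reassoc

/-- The multiplication of the last two factors, `a ⊗ b ⊗ c ↦ a ⊗ b c`. -/
def mulSnd : BiHom k R.plus3 R.plus2 := BT.map (BiHom.id k _) R.mulPlus

/-- The differential `a ⊗ b ⊗ c ↦ - a b ⊗ c + a ⊗ b c` of `k ⊗_A C̄_•(A) ⊗_A k`. -/
def torD3 : BiHom k R.plus3 R.plus2 := - R.mulFst + R.mulSnd

/-- The differential `a ⊗ b ⊗ c ⊗ d ↦ - a b ⊗ c ⊗ d + a ⊗ b c ⊗ d - a ⊗ b ⊗ c d`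
of `k ⊗_A C̄_•(A) ⊗_A k`. -/
def torD4 : BiHom k R.plus4 R.plus3 :=
  - (BT.map R.mulPlus (BiHom.id k _)).comp BT.reassoc
    + BT.map (BiHom.id k _) R.mulFst - BT.map (BiHom.id k _) R.mulSnd

/-- `Tor₃^A(k, k)` is concentrated in the internal degree `e`: in every other internal degree the
reduced bar complex is exact at `(A / k)^{⊗ 3}`. -/
def Tor3ConcentratedIn (e : ℕ) : Prop :=
  ∀ d, d ≠ e → ∀ z ∈ R.plus3Comp d, R.torD3 z = 0 → ∃ y, R.torD4 y = z

/-! #### The reduced Hochschild complex `C̄_n = A ⊗ (A / k)^{⊗ n} ⊗ A` in low degrees -/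

/-- `a ⊗ w ↦ a | w | 1`. -/
def actL (W : Type*) [AddCommGroup W] [Module k W] [Module kᵐᵒᵖ W] [SMulCommClass k kᵐᵒᵖ W] :
    BiHom k (BT k R.plus W) (FB k R.Alg W) := BT.map R.incl (oneR k R.Alg W)

/-- `w ⊗ a ↦ 1 | w | a`. -/
def actR (W : Type*) [AddCommGroup W] [Module k W] [Module kᵐᵒᵖ W] [SMulCommClass k kᵐᵒᵖ W] :
    BiHom k (BT k W R.plus) (FB k R.Alg W) :=
  (oneL k R.Alg (BT k W R.Alg)).comp (BT.map (BiHom.id k W) R.incl)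

/-- `a ↦ a | 1 - 1 | a`. -/
def unitDiff : BiHom k R.Alg (BT k R.Alg R.Alg) := oneR k R.Alg R.Alg - oneL k R.Alg R.Alg

/-- `b̄₁ (1|a|1) = a|1 - 1|a`. -/
def b1 : BiHom R.Alg (FB k R.Alg R.plus) (BT k R.Alg R.Alg) := extend (R.unitDiff.comp R.incl)

/-- `b̄₂ (1|a|b|1) = a|b|1 - 1|ab|1 + 1|a|b`. -/
def b2 : BiHom R.Alg (FB k R.Alg R.plus2) (FB k R.Alg R.plus) :=
  extend (R.actL R.plus - (gen k R.Alg R.plus).comp R.mulPlus + R.actR R.plus)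

/-- `b̄₃ (1|a|b|c|1) = a|b|c|1 - 1|ab|c|1 + 1|a|bc|1 - 1|a|b|c`. -/
def b3 : BiHom R.Alg (FB k R.Alg R.plus3) (FB k R.Alg R.plus2) :=
  extend (R.actL R.plus2 - (gen k R.Alg R.plus2).comp R.mulFst + (gen k R.Alg R.plus2).comp R.mulSnd
    - (R.actR R.plus2).comp BT.reassoc)

end HomRel

/-! ### The bimodule Koszul complex in low degrees and the comparison with `C̄_•` -/

namespace HomRel

variable {k V} [SMulCommClass k kᵐᵒᵖ V] {N : ℕ} (R : HomRel k V N)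

/-- `T_k V → A ⋉ (A ⊗ V ⊗ A)`, with `v ↦ (v, 1|v|1)`; the second component is the derivation
`v₁ ⋯ v_n ↦ ∑ v₁ ⋯ v_{i-1} | v_i | v_{i+1} ⋯ v_n`. -/
def parAux : TV k V →+* TrivSqZeroExt R.Alg (FB k R.Alg V) :=
  TV.lift ((TrivSqZeroExt.inlHom R.Alg (FB k R.Alg V)).comp KAlg.unit)
    (AddMonoidHom.mk' (fun v => TrivSqZeroExt.inl (R.toAlg (TV.ι v)) +
      TrivSqZeroExt.inr (gen k R.Alg V v)) (by
        intro v w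
        ext <;> simp [BiHom.map_add]))
    (by
      intro c v
      ext
      · simp [BiHom.map_smul, KAlg.smul_def]
        rfl
      · simp [BiHom.map_smul, Compat.unit_smul])
    (by
      intro c v
      ext
      · simp [BiHom.map_op_smul, KAlg.op_smul_def]
        rfl
      · simp [BiHom.map_op_smul, Compat.op_unit_smul])

theorem fst_parAux (x : TV k V) : (R.parAux x).fst = R.toAlg x := by
  induction x using TV.induction with
  | unit c => simp [parAux]; rfl
  | ι v => simp [parAux]
  | add x y hx hy => simp [hx, hy]
  | mul x y hx hy => simp [hx, hy]

/-- The map `α ↦ α_(1) | ᾱ_(2) | α_(3)` from `T_k V` to `A ⊗ V ⊗ A`: on `v₁ ⋯ v_n` it is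
`∑ v₁ ⋯ v_{i-1} | v_i | v_{i+1} ⋯ v_n`. -/
def par : BiHom k (TV k V) (FB k R.Alg V) :=
  ⟨AddMonoidHom.mk' (fun x => (R.parAux x).snd) (by intros; simp), by
    constructor <;> intro c x
    · change (R.parAux (KAlg.unit c * x)).snd = c • (R.parAux x).snd
      rw [map_mul, ← Compat.unit_smul (k := k) (A := R.Alg)]
      simp [parAux]
    · change (R.parAux (x * KAlg.unit c)).snd = op c • (R.parAux x).snd
      rw [map_mul, ← Compat.op_unit_smul (k := k) (A := R.Alg)]
      simp [parAux]⟩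

theorem par_ι (v : V) : R.par (TV.ι v) = gen k R.Alg V v := by
  change (R.parAux (TV.ι v)).snd = _
  simp [parAux]

theorem par_mul (x y : TV k V) :
    R.par (x * y) = R.toAlg x • R.par y + op (R.toAlg y) • R.par x := by
  change (R.parAux (x * y)).snd = _
  rw [map_mul, TrivSqZeroExt.snd_mul, fst_parAux, fst_parAux]
  rfl

/-- The inclusion of `V` into `I₊`. -/
def vIncl : BiHom k V R.plus := R.bar.comp ((pmkHom (R.rel : Set (TV k V))).comp TV.ι)

theorem coe_vIncl (v : V) : (R.vIncl v : R.Alg) = R.toAlg (TV.ι v) := by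
  change R.toAlg (TV.ι v) - KAlg.unit (TV.aug (TV.ι v)) = _
  simp [TV.aug]

/-- The inclusion of `R` into the tensor algebra. -/
def relIncl : BiHom k R.rel (TV k V) :=
  ⟨R.rel.toAddSubgroup.subtype, fun _ _ => rfl, fun _ _ => rfl⟩

/-- The terms of the bimodule Koszul complex: `K₀ = A ⊗ A`, `K₁ = A ⊗ V ⊗ A`, `K₂ = A ⊗ R ⊗ A`. -/
abbrev K0 : Type _ := BT k R.Alg R.Alg
abbrev K1 : Type _ := FB k R.Alg V
abbrev K2 : Type _ := FB k R.Alg R.rel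

/-- The terms of the reduced Hochschild complex: `C̄₀ = A ⊗ A = K₀` and
`C̄_n = A ⊗ (A / k)^{⊗ n} ⊗ A`. -/
abbrev C1 : Type _ := FB k R.Alg R.plus
abbrev C2 : Type _ := FB k R.Alg R.plus2
abbrev C3 : Type _ := FB k R.Alg R.plus3

/-- The grading of `A ⊗ W ⊗ A` induced by a grading of `W`. -/
def freeComp {W : Type*} [AddCommGroup W] [Module k W] [Module kᵐᵒᵖ W] [SMulCommClass k kᵐᵒᵖ W]
    (G : ℕ → AddSubgroup W) : ℕ → AddSubgroup (FB k R.Alg W) :=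
  BT.grading R.comp (BT.grading G R.comp)

/-- The gradings of `K₁`, `K₂`, `C̄₁`, `C̄₂` and `C̄₃`; here `V` has degree `1` and `R` has degree
`N`. -/
def K1Comp : ℕ → AddSubgroup R.K1 := R.freeComp (concentrated V 1)
def K2Comp : ℕ → AddSubgroup R.K2 := R.freeComp (concentrated R.rel N)
def C1Comp : ℕ → AddSubgroup R.C1 := R.freeComp R.plusComp
def C2Comp : ℕ → AddSubgroup R.C2 := R.freeComp R.plus2Comp
def C3Comp : ℕ → AddSubgroup R.C3 := R.freeComp R.plus3Comp

/-- `d₁ (1|v|1) = v|1 - 1|v`. -/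
def d1 : BiHom R.Alg R.K1 R.K0 := extend (R.unitDiff.comp (R.incl.comp R.vIncl))

/-- `d₂ (1|r|1) = r_(1) | r̄_(2) | r_(3)`. -/
def d2 : BiHom R.Alg R.K2 R.K1 := extend (R.par.comp R.relIncl)

/-- `x | v | y ↦ 1 | x | v | y`, where `x` is replaced by its class in `A / k`. -/
def ins : BiHom k R.K1 R.C2 :=
  (oneL k R.Alg _).comp (BT.reassoc.comp (BT.map R.bar (BT.map R.vIncl (BiHom.id k R.Alg))))

/-- `a ⊗ (x | v | y) ↦ 1 | a | x | v | y`, where `x` is replaced by its class in `A / k`. -/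
def ins2 : BiHom k (BT k R.plus R.K1) R.C3 :=
  (oneL k R.Alg _).comp (BT.reassoc.comp (BT.map (BiHom.id k R.plus)
    (BT.reassoc.comp (BT.map R.bar (BT.map R.vIncl (BiHom.id k R.Alg))))))

/-- `σ̄₁ (1|v|1) = 1|v|1`. -/
def sigma1 : BiHom R.Alg R.K1 R.C1 := extend ((gen k R.Alg R.plus).comp R.vIncl)

/-- `σ̄₂ (1|r|1) = 1 | r_(1) | r̄_(2) | r_(3)`. -/
def sigma2 : BiHom R.Alg R.K2 R.C2 := extend (R.ins.comp (R.par.comp R.relIncl))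

/-- Relation decompositions `∑ a_i ⊗ b_i`: finite families of homogeneous elements `α_i`, `β_i` of
the tensor algebra, of positive degrees `p_i` and `N - p_i`, with `∑ α_i β_i ∈ R`. -/
structure RelDecomp where
  n : ℕ
  α : Fin n → TV k V
  β : Fin n → TV k V
  p : Fin n → ℕ
  q : Fin n → ℕ
  p_pos : ∀ i, 1 ≤ p i
  q_pos : ∀ i, 1 ≤ q i
  add_eq : ∀ i, p i + q i = N
  α_mem : ∀ i, α i ∈ TV.tpow k V (p i)
  β_mem : ∀ i, β i ∈ TV.tpow k V (q i)
  mem : ∑ i, α i * β i ∈ R.rel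

/-- The elements `1|ᾱ|1` of `C̄₁` and `1|ᾱ|β̄|1` of `C̄₂`, for `α` and `β` in the tensor algebra. -/
def bar1 (α : TV k V) : R.C1 := gen k R.Alg R.plus (R.cls α)
def bar2 (α β : TV k V) : R.C2 := gen k R.Alg R.plus2 (BT.tmul k (R.cls α) (R.cls β))

/-- Bimodule maps `τ̄_n : C̄_n → K_n` and `s_n : C̄_n → C̄_{n+1}`, for `n = 1, 2`. -/
structure ComparisonMaps where
  tau1 : BiHom R.Alg R.C1 R.K1
  tau2 : BiHom R.Alg R.C2 R.K2
  s1 : BiHom R.Alg R.C1 R.C2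
  s2 : BiHom R.Alg R.C2 R.C3

namespace ComparisonMaps

variable {R} (c : R.ComparisonMaps)

/-- The maps preserve the gradings. -/
def IsGraded : Prop :=
  (∀ d, ∀ x ∈ R.C1Comp d, c.tau1 x ∈ R.K1Comp d) ∧
  (∀ d, ∀ x ∈ R.C2Comp d, c.tau2 x ∈ R.K2Comp d) ∧
  (∀ d, ∀ x ∈ R.C1Comp d, c.s1 x ∈ R.C2Comp d) ∧
  ∀ d, ∀ x ∈ R.C2Comp d, c.s2 x ∈ R.C3Comp d

/-- `τ̄_•`, with `τ̄₀` the identity of `A ⊗ A`, is a morphism of complexes. -/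
def IsMorphism : Prop :=
  (∀ x, R.d1 (c.tau1 x) = R.b1 x) ∧ ∀ x, R.d2 (c.tau2 x) = c.tau1 (R.b2 x)

/-- `s_•`, with `s₀ = 0`, is a homotopy between the identity of `C̄_•` and `σ̄_• τ̄_•`. -/
def IsHomotopy : Prop :=
  (∀ x, R.b2 (c.s1 x) = x - R.sigma1 (c.tau1 x)) ∧
  ∀ x, R.b3 (c.s2 x) + c.s1 (R.b2 x) = x - R.sigma2 (c.tau2 x)

/-- The prescribed values of `τ̄_•`. -/
def TauValues : Prop :=
  (∀ n < N, ∀ α ∈ TV.tpow k V n, c.tau1 (R.bar1 α) = R.par α) ∧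
  (∀ p q, p + q < N → ∀ α ∈ TV.tpow k V p, ∀ β ∈ TV.tpow k V q, c.tau2 (R.bar2 α β) = 0) ∧
  ∀ r : R.RelDecomp, c.tau2 (∑ i, R.bar2 (r.α i) (r.β i)) =
    gen k R.Alg R.rel ⟨∑ i, r.α i * r.β i, r.mem⟩

/-- The prescribed values of `s_•`. -/
def SValues : Prop :=
  (∀ n < N, ∀ α ∈ TV.tpow k V n, c.s1 (R.bar1 α) = - R.ins (R.par α)) ∧
  (∀ p q, p + q < N → ∀ α ∈ TV.tpow k V p, ∀ β ∈ TV.tpow k V q,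
    c.s2 (R.bar2 α β) = R.ins2 (BT.tmul k (R.cls α) (R.par β))) ∧
  ∀ r : R.RelDecomp, c.s2 (∑ i, R.bar2 (r.α i) (r.β i)) =
    R.ins2 (∑ i, BT.tmul k (R.cls (r.α i)) (R.par (r.β i)))

end ComparisonMaps

/-- A choice of the comparison morphism `τ̄_• : C̄_• → K_•` (with `τ̄₀` the identity of `A ⊗ A`) and
of the homotopy `s_•` (with `s₀ = 0`) between the identity of `C̄_•` and `σ̄_• τ̄_•`, in degrees at
most two, taking the prescribed values on the normalized elements and on the relation
decompositions. -/
structure Comparison extends R.ComparisonMaps where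
  graded : toComparisonMaps.IsGraded
  morphism : toComparisonMaps.IsMorphism
  homotopy : toComparisonMaps.IsHomotopy
  tau_values : toComparisonMaps.TauValues
  s_values : toComparisonMaps.SValues

/-! ### Cochains -/

/-- The reduced `2`-cochains, i.e. the homomorphisms of bimodules `(A / k)^{⊗ 2} → A`. -/
abbrev Cochain2 : Type _ := BiHom k R.plus2 R.Alg

/-- The `3`-cochain `sq(ψ₁, …, ψ_j)`, mapping `a ⊗ b ⊗ c` to
`∑_{i=1}^{j} (ψ_i(a, ψ_{j+1-i}(b, c)) - ψ_i(ψ_{j+1-i}(a, b), c))`. -/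
def sq (ψ : ℕ → R.Cochain2) (j : ℕ) : BiHom k R.plus3 R.Alg :=
  ∑ i ∈ Finset.Icc 1 j,
    ((ψ i).comp (BT.map (BiHom.id k R.plus) (R.bar.comp (ψ (j + 1 - i)))) -
      (ψ i).comp ((BT.map (R.bar.comp (ψ (j + 1 - i))) (BiHom.id k R.plus)).comp BT.reassoc))

/-- The cochains `ψ_j` (`j ≥ 1`) are normalized: they vanish on `a ⊗ b` if `a` and `b` are
homogeneous with `deg a + deg b < N`. -/
def Normalized (ψ : ℕ → R.Cochain2) : Prop :=
  ∀ j, 1 ≤ j → ∀ p q, p + q < N → ∀ a ∈ R.plusComp p, ∀ b ∈ R.plusComp q, ψ j (BT.tmul k a b) = 0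

variable {R} in
/-- The cochains `ψ'_j = φ_{N-j}^~ ∘ τ̄₂` for `1 ≤ j ≤ N`, and `ψ'_j = 0` otherwise. -/
def psi' (c : R.Comparison) (φ : ℕ → BiHom k R.rel R.Alg) (j : ℕ) : R.Cochain2 :=
  if 1 ≤ j ∧ j ≤ N then
    (restrict ((extend (φ (N - j))).comp c.tau2)).comp (gen k R.Alg R.plus2)
  else 0

variable {R} in
/-- The recursively defined cochains: `ψ₁ = ψ'₁` and `ψ_{j+1} = ψ'_{j+1} - η_{j+1}`, where
`η_{j+1}^~ = (dψ'_{j+1})^~ ∘ s₂ + sq(ψ₁, …, ψ_j)^~ ∘ s₂`, for `j ≥ 1`. -/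
def psi (c : R.Comparison) (φ : ℕ → BiHom k R.rel R.Alg) : ℕ → R.Cochain2
  | 0 => 0
  | 1 => psi' c φ 1
  | j + 2 =>
    psi' c φ (j + 2) -
      (restrict (((extend (psi' c φ (j + 2))).comp R.b3 +
        extend (R.sq (fun i => if _h : i < j + 2 then psi c φ i else 0) (j + 1))).comp c.s2)).comp
          (gen k R.Alg R.plus2)

/-! ### Graded deformations -/

/-- The elements of degree `n` of `A[t]`, where `t` has degree `1`. -/
def IsHomogeneousOfDegree (n : ℕ) (x : R.Alg[X]) : Prop :=
  (∀ i ≤ n, x.coeff i ∈ R.comp (n - i)) ∧ ∀ i, n < i → x.coeff i = 0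

/-- A (polynomial) graded deformation of `A` preserving the unit: a graded `k[t]`-algebra structure
on the `k[t]`-bimodule `A[t]`, with unit `1 ∈ A`, which modulo `t` is the algebra `A`. -/
structure GradedDeformation where
  mul : R.Alg[X] → R.Alg[X] → R.Alg[X]
  add_mul : ∀ x y z, mul (x + y) z = mul x z + mul y z
  mul_add : ∀ x y z, mul x (y + z) = mul x y + mul x z
  mul_assoc : ∀ x y z, mul (mul x y) z = mul x (mul y z)
  one_mul : ∀ x, mul 1 x = x
  mul_one : ∀ x, mul x 1 = x
  t_mul : ∀ x y, mul (Polynomial.X * x) y = Polynomial.X * mul x y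
  mul_t : ∀ x y, mul x (Polynomial.X * y) = Polynomial.X * mul x y
  unit_mul : ∀ (c : k) x y, mul (Polynomial.C (KAlg.unit c) * x) y =
    Polynomial.C (KAlg.unit c) * mul x y
  mul_unit : ∀ (c : k) x y, mul x (y * Polynomial.C (KAlg.unit c)) =
    mul x y * Polynomial.C (KAlg.unit c)
  balanced : ∀ (c : k) x y, mul (x * Polynomial.C (KAlg.unit c)) y =
    mul x (Polynomial.C (KAlg.unit c) * y)
  degree : ∀ m n x y, R.IsHomogeneousOfDegree m x → R.IsHomogeneousOfDegree n y →
    R.IsHomogeneousOfDegree (m + n) (mul x y)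
  mod_t : ∀ x y, (mul x y).coeff 0 = x.coeff 0 * y.coeff 0

namespace GradedDeformation

variable {R} (D : R.GradedDeformation)

/-- The deformed algebra `A_t`: the additive group `A[t]` with the deformed product. -/
def At (_ : R.GradedDeformation) : Type (max u v) := R.Alg[X]

instance : AddCommGroup D.At := inferInstanceAs (AddCommGroup R.Alg[X])

instance : Ring D.At where
  __ := (inferInstanceAs (AddCommGroup R.Alg[X]) : AddCommGroup D.At)
  mul := D.mul
  one := (1 : R.Alg[X])
  left_distrib := D.mul_add
  right_distrib := D.add_mul
  zero_mul x := by
    have h := D.add_mul 0 0 x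
    rw [add_zero] at h
    exact left_eq_add.1 h
  mul_zero x := by
    have h := D.mul_add x 0 0
    rw [add_zero] at h
    exact left_eq_add.1 h
  mul_assoc := D.mul_assoc
  one_mul := D.one_mul
  mul_one := D.mul_one

/-- The identity map from `A_t` to `A[t]`. -/
def toPoly (x : D.At) : R.Alg[X] := x

/-- The identity map from `A[t]` to `A_t`. -/
def ofPoly (x : R.Alg[X]) : D.At := x

/-- `A_t → A_t / ⟨t⟩ ≅ A`. -/
def special : D.At →+* R.Alg where
  toFun x := (D.toPoly x).coeff 0
  map_one' := Polynomial.coeff_one_zero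
  map_mul' := D.mod_t
  map_zero' := Polynomial.coeff_zero 0
  map_add' x y := Polynomial.coeff_add _ _ 0

/-- The deformation is given by the cochains `ψ_j` for `j ≥ 1`:
`a × b = a b + ∑_{j ≥ 1} ψ_j(a, b) t^j` for all `a, b ∈ A`. -/
def IsGivenBy (ψ : ℕ → R.Cochain2) : Prop :=
  ∀ j, 1 ≤ j → ∀ a b : R.Alg, (D.mul (Polynomial.C a) (Polynomial.C b)).coeff j =
    ψ j (BT.tmul k (R.bar a) (R.bar b))

end GradedDeformation

end HomRel

/-! ### Filtered algebras and their Rees algebras -/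

section Rees

variable {k V} (P : Set (TV k V))

/-- The filtration of `U = T_k V / ⟨P⟩` induced by the one of the tensor algebra. -/
def filU (n : ℕ) : AddSubgroup (PresAlg P) := (TV.fil k V n).map (pmk P).toAddMonoidHom

theorem tpow_le_fil (n : ℕ) {x : TV k V} (hx : x ∈ TV.tpow k V n) : x ∈ TV.fil k V n :=
  TV.mem_fil_iff.2 fun m hm => by rw [TV.proj_of_mem hx, if_neg (by omega)]

theorem fil_mul {m n : ℕ} {x y : TV k V} (hx : x ∈ TV.fil k V m) (hy : y ∈ TV.fil k V n) :
    x * y ∈ TV.fil k V (m + n) := by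
  rw [TV.mem_fil_iff] at *
  intro l hl
  rw [TV.proj, map_mul, Polynomial.coeff_mul]
  refine Finset.sum_eq_zero fun ij hij => ?_
  have h := Finset.HasAntidiagonal.mem_antidiagonal.1 hij
  by_cases hi : m < ij.1
  · have := hx _ hi
    rw [TV.proj] at this
    rw [this, zero_mul]
  · have := hy ij.2 (by omega)
    rw [TV.proj] at this
    rw [this, mul_zero]

/-- The Rees algebra `R(U) = {∑ u_i t^i : u_i ∈ F^i U} ⊆ U[t]`. -/
def Rees : Subring (PresAlg P)[X] where
  carrier := {x | ∀ i, x.coeff i ∈ filU P i}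
  zero_mem' i := by simp [zero_mem]
  add_mem' hx hy i := by rw [Polynomial.coeff_add]; exact add_mem (hx i) (hy i)
  neg_mem' hx i := by rw [Polynomial.coeff_neg]; exact neg_mem (hx i)
  one_mem' i := by
    rw [Polynomial.coeff_one]
    split_ifs with h
    · exact ⟨1, TV.mem_fil_iff.2 fun m hm => by
        have h0 : (1 : TV k V) ∈ TV.tpow k V 0 := ⟨1, map_one (KAlg.unit (k := k) (B := TV k V))⟩
        rw [TV.proj_of_mem h0, if_neg (by omega)], map_one (pmk P)⟩
    · exact zero_mem _
  mul_mem' {x y} hx hy i := by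
    rw [Polynomial.coeff_mul]
    refine sum_mem fun ij hij => ?_
    rw [← Finset.HasAntidiagonal.mem_antidiagonal.1 hij]
    obtain ⟨a, ha, ha'⟩ := hx ij.1
    obtain ⟨b, hb, hb'⟩ := hy ij.2
    exact ⟨a * b, fil_mul ha hb, by rw [← ha', ← hb']; exact map_mul (pmk P) a b⟩

namespace Rees

/-- The homogeneous element `π(x) t^n` of the Rees algebra, for `x ∈ F^n`. -/
def mono (n : ℕ) (x : TV k V) (hx : x ∈ TV.fil k V n) : Rees P :=
  ⟨Polynomial.monomial n (pmk P x), fun i => by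
    rw [Polynomial.coeff_monomial]
    split_ifs with h
    · subst h; exact ⟨x, hx, rfl⟩
    · exact zero_mem _⟩

/-- The element `t` of the Rees algebra. -/
def t : Rees P := mono P 1 1 (TV.mem_fil_iff.2 fun m hm => by
  have h0 : (1 : TV k V) ∈ TV.tpow k V 0 := ⟨1, map_one (KAlg.unit (k := k) (B := TV k V))⟩
  rw [TV.proj_of_mem h0, if_neg (by omega)])

/-- The structure map from `k` to the Rees algebra. -/
def const (c : k) : Rees P := mono P 0 (KAlg.unit c) (tpow_le_fil 0 ⟨c, rfl⟩)

/-- The ring homomorphism `T_k V → R(U)` with `α ↦ π(α) t^n` for `α ∈ V^{⊗ n}`. -/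
def hom : TV k V →+* Rees P :=
  TV.lift
    { toFun := const P
      map_one' := by
        apply Subtype.ext
        change Polynomial.monomial 0 (pmk P (KAlg.unit 1)) = 1
        rw [map_one, map_one]; rfl
      map_mul' := fun c d => by
        apply Subtype.ext
        change Polynomial.monomial 0 (pmk P (KAlg.unit (c * d))) =
          Polynomial.monomial 0 (pmk P (KAlg.unit c)) * Polynomial.monomial 0 (pmk P (KAlg.unit d))
        rw [map_mul, map_mul, Polynomial.monomial_mul_monomial]
      map_zero' := by
        apply Subtype.ext
        change Polynomial.monomial 0 (pmk P (KAlg.unit 0)) = 0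
        rw [map_zero, map_zero, map_zero]
      map_add' := fun c d => by
        apply Subtype.ext
        change Polynomial.monomial 0 (pmk P (KAlg.unit (c + d))) =
          Polynomial.monomial 0 (pmk P (KAlg.unit c)) + Polynomial.monomial 0 (pmk P (KAlg.unit d))
        rw [map_add, map_add, map_add] }
    (AddMonoidHom.mk' (fun v => mono P 1 (TV.ι v) (tpow_le_fil 1 (TV.ι_mem v)))
      (fun v w => by
        apply Subtype.ext
        change Polynomial.monomial 1 (pmk P (TV.ι (v + w))) =
          Polynomial.monomial 1 (pmk P (TV.ι v)) + Polynomial.monomial 1 (pmk P (TV.ι w))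
        rw [BiHom.map_add, map_add, map_add]))
    (by
      intro c v
      apply Subtype.ext
      change Polynomial.monomial 1 (pmk P (TV.ι (c • v))) =
        Polynomial.monomial 0 (pmk P (KAlg.unit c)) * Polynomial.monomial 1 (pmk P (TV.ι v))
      rw [BiHom.map_smul, KAlg.smul_def, map_mul, Polynomial.monomial_mul_monomial])
    (by
      intro c v
      apply Subtype.ext
      change Polynomial.monomial 1 (pmk P (TV.ι (op c • v))) =
        Polynomial.monomial 1 (pmk P (TV.ι v)) * Polynomial.monomial 0 (pmk P (KAlg.unit c))
      rw [BiHom.map_op_smul, KAlg.op_smul_def, map_mul, Polynomial.monomial_mul_monomial])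

theorem hom_of_mem {n : ℕ} {x : TV k V} (hx : x ∈ TV.tpow k V n) :
    hom P x = mono P n x (tpow_le_fil n hx) := by
  apply Subtype.ext
  change (hom P x).1 = Polynomial.monomial n (pmk P x)
  induction n generalizing x with
  | zero =>
    obtain ⟨c, rfl⟩ := hx
    change (hom P (KAlg.unit c)).1 = _
    rw [hom, TV.lift_unit]
    rfl
  | succ n ih =>
    refine AddSubgroup.closure_induction ?_ ?_ ?_ ?_ hx
    · rintro _ ⟨v, x, hx, rfl⟩
      rw [map_mul, Subring.coe_mul, ih hx, hom, TV.lift_ι, map_mul (pmk P), add_comm]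
      exact Polynomial.monomial_mul_monomial 1 n _ _
    · rw [map_zero, map_zero, map_zero]; rfl
    · intro x y _ _ hx hy
      rw [map_add, map_add, map_add, Subring.coe_add, hx, hy]
    · intro x _ hx
      rw [map_neg, map_neg, map_neg, Subring.coe_neg, hx]

/-- The quotient `R(U) / ⟨t⟩`. -/
abbrev modT : Type (max u v) := Rees P ⧸ idealOf {t P}

end Rees
end Rees

/-! ### The relations and algebras corresponding to each other -/

section Main

variable {k V} [SMulCommClass k kᵐᵒᵖ V] {N : ℕ}

/-- The graded `k[t]`-algebras `R(U)`, for `U = T_k V / ⟨P⟩`, and `A_t` are isomorphic through an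
isomorphism inducing the identity of `A`.

Here `Φ` is a ring isomorphism compatible with the structure maps from `k[t]` and with the
gradings; `e` is the canonical map `A → gr(U) ≅ R(U) / ⟨t⟩`, sending the class of `α ∈ V^{⊗ n}` to
the class of `π(α) t^n`, which is part of the assertion to be a well defined isomorphism; and the
last condition says that the composition of `e`, the map `R(U) / ⟨t⟩ → A_t / ⟨t⟩` induced by `Φ`
and `A_t / ⟨t⟩ ≅ A` is the identity. -/
def ReesIsomorphic (R : HomRel k V N) (P : Set (TV k V)) (D : R.GradedDeformation) : Prop :=
  ∃ Φ : Rees P ≃+* D.At,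
    (∀ c : k, Φ (Rees.const P c) = D.ofPoly (Polynomial.C (KAlg.unit c))) ∧
    Φ (Rees.t P) = D.ofPoly Polynomial.X ∧
    (∀ (n : ℕ) (x : Rees P), (∃ u ∈ filU P n, (x : (PresAlg P)[X]) = Polynomial.monomial n u) ↔
      R.IsHomogeneousOfDegree n (D.toPoly (Φ x))) ∧
    ∃ e : R.Alg ≃+* Rees.modT P,
      (∀ x : TV k V, e (R.toAlg x) = Ideal.Quotient.mk _ (Rees.hom P x)) ∧
      ∀ (a : R.Alg) (y : Rees P), Ideal.Quotient.mk _ y = e a → D.special (Φ y) = a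

/-- The set `P = {r - ∑_{j < N} φ_j(r) : r ∈ R}` obtained from the cochains `ψ_j` of a deformation,
where `φ_j(r) ∈ V^{⊗ j}`, for `0 ≤ j < N`, is the element whose class in `A_j ≅ V^{⊗ j}` is
`(ψ_{N-j}^~ ∘ σ̄₂)(1|r|1)`. -/
def relationsOf (R : HomRel k V N) (ψ : ℕ → R.Cochain2) : Set (TV k V) :=
  {x | ∃ (r : R.rel) (y : ℕ → TV k V),
    (∀ j < N, y j ∈ TV.tpow k V j ∧
      R.toAlg (y j) = extend (ψ (N - j)) (R.sigma2 (gen k R.Alg R.rel r))) ∧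
    x = r - ∑ j ∈ Finset.range N, y j}

/-- The homogeneous relations `R = π_N(P)`. -/
def topPart (P : SubBimod k (TV k V)) (hN : 2 ≤ N) : HomRel k V N where
  rel :=
    { toAddSubgroup := P.toAddSubgroup.map (TV.projHom N).1
      smul_mem' := by
        rintro c _ ⟨x, hx, rfl⟩
        exact ⟨c • x, P.smul_mem' c hx, (TV.projHom N).map_smul c x⟩
      op_smul_mem' := by
        rintro c _ ⟨x, hx, rfl⟩
        exact ⟨op c • x, P.op_smul_mem' c hx, (TV.projHom N).map_op_smul c x⟩ }
  two_le := hN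
  le := by
    rintro _ ⟨x, _, rfl⟩
    exact TV.proj_mem N x

variable (P : SubBimod k (TV k V)) (hN : 2 ≤ N)

/-- The isomorphism `π_N : P → R`, if `P ⊆ F^N` and `P ∩ F^{N-1} = 0`. -/
def topEquiv (hP : ∀ x ∈ P, x ∈ TV.fil k V N) (h1 : ∀ x ∈ P, x ∈ TV.fil k V (N - 1) → x = 0) :
    P ≃+ (topPart P hN).rel :=
  AddEquiv.ofBijective
    (AddMonoidHom.mk' (fun x : P => (⟨TV.projHom N x.1, x.1, x.2, rfl⟩ : (topPart P hN).rel))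
      (fun x y => Subtype.ext ((TV.projHom N).map_add x.1 y.1))) <| by
    constructor
    · rw [injective_iff_map_eq_zero]
      intro x hx
      have hx0 : TV.proj N x.1 = 0 := congrArg Subtype.val hx
      refine Subtype.ext (h1 x.1 x.2 (TV.mem_fil_iff.2 fun m hm => ?_))
      rcases eq_or_ne m N with rfl | hm'
      · exact hx0
      · exact TV.mem_fil_iff.1 (hP x.1 x.2) m (by omega)
    · rintro ⟨_, x, hx, rfl⟩
      exact ⟨⟨x, hx⟩, rfl⟩

/-- The homomorphisms `φ_j : R → V^{⊗ j}`, for `0 ≤ j < N`, with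
`P = {r - ∑_{j < N} φ_j(r) : r ∈ R}`. -/
def phi (hP : ∀ x ∈ P, x ∈ TV.fil k V N) (h1 : ∀ x ∈ P, x ∈ TV.fil k V (N - 1) → x = 0) (j : ℕ) :
    BiHom k (topPart P hN).rel (TV k V) :=
  ⟨AddMonoidHom.mk' (fun r => - TV.projHom j ((topEquiv P hN hP h1).symm r).1) (by
      intro r s
      rw [map_add, AddMemClass.coe_add, BiHom.map_add, neg_add]), by
    constructor <;> intro c r
    · have h : (topEquiv P hN hP h1).symm (c • r) = c • (topEquiv P hN hP h1).symm r := by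
        rw [AddEquiv.symm_apply_eq]
        apply Subtype.ext
        change c • r.1 = TV.projHom N (c • ((topEquiv P hN hP h1).symm r).1)
        rw [BiHom.map_smul]
        exact congrArg (c • ·) (congrArg Subtype.val
          ((topEquiv P hN hP h1).apply_symm_apply r)).symm
      change - TV.projHom j ((topEquiv P hN hP h1).symm (c • r)).1 =
        c • - TV.projHom j ((topEquiv P hN hP h1).symm r).1
      rw [h, smul_neg, ← BiHom.map_smul]
      rfl
    · have h : (topEquiv P hN hP h1).symm (op c • r) = op c • (topEquiv P hN hP h1).symm r := by
        rw [AddEquiv.symm_apply_eq]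
        apply Subtype.ext
        change op c • r.1 = TV.projHom N (op c • ((topEquiv P hN hP h1).symm r).1)
        rw [BiHom.map_op_smul]
        exact congrArg (op c • ·) (congrArg Subtype.val
          ((topEquiv P hN hP h1).apply_symm_apply r)).symm
      change - TV.projHom j ((topEquiv P hN hP h1).symm (op c • r)).1 =
        op c • - TV.projHom j ((topEquiv P hN hP h1).symm r).1
      rw [h, smul_neg, ← BiHom.map_op_smul]
      rfl⟩

/-- `r - ∑_{j < N} φ_j(r)` is the element of `P` whose component of degree `N` is `r`. -/
theorem sub_phi_mem (hP : ∀ x ∈ P, x ∈ TV.fil k V N)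
    (h1 : ∀ x ∈ P, x ∈ TV.fil k V (N - 1) → x = 0) (r : (topPart P hN).rel) :
    (r : TV k V) - ∑ j ∈ Finset.range N, phi P hN hP h1 j r ∈ P := by
  have h : (r : TV k V) - ∑ j ∈ Finset.range N, phi P hN hP h1 j r =
      ((topEquiv P hN hP h1).symm r).1 := by
    obtain ⟨x, rfl⟩ := (topEquiv P hN hP h1).surjective r
    have h2 : ∀ j, phi P hN hP h1 j (topEquiv P hN hP h1 x) = - TV.proj j x.1 := by
      intro j
      change - TV.projHom j ((topEquiv P hN hP h1).symm (topEquiv P hN hP h1 x)).1 = _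
      rw [AddEquiv.symm_apply_apply]; rfl
    simp only [h2, Finset.sum_neg_distrib, sub_neg_eq_add, AddEquiv.symm_apply_apply]
    change TV.proj N x.1 + _ = x.1
    rw [add_comm, ← Finset.sum_range_succ (fun j => TV.proj j x.1)]
    conv_rhs => rw [← TV.sum_proj x.1]
    refine (Polynomial.sum_over_range' (f := fun _ y => y) _ (fun _ => rfl) (N + 1) ?_).symm
    rw [Nat.lt_succ_iff, Polynomial.natDegree_le_iff_coeff_eq_zero]
    exact TV.mem_fil_iff.1 (hP x.1 x.2)
  rw [h]
  exact ((topEquiv P hN hP h1).symm r).2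

/-- `U = T_k V / ⟨P⟩` is a weak PBW-deformation of `A = T_k V / ⟨R⟩`, with `R = π_N(P)`: the
sub-bimodule `P ⊆ F^N` satisfies `P ∩ F^{N-1} = 0` and, for all
`w = ∑ r_i u_i = ∑ v_i s_i ∈ (R ⊗ V) ∩ (V ⊗ R)`, the elements
`θ_j = (φ_j ⊗ 1 - 1 ⊗ φ_j)(w) = ∑ φ_j(r_i) u_i - ∑ v_i φ_j(s_i)` are such that `θ_{N-1} ∈ R`,
`φ_0(θ_{N-1}) = 0` and `φ_j(θ_{N-1}) + θ_{j-1} = 0` for `0 < j < N`. -/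
structure IsWeakPBW : Prop where
  le_fil : ∀ x ∈ P, x ∈ TV.fil k V N
  inf_fil : ∀ x ∈ P, x ∈ TV.fil k V (N - 1) → x = 0
  compat : ∀ (m n : ℕ) (r : Fin m → (topPart P hN).rel) (u : Fin m → V) (v : Fin n → V)
    (s : Fin n → (topPart P hN).rel),
    ∑ i, (r i : TV k V) * TV.ι (u i) = ∑ i, TV.ι (v i) * (s i : TV k V) →
    ∀ θ : ℕ → TV k V,
    (∀ j, θ j = ∑ i, phi P hN le_fil inf_fil j (r i) * TV.ι (u i)
      - ∑ i, TV.ι (v i) * phi P hN le_fil inf_fil j (s i)) →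
    ∃ h : θ (N - 1) ∈ (topPart P hN).rel,
      phi P hN le_fil inf_fil 0 ⟨θ (N - 1), h⟩ = 0 ∧
      ∀ j, 0 < j → j < N → phi P hN le_fil inf_fil j ⟨θ (N - 1), h⟩ + θ (j - 1) = 0

variable {P hN} in
/-- The homomorphisms `φ_j : R → A_j` describing a weak PBW-deformation. -/
def IsWeakPBW.phi (h : IsWeakPBW P hN) (j : ℕ) : BiHom k (topPart P hN).rel (topPart P hN).Alg :=
  (pmkHom _).comp (PBW.phi P hN h.le_fil h.inf_fil j)

end Main
end Homogeneous
end PBW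

/-! Two arguments carry the theorem: a comparison of two quotients of `(T_k V)[t]`, which gives (1)
and the last claim of (2), and an obstruction argument, which makes the product in (2) associative.

Comparison. The ring `(T_k V)[t]` maps onto `R(U)` (`Rees.polyHom`) and onto `A_t`
(`GradedDeformation.hom`). Every polynomial is a sum of homogenizations `∑_{j ≤ n} x_j t^(n-j)` of
elements `x ∈ F^n`, and the map to `R(U)` kills such a homogenization exactly when `x ∈ ⟨P⟩`. The
same criterion holds for `A_t`. As the `ψ_j` are normalized, words of length below `N` multiply in
`A_t` as in `A`, so a relation `r` becomes `∑ φ_j(r) t^(N-j)` there and the homogenized elements of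
`P` vanish. As `A_t` has no `t`-torsion, the vanishing extends to all of `⟨P⟩` at the correct level
(`hom_homogenize_eq_zero`). As `A_t / ⟨t⟩ = A`, an induction on the filtration gives the converse
(`mem_idealOf_of_hom_homogenize_eq_zero`). The kernels agree, and `reesIsomorphic` follows.

Comparison data. Over the semisimple ring `k ⊗_F kᵒᵖ` bimodule maps lift, degree by degree
(`exists_gradedLift`). A homogeneous section of `T_k V → A` gives `τ̄₁` and `s₁`, a lift of `τ̄₁
b̄₂` through `d₂` gives `τ̄₂`, and the contracting homotopy `hL` of the bar complex, applied to the
remaining defect, gives `s₂`. The prescribed values hold because `A` agrees with `T_k V` below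
degree `N` and `K₂` starts in degree `N` with `R`.

Associativity. Put `ω_n = (ψ'_n)^~ b̄₃ + sq(ψ₁, …, ψ_{n-1})^~` (`obstruction`). The recursion says
`ψ_n^~ = (ψ'_n)^~ - ω_n s₂`, so the associator in order `n` is `ω_n (id - s₂ b̄₃)`. If lower orders
are associative, the pentagon identity makes the associator a Hochschild cocycle, and then `ω_n`
depends only on the boundary of its argument. The boundary of `x - s₂ b̄₃ x` is `σ̄₂` of the Koszul
cycle `τ̄₂ b̄₃ x`. Since `Tor₃` is concentrated in degree `N + 1`, the cycles of `K₂` are generated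
as a bimodule by the overlaps `∑ 1|r|u - ∑ v|s|1` with `∑ r u = ∑ v s` (`mem_of_d2_eq_zero_of_mem`,
a graded Nakayama argument). On such an overlap `ω_n` equals `θ_{N-n} + φ_{N-n+1}(θ_{N-1})`,
suitably read at the ends of the range, and this is zero by the weak PBW conditions
(`relCochain_add_eq_zero`). -/

namespace PBW

universe u v w

set_option linter.unusedSectionVars false

/-! ### Bimodule homomorphisms and balanced tensor products: evaluation and gradings. -/

section Basics

variable {k : Type*} [Ring k] {M N L : Type*} [AddCommGroup M] [Module k M] [Module kᵐᵒᵖ M]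
  [AddCommGroup N] [Module k N] [Module kᵐᵒᵖ N] [AddCommGroup L] [Module k L] [Module kᵐᵒᵖ L]

@[simp]
private theorem BiHom.comp_apply (g : BiHom k N L) (f : BiHom k M N) (x : M) : g.comp f x = g (f x) := rfl

@[simp]
private theorem BiHom.id_apply (x : M) : BiHom.id k M x = x := rfl

@[simp]
private theorem BiHom.add_apply (f g : BiHom k M N) (x : M) : (f + g) x = f x + g x := rfl

@[simp]
private theorem BiHom.sub_apply (f g : BiHom k M N) (x : M) : (f - g) x = f x - g x := rfl

@[simp]
private theorem BiHom.zero_apply (x : M) : (0 : BiHom k M N) x = 0 := rfl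

private theorem BiHom.sum_apply {ι : Type*} (s : Finset ι) (f : ι → BiHom k M N) (x : M) :
    (∑ i ∈ s, f i) x = ∑ i ∈ s, f i x := by
  classical
  induction s using Finset.induction_on with
  | empty => rfl
  | insert a s ha ih => rw [Finset.sum_insert ha, Finset.sum_insert ha, BiHom.add_apply, ih]

private theorem BT.zero_tmul (n : N) : BT.tmul k (0 : M) n = 0 := by
  have := BT.add_tmul k (0 : M) 0 n
  rwa [add_zero, left_eq_add] at this

private theorem BT.tmul_zero (m : M) : BT.tmul k m (0 : N) = 0 := by
  have := BT.tmul_add k m (0 : N) 0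
  rwa [add_zero, left_eq_add] at this

variable (k) in
/-- `n ↦ m ⊗ n` as an additive map. -/
def BT.tmulHom (m : M) : N →+ BT k M N := AddMonoidHom.mk' (BT.tmul k m) (BT.tmul_add k m)

variable (k) in
/-- `m ↦ m ⊗ n` as an additive map. -/
def BT.tmulHomLeft (n : N) : M →+ BT k M N :=
  AddMonoidHom.mk' (fun m => BT.tmul k m n) (fun m m' => BT.add_tmul k m m' n)

/-- The graded pieces of a tensor product are generated by tensors of elements of additive
generating sets. -/
private theorem BT.tmul_mem_grading {G : ℕ → AddSubgroup M} {H : ℕ → AddSubgroup N} {i j d : ℕ}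
    (h : i + j = d) {m : M} (hm : m ∈ G i) {n : N} (hn : n ∈ H j) :
    BT.tmul k m n ∈ BT.grading (k := k) G H d :=
  AddSubgroup.subset_closure ⟨i, j, h, m, hm, n, hn, rfl⟩

private theorem BT.grading_le {G : ℕ → AddSubgroup M} {H : ℕ → AddSubgroup N} {d : ℕ}
    {S : AddSubgroup (BT k M N)}
    (h : ∀ i j, i + j = d → ∀ m ∈ G i, ∀ n ∈ H j, BT.tmul k m n ∈ S) : BT.grading (k := k) G H d ≤ S := by
  rw [BT.grading, AddSubgroup.closure_le]
  rintro _ ⟨i, j, hij, m, hm, n, hn, rfl⟩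
  exact h i j hij m hm n hn

end Basics

/-! ### The tensor algebra: words read from either end, homogeneous components. -/

section TensorAlgebra

variable {k : Type u} [Ring k] {V : Type v} [AddCommGroup V] [Module k V] [Module kᵐᵒᵖ V]

namespace TV

private theorem unit_mem (c : k) : (KAlg.unit c : TV k V) ∈ tpow k V 0 := ⟨c, rfl⟩

private theorem one_mem : (1 : TV k V) ∈ tpow k V 0 := ⟨1, map_one (KAlg.unit (k := k) (B := TV k V))⟩

/-- The powers are defined by adding letters on the left, whereas the derivation `par` and the
insertion maps are computed by adding letters on the right; this passes from one to the other. A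
scalar in last place is absorbed into the letter through the right action. -/
private theorem tpow_succ_right (n : ℕ) :
    tpow k V (n + 1) = AddSubgroup.closure {z | ∃ x ∈ tpow k V n, ∃ v : V, z = x * ι v} := by
  apply le_antisymm
  · induction n with
    | zero =>
      refine (AddSubgroup.closure_le _).2 ?_
      rintro _ ⟨v, _, ⟨c, rfl⟩, rfl⟩
      refine AddSubgroup.subset_closure ⟨1, one_mem, op c • v, ?_⟩
      rw [one_mul, BiHom.map_op_smul, KAlg.op_smul_def]
      rfl
    | succ n ih =>
      rw [tpow, AddSubgroup.closure_le]
      rintro _ ⟨v, x, hx, rfl⟩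
      have := ih hx
      clear hx
      induction this using AddSubgroup.closure_induction with
      | mem y hy =>
        obtain ⟨y, hy, w, rfl⟩ := hy
        exact AddSubgroup.subset_closure ⟨ι v * y, AddSubgroup.subset_closure ⟨v, y, hy, rfl⟩, w,
          (mul_assoc _ _ _).symm⟩
      | zero => rw [mul_zero]; exact zero_mem _
      | add x y _ _ hx hy => rw [mul_add]; exact add_mem hx hy
      | neg x _ hx => rw [mul_neg]; exact neg_mem hx
  · rw [AddSubgroup.closure_le]
    rintro _ ⟨x, hx, v, rfl⟩
    exact mul_mem hx (ι_mem v)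

/-- The map `ng` absorbs signs into the data, so elements of the generated subgroup are finite
families summed without coefficients. Relation decompositions and the weak PBW condition are stated
with such families. -/
private theorem exists_sum_of_closure {X : Type*} [AddCommGroup X] {T : Type*} (f : T → X) (p : T → Prop)
    (ng : T → T) (hp : ∀ t, p t → p (ng t)) (hng : ∀ t, f (ng t) = - f t) {z : X}
    (hz : z ∈ AddSubgroup.closure {z | ∃ t, p t ∧ z = f t}) :
    ∃ (m : ℕ) (t : Fin m → T), (∀ i, p (t i)) ∧ z = ∑ i, f (t i) := by
  induction hz using AddSubgroup.closure_induction with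
  | mem y hy =>
    obtain ⟨t, ht, rfl⟩ := hy
    exact ⟨1, fun _ => t, fun _ => ht, by simp⟩
  | zero => exact ⟨0, Fin.elim0, fun i => i.elim0, by simp⟩
  | add x y _ _ hx hy =>
    obtain ⟨m, t, ht, rfl⟩ := hx
    obtain ⟨n, s, hs, rfl⟩ := hy
    refine ⟨m + n, Fin.append t s, fun i => ?_, ?_⟩
    · induction i using Fin.addCases with
      | left i => rw [Fin.append_left]; exact ht i
      | right i => rw [Fin.append_right]; exact hs i
    · rw [Fin.sum_univ_add]; simp
  | neg x _ hx =>
    obtain ⟨m, t, ht, rfl⟩ := hx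
    exact ⟨m, fun i => ng (t i), fun i => hp _ (ht i), by simp [hng]⟩

private theorem exists_sum_right {n : ℕ} {z : TV k V} (hz : z ∈ tpow k V (n + 1)) :
    ∃ (m : ℕ) (x : Fin m → TV k V) (v : Fin m → V), (∀ i, x i ∈ tpow k V n) ∧
      z = ∑ i, x i * ι (v i) := by
  rw [tpow_succ_right] at hz
  obtain ⟨m, t, ht, h⟩ := exists_sum_of_closure (fun t : TV k V × V => t.1 * ι t.2)
    (fun t => t.1 ∈ tpow k V n) (fun t => (-t.1, t.2)) (fun t ht => neg_mem ht)
    (fun t => neg_mul _ _) (z := z) (by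
      refine AddSubgroup.closure_mono ?_ hz
      rintro _ ⟨x, hx, v, rfl⟩
      exact ⟨(x, v), hx, rfl⟩)
  exact ⟨m, fun i => (t i).1, fun i => (t i).2, ht, h⟩

private theorem exists_sum_left {n : ℕ} {z : TV k V} (hz : z ∈ tpow k V (n + 1)) :
    ∃ (m : ℕ) (v : Fin m → V) (x : Fin m → TV k V), (∀ i, x i ∈ tpow k V n) ∧
      z = ∑ i, ι (v i) * x i := by
  obtain ⟨m, t, ht, h⟩ := exists_sum_of_closure (fun t : V × TV k V => ι t.1 * t.2)
    (fun t => t.2 ∈ tpow k V n) (fun t => (t.1, -t.2)) (fun t ht => neg_mem ht)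
    (fun t => mul_neg _ _) (z := z) (by
      refine AddSubgroup.closure_mono ?_ hz
      rintro _ ⟨v, x, hx, rfl⟩
      exact ⟨(v, x), hx, rfl⟩)
  exact ⟨m, fun i => (t i).1, fun i => (t i).2, ht, h⟩

@[simp]
private theorem proj_add (n : ℕ) (x y : TV k V) : proj n (x + y) = proj n x + proj n y :=
  (projHom n).map_add x y

@[simp]
private theorem proj_zero (n : ℕ) : proj n (0 : TV k V) = 0 := (projHom n).1.map_zero

@[simp]
private theorem proj_neg (n : ℕ) (x : TV k V) : proj n (-x) = - proj n x := (projHom n).1.map_neg x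

@[simp]
private theorem proj_sub (n : ℕ) (x y : TV k V) : proj n (x - y) = proj n x - proj n y :=
  (projHom n).1.map_sub x y

private theorem proj_sum {ι : Type*} (n : ℕ) (s : Finset ι) (f : ι → TV k V) :
    proj n (∑ i ∈ s, f i) = ∑ i ∈ s, proj n (f i) := map_sum (projHom n).1 f s

private theorem proj_eq_self {n : ℕ} {x : TV k V} (hx : x ∈ tpow k V n) : proj n x = x := by
  rw [proj_of_mem hx, if_pos rfl]

private theorem proj_eq_zero {n m : ℕ} (h : n ≠ m) {x : TV k V} (hx : x ∈ tpow k V n) : proj m x = 0 := by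
  rw [proj_of_mem hx, if_neg h]

private theorem proj_proj (n m : ℕ) (x : TV k V) : proj m (proj n x) = if n = m then proj n x else 0 :=
  proj_of_mem (proj_mem n x) m

private theorem proj_mul (n : ℕ) (x y : TV k V) :
    proj n (x * y) = ∑ ij ∈ Finset.HasAntidiagonal.antidiagonal n, proj ij.1 x * proj ij.2 y := by
  rw [proj, map_mul, Polynomial.coeff_mul]
  rfl

private theorem exists_mem_fil (x : TV k V) : ∃ n, x ∈ fil k V n :=
  ⟨(gr k V x).natDegree, mem_fil_iff.2 fun _ hm => Polynomial.coeff_eq_zero_of_natDegree_lt hm⟩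

private theorem eq_sum_proj {n : ℕ} {x : TV k V} (hx : x ∈ fil k V n) :
    x = ∑ j ∈ Finset.range (n + 1), proj j x := by
  conv_lhs => rw [← sum_proj x]
  refine Polynomial.sum_over_range' (f := fun _ y => y) _ (fun _ => rfl) (n + 1) ?_
  rw [Nat.lt_succ_iff, Polynomial.natDegree_le_iff_coeff_eq_zero]
  exact mem_fil_iff.1 hx

private theorem fil_mono {m n : ℕ} (h : m ≤ n) : fil k V m ≤ fil k V n := fun _ hx =>
  mem_fil_iff.2 fun l hl => mem_fil_iff.1 hx l (by omega)

private theorem mem_fil_of_mem {m n : ℕ} (h : m ≤ n) {x : TV k V} (hx : x ∈ tpow k V m) :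
    x ∈ fil k V n := fil_mono h (tpow_le_fil m hx)

/-- An additive subgroup containing all the `V^{⊗ n}` is everything. -/
private theorem mem_of_tpow {S : AddSubgroup (TV k V)} (h : ∀ n, tpow k V n ≤ S) (x : TV k V) : x ∈ S := by
  obtain ⟨n, hn⟩ := exists_mem_fil x
  rw [eq_sum_proj hn]
  exact sum_mem fun j _ => h j (proj_mem j x)

/-- Induction on words by appending a letter, the form that matches the recursion `par_mul_ι`. -/
private theorem right_induction {S : AddSubgroup (TV k V)} (hu : ∀ c : k, KAlg.unit c ∈ S)
    (hv : ∀ x ∈ S, ∀ v : V, x * ι v ∈ S) (x : TV k V) : x ∈ S := by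
  refine mem_of_tpow (fun n => ?_) x
  induction n with
  | zero => rintro _ ⟨c, rfl⟩; exact hu c
  | succ n ih =>
    rw [tpow_succ_right, AddSubgroup.closure_le]
    rintro _ ⟨x, hx, v, rfl⟩
    exact hv x (ih hx) v

private theorem addHom_ext_right {X : Type*} [AddCommGroup X] {f g : TV k V →+ X}
    (hu : ∀ c : k, f (KAlg.unit c) = g (KAlg.unit c))
    (hv : ∀ x, f x = g x → ∀ v : V, f (x * ι v) = g (x * ι v)) (x : TV k V) : f x = g x :=
  right_induction (S := f.eqLocus g) hu hv x

private theorem proj_zero_eq (x : TV k V) : proj 0 x = KAlg.unit (aug x) := by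
  have : (projHom (k := k) (V := V) 0).1 = (KAlg.unit (k := k)
      (B := TV k V)).toAddMonoidHom.comp (aug (k := k) (V := V)).toAddMonoidHom := by
    ext x
    refine right_induction (S := AddMonoidHom.eqLocus (projHom (k := k) (V := V) 0).1
      ((KAlg.unit (k := k) (B := TV k V)).toAddMonoidHom.comp
        (aug (k := k) (V := V)).toAddMonoidHom)) ?_ ?_ x
    · intro c
      change proj 0 (KAlg.unit c) = (KAlg.unit (aug (KAlg.unit c : TV k V)) : TV k V)
      rw [proj_eq_self (unit_mem c)]
      simp [aug]
    · intro x _ v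
      change proj 0 (x * ι v) = (KAlg.unit (aug (x * ι v)) : TV k V)
      rw [proj_mul, Finset.Nat.antidiagonal_zero, Finset.sum_singleton,
        proj_eq_zero one_ne_zero (ι_mem v), map_mul]
      simp [aug]
  exact DFunLike.congr_fun this x

end TV

/-! ### Ideals, the grading of an `N`-homogeneous algebra, and its agreement with `T_k V` below
degree `N`. -/

open scoped Pointwise in
private theorem mem_idealOf_iff {B : Type*} [Ring B] (P : Set B) (z : B) :
    z ∈ idealOf P ↔ z ∈ AddSubgroup.closure {y | ∃ a, ∃ p ∈ P, ∃ b, y = a * p * b} := by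
  rw [idealOf, TwoSidedIdeal.mem_asIdeal, TwoSidedIdeal.mem_span_iff_mem_addSubgroup_closure]
  have : {y | ∃ a, ∃ p ∈ P, ∃ b, y = a * p * b} = (Set.univ : Set B) * P * (Set.univ : Set B) := by
    ext y
    simp only [Set.mem_ofPred_eq, Set.mem_mul, Set.mem_univ, true_and]
    constructor
    · rintro ⟨a, p, hp, b, rfl⟩
      exact ⟨a * p, ⟨a, p, hp, rfl⟩, b, rfl⟩
    · rintro ⟨_, ⟨a, p, hp, rfl⟩, b, rfl⟩
      exact ⟨a, p, hp, b, rfl⟩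
  rw [this]

private theorem pmk_eq_zero_iff (P : Set (TV k V)) (x : TV k V) : pmk P x = 0 ↔ x ∈ idealOf P :=
  Ideal.Quotient.eq_zero_iff_mem

private theorem pmk_surjective (P : Set (TV k V)) : Function.Surjective (pmk P) :=
  Ideal.Quotient.mk_surjective

@[simp]
private theorem pmk_unit (P : Set (TV k V)) (c : k) : pmk P (KAlg.unit c) = KAlg.unit c := rfl

namespace HomRel

variable {N : ℕ} (R : HomRel k V N)

private theorem toAlg_rel {x : TV k V} (hx : x ∈ R.rel) : R.toAlg x = 0 :=
  (pmk_eq_zero_iff _ x).2 (subset_idealOf _ hx)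

/-- The homomorphism `A → A[t]` multiplying the elements of `A_n` by `t^n`. -/
def grHom : R.Alg →+* R.Alg[X] :=
  Ideal.Quotient.lift _ ((Polynomial.mapRingHom R.toAlg).comp (TV.gr k V))
    (map_eq_zero_of_mem_idealOf _ fun x hx => by
      rw [RingHom.comp_apply, TV.gr_of_mem (R.le x hx), Polynomial.coe_mapRingHom,
        Polynomial.map_monomial, R.toAlg_rel hx, map_zero])

private theorem grHom_toAlg (x : TV k V) :
    R.grHom (R.toAlg x) = (TV.gr k V x).map R.toAlg := rfl

/-- The projection `A → A_n`. -/
def prA (n : ℕ) : BiHom k R.Alg R.Alg :=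
  ⟨(Polynomial.lcoeff R.Alg n).toAddMonoidHom.comp R.grHom.toAddMonoidHom, by
    have h : ∀ c : k, R.grHom (KAlg.unit c) = Polynomial.C (KAlg.unit c) := fun c => by
      rw [← pmk_unit, grHom_toAlg, TV.gr_of_mem (TV.unit_mem c), Polynomial.map_monomial]
      rfl
    constructor <;> intro c x
    · change (R.grHom (KAlg.unit c * x)).coeff n = KAlg.unit c * (R.grHom x).coeff n
      rw [map_mul, h, Polynomial.coeff_C_mul]
    · change (R.grHom (x * KAlg.unit c)).coeff n = (R.grHom x).coeff n * KAlg.unit c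
      rw [map_mul, h, Polynomial.coeff_mul_C]⟩

private theorem prA_toAlg (n : ℕ) (x : TV k V) : R.prA n (R.toAlg x) = R.toAlg (TV.proj n x) := by
  change (R.grHom (R.toAlg x)).coeff n = _
  rw [grHom_toAlg, Polynomial.coeff_map]
  rfl

private theorem prA_mem (n : ℕ) (a : R.Alg) : R.prA n a ∈ R.comp n := by
  obtain ⟨x, rfl⟩ := pmk_surjective _ a
  rw [prA_toAlg]
  exact ⟨_, TV.proj_mem n x, rfl⟩

private theorem prA_of_mem {n : ℕ} {a : R.Alg} (ha : a ∈ R.comp n) (m : ℕ) :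
    R.prA m a = if n = m then a else 0 := by
  obtain ⟨x, hx, rfl⟩ := ha
  change R.prA m (R.toAlg x) = if n = m then R.toAlg x else 0
  rw [prA_toAlg, TV.proj_of_mem hx]
  split_ifs <;> simp

private theorem toAlg_mem {n : ℕ} {x : TV k V} (hx : x ∈ TV.tpow k V n) : R.toAlg x ∈ R.comp n :=
  ⟨x, hx, rfl⟩

private theorem mul_mem_comp {m n : ℕ} {a b : R.Alg} (ha : a ∈ R.comp m) (hb : b ∈ R.comp n) :
    a * b ∈ R.comp (m + n) := by
  obtain ⟨x, hx, rfl⟩ := ha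
  obtain ⟨y, hy, rfl⟩ := hb
  exact ⟨x * y, TV.mul_mem hx hy, map_mul R.toAlg x y⟩

private theorem unit_mem_comp (c : k) : (KAlg.unit c : R.Alg) ∈ R.comp 0 := ⟨_, TV.unit_mem c, rfl⟩

private theorem one_mem_comp : (1 : R.Alg) ∈ R.comp 0 := ⟨_, TV.one_mem, map_one R.toAlg⟩

/-- An additive subgroup containing all the `A_n` is everything. -/
private theorem mem_of_comp {S : AddSubgroup R.Alg} (h : ∀ n, R.comp n ≤ S) (a : R.Alg) : a ∈ S := by
  obtain ⟨x, rfl⟩ := pmk_surjective _ a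
  exact TV.mem_of_tpow (S := S.comap R.toAlg.toAddMonoidHom)
    (fun n x hx => h n ⟨x, hx, rfl⟩) x

private theorem aug_of_mem {n : ℕ} (hn : n ≠ 0) {a : R.Alg} (ha : a ∈ R.comp n) : R.aug a = 0 := by
  obtain ⟨x, hx, rfl⟩ := ha
  exact TV.aug_of_mem hn hx

private theorem eq_unit_of_mem {a : R.Alg} (ha : a ∈ R.comp 0) : a = KAlg.unit (R.aug a) := by
  obtain ⟨_, ⟨c, rfl⟩, rfl⟩ := ha
  change KAlg.unit c = KAlg.unit (R.aug (KAlg.unit c))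
  rw [aug_unit]

/-- The ideal is generated in degree `N`: a component of degree `n < N` of `a r b` would need a
component of `r` of degree at most `n`. -/
private theorem proj_eq_zero_of_mem_ideal {x : TV k V} (hx : x ∈ idealOf (R.rel : Set (TV k V))) {n : ℕ}
    (hn : n < N) : TV.proj n x = 0 := by
  rw [mem_idealOf_iff] at hx
  induction hx using AddSubgroup.closure_induction with
  | mem y hy =>
    obtain ⟨a, r, hr, b, rfl⟩ := hy
    rw [mul_assoc, TV.proj_mul]
    refine Finset.sum_eq_zero fun ij hij => ?_
    rw [TV.proj_mul, Finset.sum_eq_zero, mul_zero]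
    intro lm hlm
    rw [Finset.HasAntidiagonal.mem_antidiagonal] at hij hlm
    rw [TV.proj_eq_zero _ (R.le r hr), zero_mul]
    omega
  | zero => exact TV.proj_zero n
  | add x y _ _ hx hy => rw [TV.proj_add, hx, hy, add_zero]
  | neg x _ hx => rw [TV.proj_neg, hx, neg_zero]

/-- In degrees `< N` the projection `T_k V → A` is injective. -/
private theorem eq_of_toAlg_eq {n : ℕ} (hn : n < N) {x y : TV k V} (hx : x ∈ TV.tpow k V n)
    (hy : y ∈ TV.tpow k V n) (h : R.toAlg x = R.toAlg y) : x = y := by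
  have h1 : R.toAlg (x - y) = 0 := by rw [map_sub, h, sub_self]
  have := R.proj_eq_zero_of_mem_ideal ((pmk_eq_zero_iff _ _).1 h1) hn
  rw [TV.proj_sub, TV.proj_eq_self hx, TV.proj_eq_self hy] at this
  exact sub_eq_zero.1 this

/-- The map `A → T_k V` sending the class of `x` to `π_n(x)`, for `n < N`. -/
def trunc (n : ℕ) (hn : n < N) : R.Alg →+ TV k V :=
  QuotientAddGroup.lift _ (TV.projHom n).1 fun _ hx => R.proj_eq_zero_of_mem_ideal hx hn

private theorem trunc_toAlg (n : ℕ) (hn : n < N) (x : TV k V) : R.trunc n hn (R.toAlg x) = TV.proj n x :=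
  rfl

/-! The projection `A → A / k ≅ I₊` -/

private theorem coe_bar (a : R.Alg) : (R.bar a : R.Alg) = a - KAlg.unit (R.aug a) := rfl

@[simp]
private theorem bar_unit (c : k) : R.bar (KAlg.unit c) = 0 := by
  apply Subtype.ext
  rw [coe_bar, aug_unit, sub_self]; rfl

@[simp]
private theorem bar_one : R.bar 1 = 0 := by
  rw [← map_one (KAlg.unit (k := k) (B := R.Alg)), bar_unit]

@[simp]
private theorem bar_coe (a : R.plus) : R.bar a = a := by
  apply Subtype.ext
  rw [coe_bar, R.mem_plus.1 a.2, map_zero, sub_zero]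

private theorem bar_of_mem_zero {a : R.Alg} (ha : a ∈ R.comp 0) : R.bar a = 0 := by
  rw [R.eq_unit_of_mem ha, bar_unit]

private theorem coe_bar_of_mem {n : ℕ} (hn : n ≠ 0) {a : R.Alg} (ha : a ∈ R.comp n) :
    (R.bar a : R.Alg) = a := by rw [coe_bar, R.aug_of_mem hn ha, map_zero, sub_zero]

private theorem bar_mem {n : ℕ} {a : R.Alg} (ha : a ∈ R.comp n) : R.bar a ∈ R.plusComp n := by
  change (R.bar a : R.Alg) ∈ R.comp n
  rcases eq_or_ne n 0 with rfl | hn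
  · rw [R.bar_of_mem_zero ha]; exact zero_mem _
  · rwa [R.coe_bar_of_mem hn ha]

private theorem mem_plusComp {n : ℕ} {a : R.plus} : a ∈ R.plusComp n ↔ (a : R.Alg) ∈ R.comp n := Iff.rfl

private theorem cls_mem {n : ℕ} {x : TV k V} (hx : x ∈ TV.tpow k V n) : R.cls x ∈ R.plusComp n :=
  R.bar_mem (R.toAlg_mem hx)

private theorem cls_rel {x : TV k V} (hx : x ∈ R.rel) : R.cls x = 0 := by
  rw [cls, R.toAlg_rel hx]; exact map_zero R.bar.1

@[simp]
private theorem cls_unit (c : k) : R.cls (KAlg.unit c) = 0 := R.bar_unit c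

/-- `x ↦ x̄` as a homomorphism. -/
def clsHom : BiHom k (TV k V) R.plus := R.bar.comp (pmkHom _)

private theorem clsHom_apply (x : TV k V) : R.clsHom x = R.cls x := rfl

private theorem mulPlus_tmul (a b : R.plus) :
    (R.mulPlus (BT.tmul k a b) : R.Alg) = (a : R.Alg) * b := rfl

/-- Homogeneous elements of `I₊` are classes of homogeneous elements of the tensor algebra. -/
private theorem exists_cls_of_mem {n : ℕ} {a : R.plus} (ha : a ∈ R.plusComp n) :
    ∃ x ∈ TV.tpow k V n, R.cls x = a := by
  obtain ⟨x, hx, h⟩ := ha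
  refine ⟨x, hx, ?_⟩
  change R.bar (R.toAlg x) = a
  rw [show R.toAlg x = (a : R.Alg) from h, bar_coe]

/-- An additive subgroup of `I₊` containing its homogeneous elements of positive degrees is
everything. -/
private theorem mem_of_plusComp {S : AddSubgroup R.plus} (h : ∀ n, R.plusComp (n + 1) ≤ S) (a : R.plus) :
    a ∈ S := by
  rw [← R.bar_coe a]
  refine R.mem_of_comp (S := S.comap R.bar.1) (fun n x hx => ?_) a
  rw [AddSubgroup.mem_comap]
  cases n with
  | zero =>
    have := R.bar_of_mem_zero hx
    change R.bar x ∈ S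
    rw [this]; exact zero_mem S
  | succ n => exact h n (R.bar_mem hx)

end HomRel

end TensorAlgebra

end PBW

/-! ### Free bimodules `A ⊗ W ⊗ A`: generators and insertion maps. -/

namespace PBW

universe u v w

set_option linter.unusedSectionVars false

section FreeBimodules

variable {k A : Type*} [Ring k] [Ring A] [KAlg k A]
variable {W W' X : Type*} [AddCommGroup W] [Module k W] [Module kᵐᵒᵖ W] [SMulCommClass k kᵐᵒᵖ W]
  [AddCommGroup W'] [Module k W'] [Module kᵐᵒᵖ W'] [SMulCommClass k kᵐᵒᵖ W']
  [AddCommGroup X] [Module k X] [Module kᵐᵒᵖ X] [Module A X] [Module Aᵐᵒᵖ X] [Compat k A X]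

private theorem gen_apply (w : W) : gen k A W w = BT.tmul k 1 (BT.tmul k w 1) := rfl

private theorem smul_gen (a b : A) (w : W) :
    a • op b • gen k A W w = BT.tmul k a (BT.tmul k w b) := by
  change BT.tmul k (a * 1) (BT.tmul k w (1 * b)) = _
  rw [mul_one, one_mul]

private theorem smul_tmul_tmul (c a : A) (m : BT k W A) : c • BT.tmul k a m = BT.tmul k (c * a) m := rfl

private theorem op_smul_tmul_tmul (c a b : A) (w : W) :
    op c • BT.tmul k a (BT.tmul k w b) = BT.tmul k a (BT.tmul k w (b * c)) := rfl

/-- Scalar multiplication as an additive map. -/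
def smulHom {S : Type*} [Monoid S] {X : Type*} [AddMonoid X] [DistribMulAction S X] (a : S) : X →+ X :=
  DistribSMul.toAddMonoidHom X a

@[simp]
private theorem smulHom_apply {S : Type*} [Monoid S] {X : Type*} [AddMonoid X] [DistribMulAction S X]
    (a : S) (x : X) : smulHom a x = a • x := rfl

private theorem BT.tmulHom_apply {M : Type*} [AddCommGroup M] [Module kᵐᵒᵖ M] (m : M) (n : W) :
    BT.tmulHom k m n = BT.tmul k m n := rfl

private theorem FB.addHom_ext {Y : Type*} [AddCommGroup Y] {f g : FB k A W →+ Y}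
    (h : ∀ a w b, f (BT.tmul k a (BT.tmul k w b)) = g (BT.tmul k a (BT.tmul k w b))) : f = g := by
  apply BT.addHom_ext
  intro a m
  induction m using BT.induction with
  | zero => rw [BT.tmul_zero, map_zero, map_zero]
  | tmul w b => exact h a w b
  | add x y hx hy => rw [BT.tmul_add, map_add, map_add, hx, hy]

private theorem FB.eq_of_tmul {Y : Type*} [AddCommGroup Y] (f g : FB k A W →+ Y)
    (h : ∀ a w b, f (BT.tmul k a (BT.tmul k w b)) = g (BT.tmul k a (BT.tmul k w b)))
    (x : FB k A W) : f x = g x := DFunLike.congr_fun (FB.addHom_ext h) x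

private theorem FB.mem_of_tmul {S : AddSubgroup (FB k A W)}
    (h : ∀ a w b, BT.tmul k a (BT.tmul k w b) ∈ S) (x : FB k A W) : x ∈ S := by
  induction x using BT.induction with
  | zero => exact zero_mem S
  | tmul a m =>
    induction m using BT.induction with
    | zero => rw [BT.tmul_zero]; exact zero_mem S
    | tmul w b => exact h a w b
    | add x y hx hy => rw [BT.tmul_add]; exact add_mem hx hy
  | add x y hx hy => exact add_mem hx hy

/-- Homomorphisms of `A`-bimodules agreeing on the generators agree. -/
private theorem FB.hom_eq {f g : BiHom A (FB k A W) X} (h : ∀ w, f (gen k A W w) = g (gen k A W w))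
    (x : FB k A W) : f x = g x := by
  refine FB.mem_of_tmul (S := f.1.eqLocus g.1) (fun a w b => ?_) x
  change f _ = g _
  rw [← smul_gen, f.map_smul, g.map_smul, f.map_op_smul, g.map_op_smul, h]

private theorem BiHom.map_base_smul {Y : Type*} [AddCommGroup Y] [Module k Y] [Module kᵐᵒᵖ Y] [Module A Y]
    [Module Aᵐᵒᵖ Y] [Compat k A Y] (f : BiHom A X Y) (c : k) (x : X) :
    f (c • x) = c • f x := (restrict f).map_smul c x

variable (k A W W') in
/-- The homomorphism of right `A`-modules `x ⊗ w ⊗ y ↦ 1 ⊗ (f(x) ⊗ w) ⊗ y`. -/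
def insLeft (f : BiHom k A W') : BiHom k (FB k A W) (FB k A (BT k W' W)) :=
  (oneL k A _).comp (BT.reassoc.comp (BT.map f (BiHom.id k _)))

private theorem insLeft_tmul (f : BiHom k A W') (a b : A) (w : W) :
    insLeft k A W W' f (BT.tmul k a (BT.tmul k w b)) =
      op b • gen k A _ (BT.tmul k (f a) w) := by
  rw [gen_apply, op_smul_tmul_tmul, one_mul]; rfl

private theorem insLeft_op_smul (f : BiHom k A W') (c : A) (x : FB k A W) :
    insLeft k A W W' f (op c • x) = op c • insLeft k A W W' f x := by
  refine FB.eq_of_tmul ((insLeft k A W W' f).1.comp (smulHom (op c)))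
    ((smulHom (op c)).comp (insLeft k A W W' f).1) (fun a w b => ?_) x
  simp only [AddMonoidHom.comp_apply, smulHom_apply, op_smul_tmul_tmul, insLeft_tmul, ← mul_smul,
    op_mul]

variable (k A W W') in
/-- The homomorphism of left `A`-modules `x ⊗ w ⊗ y ↦ x ⊗ (w ⊗ f(y)) ⊗ 1`. -/
def insRight (f : BiHom k A W') : BiHom k (FB k A W) (FB k A (BT k W W')) :=
  BT.map (BiHom.id k A) ((oneR k A _).comp (BT.map (BiHom.id k W) f))

private theorem insRight_tmul (f : BiHom k A W') (a b : A) (w : W) :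
    insRight k A W W' f (BT.tmul k a (BT.tmul k w b)) =
      a • gen k A _ (BT.tmul k w (f b)) := by
  rw [gen_apply, smul_tmul_tmul, mul_one]; rfl

private theorem insRight_smul (f : BiHom k A W') (c : A) (x : FB k A W) :
    insRight k A W W' f (c • x) = c • insRight k A W W' f x := by
  refine FB.eq_of_tmul ((insRight k A W W' f).1.comp (smulHom c))
    ((smulHom c).comp (insRight k A W W' f).1) (fun a w b => ?_) x
  simp only [AddMonoidHom.comp_apply, smulHom_apply, smul_tmul_tmul, insRight_tmul, ← mul_smul]

end FreeBimodules

/-! ### The two complexes in low degrees: values on generators, gradings, the left contracting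
homotopy. -/

section Graded

variable {k : Type u} [Ring k] {V : Type v} [AddCommGroup V] [Module k V] [Module kᵐᵒᵖ V]
  [SMulCommClass k kᵐᵒᵖ V] {N : ℕ} (R : HomRel k V N)

namespace HomRel

section FreeComp

variable {W : Type*} [AddCommGroup W] [Module k W] [Module kᵐᵒᵖ W] [SMulCommClass k kᵐᵒᵖ W]
  {G : ℕ → AddSubgroup W}

private theorem freeComp_le {d : ℕ} {S : AddSubgroup (FB k R.Alg W)}
    (h : ∀ i j l, i + j + l = d → ∀ a ∈ R.comp i, ∀ w ∈ G j, ∀ b ∈ R.comp l,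
      BT.tmul k a (BT.tmul k w b) ∈ S) : R.freeComp G d ≤ S := by
  refine BT.grading_le fun i e hie a ha m hm => ?_
  have : BT.grading (k := k) G R.comp e ≤ S.comap (BT.tmulHom k a) :=
    BT.grading_le fun j l hjl w hw b hb => h i j l (by omega) a ha w hw b hb
  exact this hm

private theorem tmul_mem_freeComp {i j l d : ℕ} (hd : i + j + l = d) {a b : R.Alg} {w : W}
    (ha : a ∈ R.comp i) (hw : w ∈ G j) (hb : b ∈ R.comp l) :
    (BT.tmul k a (BT.tmul k w b) : FB k R.Alg W) ∈ R.freeComp G d :=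
  BT.tmul_mem_grading (j := j + l) (by omega) ha (BT.tmul_mem_grading rfl hw hb)

private theorem gen_mem_freeComp {d : ℕ} {w : W} (hw : w ∈ G d) :
    gen k R.Alg W w ∈ R.freeComp G d :=
  R.tmul_mem_freeComp (by omega) R.one_mem_comp hw R.one_mem_comp

private theorem smul_mem_freeComp {i d e : ℕ} (h : i + d = e) {a : R.Alg} (ha : a ∈ R.comp i)
    {x : FB k R.Alg W} (hx : x ∈ R.freeComp G d) : a • x ∈ R.freeComp G e := by
  have : R.freeComp G d ≤ (R.freeComp G e).comap (smulHom a) := by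
    refine R.freeComp_le fun i' j l hd x hx w hw b hb => ?_
    exact R.tmul_mem_freeComp (i := i + i') (by omega) (R.mul_mem_comp ha hx) hw hb
  exact this hx

private theorem op_smul_mem_freeComp {i d e : ℕ} (h : d + i = e) {a : R.Alg} (ha : a ∈ R.comp i)
    {x : FB k R.Alg W} (hx : x ∈ R.freeComp G d) : op a • x ∈ R.freeComp G e := by
  have : R.freeComp G d ≤ (R.freeComp G e).comap (smulHom (op a)) := by
    refine R.freeComp_le fun i' j l hd x hx w hw b hb => ?_
    exact R.tmul_mem_freeComp (l := l + i) (by omega) hx hw (R.mul_mem_comp hb ha)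
  exact this hx

/-- The extension of a homogeneous homomorphism of bimodules is homogeneous. -/
private theorem extend_mem {X : Type*} [AddCommGroup X] [Module k X] [Module kᵐᵒᵖ X] [Module R.Alg X]
    [Module R.Algᵐᵒᵖ X] [Compat k R.Alg X] [SMulCommClass R.Alg R.Algᵐᵒᵖ X]
    {H : ℕ → AddSubgroup X}
    (hl : ∀ i d, ∀ a ∈ R.comp i, ∀ x ∈ H d, a • x ∈ H (i + d))
    (hr : ∀ i d, ∀ a ∈ R.comp i, ∀ x ∈ H d, op a • x ∈ H (d + i)) (f : BiHom k W X)
    (hf : ∀ d, ∀ w ∈ G d, f w ∈ H d) (d : ℕ) (x : FB k R.Alg W) (hx : x ∈ R.freeComp G d) :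
    extend f x ∈ H d := by
  have : R.freeComp G d ≤ (H d).comap (extend f).1 := by
    refine R.freeComp_le fun i j l hd a ha w hw b hb => ?_
    change a • op b • f w ∈ H d
    rw [← hd, add_assoc]
    exact hl _ _ a ha _ (hr _ _ b hb _ (hf j w hw))
  exact this hx

private theorem extend_mem_freeComp {W' : Type*} [AddCommGroup W'] [Module k W'] [Module kᵐᵒᵖ W']
    [SMulCommClass k kᵐᵒᵖ W'] {H : ℕ → AddSubgroup W'} (f : BiHom k W (FB k R.Alg W'))
    (hf : ∀ d, ∀ w ∈ G d, f w ∈ R.freeComp H d) (d : ℕ) (x : FB k R.Alg W)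
    (hx : x ∈ R.freeComp G d) : extend f x ∈ R.freeComp H d :=
  R.extend_mem (fun _ _ _ ha _ hx => R.smul_mem_freeComp rfl ha hx)
    (fun _ _ _ ha _ hx => R.op_smul_mem_freeComp rfl ha hx) f hf d x hx

/-- Every element of `A ⊗ W ⊗ A` is a sum of homogeneous ones if this is true in `W`. -/
private theorem mem_of_freeComp (hG : ∀ S : AddSubgroup W, (∀ n, G n ≤ S) → S = ⊤)
    {S : AddSubgroup (FB k R.Alg W)} (h : ∀ n, R.freeComp G n ≤ S) (x : FB k R.Alg W) : x ∈ S := by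
  refine FB.mem_of_tmul (fun a w b => ?_) x
  refine R.mem_of_comp (S := S.comap (BT.tmulHomLeft k (BT.tmul k w b))) (fun i a ha => ?_) a
  refine R.mem_of_comp (S := (S.comap (BT.tmulHom k a)).comap (BT.tmulHom k w))
    (fun l b hb => ?_) b
  have : S.comap ((BT.tmulHom k a).comp (BT.tmulHomLeft k b)) = ⊤ :=
    hG _ fun j w hw => h (i + j + l) (R.tmul_mem_freeComp rfl ha hw hb)
  have h2 : w ∈ S.comap ((BT.tmulHom k a).comp (BT.tmulHomLeft k b)) := this ▸ AddSubgroup.mem_top w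
  exact h2

end FreeComp

private theorem concentrated_self (M : Type*) [AddCommGroup M] (e : ℕ) (m : M) :
    m ∈ concentrated M e e := by
  rw [concentrated, if_pos rfl]; exact AddSubgroup.mem_top m

private theorem eq_zero_of_concentrated {M : Type*} [AddCommGroup M] {e d : ℕ} (h : d ≠ e) {m : M}
    (hm : m ∈ concentrated M e d) : m = 0 := by
  rw [concentrated, if_neg h] at hm
  exact hm

/-! The differentials and other maps on generators -/

private theorem actL_tmul (W : Type*) [AddCommGroup W] [Module k W] [Module kᵐᵒᵖ W]
    [SMulCommClass k kᵐᵒᵖ W] (a : R.plus) (w : W) :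
    R.actL W (BT.tmul k a w) = (a : R.Alg) • gen k R.Alg W w := by
  rw [gen_apply, smul_tmul_tmul, mul_one]; rfl

private theorem actR_tmul (W : Type*) [AddCommGroup W] [Module k W] [Module kᵐᵒᵖ W]
    [SMulCommClass k kᵐᵒᵖ W] (a : R.plus) (w : W) :
    R.actR W (BT.tmul k w a) = op (a : R.Alg) • gen k R.Alg W w := by
  rw [gen_apply, op_smul_tmul_tmul, one_mul]; rfl

private theorem b1_gen (a : R.plus) :
    R.b1 (gen k R.Alg _ a) = BT.tmul k (a : R.Alg) 1 - BT.tmul k 1 (a : R.Alg) :=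
  extend_gen _ _

private theorem mulFst_tmul (a b c : R.plus) : R.mulFst (BT.tmul k a (BT.tmul k b c)) =
    BT.tmul k (R.mulPlus (BT.tmul k a b)) c := rfl

private theorem mulSnd_tmul (a b c : R.plus) : R.mulSnd (BT.tmul k a (BT.tmul k b c)) =
    BT.tmul k a (R.mulPlus (BT.tmul k b c)) := rfl

private theorem b2_gen (a b : R.plus) : R.b2 (gen k R.Alg _ (BT.tmul k a b)) =
    (a : R.Alg) • gen k R.Alg _ b - gen k R.Alg _ (R.mulPlus (BT.tmul k a b)) +
      op (b : R.Alg) • gen k R.Alg _ a := by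
  simp only [b2, extend_gen, BiHom.add_apply, BiHom.sub_apply, BiHom.comp_apply, actL_tmul,
    actR_tmul]

private theorem b3_gen (a b c : R.plus) : R.b3 (gen k R.Alg _ (BT.tmul k a (BT.tmul k b c))) =
    (a : R.Alg) • gen k R.Alg _ (BT.tmul k b c)
      - gen k R.Alg _ (BT.tmul k (R.mulPlus (BT.tmul k a b)) c)
      + gen k R.Alg _ (BT.tmul k a (R.mulPlus (BT.tmul k b c)))
      - op (c : R.Alg) • gen k R.Alg _ (BT.tmul k a b) := by
  simp only [b3, extend_gen, BiHom.add_apply, BiHom.sub_apply, BiHom.comp_apply, actL_tmul,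
    mulFst_tmul, mulSnd_tmul, BT.reassoc_tmul, actR_tmul]

private theorem sigma1_gen (v : V) : R.sigma1 (gen k R.Alg V v) = gen k R.Alg _ (R.vIncl v) :=
  extend_gen _ _

private theorem d1_gen (v : V) : R.d1 (gen k R.Alg V v) =
    BT.tmul k (R.toAlg (TV.ι v)) 1 - BT.tmul k 1 (R.toAlg (TV.ι v)) := by
  rw [← coe_vIncl]
  exact extend_gen _ _

private theorem d2_gen (r : R.rel) : R.d2 (gen k R.Alg _ r) = R.par r := extend_gen _ _

private theorem sigma2_gen (r : R.rel) : R.sigma2 (gen k R.Alg _ r) = R.ins (R.par r) := extend_gen _ _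

private theorem ins_tmul (x y : R.Alg) (v : V) : R.ins (BT.tmul k x (BT.tmul k v y)) =
    op y • gen k R.Alg _ (BT.tmul k (R.bar x) (R.vIncl v)) := by
  simp only [gen_apply, op_smul_tmul_tmul, one_mul]; rfl

private theorem ins2_tmul (a : R.plus) (x y : R.Alg) (v : V) :
    R.ins2 (BT.tmul k a (BT.tmul k x (BT.tmul k v y))) =
      op y • gen k R.Alg _ (BT.tmul k a (BT.tmul k (R.bar x) (R.vIncl v))) := by
  simp only [gen_apply, op_smul_tmul_tmul, one_mul]; rfl

private theorem ins_op_smul (c : R.Alg) (x : R.K1) : R.ins (op c • x) = op c • R.ins x := by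
  refine FB.eq_of_tmul (R.ins.1.comp (smulHom (op c))) ((smulHom (op c)).comp R.ins.1)
    (fun a w b => ?_) x
  simp only [AddMonoidHom.comp_apply, smulHom_apply, op_smul_tmul_tmul, ins_tmul, ← mul_smul,
    op_mul]

private theorem ins2_op_smul (a : R.plus) (c : R.Alg) (x : R.K1) :
    R.ins2 (BT.tmul k a (op c • x)) = op c • R.ins2 (BT.tmul k a x) := by
  refine FB.eq_of_tmul ((R.ins2.1.comp (BT.tmulHom k a)).comp (smulHom (op c)))
    ((smulHom (op c)).comp (R.ins2.1.comp (BT.tmulHom k a))) (fun x w b => ?_) x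
  simp only [AddMonoidHom.comp_apply, smulHom_apply, op_smul_tmul_tmul, BT.tmulHom_apply,
    ins2_tmul, ← mul_smul, op_mul]

private theorem par_unit (c : k) : R.par (KAlg.unit c) = 0 := by
  change (R.parAux (KAlg.unit c)).snd = 0
  simp [parAux]

private theorem par_mul_ι (x : TV k V) (v : V) : R.par (x * TV.ι v) =
    R.toAlg x • gen k R.Alg V v + op (R.toAlg (TV.ι v)) • R.par x := by
  rw [par_mul, par_ι]

private theorem smul_gen_left {W : Type*} [AddCommGroup W] [Module k W] [Module kᵐᵒᵖ W]
    [SMulCommClass k kᵐᵒᵖ W] (a : R.Alg) (w : W) :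
    a • gen k R.Alg W w = BT.tmul k a (BT.tmul k w 1) := by
  rw [gen_apply, smul_tmul_tmul, mul_one]

private theorem ins_smul_gen (x : R.Alg) (v : V) :
    R.ins (x • gen k R.Alg V v) = gen k R.Alg _ (BT.tmul k (R.bar x) (R.vIncl v)) := by
  simp only [smul_gen_left, ins_tmul, op_one, one_smul]

private theorem ins2_smul_gen (a : R.plus) (x : R.Alg) (v : V) :
    R.ins2 (BT.tmul k a (x • gen k R.Alg V v)) =
      gen k R.Alg _ (BT.tmul k a (BT.tmul k (R.bar x) (R.vIncl v))) := by
  simp only [smul_gen_left, ins2_tmul, op_one, one_smul]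

private theorem ins_par_mul_ι (x : TV k V) (v : V) : R.ins (R.par (x * TV.ι v)) =
    R.bar2 x (TV.ι v) + op (R.toAlg (TV.ι v)) • R.ins (R.par x) := by
  simp only [par_mul_ι, map_add, ins_op_smul, ins_smul_gen]; rfl

private theorem ins2_par_mul_ι (a : R.plus) (x : TV k V) (v : V) :
    R.ins2 (BT.tmul k a (R.par (x * TV.ι v))) =
      gen k R.Alg _ (BT.tmul k a (BT.tmul k (R.cls x) (R.vIncl v))) +
        op (R.toAlg (TV.ι v)) • R.ins2 (BT.tmul k a (R.par x)) := by
  simp only [par_mul_ι, map_add, BT.tmul_add, ins2_op_smul, ins2_smul_gen]; rfl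

/-- `d₂ (x|r|y)` is obtained from `x r y`. -/
private theorem d2_tmul (x y : TV k V) (r : R.rel) :
    R.d2 (BT.tmul k (R.toAlg x) (BT.tmul k r (R.toAlg y))) = R.par (x * r * y) := by
  -- The terms of the derivation `par` that differentiate `x` or `y` carry the class of `r` in `A`,
  -- which is zero.
  simp only [← smul_gen, BiHom.map_smul, BiHom.map_op_smul, d2_gen, par_mul, map_mul,
    R.toAlg_rel r.2, mul_zero, zero_smul, zero_add, op_zero, add_zero]
  exact smul_comm _ _ _

/-! Homogeneity -/

private theorem par_mem {n : ℕ} {x : TV k V} (hx : x ∈ TV.tpow k V n) : R.par x ∈ R.K1Comp n := by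
  induction n generalizing x with
  | zero =>
    obtain ⟨c, rfl⟩ := hx
    change R.par (KAlg.unit c) ∈ R.K1Comp 0
    rw [par_unit]; exact zero_mem _
  | succ n ih =>
    have : TV.tpow k V (n + 1) ≤ (R.K1Comp (n + 1)).comap R.par.1 := by
      rw [TV.tpow_succ_right, AddSubgroup.closure_le]
      rintro _ ⟨x, hx, v, rfl⟩
      change R.par (x * TV.ι v) ∈ R.K1Comp (n + 1)
      rw [par_mul_ι]
      exact add_mem (R.smul_mem_freeComp rfl (R.toAlg_mem hx)
        (R.gen_mem_freeComp (concentrated_self V 1 v)))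
        (R.op_smul_mem_freeComp rfl (R.toAlg_mem (TV.ι_mem v)) (ih hx))
    exact this hx

private theorem vIncl_mem (v : V) : R.vIncl v ∈ R.plusComp 1 := R.cls_mem (TV.ι_mem v)

private theorem vIncl_mem' {d : ℕ} {v : V} (hv : v ∈ concentrated V 1 d) : R.vIncl v ∈ R.plusComp d := by
  rcases eq_or_ne d 1 with rfl | hd
  · exact R.vIncl_mem v
  · rw [eq_zero_of_concentrated hd hv, map_zero]; exact zero_mem _

private theorem ins_mem {n : ℕ} {x : R.K1} (hx : x ∈ R.K1Comp n) : R.ins x ∈ R.C2Comp n := by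
  have : R.K1Comp n ≤ (R.C2Comp n).comap R.ins.1 := by
    refine R.freeComp_le fun i j l hd a ha v hv b hb => ?_
    change R.ins (BT.tmul k a (BT.tmul k v b)) ∈ R.C2Comp n
    simp only [ins_tmul]
    exact R.op_smul_mem_freeComp hd hb (R.gen_mem_freeComp
      (BT.tmul_mem_grading rfl (R.bar_mem ha) (R.vIncl_mem' hv)))
  exact this hx

private theorem rel_mem {d : ℕ} {r : R.rel} (hr : r ∈ concentrated R.rel N d) :
    (r : TV k V) ∈ TV.tpow k V d := by
  rcases eq_or_ne d N with rfl | hd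
  · exact R.le r r.2
  · rw [eq_zero_of_concentrated hd hr]; exact zero_mem _

private theorem d2_mem (n : ℕ) (x : R.K2) (hx : x ∈ R.K2Comp n) : R.d2 x ∈ R.K1Comp n :=
  R.extend_mem_freeComp (R.par.comp R.relIncl) (fun _ _ hr => R.par_mem (R.rel_mem hr)) n x hx

private theorem sigma2_mem (n : ℕ) (x : R.K2) (hx : x ∈ R.K2Comp n) : R.sigma2 x ∈ R.C2Comp n :=
  R.extend_mem_freeComp (R.ins.comp (R.par.comp R.relIncl)) (fun _ _ hr => R.ins_mem (R.par_mem (R.rel_mem hr))) n x hx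

private theorem mulPlus_mem {i j n : ℕ} (h : i + j = n) {a b : R.plus} (ha : a ∈ R.plusComp i)
    (hb : b ∈ R.plusComp j) : R.mulPlus (BT.tmul k a b) ∈ R.plusComp n := by
  rw [mem_plusComp, mulPlus_tmul, ← h]
  exact R.mul_mem_comp ha hb

private theorem plus2_induction {d : ℕ} {S : AddSubgroup R.plus2} (h : ∀ i j, i + j = d →
    ∀ a ∈ R.plusComp i, ∀ b ∈ R.plusComp j, BT.tmul k a b ∈ S) : R.plus2Comp d ≤ S :=
  BT.grading_le h

private theorem plus3_induction {d : ℕ} {S : AddSubgroup R.plus3} (h : ∀ i j l, i + j + l = d →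
    ∀ a ∈ R.plusComp i, ∀ b ∈ R.plusComp j, ∀ c ∈ R.plusComp l,
      BT.tmul k a (BT.tmul k b c) ∈ S) : R.plus3Comp d ≤ S := by
  refine BT.grading_le fun i e hie a ha m hm => ?_
  have : R.plus2Comp e ≤ S.comap (BT.tmulHom k a) :=
    BT.grading_le fun j l hjl b hb c hc => h i j l (by omega) a ha b hb c hc
  exact this hm

private theorem b2_gen_mem {i j d : ℕ} (hij : i + j = d) {a b : R.plus} (ha : a ∈ R.plusComp i)
    (hb : b ∈ R.plusComp j) : R.b2 (gen k R.Alg _ (BT.tmul k a b)) ∈ R.C1Comp d := by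
  simp only [b2_gen]
  exact add_mem (sub_mem (R.smul_mem_freeComp hij ha (R.gen_mem_freeComp hb))
      (R.gen_mem_freeComp (R.mulPlus_mem hij ha hb)))
      (R.op_smul_mem_freeComp hij hb (R.gen_mem_freeComp ha))

private theorem b2_mem (n : ℕ) (x : R.C2) (hx : x ∈ R.C2Comp n) : R.b2 x ∈ R.C1Comp n := by
  refine R.extend_mem_freeComp (G := R.plus2Comp) (H := R.plusComp)
    (R.actL R.plus - (gen k R.Alg R.plus).comp R.mulPlus + R.actR R.plus) (fun d w hw => ?_) n x hx
  refine R.plus2_induction (S := (R.C1Comp d).comap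
    (R.actL R.plus - (gen k R.Alg R.plus).comp R.mulPlus + R.actR R.plus).1)
    (fun i j hij a ha b hb => ?_) hw
  have := R.b2_gen_mem hij ha hb
  simp only [b2, extend_gen] at this
  exact this

private theorem b3_gen_mem {i j l d : ℕ} (hij : i + j + l = d) {a b c : R.plus} (ha : a ∈ R.plusComp i)
    (hb : b ∈ R.plusComp j) (hc : c ∈ R.plusComp l) :
    R.b3 (gen k R.Alg _ (BT.tmul k a (BT.tmul k b c))) ∈ R.C2Comp d := by
  simp only [b3_gen]
  have h1 := R.mulPlus_mem rfl ha hb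
  have h2 := R.mulPlus_mem rfl hb hc
  exact sub_mem (add_mem (sub_mem
    (R.smul_mem_freeComp (d := j + l) (by omega) ha
      (R.gen_mem_freeComp (BT.tmul_mem_grading rfl hb hc)))
    (R.gen_mem_freeComp (BT.tmul_mem_grading (by omega) h1 hc)))
    (R.gen_mem_freeComp (BT.tmul_mem_grading (by omega) ha h2)))
    (R.op_smul_mem_freeComp (d := i + j) (by omega) hc
      (R.gen_mem_freeComp (BT.tmul_mem_grading rfl ha hb)))

private theorem b3_mem (n : ℕ) (x : R.C3) (hx : x ∈ R.C3Comp n) : R.b3 x ∈ R.C2Comp n := by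
  refine R.extend_mem_freeComp (G := R.plus3Comp) (H := R.plus2Comp) (R.actL R.plus2 -
    (gen k R.Alg R.plus2).comp R.mulFst + (gen k R.Alg R.plus2).comp R.mulSnd
    - (R.actR R.plus2).comp BT.reassoc) (fun d w hw => ?_) n x hx
  refine R.plus3_induction (S := (R.C2Comp d).comap (R.actL R.plus2 -
    (gen k R.Alg R.plus2).comp R.mulFst + (gen k R.Alg R.plus2).comp R.mulSnd
    - (R.actR R.plus2).comp BT.reassoc).1) (fun i j l hij a ha b hb c hc => ?_) hw
  have := R.b3_gen_mem hij ha hb hc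
  simp only [b3, extend_gen] at this
  exact this

/-- The contracting homotopy `h (x|w|y) = 1|x̄ ⊗ w|y`, raising the bar degree by one. -/
def hL (W : Type*) [AddCommGroup W] [Module k W] [Module kᵐᵒᵖ W] [SMulCommClass k kᵐᵒᵖ W] :
    BiHom k (FB k R.Alg W) (FB k R.Alg (BT k R.plus W)) := insLeft k R.Alg W R.plus R.bar

private theorem hL_tmul {W : Type*} [AddCommGroup W] [Module k W] [Module kᵐᵒᵖ W]
    [SMulCommClass k kᵐᵒᵖ W] (x y : R.Alg) (w : W) :
    R.hL W (BT.tmul k x (BT.tmul k w y)) = op y • gen k R.Alg _ (BT.tmul k (R.bar x) w) :=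
  insLeft_tmul _ _ _ _

private theorem hL_op_smul {W : Type*} [AddCommGroup W] [Module k W] [Module kᵐᵒᵖ W]
    [SMulCommClass k kᵐᵒᵖ W] (c : R.Alg) (x : FB k R.Alg W) :
    R.hL W (op c • x) = op c • R.hL W x := insLeft_op_smul _ _ _

private theorem hL_smul_gen {W : Type*} [AddCommGroup W] [Module k W] [Module kᵐᵒᵖ W]
    [SMulCommClass k kᵐᵒᵖ W] (x : R.Alg) (w : W) :
    R.hL W (x • gen k R.Alg W w) = gen k R.Alg _ (BT.tmul k (R.bar x) w) := by
  simp only [smul_gen_left, hL_tmul, op_one, one_smul]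

private theorem hL_gen {W : Type*} [AddCommGroup W] [Module k W] [Module kᵐᵒᵖ W]
    [SMulCommClass k kᵐᵒᵖ W] (w : W) : R.hL W (gen k R.Alg W w) = 0 := by
  have := R.hL_smul_gen 1 w
  simp only [one_smul, bar_one, BT.zero_tmul, map_zero] at this
  exact this

private theorem hL_mem {W : Type*} [AddCommGroup W] [Module k W] [Module kᵐᵒᵖ W]
    [SMulCommClass k kᵐᵒᵖ W] {G : ℕ → AddSubgroup W} {d : ℕ} {x : FB k R.Alg W}
    (hx : x ∈ R.freeComp G d) :
    R.hL W x ∈ R.freeComp (BT.grading R.plusComp G) d := by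
  have : R.freeComp G d ≤ (R.freeComp (BT.grading R.plusComp G) d).comap (R.hL W).1 := by
    refine R.freeComp_le fun i j l hd a ha w hw b hb => ?_
    change R.hL W (BT.tmul k a (BT.tmul k w b)) ∈ R.freeComp (BT.grading R.plusComp G) d
    simp only [hL_tmul]
    exact R.op_smul_mem_freeComp hd hb (R.gen_mem_freeComp
      (BT.tmul_mem_grading rfl (R.bar_mem ha) hw))
  exact this hx

/-- The map `ins` puts `1` into the leftmost factor, and `hL` applies `bar` there, which kills `1`.
-/
private theorem hL_ins (x : R.K1) : R.hL _ (R.ins x) = 0 := by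
  refine FB.eq_of_tmul ((R.hL _).1.comp R.ins.1) 0 (fun a w b => ?_) x
  simp only [AddMonoidHom.comp_apply, ins_tmul, hL_op_smul, hL_gen, smul_zero,
    AddMonoidHom.zero_apply]

/-- The left coefficient turns into a new bar factor in front. This is how the prescribed values of
`s₂` arise from those of `s₁`. -/
private theorem hL_smul_ins (a : R.Alg) (x : R.K1) :
    R.hL _ (a • R.ins x) = R.ins2 (BT.tmul k (R.bar a) x) := by
  refine FB.eq_of_tmul ((R.hL _).1.comp ((smulHom a).comp R.ins.1))
    (R.ins2.1.comp (BT.tmulHom k (R.bar a))) (fun x w b => ?_) x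
  simp only [AddMonoidHom.comp_apply, ins_tmul, smulHom_apply, BT.tmulHom_apply, ins2_tmul,
    smul_comm a (op b), hL_op_smul, hL_smul_gen]

private theorem C2_eq_of_tmul {Y : Type*} [AddCommGroup Y] (f g : R.C2 →+ Y)
    (h : ∀ (x y : R.Alg) (a b : R.plus), f (x • op y • gen k R.Alg _ (BT.tmul k a b)) =
      g (x • op y • gen k R.Alg _ (BT.tmul k a b))) (x : R.C2) : f x = g x := by
  refine FB.eq_of_tmul f g (fun x w y => ?_) x
  induction w using BT.induction with
  | zero => simp only [BT.zero_tmul, BT.tmul_zero, map_zero]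
  | add w w' hw hw' => simp only [BT.add_tmul, BT.tmul_add, map_add, hw, hw']
  | tmul a b => simp only [← smul_gen, h]

private theorem C3_eq_of_tmul {Y : Type*} [AddCommGroup Y] (f g : R.C3 →+ Y)
    (h : ∀ (x y : R.Alg) (a b c : R.plus), f (x • op y • gen k R.Alg _ (BT.tmul k a (BT.tmul k b c))) =
      g (x • op y • gen k R.Alg _ (BT.tmul k a (BT.tmul k b c)))) (x : R.C3) : f x = g x := by
  refine FB.eq_of_tmul f g (fun x w y => ?_) x
  induction w using BT.induction with
  | zero => simp only [BT.zero_tmul, BT.tmul_zero, map_zero]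
  | add w w' hw hw' => simp only [BT.add_tmul, BT.tmul_add, map_add, hw, hw']
  | tmul a w =>
    induction w using BT.induction with
    | zero => simp only [BT.zero_tmul, BT.tmul_zero, map_zero]
    | add w w' hw hw' => simp only [BT.add_tmul, BT.tmul_add, map_add, hw, hw']
    | tmul b c => simp only [← smul_gen, h]

/-- The correction term is there because `x` may have a scalar part, which `bar` removes before
multiplying. -/
private theorem bar_mul_coe (x : R.Alg) (a : R.plus) :
    R.bar (x * (a : R.Alg)) = R.mulPlus (BT.tmul k (R.bar x) a) + R.aug x • a := by
  apply Subtype.ext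
  rw [coe_bar, map_mul, R.mem_plus.1 a.2, mul_zero, map_zero, sub_zero, AddMemClass.coe_add,
    mulPlus_tmul, coe_bar, SubBimod.coe_smul, KAlg.smul_def, sub_mul, sub_add_cancel]

private theorem bar_coe_mul (a : R.plus) (y : R.Alg) :
    R.bar ((a : R.Alg) * y) = R.mulPlus (BT.tmul k a (R.bar y)) + op (R.aug y) • a := by
  apply Subtype.ext
  rw [coe_bar, map_mul, R.mem_plus.1 a.2, zero_mul, map_zero, sub_zero, AddMemClass.coe_add,
    mulPlus_tmul, coe_bar, SubBimod.coe_op_smul, KAlg.op_smul_def, mul_sub, sub_add_cancel]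

/-- `x|w|y = x̄|w|y + 1|ε(x)w|y`. -/
private theorem coe_bar_smul {X : Type*} [AddCommGroup X] [Module k X] [Module kᵐᵒᵖ X] [Module R.Alg X]
    [Module R.Algᵐᵒᵖ X] [Compat k R.Alg X] (x : R.Alg) (m : X) :
    (R.bar x : R.Alg) • m = x • m - R.aug x • m := by
  rw [coe_bar, sub_smul, Compat.unit_smul]

private theorem gen_bar_mul_tmul {W : Type*} [AddCommGroup W] [Module k W] [Module kᵐᵒᵖ W]
    [SMulCommClass k kᵐᵒᵖ W] (x : R.Alg) (a : R.plus) (w : W) :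
    gen k R.Alg _ (BT.tmul k (R.bar (x * (a : R.Alg))) w) =
      gen k R.Alg _ (BT.tmul k (R.mulPlus (BT.tmul k (R.bar x) a)) w) +
        R.aug x • gen k R.Alg _ (BT.tmul k a w) := by
  simp only [bar_mul_coe, BT.add_tmul, map_add, ← BiHom.map_smul, BT.smul_tmul_left]

/-- `h` is a contracting homotopy in degree two. -/
private theorem b3_hL_add_hL_b2 (x : R.C2) : R.b3 (R.hL _ x) + R.hL _ (R.b2 x) = x := by
  refine R.C2_eq_of_tmul (R.b3.1.comp (R.hL _).1 + (R.hL _).1.comp R.b2.1) (AddMonoidHom.id _)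
    (fun x y a b => ?_) x
  simp only [AddMonoidHom.add_apply, AddMonoidHom.comp_apply, AddMonoidHom.id_apply,
    BiHom.map_smul, BiHom.map_op_smul, smul_comm x (op y), hL_op_smul, hL_smul_gen, b3_gen,
    b2_gen, smul_add, smul_sub, map_add, map_sub, smul_comm x (op (b : R.Alg))]
  simp only [← mul_smul x, hL_smul_gen, gen_bar_mul_tmul, coe_bar_smul, smul_add, smul_sub]
  abel

/-- `h` is a contracting homotopy in degree three, up to the part of the differential of degree
four. -/
private theorem hL_b3_smul_gen (x : R.Alg) (a b c : R.plus) :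
    R.hL _ (R.b3 (x • gen k R.Alg _ (BT.tmul k a (BT.tmul k b c)))) =
      gen k R.Alg _ (BT.tmul k (R.mulPlus (BT.tmul k (R.bar x) a)) (BT.tmul k b c)) +
        R.aug x • gen k R.Alg _ (BT.tmul k a (BT.tmul k b c))
      - gen k R.Alg _ (BT.tmul k (R.bar x) (BT.tmul k (R.mulPlus (BT.tmul k a b)) c))
      + gen k R.Alg _ (BT.tmul k (R.bar x) (BT.tmul k a (R.mulPlus (BT.tmul k b c))))
      - op (c : R.Alg) • gen k R.Alg _ (BT.tmul k (R.bar x) (BT.tmul k a b)) := by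
  simp only [BiHom.map_smul, b3_gen, smul_add, smul_sub, map_add, map_sub,
    smul_comm x (op (c : R.Alg)), hL_op_smul, hL_smul_gen]
  simp only [← mul_smul x, hL_smul_gen, gen_bar_mul_tmul]

end HomRel

end Graded

end PBW

/-! ### Identities between the bar and Koszul differentials; the right contracting homotopy. -/

namespace PBW

universe u v w

set_option linter.unusedSectionVars false

variable {k : Type u} [Ring k] {V : Type v} [AddCommGroup V] [Module k V] [Module kᵐᵒᵖ V]
  [SMulCommClass k kᵐᵒᵖ V] {N : ℕ} (R : HomRel k V N)

namespace HomRel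

private theorem add_sub_rearrange {X : Type*} [AddCommGroup X] {p q r s t u : X}
    (h : p - u - q + r - s + t = 0) : q + u - r + s - t = p := by
  rw [← sub_eq_zero, ← neg_eq_zero, ← h]
  abel

/-- A homomorphism of bimodules `C̄₃ → X` vanishing on boundaries factors through `b̄₃`. -/
private theorem eq_hL_b3 {X : Type*} [AddCommGroup X] [Module k X] [Module kᵐᵒᵖ X] [Module R.Alg X]
    [Module R.Algᵐᵒᵖ X] [Compat k R.Alg X] [SMulCommClass R.Alg R.Algᵐᵒᵖ X] (f : BiHom R.Alg R.C3 X)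
    (hf : ∀ a b c d : R.plus,
      (a : R.Alg) • f (gen k R.Alg _ (BT.tmul k b (BT.tmul k c d)))
      - f (gen k R.Alg _ (BT.tmul k (R.mulPlus (BT.tmul k a b)) (BT.tmul k c d)))
      + f (gen k R.Alg _ (BT.tmul k a (BT.tmul k (R.mulPlus (BT.tmul k b c)) d)))
      - f (gen k R.Alg _ (BT.tmul k a (BT.tmul k b (R.mulPlus (BT.tmul k c d)))))
      + op (d : R.Alg) • f (gen k R.Alg _ (BT.tmul k a (BT.tmul k b c))) = 0) (x : R.C3) :
    f (R.hL _ (R.b3 x)) = f x := by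
  refine R.C3_eq_of_tmul ((f.1.comp (R.hL _).1).comp R.b3.1) f.1 (fun x y a b c => ?_) x
  simp only [AddMonoidHom.comp_apply, smul_comm x (op y), BiHom.map_op_smul, hL_op_smul]
  refine congrArg (op y • ·) ?_
  -- The expansion of `hL (b̄₃ z)` is `z` minus the next bar differential of `hL z`. The hypothesis
  -- `hf` with first argument `R.bar x` says that `f` kills that differential.
  refine (congrArg (fun z => f z) (R.hL_b3_smul_gen x a b c)).trans ?_
  simp only [map_add, map_sub, BiHom.map_smul, BiHom.map_op_smul, BiHom.map_base_smul]
  have h := hf (R.bar x) a b c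
  simp only [coe_bar_smul] at h
  exact add_sub_rearrange h

private theorem coe_bar_op_smul {X : Type*} [AddCommGroup X] [Module k X] [Module kᵐᵒᵖ X] [Module R.Alg X]
    [Module R.Algᵐᵒᵖ X] [Compat k R.Alg X] (x : R.Alg) (m : X) :
    op (R.bar x : R.Alg) • m = op x • m - op (R.aug x) • m := by
  rw [coe_bar, op_sub, sub_smul, Compat.op_unit_smul]

private theorem cls_mul_ι (x : TV k V) (v : V) : R.cls (x * TV.ι v) =
    R.mulPlus (BT.tmul k (R.cls x) (R.vIncl v)) + R.aug (R.toAlg x) • R.vIncl v := by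
  refine Eq.trans ?_ (R.bar_mul_coe (R.toAlg x) (R.vIncl v))
  rw [coe_vIncl, ← map_mul]; rfl

private theorem cls_smul {X : Type*} [AddCommGroup X] [Module k X] [Module kᵐᵒᵖ X] [Module R.Alg X]
    [Module R.Algᵐᵒᵖ X] [Compat k R.Alg X] (x : TV k V) (m : X) :
    (R.cls x : R.Alg) • m = R.toAlg x • m - R.aug (R.toAlg x) • m := R.coe_bar_smul _ _

private theorem add_sub_rearrange₂ {X : Type*} [AddCommGroup X] (p q r s t : X) :
    p - q - r + s + (t - s) = p + t - (r + q) := by abel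

private theorem bar2_ι (x : TV k V) (v : V) :
    R.bar2 x (TV.ι v) = gen k R.Alg _ (BT.tmul k (R.cls x) (R.vIncl v)) := rfl

/-- Appending a letter adds one boundary, which telescopes with the earlier ones. Up to sign this is
the homotopy identity in degree one; when `x` is a relation its class vanishes and the identity says
that `σ̄` commutes with the differentials in degree two. -/
private theorem b2_ins_par (x : TV k V) : R.b2 (R.ins (R.par x)) = R.sigma1 (R.par x) - R.bar1 x := by
  refine TV.addHom_ext_right (f := R.b2.1.comp (R.ins.1.comp R.par.1))
    (g := R.sigma1.1.comp R.par.1 - (gen k R.Alg R.plus).1.comp R.clsHom.1) (fun c => ?_)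
    (fun x hx v => ?_) x
  · simp only [AddMonoidHom.comp_apply, AddMonoidHom.sub_apply, par_unit, map_zero, clsHom_apply,
      cls_unit, sub_zero]
  · simp only [AddMonoidHom.comp_apply, AddMonoidHom.sub_apply, clsHom_apply] at hx ⊢
    simp only [ins_par_mul_ι]
    simp only [map_add, BiHom.map_op_smul, hx, bar2_ι, b2_gen, coe_vIncl, cls_smul,
      par_mul_ι, BiHom.map_smul, sigma1_gen, cls_mul_ι, smul_sub]
    exact add_sub_rearrange₂ _ _ _ _ _

private theorem b2_sigma2 (x : R.K2) : R.b2 (R.sigma2 x) = R.sigma1 (R.d2 x) := by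
  refine FB.hom_eq (f := R.b2.comp R.sigma2) (g := R.sigma1.comp R.d2) (fun r => ?_) x
  simp only [BiHom.comp_apply, sigma2_gen, d2_gen, b2_ins_par, bar1, R.cls_rel r.2, map_zero,
    sub_zero]

private theorem K0_smul_left (x a b : R.Alg) : (x • BT.tmul k a b : R.K0) = BT.tmul k (x * a) b := rfl

private theorem K0_smul_right (y a b : R.Alg) : (op y • BT.tmul k a b : R.K0) = BT.tmul k a (b * y) := rfl

/-- The sum telescopes: consecutive splittings of a word cancel. -/
private theorem d1_par (x : TV k V) : R.d1 (R.par x) =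
    BT.tmul k (R.toAlg x) 1 - BT.tmul k 1 (R.toAlg x) := by
  refine TV.addHom_ext_right (f := R.d1.1.comp R.par.1)
    (g := (BT.tmulHomLeft k (1 : R.Alg) - BT.tmulHom k (1 : R.Alg)).comp R.toAlg.toAddMonoidHom)
    (fun c => ?_) (fun x hx v => ?_) x
  · simp only [AddMonoidHom.comp_apply, par_unit, map_zero]
    change 0 = (BT.tmul k (KAlg.unit c : R.Alg) (1 : R.Alg) -
      BT.tmul k (1 : R.Alg) (KAlg.unit c) : R.K0)
    have := BT.smul_tmul k (1 : R.Alg) c (1 : R.Alg)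
    rw [KAlg.op_smul_def, KAlg.smul_def, one_mul, mul_one] at this
    rw [this, sub_self]
  · have hx' : R.d1 (R.par x) = BT.tmul k (R.toAlg x) 1 - BT.tmul k 1 (R.toAlg x) := hx
    change R.d1 (R.par (x * TV.ι v)) =
      BT.tmul k (R.toAlg (x * TV.ι v)) 1 - BT.tmul k 1 (R.toAlg (x * TV.ι v))
    simp only [par_mul_ι, map_add, BiHom.map_op_smul, BiHom.map_smul, hx', d1_gen, smul_sub,
      K0_smul_left, K0_smul_right, one_mul, mul_one, map_mul, sub_add_sub_cancel]

private theorem d1_d2 (x : R.K2) : R.d1 (R.d2 x) = 0 := by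
  refine FB.hom_eq (f := R.d1.comp R.d2) (g := 0) (fun r => ?_) x
  simp only [BiHom.comp_apply, d2_gen, d1_par, R.toAlg_rel r.2, BT.tmul_zero, BT.zero_tmul,
    sub_zero, BiHom.zero_apply]

private theorem b1_sigma1 (x : R.K1) : R.b1 (R.sigma1 x) = R.d1 x := by
  refine FB.hom_eq (f := R.b1.comp R.sigma1) (g := R.d1) (fun v => ?_) x
  simp only [BiHom.comp_apply, sigma1_gen, d1_gen, b1_gen, coe_vIncl]

/-- The contracting homotopy `x|a|y ↦ x|a ⊗ ȳ|1`. -/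
def hR : BiHom k R.C1 R.C2 := insRight k R.Alg R.plus R.plus R.bar

private theorem hR_tmul (x y : R.Alg) (a : R.plus) : R.hR (BT.tmul k x (BT.tmul k a y)) =
    x • gen k R.Alg _ (BT.tmul k a (R.bar y)) := insRight_tmul _ _ _ _

private theorem hR_smul (c : R.Alg) (x : R.C1) : R.hR (c • x) = c • R.hR x := insRight_smul _ _ _

/-- The contracting homotopy `x|y ↦ x|ȳ|1`. -/
def hR₀ : BiHom k R.K0 R.C1 := BT.map (BiHom.id k R.Alg) ((oneR k R.Alg _).comp R.bar)

private theorem hR₀_tmul (x y : R.Alg) : R.hR₀ (BT.tmul k x y) = x • gen k R.Alg _ (R.bar y) := by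
  rw [smul_gen_left]; rfl

private theorem gen_bar_coe_mul (a : R.plus) (y : R.Alg) :
    gen k R.Alg _ (R.bar ((a : R.Alg) * y)) = gen k R.Alg _ (R.mulPlus (BT.tmul k a (R.bar y))) +
        op (R.aug y) • gen k R.Alg _ a := by
  simp only [bar_coe_mul, map_add, ← BiHom.map_op_smul]

private theorem add_sub_rearrange₃ {X : Type*} [AddCommGroup X] (p q r s : X) :
    p - q + (r - s) = r + (p - (q + s)) := by abel

/-- The contraction `hR` acts on the right factor and is left `A`-linear, unlike `hL`. It serves to
build a left linear projection of `K₂` onto its cycles. -/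
private theorem b2_hR (x : R.C1) : R.b2 (R.hR x) = x + R.hR₀ (R.b1 x) := by
  refine FB.eq_of_tmul (R.b2.1.comp R.hR.1) (AddMonoidHom.id _ + R.hR₀.1.comp R.b1.1)
    (fun x a y => ?_) x
  simp only [AddMonoidHom.comp_apply, AddMonoidHom.add_apply, AddMonoidHom.id_apply, hR_tmul]
  simp only [← smul_gen, BiHom.map_smul, BiHom.map_op_smul, b2_gen, b1_gen, smul_sub,
    K0_smul_left, K0_smul_right, one_mul, mul_one, map_sub, hR₀_tmul, gen_bar_coe_mul,
    smul_add, coe_bar_op_smul, mul_smul]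
  exact add_sub_rearrange₃ _ _ _ _

end HomRel

end PBW

/-! ### Lifting of bimodule homomorphisms over a semisimple enveloping algebra. -/

namespace PBW

universe u v w

set_option linter.unusedSectionVars false

section Splitting

/-- The two actions of the subfield `F` of `k` on a bimodule agree. -/
def IsCentral (F k : Type*) [Field F] [Ring k] [Algebra F k] (M : Type*) [AddCommGroup M]
    [Module k M] [Module kᵐᵒᵖ M] : Prop :=
  ∀ (c : F) (m : M), algebraMap F k c • m = op (algebraMap F k c) • m

variable {F k : Type*} [Field F] [Ring k] [Algebra F k]
variable {X Y T : Type*} [AddCommGroup X] [Module k X] [Module kᵐᵒᵖ X] [SMulCommClass k kᵐᵒᵖ X]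
  [AddCommGroup Y] [Module k Y] [Module kᵐᵒᵖ Y] [SMulCommClass k kᵐᵒᵖ Y]
  [AddCommGroup T] [Module k T] [Module kᵐᵒᵖ T] [SMulCommClass k kᵐᵒᵖ T]

/-- A bimodule on which the two actions of `F` agree is a module over `k ⊗_F kᵒᵖ`. -/
@[reducible]
def envModule (h : IsCentral F k X) : Module (k ⊗[F] kᵐᵒᵖ) X :=
  letI : Module F X := Module.compHom X (algebraMap F k)
  haveI : IsScalarTower F k X := ⟨fun a c x => by
    change (a • c) • x = algebraMap F k a • c • x
    rw [Algebra.smul_def, mul_smul]⟩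
  haveI : IsScalarTower F kᵐᵒᵖ X := ⟨fun a c x => by
    change (a • c) • x = algebraMap F k a • c • x
    -- The action of `F` is defined through the left action of `k`; compatibility with the right
    -- action needs that both actions of `F` agree.
    rw [h, ← mul_smul]
    congr 1
    apply unop_injective
    rw [unop_smul, unop_mul, unop_op, Algebra.smul_def]
    exact Algebra.commutes a c.unop⟩
  TensorProduct.Algebra.module

/-- Homomorphisms of bimodules are linear over `k ⊗_F kᵒᵖ`. -/
def envLinear (hX : IsCentral F k X) (hY : IsCentral F k Y) (f : BiHom k X Y) :
    letI := envModule hX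
    letI := envModule hY
    X →ₗ[k ⊗[F] kᵐᵒᵖ] Y :=
  letI := envModule hX
  letI := envModule hY
  { toFun := f
    map_add' := f.map_add
    map_smul' := fun c x => by
      induction c using TensorProduct.induction_on with
      | zero =>
        exact ((congrArg f.1 (zero_smul (k ⊗[F] kᵐᵒᵖ) x)).trans (map_zero f.1)).trans
          (zero_smul (k ⊗[F] kᵐᵒᵖ) (f x)).symm
      | tmul a b =>
        refine (f.map_smul a (b • x)).trans (congrArg (a • ·) (f.map_op_smul b.unop x))
      | add c d hc hd =>
        rw [add_smul, RingHom.id_apply, add_smul, f.map_add, hc, hd]; rfl }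

/-- All modules over the semisimple ring `k ⊗_F kᵒᵖ` are projective, so `f` lifts along the
corestriction of `g` to its range. -/
private theorem exists_lift [IsSemisimpleRing (k ⊗[F] kᵐᵒᵖ)] (hX : IsCentral F k X)
    (hY : IsCentral F k Y) (hT : IsCentral F k T) (f : BiHom k X T) (g : BiHom k Y T)
    (h : ∀ x, ∃ y, g y = f x) : ∃ L : BiHom k X Y, ∀ x, g (L x) = f x := by
  let := envModule hX
  let := envModule hY
  let := envModule hT
  have : Module.Projective (k ⊗[F] kᵐᵒᵖ) X := Module.projective_of_isSemisimpleRing _ _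
  let f' := envLinear hX hT f
  let g' := envLinear hY hT g
  obtain ⟨L, hL⟩ := Module.projective_lifting_property g'.rangeRestrict
    (f'.codRestrict (LinearMap.range g') fun x => h x) g'.surjective_rangeRestrict
  refine ⟨⟨L.toAddMonoidHom, fun c x => ?_, fun c x => ?_⟩, fun x => ?_⟩
  · have h1 := L.map_smul (c ⊗ₜ[F] 1) x
    have h2 : ((c ⊗ₜ[F] (1 : kᵐᵒᵖ)) • x : X) = c • x := congrArg (c • ·) (one_smul kᵐᵒᵖ x)
    have h3 : ((c ⊗ₜ[F] (1 : kᵐᵒᵖ)) • L x : Y) = c • L x := congrArg (c • ·) (one_smul kᵐᵒᵖ (L x))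
    rw [h2, h3] at h1
    exact h1
  · have h1 := L.map_smul ((1 : k) ⊗ₜ[F] op c) x
    have h2 : (((1 : k) ⊗ₜ[F] op c) • x : X) = op c • x := one_smul k _
    have h3 : (((1 : k) ⊗ₜ[F] op c) • L x : Y) = op c • L x := one_smul k _
    rw [h2, h3] at h1
    exact h1
  · exact congrArg Subtype.val (DFunLike.congr_fun hL x)

/-- The inclusion of a sub-bimodule. -/
def SubBimod.incl (S : SubBimod k X) : BiHom k S X :=
  ⟨S.toAddSubgroup.subtype, fun _ _ => rfl, fun _ _ => rfl⟩

private theorem IsCentral.sub (h : IsCentral F k X) (S : SubBimod k X) : IsCentral F k S :=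
  fun c m => Subtype.ext (h c m)

/-- Lifting of homogeneous homomorphisms. -/
private theorem exists_gradedLift [IsSemisimpleRing (k ⊗[F] kᵐᵒᵖ)] (hX : IsCentral F k X)
    (hY : IsCentral F k Y) (hT : IsCentral F k T) (pr : ℕ → BiHom k X X)
    (hfin : ∀ x, ∃ m, ∀ n, m ≤ n → pr n x = 0)
    (horth : ∀ m n x, m ≠ n → pr m (pr n x) = 0) (f : BiHom k X T) (g : BiHom k Y T)
    (Yn : ℕ → SubBimod k Y) (h : ∀ n x, ∃ y ∈ Yn n, g y = f (pr n x)) :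
    ∃ L : BiHom k X Y, ∀ n x, pr n x = x → L x ∈ Yn n ∧ g (L x) = f x := by
  have key : ∀ n, ∃ L : BiHom k X (Yn n), ∀ x, g.comp (Yn n).incl (L x) = f.comp (pr n) x :=
    fun n => exists_lift hX (hY.sub _) hT _ _ fun x => by
      obtain ⟨y, hy, h⟩ := h n x
      exact ⟨⟨y, hy⟩, h⟩
  choose L hL using key
  -- The lifts are chosen on each homogeneous component and then added up; `hfin` makes the sum
  -- finite on every element, and `horth` isolates one term on homogeneous elements.
  let M : ℕ → BiHom k X Y := fun n => (Yn n).incl.comp ((L n).comp (pr n))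
  have hM : ∀ x, (Function.support fun n => M n x).Finite := fun x => by
    obtain ⟨m, hm⟩ := hfin x
    refine (Set.finite_Iio m).subset fun n hn => ?_
    rw [Set.mem_Iio]
    by_contra hmn
    refine hn ?_
    change (Yn n).incl (L n (pr n x)) = 0
    rw [hm n (not_lt.1 hmn), map_zero, map_zero]
  have hsmul : ∀ (φ : X →+ X) (ψ : Y →+ Y), (∀ n x, M n (φ x) = ψ (M n x)) →
      ∀ x, ∑ᶠ n, M n (φ x) = ψ (∑ᶠ n, M n x) := fun φ ψ hφ x => by
    rw [ψ.map_finsum (hM x)]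
    exact finsum_congr fun n => hφ n x
  refine ⟨⟨AddMonoidHom.mk' (fun x => ∑ᶠ n, M n x) fun x y => ?_, fun c x => ?_, fun c x => ?_⟩,
    fun n x hx => ?_⟩
  · rw [← finsum_add_distrib (hM x) (hM y)]
    exact finsum_congr fun n => (M n).map_add x y
  · exact hsmul (smulHom c) (smulHom c) (fun n x => (M n).map_smul c x) x
  · exact hsmul (smulHom (op c)) (smulHom (op c)) (fun n x => (M n).map_op_smul c x) x
  · have h1 : ∑ᶠ n, M n x = M n x := finsum_eq_single _ _ fun m hm => by
      change (Yn m).incl (L m (pr m x)) = 0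
      rw [← hx, horth m n x hm, map_zero, map_zero]
    change ∑ᶠ n, M n x ∈ Yn n ∧ g (∑ᶠ n, M n x) = f x
    rw [h1]
    refine ⟨(L n (pr n x)).2, (hL n (pr n x)).trans ?_⟩
    change f (pr n (pr n x)) = f x
    rw [hx, hx]

private theorem IsCentral.bt (hX : IsCentral F k X) (hY : IsCentral F k Y) : IsCentral F k (BT k X Y) :=
  fun c z => by
    induction z using BT.induction with
    | zero => rw [smul_zero, smul_zero]
    | tmul x y => rw [BT.smul_tmul_left, BT.smul_tmul_right, hX, BT.smul_tmul, hY]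
    | add z w hz hw => rw [smul_add, smul_add, hz, hw]

private theorem isCentral_kAlg {B : Type*} [Ring B] [KAlg k B]
    (h : ∀ (c : F) (b : B), KAlg.unit (algebraMap F k c) * b = b * KAlg.unit (algebraMap F k c)) :
    IsCentral F k B := h

end Splitting

end PBW

/-! ### A homogeneous section of `T_k V → A`, and the Koszul complex in low degrees. -/

namespace PBW

universe u v w

set_option linter.unusedSectionVars false

variable {k : Type u} [Ring k] {V : Type v} [AddCommGroup V] [Module k V] [Module kᵐᵒᵖ V]
  [SMulCommClass k kᵐᵒᵖ V] {N : ℕ}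

private theorem TV.proj_mul_ι (n : ℕ) (x : TV k V) (v : V) :
    TV.proj (n + 1) (x * TV.ι v) = TV.proj n x * TV.ι v := by
  rw [TV.proj_mul, Finset.sum_eq_single (n, 1)]
  · rw [TV.proj_eq_self (TV.ι_mem v)]
  · rintro ⟨i, j⟩ hij hne
    rw [Finset.HasAntidiagonal.mem_antidiagonal] at hij
    have : 1 ≠ j := by rintro rfl; exact hne (by simp at hij; simp [hij])
    rw [TV.proj_eq_zero this (TV.ι_mem v), mul_zero]
  · intro h
    exact absurd (Finset.HasAntidiagonal.mem_antidiagonal (a := (n, 1)).2 rfl) h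

private theorem TV.proj_zero_mul_ι (x : TV k V) (v : V) : TV.proj 0 (x * TV.ι v) = 0 := by
  rw [TV.proj_zero_eq, map_mul, TV.aug_of_mem one_ne_zero (TV.ι_mem v), mul_zero, map_zero]

section Central

variable {F : Type*} [Field F] [Algebra F k] (hV : IsCentral F k V)
include hV

private theorem TV.isCentral : IsCentral F k (TV k V) := isCentral_kAlg fun c x => by
  induction x using TV.induction with
  | unit d => rw [← map_mul, ← map_mul, Algebra.commutes]
  | ι v =>
    rw [← KAlg.smul_def, ← KAlg.op_smul_def, ← BiHom.map_smul, ← BiHom.map_op_smul, hV]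
  | add x y hx hy => rw [mul_add, add_mul, hx, hy]
  | mul x y hx hy => rw [← mul_assoc, hx, mul_assoc, hy, mul_assoc]

private theorem PresAlg.isCentral (P : Set (TV k V)) : IsCentral F k (PresAlg P) := fun c a => by
  obtain ⟨x, rfl⟩ := pmk_surjective P a
  exact congrArg (pmk P) (TV.isCentral hV c x)

end Central

/-- The tensor power `V^{⊗ n}` as a sub-bimodule. -/
def tpowSub (n : ℕ) : SubBimod k (TV k V) where
  toAddSubgroup := TV.tpow k V n
  smul_mem' c _ hx := TV.unit_mul_mem c hx
  op_smul_mem' c _ hx := TV.mul_mem hx (TV.unit_mem c)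

variable (R : HomRel k V N)

namespace HomRel

private theorem exists_prA_eq_zero (a : R.Alg) : ∃ m, ∀ n, m ≤ n → R.prA n a = 0 := by
  obtain ⟨x, rfl⟩ := pmk_surjective _ a
  obtain ⟨m, hm⟩ := TV.exists_mem_fil x
  refine ⟨m + 1, fun n hn => ?_⟩
  change R.prA n (R.toAlg x) = 0
  rw [prA_toAlg, TV.mem_fil_iff.1 hm n hn, map_zero]

/-- A homogeneous section of the projection from the tensor algebra. -/
private theorem exists_section {F : Type*} [Field F] [Algebra F k] [IsSemisimpleRing (k ⊗[F] kᵐᵒᵖ)]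
    (hV : IsCentral F k V) : ∃ ρ : BiHom k R.Alg (TV k V),
      (∀ n, ∀ a ∈ R.comp n, ρ a ∈ TV.tpow k V n) ∧ ∀ a, R.toAlg (ρ a) = a := by
  have hA : IsCentral F k R.Alg := PresAlg.isCentral hV _
  obtain ⟨ρ, hρ⟩ := exists_gradedLift hA (TV.isCentral hV) hA R.prA R.exists_prA_eq_zero
    (fun m n x h => by rw [R.prA_of_mem (R.prA_mem n x), if_neg h.symm]) (BiHom.id k _)
    (pmkHom (R.rel : Set (TV k V))) tpowSub (fun n x => by
      obtain ⟨y, hy, h⟩ := R.prA_mem n x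
      exact ⟨y, hy, h⟩)
  refine ⟨ρ, fun n a ha => (hρ n a (by rw [R.prA_of_mem ha, if_pos rfl])).1, fun a => ?_⟩
  refine R.mem_of_comp (S := (R.toAlg.toAddMonoidHom.comp ρ.1).eqLocus (AddMonoidHom.id _))
    (fun n a ha => ?_) a
  exact (hρ n a (by rw [R.prA_of_mem ha, if_pos rfl])).2

/-! Injectivity of `par` in low degrees -/

private theorem trunc_smul (n : ℕ) (hn : n < N) (c : k) (a : R.Alg) :
    R.trunc n hn (c • a) = KAlg.unit c * R.trunc n hn a := by
  obtain ⟨x, rfl⟩ := pmk_surjective _ a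
  exact (TV.projHom n).map_smul c x

private theorem trunc_op_smul (n : ℕ) (hn : n < N) (c : k) (a : R.Alg) :
    R.trunc n hn (op c • a) = R.trunc n hn a * KAlg.unit c := by
  obtain ⟨x, rfl⟩ := pmk_surjective _ a
  exact (TV.projHom n).map_op_smul c x

/-- `v ⊗ b ↦ v b_q`, where `b_q ∈ A_q ≃ V^{⊗ q}` is the component of degree `q < N`. -/
def mulTruncRight (q : ℕ) (hq : q < N) : BiHom k (BT k V R.Alg) (TV k V) :=
  BT.liftBi (fun v b => TV.ι v * R.trunc q hq b)
    (by intros; rw [BiHom.map_add, add_mul]) (by intros; rw [map_add, mul_add])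
    (by intros; rw [BiHom.map_op_smul, trunc_smul, KAlg.op_smul_def, mul_assoc])
    (by intros; rw [BiHom.map_smul, KAlg.smul_def, KAlg.smul_def, mul_assoc])
    (by intros; rw [trunc_op_smul, KAlg.op_smul_def, mul_assoc])

/-- `a|v|b ↦ a_l v b_q`. -/
def mulTrunc (l q : ℕ) (hl : l < N) (hq : q < N) : R.K1 →+ TV k V :=
  BT.lift (fun a y => R.trunc l hl a * R.mulTruncRight q hq y)
    (by intros; rw [map_add, add_mul]) (by intros; rw [BiHom.map_add, mul_add])
    (by intros; rw [BiHom.map_smul, trunc_op_smul, KAlg.smul_def, mul_assoc])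

private theorem mulTrunc_tmul (l q : ℕ) (hl : l < N) (hq : q < N) (a b : R.Alg) (v : V) :
    R.mulTrunc l q hl hq (BT.tmul k a (BT.tmul k v b)) =
      R.trunc l hl a * (TV.ι v * R.trunc q hq b) := rfl

private theorem trunc_succ_mul_ι (q : ℕ) (hq : q + 1 < N) (b : R.Alg) (v : V) :
    R.trunc (q + 1) hq (b * R.toAlg (TV.ι v)) = R.trunc q (by omega) b * TV.ι v := by
  obtain ⟨x, rfl⟩ := pmk_surjective _ b
  exact TV.proj_mul_ι q x v

private theorem trunc_zero_mul_ι (hN : 0 < N) (b : R.Alg) (v : V) :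
    R.trunc 0 hN (b * R.toAlg (TV.ι v)) = 0 := by
  obtain ⟨x, rfl⟩ := pmk_surjective _ b
  exact TV.proj_zero_mul_ι x v

private theorem mulTrunc_zero_op_smul_ι (l : ℕ) (hl : l < N) (hN : 0 < N) (z : R.K1) (v : V) :
    R.mulTrunc l 0 hl hN (op (R.toAlg (TV.ι v)) • z) = 0 := by
  refine FB.eq_of_tmul ((R.mulTrunc l 0 hl hN).comp (smulHom (op (R.toAlg (TV.ι v))))) 0
    (fun a w b => ?_) z
  simp only [AddMonoidHom.comp_apply, smulHom_apply, op_smul_tmul_tmul, mulTrunc_tmul,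
    trunc_zero_mul_ι, mul_zero, AddMonoidHom.zero_apply]

private theorem mulTrunc_succ_op_smul_ι (l q : ℕ) (hl : l < N) (hq : q + 1 < N) (z : R.K1) (v : V) :
    R.mulTrunc l (q + 1) hl hq (op (R.toAlg (TV.ι v)) • z) =
      R.mulTrunc l q hl (by omega) z * TV.ι v := by
  refine FB.eq_of_tmul ((R.mulTrunc l (q + 1) hl hq).comp (smulHom (op (R.toAlg (TV.ι v)))))
    ((AddMonoidHom.mulRight (TV.ι v)).comp (R.mulTrunc l q hl (by omega))) (fun a w b => ?_) z
  simp only [AddMonoidHom.comp_apply, smulHom_apply, op_smul_tmul_tmul, mulTrunc_tmul,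
    trunc_succ_mul_ι, AddMonoidHom.mulRight_apply, mul_assoc]

/-- Among the terms of `par` of a word, only the one whose distinguished letter has `l` letters
before and `q` letters after it survives, and multiplying it out gives the word back. No information
is lost in the outer factors because `l` and `q` are below `N`. -/
private theorem mulTrunc_par (l q : ℕ) (hl : l < N) (hq : q < N) (x : TV k V) :
    R.mulTrunc l q hl hq (R.par x) = TV.proj (l + q + 1) x := by
  induction q generalizing x with
  | zero =>
    refine TV.addHom_ext_right (f := (R.mulTrunc l 0 hl hq).comp R.par.1)
      (g := (TV.projHom (l + 0 + 1)).1) (fun c => ?_) (fun x _ v => ?_) x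
    · simp only [AddMonoidHom.comp_apply, par_unit, map_zero]
      exact (TV.proj_eq_zero (by omega) (TV.unit_mem c)).symm
    · simp only [AddMonoidHom.comp_apply, par_mul_ι, map_add, mulTrunc_zero_op_smul_ι,
        smul_gen_left, mulTrunc_tmul, trunc_toAlg, add_zero]
      rw [← map_one R.toAlg, trunc_toAlg, TV.proj_eq_self TV.one_mem, mul_one]
      exact (TV.proj_mul_ι l x v).symm
  | succ q ih =>
    refine TV.addHom_ext_right (f := (R.mulTrunc l (q + 1) hl hq).comp R.par.1)
      (g := (TV.projHom (l + (q + 1) + 1)).1) (fun c => ?_) (fun x _ v => ?_) x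
    · simp only [AddMonoidHom.comp_apply, par_unit, map_zero]
      exact (TV.proj_eq_zero (by omega) (TV.unit_mem c)).symm
    · simp only [AddMonoidHom.comp_apply, par_mul_ι, map_add, mulTrunc_succ_op_smul_ι,
        smul_gen_left, mulTrunc_tmul, trunc_toAlg, ih]
      rw [← map_one R.toAlg, trunc_toAlg, TV.proj_eq_zero (by omega) TV.one_mem, mul_zero,
        mul_zero, zero_add]
      exact (TV.proj_mul_ι (l + q + 1) x v).symm

/-- Two cases matter: degree `N` for relations (`l = 0`, `q = N - 1`) and degree `N + 1` for
overlaps in `(R ⊗ V) ∩ (V ⊗ R)` (`l = 1`, `q = N - 1`). -/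
private theorem eq_zero_of_par_eq_zero (l q : ℕ) (hl : l < N) (hq : q < N) {x : TV k V}
    (hx : x ∈ TV.tpow k V (l + q + 1)) (h : R.par x = 0) : x = 0 := by
  rw [← TV.proj_eq_self hx, ← R.mulTrunc_par l q hl hq, h, map_zero]

/-! The bimodule `K₂` in low degrees -/

private theorem eq_zero_of_mem_K2Comp {n : ℕ} (hn : n < N) {x : R.K2} (hx : x ∈ R.K2Comp n) : x = 0 := by
  have : R.K2Comp n ≤ ⊥ := R.freeComp_le fun i j l hd a ha w hw b hb => by
    rw [eq_zero_of_concentrated (by omega) hw, BT.zero_tmul, BT.tmul_zero]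
    exact zero_mem _
  exact this hx

private theorem exists_gen_of_mem_K2Comp {x : R.K2} (hx : x ∈ R.K2Comp N) :
    ∃ r : R.rel, gen k R.Alg R.rel r = x := by
  have : R.K2Comp N ≤ (gen k R.Alg R.rel).1.range := R.freeComp_le fun i j l hd a ha w hw b hb => by
    rcases eq_or_ne j N with rfl | hj
    · obtain rfl : i = 0 := by omega
      obtain rfl : l = 0 := by omega
      rw [R.eq_unit_of_mem ha, R.eq_unit_of_mem hb, ← smul_gen, Compat.unit_smul,
        Compat.op_unit_smul]
      exact ⟨R.aug a • op (R.aug b) • w, by simp only [BiHom.map_smul, BiHom.map_op_smul]⟩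
    · rw [eq_zero_of_concentrated hj hw, BT.zero_tmul, BT.tmul_zero]
      exact zero_mem _
  exact this hx

private theorem exists_d2_eq_par_proj_mul (n : ℕ) {i l : ℕ} {a b r : TV k V} (ha : a ∈ TV.tpow k V i)
    (hr : r ∈ R.rel) (hb : b ∈ TV.tpow k V l) :
    ∃ y ∈ R.K2Comp n, R.d2 y = R.par (TV.proj n (a * r * b)) := by
  have hm : a * r * b ∈ TV.tpow k V (i + N + l) := TV.mul_mem (TV.mul_mem ha (R.le r hr)) hb
  rw [TV.proj_of_mem hm]
  split_ifs with h
  · exact ⟨_, R.tmul_mem_freeComp h (R.toAlg_mem ha) (concentrated_self R.rel N ⟨r, hr⟩)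
      (R.toAlg_mem hb), R.d2_tmul a b ⟨r, hr⟩⟩
  · exact ⟨0, zero_mem _, (map_zero R.d2.1).trans (map_zero R.par.1).symm⟩

/-- The ideal is spanned by products `a r b`, and `par (a r b) = d₂ (a|r|b)`; for homogeneous
factors the projection keeps or kills the whole product. This is the amount of exactness at `K₁`
needed to lift `τ̄₁ b̄₂` through `d₂`. -/
private theorem exists_d2_eq_par_proj {z : TV k V} (hz : R.toAlg z = 0) (n : ℕ) :
    ∃ y ∈ R.K2Comp n, R.d2 y = R.par (TV.proj n z) := by
  rw [pmk_eq_zero_iff, mem_idealOf_iff] at hz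
  let S : AddSubgroup (TV k V) := ((R.K2Comp n).map R.d2.1).comap (R.par.1.comp (TV.projHom n).1)
  suffices h : AddSubgroup.closure _ ≤ S from h hz
  rw [AddSubgroup.closure_le]
  rintro _ ⟨a, r, hr, b, rfl⟩
  refine TV.mem_of_tpow (S := S.comap (AddMonoidHom.mulLeft (a * r))) (fun l b hb => ?_) b
  refine TV.mem_of_tpow (S := S.comap ((AddMonoidHom.mulRight b).comp (AddMonoidHom.mulRight r)))
    (fun i a ha => ?_) a
  exact R.exists_d2_eq_par_proj_mul n ha hr hb

end HomRel

end PBW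

/-! ### The grading of `(A / k)^{⊗ 2}` and the construction of `τ̄₂`. -/

namespace PBW

universe u v w

set_option linter.unusedSectionVars false

variable {k : Type u} [Ring k] {V : Type v} [AddCommGroup V] [Module k V] [Module kᵐᵒᵖ V]
  [SMulCommClass k kᵐᵒᵖ V] {N : ℕ} (R : HomRel k V N)

namespace HomRel

/-! The homogeneous components of `(A / k)^{⊗ 2}` -/

/-- The projection of `I₊` to its component of degree `n`. -/
def prP (n : ℕ) : BiHom k R.plus R.plus := R.bar.comp ((R.prA n).comp R.incl)

private theorem prP_mem (n : ℕ) (a : R.plus) : R.prP n a ∈ R.plusComp n := R.bar_mem (R.prA_mem n _)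

private theorem prP_of_mem {n : ℕ} {a : R.plus} (ha : a ∈ R.plusComp n) (m : ℕ) :
    R.prP m a = if n = m then a else 0 := by
  refine (congrArg R.bar.1 (R.prA_of_mem (R.mem_plusComp.1 ha) m)).trans ?_
  split_ifs
  · rw [bar_coe]
  · exact map_zero R.bar.1

/-- The projection of `I₊ ⊗ I₊` to its component of degree `n`. -/
def pr2 (n : ℕ) : BiHom k R.plus2 R.plus2 :=
  ∑ ij ∈ Finset.HasAntidiagonal.antidiagonal n, BT.map (R.prP ij.1) (R.prP ij.2)

private theorem pr2_tmul (n : ℕ) (a b : R.plus) : R.pr2 n (BT.tmul k a b) =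
    ∑ ij ∈ Finset.HasAntidiagonal.antidiagonal n, BT.tmul k (R.prP ij.1 a) (R.prP ij.2 b) :=
  BiHom.sum_apply _ _ _

private theorem pr2_mem (n : ℕ) (w : R.plus2) : R.pr2 n w ∈ R.plus2Comp n := by
  induction w using BT.induction with
  | zero => rw [map_zero]; exact zero_mem _
  | tmul a b =>
    rw [pr2_tmul]
    exact sum_mem fun ij hij => BT.tmul_mem_grading
      (Finset.HasAntidiagonal.mem_antidiagonal.1 hij) (R.prP_mem _ _) (R.prP_mem _ _)
  | add x y hx hy => rw [map_add]; exact add_mem hx hy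

private theorem pr2_of_mem {n : ℕ} {w : R.plus2} (hw : w ∈ R.plus2Comp n) : R.pr2 n w = w := by
  have : R.plus2Comp n ≤ (R.pr2 n).1.eqLocus (AddMonoidHom.id _) :=
    R.plus2_induction fun i j hij a ha b hb => by
      change R.pr2 n (BT.tmul k a b) = BT.tmul k a b
      rw [pr2_tmul, Finset.sum_eq_single (i, j)]
      · rw [R.prP_of_mem ha, R.prP_of_mem hb, if_pos rfl, if_pos rfl]
      · rintro ⟨i', j'⟩ hij' hne
        rw [Finset.HasAntidiagonal.mem_antidiagonal] at hij'
        have h1 : i ≠ i' := by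
          rintro rfl
          exact hne (Prod.ext rfl (by change i + j' = n at hij'; change j' = j; omega))
        rw [R.prP_of_mem ha, if_neg h1, BT.zero_tmul]
      · intro h
        exact absurd (Finset.HasAntidiagonal.mem_antidiagonal (a := (i, j)).2 hij) h
  exact this hw

private theorem pr2_of_mem_of_ne {m n : ℕ} (h : m ≠ n) {w : R.plus2} (hw : w ∈ R.plus2Comp n) :
    R.pr2 m w = 0 := by
  have : R.plus2Comp n ≤ (R.pr2 m).1.ker := R.plus2_induction fun i j hij a ha b hb => by
    change R.pr2 m (BT.tmul k a b) = 0
    rw [pr2_tmul]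
    refine Finset.sum_eq_zero fun ij hij' => ?_
    rw [Finset.HasAntidiagonal.mem_antidiagonal] at hij'
    rw [R.prP_of_mem ha, R.prP_of_mem hb]
    by_cases h1 : i = ij.1
    · rw [if_neg (show j ≠ ij.2 by omega), BT.tmul_zero]
    · rw [if_neg h1, BT.zero_tmul]
  exact this hw

private theorem exists_prP_eq_zero (a : R.plus) : ∃ m, ∀ n, m ≤ n → R.prP n a = 0 := by
  obtain ⟨m, hm⟩ := R.exists_prA_eq_zero (a : R.Alg)
  refine ⟨m, fun n hn => ?_⟩
  change R.bar (R.prA n (a : R.Alg)) = 0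
  rw [hm n hn]; exact map_zero R.bar.1

private theorem exists_pr2_eq_zero (w : R.plus2) : ∃ m, ∀ n, m ≤ n → R.pr2 n w = 0 := by
  induction w using BT.induction with
  | zero => exact ⟨0, fun n _ => map_zero _⟩
  | tmul a b =>
    obtain ⟨i, hi⟩ := R.exists_prP_eq_zero a
    obtain ⟨j, hj⟩ := R.exists_prP_eq_zero b
    refine ⟨i + j, fun n hn => ?_⟩
    rw [pr2_tmul]
    refine Finset.sum_eq_zero fun ij hij => ?_
    rw [Finset.HasAntidiagonal.mem_antidiagonal] at hij
    by_cases h : i ≤ ij.1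
    · rw [hi _ h, BT.zero_tmul]
    · rw [hj ij.2 (by omega), BT.tmul_zero]
  | add x y hx hy =>
    obtain ⟨i, hi⟩ := hx
    obtain ⟨j, hj⟩ := hy
    refine ⟨i + j, fun n hn => ?_⟩
    rw [map_add, hi n (by omega), hj n (by omega), add_zero]

private theorem plus2_eq_top (S : AddSubgroup R.plus2) (h : ∀ n, R.plus2Comp n ≤ S) : S = ⊤ := by
  rw [eq_top_iff]
  intro w _
  induction w using BT.induction with
  | zero => exact zero_mem _
  | add x y hx hy => exact add_mem (hx trivial) (hy trivial)
  | tmul a b =>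
    refine R.mem_of_plusComp (S := S.comap (BT.tmulHomLeft k b)) (fun i a ha => ?_) a
    refine R.mem_of_plusComp (S := S.comap (BT.tmulHom k a)) (fun j b hb => ?_) b
    exact h _ (BT.tmul_mem_grading rfl ha hb)

/-! Values of the differentials -/

private theorem coe_cls {x : TV k V} (hx : TV.aug x = 0) : (R.cls x : R.Alg) = R.toAlg x := by
  rw [cls, coe_bar, aug_toAlg, hx, map_zero, sub_zero]

private theorem mulPlus_cls {x y : TV k V} (hx : TV.aug x = 0) (hy : TV.aug y = 0) :
    R.mulPlus (BT.tmul k (R.cls x) (R.cls y)) = R.cls (x * y) := by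
  apply Subtype.ext
  rw [mulPlus_tmul, R.coe_cls hx, R.coe_cls hy, R.coe_cls (by rw [map_mul, hx, zero_mul]), map_mul]

private theorem b2_bar2 {x y : TV k V} (hx : TV.aug x = 0) (hy : TV.aug y = 0) :
    R.b2 (R.bar2 x y) = R.toAlg x • R.bar1 y - R.bar1 (x * y) + op (R.toAlg y) • R.bar1 x := by
  have h := R.b2_gen (R.cls x) (R.cls y)
  simp only [R.coe_cls hx, R.coe_cls hy, R.mulPlus_cls hx hy] at h
  exact h

/-- The component of degree `n` of `K₂` as a sub-bimodule. -/
def K2Sub (n : ℕ) : SubBimod k R.K2 where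
  toAddSubgroup := R.K2Comp n
  smul_mem' c x hx := by
    rw [← Compat.unit_smul (k := k) (A := R.Alg)]
    exact R.smul_mem_freeComp (zero_add n) (R.unit_mem_comp c) hx
  op_smul_mem' c x hx := by
    rw [← Compat.op_unit_smul (k := k) (A := R.Alg)]
    exact R.op_smul_mem_freeComp (add_zero n) (R.unit_mem_comp c) hx

section Tau2

variable (τ₁ : BiHom R.Alg R.C1 R.K1) (ρ : BiHom k R.Alg (TV k V))
  (hρ : ∀ n, ∀ a ∈ R.comp n, ρ a ∈ TV.tpow k V n) (hρ' : ∀ a, R.toAlg (ρ a) = a)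
  (hτ : ∀ a : R.plus, τ₁ (gen k R.Alg _ a) = R.par (ρ a))
include hρ hρ' hτ

/-- The outer terms of `b̄₂` combine by the derivation rule of `par`, so everything is `par` of the
failure of `ρ` to be multiplicative, and that failure lies in `⟨R⟩`. -/
private theorem tau1_b2_gen_tmul (a b : R.plus) : τ₁ (R.b2 (gen k R.Alg _ (BT.tmul k a b))) =
    R.par (ρ a * ρ b - ρ (R.mulPlus (BT.tmul k a b) : R.plus)) := by
  simp only [b2_gen, map_add, map_sub, BiHom.map_smul, BiHom.map_op_smul, hτ, par_mul, hρ']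
  exact sub_add_eq_add_sub _ _ _

private theorem exists_d2_eq_tau1_b2 {n : ℕ} {w : R.plus2} (hw : w ∈ R.plus2Comp n) :
    ∃ y ∈ R.K2Comp n, R.d2 y = τ₁ (R.b2 (gen k R.Alg _ w)) := by
  refine R.plus2_induction (S := ((R.K2Comp n).map R.d2.1).comap
    ((τ₁.1.comp R.b2.1).comp (gen k R.Alg R.plus2).1)) (fun i j hij a ha b hb => ?_) hw
  have h1 : R.toAlg (ρ a * ρ b - ρ (R.mulPlus (BT.tmul k a b) : R.plus)) = 0 := by
    rw [map_sub, map_mul, hρ', hρ', hρ', mulPlus_tmul, sub_self]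
  obtain ⟨y, hy, h2⟩ := R.exists_d2_eq_par_proj h1 n
  refine ⟨y, hy, h2.trans ((congrArg R.par.1 (TV.proj_eq_self ?_)).trans
    (R.tau1_b2_gen_tmul τ₁ ρ hρ hρ' hτ a b).symm)⟩
  exact sub_mem (hij ▸ TV.mul_mem (hρ i a ha) (hρ j b hb)) (hρ n _ (R.mulPlus_mem hij ha hb))

/-- The second component of a comparison morphism exists. -/
private theorem exists_tau2 {F : Type*} [Field F] [Algebra F k] [IsSemisimpleRing (k ⊗[F] kᵐᵒᵖ)]
    (hV : IsCentral F k V) :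
    ∃ L : BiHom k R.plus2 R.K2, (∀ n, ∀ w ∈ R.plus2Comp n, L w ∈ R.K2Comp n) ∧
      ∀ w, R.d2 (L w) = τ₁ (R.b2 (gen k R.Alg _ w)) := by
  have hA : IsCentral F k R.Alg := PresAlg.isCentral hV _
  have hr : IsCentral F k R.rel := (TV.isCentral hV).sub _
  have hP : IsCentral F k R.plus := hA.sub _
  obtain ⟨L, hL⟩ := exists_gradedLift (hP.bt hP) (hA.bt (hr.bt hA)) (hA.bt (hV.bt hA)) R.pr2
    R.exists_pr2_eq_zero (fun m n w h => R.pr2_of_mem_of_ne h (R.pr2_mem n w))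
    ((restrict (k := k) (τ₁.comp R.b2)).comp (gen k R.Alg _)) (restrict (k := k) R.d2)
    R.K2Sub (fun n w => R.exists_d2_eq_tau1_b2 τ₁ ρ hρ hρ' hτ (R.pr2_mem n w))
  have hL' : ∀ n, ∀ w ∈ R.plus2Comp n, L w ∈ R.K2Comp n ∧
      R.d2 (L w) = τ₁ (R.b2 (gen k R.Alg _ w)) := fun n w hw => hL n w (R.pr2_of_mem hw)
  refine ⟨L, fun n w hw => (hL' n w hw).1, fun w => ?_⟩
  have := R.plus2_eq_top ((R.d2.1.comp L.1).eqLocus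
    ((τ₁.1.comp R.b2.1).comp (gen k R.Alg R.plus2).1)) fun n w hw => (hL' n w hw).2
  exact (this.symm ▸ AddSubgroup.mem_top w :)

end Tau2

end HomRel

end PBW

/-! ### Construction of `τ̄₁`, `s₁` and `s₂`. -/

namespace PBW

universe u v w

set_option linter.unusedSectionVars false

variable {k : Type u} [Ring k] {V : Type v} [AddCommGroup V] [Module k V] [Module kᵐᵒᵖ V]
  [SMulCommClass k kᵐᵒᵖ V] {N : ℕ} (R : HomRel k V N)

namespace HomRel

section SectionMaps

variable (ρ : BiHom k R.Alg (TV k V))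

/-- `1|a|1 ↦ ρ(a)_(1) | ρ(a)_(2) | ρ(a)_(3)`. -/
def tau1Of : BiHom R.Alg R.C1 R.K1 := extend (R.par.comp (ρ.comp R.incl))

/-- `1|a|1 ↦ - 1 | ρ(a)_(1) | ρ(a)_(2) | ρ(a)_(3)`. -/
def s1Of : BiHom R.Alg R.C1 R.C2 := extend (-(R.ins.comp (R.par.comp (ρ.comp R.incl))))

private theorem tau1Of_gen (a : R.plus) : R.tau1Of ρ (gen k R.Alg _ a) = R.par (ρ a) := extend_gen _ _

private theorem s1Of_gen (a : R.plus) : R.s1Of ρ (gen k R.Alg _ a) = - R.ins (R.par (ρ a)) :=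
  extend_gen _ _

private theorem d1_tau1Of (hρ' : ∀ a, R.toAlg (ρ a) = a) (x : R.C1) :
    R.d1 (R.tau1Of ρ x) = R.b1 x := by
  refine FB.hom_eq (f := R.d1.comp (R.tau1Of ρ)) (g := R.b1) (fun a => ?_) x
  simp only [BiHom.comp_apply, tau1Of_gen, d1_par, hρ', b1_gen]

private theorem b2_s1Of (hρ' : ∀ a, R.toAlg (ρ a) = a) (x : R.C1) :
    R.b2 (R.s1Of ρ x) = x - R.sigma1 (R.tau1Of ρ x) := by
  refine FB.hom_eq (f := R.b2.comp (R.s1Of ρ))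
    (g := BiHom.id R.Alg R.C1 - R.sigma1.comp (R.tau1Of ρ)) (fun a => ?_) x
  simp only [BiHom.comp_apply, BiHom.sub_apply, BiHom.id_apply, s1Of_gen, map_neg, tau1Of_gen,
    b2_ins_par, neg_sub]
  simp only [bar1, cls, hρ', bar_coe]

private theorem tau1Of_mem (hρ : ∀ n, ∀ a ∈ R.comp n, ρ a ∈ TV.tpow k V n) (d : ℕ) (x : R.C1)
    (hx : x ∈ R.C1Comp d) : R.tau1Of ρ x ∈ R.K1Comp d :=
  R.extend_mem_freeComp (R.par.comp (ρ.comp R.incl)) (fun n a ha => R.par_mem (hρ n a ha)) d x hx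

private theorem s1Of_mem (hρ : ∀ n, ∀ a ∈ R.comp n, ρ a ∈ TV.tpow k V n) (d : ℕ) (x : R.C1)
    (hx : x ∈ R.C1Comp d) : R.s1Of ρ x ∈ R.C2Comp d :=
  R.extend_mem_freeComp (-(R.ins.comp (R.par.comp (ρ.comp R.incl))))
    (fun n a ha => neg_mem (R.ins_mem (R.par_mem (hρ n a ha)))) d x hx

/-- Below degree `N` a homogeneous section is determined, since `T_k V → A` is injective there.
Degree zero is separate: the class in `A / k` of a scalar is zero, and `par` kills scalars. -/
private theorem par_section_cls (hρ : ∀ n, ∀ a ∈ R.comp n, ρ a ∈ TV.tpow k V n)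
    (hρ' : ∀ a, R.toAlg (ρ a) = a) {n : ℕ} (hn : n < N) {x : TV k V} (hx : x ∈ TV.tpow k V n) :
    R.par (ρ (R.cls x)) = R.par x := by
  rcases eq_or_ne n 0 with rfl | h
  · obtain ⟨c, rfl⟩ := hx
    change R.par (ρ (R.cls (KAlg.unit c))) = R.par (KAlg.unit c)
    rw [cls_unit, par_unit]
    exact (congrArg R.par.1 (map_zero ρ.1)).trans (map_zero R.par.1)
  · have h1 : ρ (R.cls x) = x := by
      rw [R.coe_cls (TV.aug_of_mem h hx)]
      exact R.eq_of_toAlg_eq hn (hρ n _ (R.toAlg_mem hx)) hx (hρ' _)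
    rw [h1]

end SectionMaps

section Homotopy

variable (τ₂ : BiHom R.Alg R.C2 R.K2) (s₁ : BiHom R.Alg R.C1 R.C2)

/-- `id - σ̄₂ τ̄₂ - s₁ b̄₂`. -/
def defect : BiHom R.Alg R.C2 R.C2 := BiHom.id R.Alg R.C2 - R.sigma2.comp τ₂ - s₁.comp R.b2

/-- The homotopy in degree two. -/
def s2Of : BiHom R.Alg R.C2 R.C3 :=
  extend ((R.hL R.plus2).comp ((restrict (R.defect τ₂ s₁)).comp (gen k R.Alg R.plus2)))

private theorem s2Of_gen (w : R.plus2) : R.s2Of τ₂ s₁ (gen k R.Alg _ w) =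
    R.hL _ (R.defect τ₂ s₁ (gen k R.Alg _ w)) := extend_gen _ _

/-- As `τ̄` and `σ̄` commute with the differentials and `s₁` is a homotopy in degree one, the defect
left in degree two is a cycle. The contraction `hL` then bounds it, which is the choice of `s₂`. -/
private theorem b2_defect (τ₁ : BiHom R.Alg R.C1 R.K1) (hτ : ∀ x, R.d2 (τ₂ x) = τ₁ (R.b2 x))
    (hs : ∀ x, R.b2 (s₁ x) = x - R.sigma1 (τ₁ x)) (x : R.C2) : R.b2 (R.defect τ₂ s₁ x) = 0 := by
  have h1 : R.b2 (R.sigma2 (τ₂ x)) = R.sigma1 (τ₁ (R.b2 x)) :=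
    (R.b2_sigma2 _).trans (congrArg R.sigma1.1 (hτ x))
  refine (map_sub R.b2.1 _ _).trans ?_
  refine (congrArg₂ (· - ·) ((map_sub R.b2.1 _ _).trans (congrArg (R.b2 x - ·) h1))
    (hs (R.b2 x))).trans (sub_self _)

private theorem b3_s2Of (τ₁ : BiHom R.Alg R.C1 R.K1) (hτ : ∀ x, R.d2 (τ₂ x) = τ₁ (R.b2 x))
    (hs : ∀ x, R.b2 (s₁ x) = x - R.sigma1 (τ₁ x)) (x : R.C2) :
    R.b3 (R.s2Of τ₂ s₁ x) = R.defect τ₂ s₁ x := by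
  refine FB.hom_eq (f := R.b3.comp (R.s2Of τ₂ s₁)) (g := R.defect τ₂ s₁) (fun w => ?_) x
  have h3 := R.b3_hL_add_hL_b2 (R.defect τ₂ s₁ (gen k R.Alg _ w))
  simp only [R.b2_defect τ₂ s₁ τ₁ hτ hs, map_zero, add_zero] at h3
  exact (congrArg R.b3.1 (R.s2Of_gen τ₂ s₁ w)).trans h3

private theorem s2Of_mem (hτ : ∀ d, ∀ x ∈ R.C2Comp d, τ₂ x ∈ R.K2Comp d)
    (hs : ∀ d, ∀ x ∈ R.C1Comp d, s₁ x ∈ R.C2Comp d) (d : ℕ) (x : R.C2) (hx : x ∈ R.C2Comp d) :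
    R.s2Of τ₂ s₁ x ∈ R.C3Comp d := by
  refine R.extend_mem_freeComp (G := R.plus2Comp) (H := R.plus3Comp)
    ((R.hL R.plus2).comp ((restrict (R.defect τ₂ s₁)).comp (gen k R.Alg R.plus2)))
    (fun n w hw => R.hL_mem (G := R.plus2Comp) ?_) d x hx
  have hg : gen k R.Alg _ w ∈ R.C2Comp n := R.gen_mem_freeComp hw
  exact sub_mem (sub_mem hg (R.sigma2_mem n _ (hτ n _ hg))) (hs n _ (R.b2_mem n _ hg))

private theorem add_sub_rearrange₄ {X : Type*} [AddCommGroup X] (p q r : X) :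
    0 - p - (-q - r - 0) = q - p + r := by abel

/-- The value of the homotopy on `1|ᾱ|β̄|1`. -/
private theorem hL_defect_bar2 {i j : ℕ} (hi : i < N) (hj : j < N) (hi0 : i ≠ 0) (hj0 : j ≠ 0)
    (hs : ∀ n < N, ∀ α ∈ TV.tpow k V n, s₁ (R.bar1 α) = - R.ins (R.par α))
    {x y : TV k V} (hx : x ∈ TV.tpow k V i) (hy : y ∈ TV.tpow k V j) :
    R.hL _ (R.defect τ₂ s₁ (R.bar2 x y)) = R.ins2 (BT.tmul k (R.cls x) (R.par y)) -
      R.hL _ (R.sigma2 (τ₂ (R.bar2 x y))) + R.hL _ (s₁ (R.bar1 (x * y))) := by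
  -- The generator has leftmost factor `1` and is killed by `hL`. Of the three terms of `s₁ b̄₂` the
  -- one multiplied by `y` on the right dies too, by `hL_ins`; the other two give the remaining
  -- terms of the formula.
  have h1 : R.hL _ (R.bar2 x y) = 0 := R.hL_gen _
  have h2 : R.hL _ (R.toAlg x • R.ins (R.par y)) = R.ins2 (BT.tmul k (R.cls x) (R.par y)) :=
    R.hL_smul_ins _ _
  have h3 : s₁ (R.b2 (R.bar2 x y)) = - (R.toAlg x • R.ins (R.par y)) - s₁ (R.bar1 (x * y)) -
      op (R.toAlg y) • R.ins (R.par x) := by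
    have h := congrArg s₁.1 (R.b2_bar2 (TV.aug_of_mem hi0 hx) (TV.aug_of_mem hj0 hy))
    simp only [map_sub, map_add, BiHom.map_smul, BiHom.map_op_smul, hs j hj y hy, hs i hi x hx,
      smul_neg, ← sub_eq_add_neg] at h
    exact h
  have h4 : R.hL _ (s₁ (R.b2 (R.bar2 x y))) = - R.ins2 (BT.tmul k (R.cls x) (R.par y)) -
      R.hL _ (s₁ (R.bar1 (x * y))) - 0 := by
    refine (congrArg (R.hL R.plus2).1 h3).trans ?_
    simp only [map_sub, map_neg, hL_op_smul, h2, hL_ins, smul_zero]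
  refine (map_sub (R.hL R.plus2).1 _ _).trans ?_
  refine (congrArg₂ (· - ·) ((map_sub (R.hL R.plus2).1 _ _).trans (congrArg (· - _) h1)) h4).trans ?_
  exact add_sub_rearrange₄ _ _ _

end Homotopy

end HomRel

end PBW

/-! ### The prescribed values, and existence of comparison data. -/

namespace PBW

universe u v w

set_option linter.unusedSectionVars false

variable {k : Type u} [Ring k] {V : Type v} [AddCommGroup V] [Module k V] [Module kᵐᵒᵖ V]
  [SMulCommClass k kᵐᵒᵖ V] {N : ℕ} (R : HomRel k V N)

namespace HomRel

private theorem bar1_eq_zero {x : TV k V} (hx : x ∈ R.rel) : R.bar1 x = 0 := by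
  rw [bar1, R.cls_rel hx, map_zero]

private theorem bar1_sum {ι : Type*} (s : Finset ι) (f : ι → TV k V) :
    R.bar1 (∑ i ∈ s, f i) = ∑ i ∈ s, R.bar1 (f i) :=
  map_sum ((gen k R.Alg R.plus).1.comp R.clsHom.1) f s

private theorem sum_bar2 {ι : Type*} (s : Finset ι) (f g : ι → TV k V) :
    ∑ i ∈ s, R.bar2 (f i) (g i) =
      gen k R.Alg R.plus2 (∑ i ∈ s, BT.tmul k (R.cls (f i)) (R.cls (g i))) :=
  (map_sum (gen k R.Alg R.plus2).1 _ s).symm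

private theorem bar2_of_mem_zero_left {x : TV k V} (hx : x ∈ TV.tpow k V 0) (y : TV k V) :
    R.bar2 x y = 0 := by
  obtain ⟨c, rfl⟩ := hx
  change gen k R.Alg R.plus2 (BT.tmul k (R.cls (KAlg.unit c)) (R.cls y)) = 0
  rw [cls_unit, BT.zero_tmul, map_zero]

private theorem bar2_of_mem_zero_right {y : TV k V} (hy : y ∈ TV.tpow k V 0) (x : TV k V) :
    R.bar2 x y = 0 := by
  obtain ⟨c, rfl⟩ := hy
  change gen k R.Alg R.plus2 (BT.tmul k (R.cls x) (R.cls (KAlg.unit c))) = 0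
  rw [cls_unit, BT.tmul_zero, map_zero]

private theorem par_of_mem_zero {x : TV k V} (hx : x ∈ TV.tpow k V 0) : R.par x = 0 := by
  obtain ⟨c, rfl⟩ := hx
  exact R.par_unit c

private theorem cls_of_mem_zero {x : TV k V} (hx : x ∈ TV.tpow k V 0) : R.cls x = 0 := by
  obtain ⟨c, rfl⟩ := hx
  exact R.cls_unit c

private theorem RelDecomp.p_lt {R : HomRel k V N} (d : R.RelDecomp) (i : Fin d.n) : d.p i < N := by
  have := d.add_eq i
  have := d.q_pos i
  omega

private theorem RelDecomp.q_lt {R : HomRel k V N} (d : R.RelDecomp) (i : Fin d.n) : d.q i < N := by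
  have := d.add_eq i
  have := d.p_pos i
  omega

private theorem RelDecomp.p_ne {R : HomRel k V N} (d : R.RelDecomp) (i : Fin d.n) : d.p i ≠ 0 :=
  Nat.one_le_iff_ne_zero.1 (d.p_pos i)

private theorem RelDecomp.q_ne {R : HomRel k V N} (d : R.RelDecomp) (i : Fin d.n) : d.q i ≠ 0 :=
  Nat.one_le_iff_ne_zero.1 (d.q_pos i)

private theorem add_sub_rearrange₅ {X : Type*} [AddCommGroup X] (p q r : X) :
    p - q + r = p + r - q := by abel

private theorem tau1_b2_bar2 (τ₁ : BiHom R.Alg R.C1 R.K1)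
    (hτ : ∀ n < N, ∀ α ∈ TV.tpow k V n, τ₁ (R.bar1 α) = R.par α) {i j : ℕ} (hi : i < N)
    (hj : j < N) (hi0 : i ≠ 0) (hj0 : j ≠ 0) {x y : TV k V} (hx : x ∈ TV.tpow k V i)
    (hy : y ∈ TV.tpow k V j) :
    τ₁ (R.b2 (R.bar2 x y)) = R.par (x * y) - τ₁ (R.bar1 (x * y)) := by
  have h := congrArg τ₁.1 (R.b2_bar2 (TV.aug_of_mem hi0 hx) (TV.aug_of_mem hj0 hy))
  simp only [map_sub, map_add, BiHom.map_smul, BiHom.map_op_smul, hτ j hj y hy, hτ i hi x hx] at h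
  refine h.trans ((add_sub_rearrange₅ _ _ _).trans ?_)
  rw [par_mul]

private theorem par_injective_of_rel (r s : R.rel) (h : R.par r = R.par s) : r = s := by
  have hN := R.two_le
  apply Subtype.ext
  rw [← sub_eq_zero]
  refine R.eq_zero_of_par_eq_zero 0 (N - 1) (by omega) (by omega) ?_
    ((map_sub R.par.1 _ _).trans (sub_eq_zero.2 h))
  rw [zero_add, Nat.sub_add_cancel (by omega)]
  exact sub_mem (R.le _ r.2) (R.le _ s.2)

private theorem sum_sub_add_eq {ι X : Type*} [AddCommGroup X] {s : Finset ι} {f g h : ι → X}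
    (hg : ∑ i ∈ s, g i = 0) (hh : ∑ i ∈ s, h i = 0) :
    ∑ i ∈ s, (f i - g i + h i) = ∑ i ∈ s, f i := by
  rw [Finset.sum_add_distrib, Finset.sum_sub_distrib, hg, hh, add_zero, sub_zero]

section Values

variable (τ₁ : BiHom R.Alg R.C1 R.K1) (τ₂ : BiHom R.Alg R.C2 R.K2) (s₁ : BiHom R.Alg R.C1 R.C2)

/-- In degree `N` the bimodule `K₂` is just `R`, where `d₂` is injective, so the value is forced by
`d₂ τ̄₂ = τ̄₁ b̄₂`. The middle terms of `b̄₂` add up to the class of a relation, which is zero. -/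
private theorem tau2_relDecomp (hτ : ∀ n < N, ∀ α ∈ TV.tpow k V n, τ₁ (R.bar1 α) = R.par α)
    (hτ₂ : ∀ d, ∀ x ∈ R.C2Comp d, τ₂ x ∈ R.K2Comp d) (hd : ∀ x, R.d2 (τ₂ x) = τ₁ (R.b2 x))
    (d : R.RelDecomp) : τ₂ (∑ i, R.bar2 (d.α i) (d.β i)) =
      gen k R.Alg R.rel ⟨∑ i, d.α i * d.β i, d.mem⟩ := by
  have hm : ∑ i, R.bar2 (d.α i) (d.β i) ∈ R.C2Comp N := sum_mem fun i _ =>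
    R.gen_mem_freeComp (BT.tmul_mem_grading (d.add_eq i) (R.cls_mem (d.α_mem i))
      (R.cls_mem (d.β_mem i)))
  obtain ⟨r, hr⟩ := R.exists_gen_of_mem_K2Comp (hτ₂ N _ hm)
  rw [← hr]
  refine congrArg (gen k R.Alg R.rel).1 (R.par_injective_of_rel _ _ ?_)
  have h1 : R.par r = τ₁ (R.b2 (∑ i, R.bar2 (d.α i) (d.β i))) :=
    (R.d2_gen r).symm.trans ((congrArg R.d2.1 hr).trans (hd _))
  have h2 : τ₁ (R.b2 (∑ i, R.bar2 (d.α i) (d.β i))) =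
      ∑ i, (R.par (d.α i * d.β i) - τ₁ (R.bar1 (d.α i * d.β i))) :=
    (map_sum (τ₁.1.comp R.b2.1) _ _).trans (Finset.sum_congr rfl fun i _ =>
      R.tau1_b2_bar2 τ₁ hτ (d.p_lt i) (d.q_lt i) (d.p_ne i) (d.q_ne i) (d.α_mem i) (d.β_mem i))
  have h3 : ∑ i, τ₁ (R.bar1 (d.α i * d.β i)) = 0 := by
    refine (map_sum τ₁.1 _ _).symm.trans ?_
    rw [← bar1_sum, R.bar1_eq_zero d.mem]
    exact map_zero τ₁.1
  rw [h1, h2, Finset.sum_sub_distrib, h3, sub_zero]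
  exact (map_sum R.par.1 _ _).symm

/-- Both corrections in `hL_defect_bar2` disappear: `τ̄₂` is zero on the element, and `s₁ (1|xy|1)`
lies in the image of `ins`, which `hL` kills. -/
private theorem s2Of_bar2 (hs : ∀ n < N, ∀ α ∈ TV.tpow k V n, s₁ (R.bar1 α) = - R.ins (R.par α))
    {p q : ℕ} (hpq : p + q < N) {x y : TV k V} (hx : x ∈ TV.tpow k V p) (hy : y ∈ TV.tpow k V q)
    (hτ₂ : τ₂ (R.bar2 x y) = 0) :
    R.s2Of τ₂ s₁ (R.bar2 x y) = R.ins2 (BT.tmul k (R.cls x) (R.par y)) := by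
  -- The formula `hL_defect_bar2` needs factors of positive degree; a scalar has class zero in `A /
  -- k` and is treated apart.
  rcases eq_or_ne p 0 with rfl | hp
  · have h : BT.tmul k (R.cls x) (R.par y) = 0 := by rw [R.cls_of_mem_zero hx, BT.zero_tmul]
    exact ((congrArg (R.s2Of τ₂ s₁).1 (R.bar2_of_mem_zero_left hx y)).trans (map_zero _)).trans
      ((congrArg R.ins2.1 h).trans (map_zero _)).symm
  rcases eq_or_ne q 0 with rfl | hq
  · have h : BT.tmul k (R.cls x) (R.par y) = 0 := by rw [R.par_of_mem_zero hy, BT.tmul_zero]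
    exact ((congrArg (R.s2Of τ₂ s₁).1 (R.bar2_of_mem_zero_right hy x)).trans (map_zero _)).trans
      ((congrArg R.ins2.1 h).trans (map_zero _)).symm
  have h1 : R.hL R.plus2 (R.sigma2 (τ₂ (R.bar2 x y))) = 0 :=
    (congrArg (fun z => R.hL R.plus2 (R.sigma2 z)) hτ₂).trans
      (map_zero ((R.hL R.plus2).1.comp R.sigma2.1))
  have h2 : R.hL R.plus2 (s₁ (R.bar1 (x * y))) = 0 :=
    (congrArg (R.hL R.plus2).1 (hs _ hpq _ (TV.mul_mem hx hy))).trans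
      ((map_neg (R.hL R.plus2).1 _).trans (neg_eq_zero.2 (R.hL_ins _)))
  refine (R.s2Of_gen τ₂ s₁ _).trans
    ((R.hL_defect_bar2 τ₂ s₁ (by omega) (by omega) hp hq hs hx hy).trans ?_)
  exact (congrArg₂ (fun u v => _ - u + v) h1 h2).trans ((add_zero _).trans (sub_zero _))

/-- Here the corrections vanish only after summation: `σ̄₂ (1|r|1)` lies in the image of `ins`, and
the middle terms add up to the class of the relation `r`. -/
private theorem s2Of_relDecomp (hs : ∀ n < N, ∀ α ∈ TV.tpow k V n, s₁ (R.bar1 α) = - R.ins (R.par α))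
    (d : R.RelDecomp) (hτ₂ : τ₂ (∑ i, R.bar2 (d.α i) (d.β i)) =
      gen k R.Alg R.rel ⟨∑ i, d.α i * d.β i, d.mem⟩) :
    R.s2Of τ₂ s₁ (∑ i, R.bar2 (d.α i) (d.β i)) =
      R.ins2 (∑ i, BT.tmul k (R.cls (d.α i)) (R.par (d.β i))) := by
  have h1 : ∑ i, R.hL R.plus2 (R.sigma2 (τ₂ (R.bar2 (d.α i) (d.β i)))) = 0 := by
    refine (map_sum ((R.hL R.plus2).1.comp (R.sigma2.1.comp τ₂.1)) _ _).symm.trans ?_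
    exact (congrArg (fun z => R.hL R.plus2 (R.sigma2 z)) hτ₂).trans
      ((congrArg (R.hL R.plus2).1 (R.sigma2_gen _)).trans (R.hL_ins _))
  have h2 : ∑ i, R.hL R.plus2 (s₁ (R.bar1 (d.α i * d.β i))) = 0 := by
    have h : ∑ i, R.bar1 (d.α i * d.β i) = 0 := by rw [← bar1_sum, R.bar1_eq_zero d.mem]
    have h' := (map_sum ((R.hL R.plus2).1.comp s₁.1) (fun i => R.bar1 (d.α i * d.β i))
      Finset.univ).symm.trans (congrArg (fun z => ((R.hL R.plus2).1.comp s₁.1) z) h)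
    exact h'.trans (map_zero ((R.hL R.plus2).1.comp s₁.1))
  refine (map_sum (R.s2Of τ₂ s₁).1 _ _).trans ((Finset.sum_congr rfl fun i _ =>
    (R.s2Of_gen τ₂ s₁ _).trans (R.hL_defect_bar2 τ₂ s₁ (d.p_lt i) (d.q_lt i) (d.p_ne i) (d.q_ne i)
      hs (d.α_mem i) (d.β_mem i))).trans ?_)
  exact (sum_sub_add_eq h1 h2).trans (map_sum R.ins2.1 _ _).symm

end Values

/-- Comparison data exist. -/
private theorem nonempty_comparison {F : Type*} [Field F] [Algebra F k]
    [IsSemisimpleRing (k ⊗[F] kᵐᵒᵖ)] (hV : IsCentral F k V) : Nonempty R.Comparison := by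
  obtain ⟨ρ, hρ, hρ'⟩ := R.exists_section hV
  obtain ⟨L, hL, hL'⟩ := R.exists_tau2 (R.tau1Of ρ) ρ hρ hρ' (R.tau1Of_gen ρ) hV
  have hd : ∀ x, R.d2 (extend L x) = R.tau1Of ρ (R.b2 x) := FB.hom_eq
    (f := R.d2.comp (extend L)) (g := (R.tau1Of ρ).comp R.b2)
    fun w => (congrArg R.d2.1 (extend_gen L w)).trans (hL' w)
  have hm : ∀ d, ∀ x ∈ R.C2Comp d, extend L x ∈ R.K2Comp d := R.extend_mem_freeComp L hL
  have hτ : ∀ n < N, ∀ α ∈ TV.tpow k V n, R.tau1Of ρ (R.bar1 α) = R.par α := fun n hn α hα =>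
    (R.tau1Of_gen ρ _).trans (R.par_section_cls ρ hρ hρ' hn hα)
  have hs : ∀ n < N, ∀ α ∈ TV.tpow k V n, R.s1Of ρ (R.bar1 α) = - R.ins (R.par α) :=
    fun n hn α hα => (R.s1Of_gen ρ _).trans
      (congrArg (fun z => - R.ins z) (R.par_section_cls ρ hρ hρ' hn hα))
  -- Homogeneity alone gives these values, as `K₂` vanishes below degree `N`.
  have h0 : ∀ p q, p + q < N → ∀ α ∈ TV.tpow k V p, ∀ β ∈ TV.tpow k V q,
      extend L (R.bar2 α β) = 0 := fun p q hpq α hα β hβ => R.eq_zero_of_mem_K2Comp hpq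
    (hm _ _ (R.gen_mem_freeComp (BT.tmul_mem_grading rfl (R.cls_mem hα) (R.cls_mem hβ))))
  have hr := R.tau2_relDecomp (R.tau1Of ρ) (extend L) hτ hm hd
  exact ⟨{
    tau1 := R.tau1Of ρ
    tau2 := extend L
    s1 := R.s1Of ρ
    s2 := R.s2Of (extend L) (R.s1Of ρ)
    graded := ⟨R.tau1Of_mem ρ hρ, hm, R.s1Of_mem ρ hρ,
      R.s2Of_mem (extend L) (R.s1Of ρ) hm (R.s1Of_mem ρ hρ)⟩
    morphism := ⟨R.d1_tau1Of ρ hρ', hd⟩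
    homotopy := ⟨R.b2_s1Of ρ hρ', fun x =>
      (congrArg (· + _) (R.b3_s2Of (extend L) (R.s1Of ρ) (R.tau1Of ρ) hd (R.b2_s1Of ρ hρ') x)).trans
        (sub_add_cancel _ _)⟩
    tau_values := ⟨hτ, h0, hr⟩
    s_values := ⟨hs, fun p q hpq α hα β hβ =>
      R.s2Of_bar2 (extend L) (R.s1Of ρ) hs hpq hα hβ (h0 p q hpq α hα β hβ),
      fun d => R.s2Of_relDecomp (extend L) (R.s1Of ρ) hs d (hr d)⟩ }⟩

end HomRel

end PBW

/-! ### Augmentations of free bimodules and their homogeneous components. -/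

namespace PBW

universe u v w

set_option linter.unusedSectionVars false

variable {k : Type u} [Ring k] {V : Type v} [AddCommGroup V] [Module k V] [Module kᵐᵒᵖ V]
  [SMulCommClass k kᵐᵒᵖ V] {N : ℕ} (R : HomRel k V N)

namespace HomRel

section Augmentation

variable {W W' : Type*} [AddCommGroup W] [Module k W] [Module kᵐᵒᵖ W] [SMulCommClass k kᵐᵒᵖ W]
  [AddCommGroup W'] [Module k W'] [Module kᵐᵒᵖ W'] [SMulCommClass k kᵐᵒᵖ W']

/-- The augmentation as an endomorphism of the bimodule `A`. -/
def augA : BiHom k R.Alg R.Alg :=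
  ⟨(KAlg.unit (k := k) (B := R.Alg)).toAddMonoidHom.comp R.aug.toAddMonoidHom, by
    constructor <;> intro c a
    · change KAlg.unit (R.aug (KAlg.unit c * a)) = KAlg.unit c * KAlg.unit (R.aug a)
      rw [map_mul, aug_unit, map_mul]
    · change KAlg.unit (R.aug (a * KAlg.unit c)) = KAlg.unit (R.aug a) * KAlg.unit c
      rw [map_mul, aug_unit, map_mul]⟩

/-- `x|w|y ↦ ε(x)|w|y`. -/
def augL (W : Type*) [AddCommGroup W] [Module k W] [Module kᵐᵒᵖ W] [SMulCommClass k kᵐᵒᵖ W] :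
    BiHom k (FB k R.Alg W) (FB k R.Alg W) := BT.map R.augA (BiHom.id k _)

private theorem augL_tmul (x y : R.Alg) (w : W) : R.augL W (BT.tmul k x (BT.tmul k w y)) =
    R.aug x • op y • gen k R.Alg W w := by
  rw [← Compat.unit_smul (k := k) (A := R.Alg), smul_gen]; rfl

private theorem augL_smul (a : R.Alg) (z : FB k R.Alg W) : R.augL W (a • z) = R.aug a • R.augL W z := by
  refine FB.eq_of_tmul ((R.augL W).1.comp (smulHom a)) ((smulHom (R.aug a)).comp (R.augL W).1)
    (fun x w y => ?_) z
  simp only [AddMonoidHom.comp_apply, smulHom_apply, smul_tmul_tmul, augL_tmul, map_mul, mul_smul]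

/-- The class of a bimodule homomorphism modulo `I₊` on the left is determined by its value modulo
`I₊`. -/
private theorem augL_hom (f : BiHom R.Alg (FB k R.Alg W) (FB k R.Alg W')) (z : FB k R.Alg W) :
    R.augL W' (f (R.augL W z)) = R.augL W' (f z) := by
  refine FB.eq_of_tmul ((R.augL W').1.comp (f.1.comp (R.augL W).1)) ((R.augL W').1.comp f.1)
    (fun x w y => ?_) z
  simp only [AddMonoidHom.comp_apply, augL_tmul, BiHom.map_base_smul, BiHom.map_smul]
  rw [← smul_gen, BiHom.map_smul, augL_smul]

/-- `w ⊗ y ↦ w ε(y)`. -/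
def augRight (W : Type*) [AddCommGroup W] [Module k W] [Module kᵐᵒᵖ W] [SMulCommClass k kᵐᵒᵖ W] :
    BiHom k (BT k W R.Alg) W :=
  BT.liftBi (fun w b => op (R.aug b) • w) (by intros; rw [smul_add])
    (by intros; rw [map_add, op_add, add_smul])
    (by intros; rw [← mul_smul, KAlg.smul_def, map_mul, aug_unit, op_mul])
    (by intros; exact (smul_comm _ _ _).symm)
    (by intros; rw [← mul_smul, KAlg.op_smul_def, map_mul, aug_unit, op_mul])

/-- `x|w|y ↦ ε(x) w ε(y)`. -/
def augLR (W : Type*) [AddCommGroup W] [Module k W] [Module kᵐᵒᵖ W] [SMulCommClass k kᵐᵒᵖ W] :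
    FB k R.Alg W →+ W :=
  BT.lift (fun a y => R.aug a • R.augRight W y) (by intros; rw [map_add, add_smul])
    (by intros; rw [BiHom.map_add, smul_add])
    (by intros; rw [BiHom.map_smul, KAlg.op_smul_def, map_mul, aug_unit, mul_smul])

private theorem augLR_tmul (x y : R.Alg) (w : W) : R.augLR W (BT.tmul k x (BT.tmul k w y)) =
    R.aug x • op (R.aug y) • w := rfl

private theorem augLR_gen (w : W) : R.augLR W (gen k R.Alg W w) = w := by
  rw [gen_apply, augLR_tmul, map_one, op_one, one_smul, one_smul]

private theorem augLR_smul (a : R.Alg) (z : FB k R.Alg W) :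
    R.augLR W (a • z) = R.aug a • R.augLR W z := by
  refine FB.eq_of_tmul ((R.augLR W).comp (smulHom a)) ((smulHom (R.aug a)).comp (R.augLR W))
    (fun x w y => ?_) z
  simp only [AddMonoidHom.comp_apply, smulHom_apply, smul_tmul_tmul, augLR_tmul, map_mul, mul_smul]

private theorem augLR_op_smul (b : R.Alg) (z : FB k R.Alg W) :
    R.augLR W (op b • z) = op (R.aug b) • R.augLR W z := by
  refine FB.eq_of_tmul ((R.augLR W).comp (smulHom (op b)))
    ((smulHom (op (R.aug b))).comp (R.augLR W)) (fun x w y => ?_) z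
  simp only [AddMonoidHom.comp_apply, smulHom_apply, op_smul_tmul_tmul, augLR_tmul, map_mul, op_mul,
    mul_smul]
  exact smul_comm (R.aug x) (op (R.aug b)) _

private theorem augLR_augL (z : FB k R.Alg W) : R.augLR W (R.augL W z) = R.augLR W z := by
  refine FB.eq_of_tmul ((R.augLR W).comp (R.augL W).1) (R.augLR W) (fun x w y => ?_) z
  simp only [AddMonoidHom.comp_apply, augL_tmul]
  rw [← Compat.unit_smul (k := k) (A := R.Alg), augLR_smul, augLR_op_smul, augLR_gen, aug_unit,
    augLR_tmul]

/-- The component of `A ⊗ W ⊗ A` with total degree `m` in the two factors `A`. -/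
def prF (W : Type*) [AddCommGroup W] [Module k W] [Module kᵐᵒᵖ W] [SMulCommClass k kᵐᵒᵖ W] (m : ℕ) :
    BiHom k (FB k R.Alg W) (FB k R.Alg W) :=
  ∑ ij ∈ Finset.HasAntidiagonal.antidiagonal m, BT.map (R.prA ij.1)
    (BT.map (BiHom.id k W) (R.prA ij.2))

private theorem prF_tmul (m : ℕ) (x y : R.Alg) (w : W) : R.prF W m (BT.tmul k x (BT.tmul k w y)) =
    ∑ ij ∈ Finset.HasAntidiagonal.antidiagonal m,
      BT.tmul k (R.prA ij.1 x) (BT.tmul k w (R.prA ij.2 y)) := BiHom.sum_apply _ _ _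

private theorem prF_tmul_of_mem (m : ℕ) {i j : ℕ} {x y : R.Alg} (hx : x ∈ R.comp i) (hy : y ∈ R.comp j)
    (w : W) : R.prF W m (BT.tmul k x (BT.tmul k w y)) =
      if i + j = m then BT.tmul k x (BT.tmul k w y) else 0 := by
  rw [prF_tmul]
  split_ifs with h
  · rw [Finset.sum_eq_single (i, j)]
    · rw [R.prA_of_mem hx, R.prA_of_mem hy, if_pos rfl, if_pos rfl]
    · rintro ⟨i', j'⟩ hij' hne
      rw [Finset.HasAntidiagonal.mem_antidiagonal] at hij'
      have h1 : i ≠ i' := by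
        rintro rfl
        exact hne (Prod.ext rfl (by change i + j' = m at hij'; change j' = j; omega))
      rw [R.prA_of_mem hx, if_neg h1, BT.zero_tmul]
    · intro h'
      exact absurd (Finset.HasAntidiagonal.mem_antidiagonal (a := (i, j)).2 h) h'
  · refine Finset.sum_eq_zero fun ij hij => ?_
    rw [Finset.HasAntidiagonal.mem_antidiagonal] at hij
    rw [R.prA_of_mem hx, R.prA_of_mem hy]
    by_cases h1 : i = ij.1
    · rw [if_neg (show j ≠ ij.2 by omega), BT.tmul_zero, BT.tmul_zero]
    · rw [if_neg h1, BT.zero_tmul]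

private theorem prF_mem (e m : ℕ) (z : FB k R.Alg W) :
    R.prF W m z ∈ R.freeComp (concentrated W e) (m + e) := by
  refine FB.mem_of_tmul (S := (R.freeComp (concentrated W e) (m + e)).comap (R.prF W m).1)
    (fun x w y => ?_) z
  change R.prF W m (BT.tmul k x (BT.tmul k w y)) ∈ R.freeComp (concentrated W e) (m + e)
  rw [prF_tmul]
  refine sum_mem fun ij hij => ?_
  rw [Finset.HasAntidiagonal.mem_antidiagonal] at hij
  exact R.tmul_mem_freeComp (by omega) (R.prA_mem _ x) (concentrated_self W e w) (R.prA_mem _ y)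

private theorem prF_of_mem {e n : ℕ} (m : ℕ) {z : FB k R.Alg W}
    (hz : z ∈ R.freeComp (concentrated W e) n) :
    R.prF W m z = if n = m + e then z else 0 := by
  have h : R.freeComp (concentrated W e) n ≤
      (R.prF W m).1.eqLocus (if n = m + e then AddMonoidHom.id _ else 0) :=
    R.freeComp_le fun i j l hd x hx w hw y hy => by
      change R.prF W m _ = _
      rcases eq_or_ne j e with rfl | hj
      · rw [R.prF_tmul_of_mem m hx hy]
        by_cases h : i + l = m
        · rw [if_pos h, if_pos (by omega)]; rfl
        · rw [if_neg h, if_neg (by omega)]; rfl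
      · rw [eq_zero_of_concentrated hj hw, BT.zero_tmul, BT.tmul_zero, map_zero]
        exact (map_zero _).symm
  have h1 := h hz
  change R.prF W m z = _ at h1
  rw [h1]
  split_ifs <;> rfl

private theorem concentrated_eq_top (e : ℕ) (S : AddSubgroup W) (h : ∀ n, concentrated W e n ≤ S) :
    S = ⊤ := eq_top_iff.2 fun w _ => h e (concentrated_self W e w)

/-- Homogeneous homomorphisms commute with the projections to the homogeneous components. -/
private theorem hom_prF {e e' s : ℕ} (f : FB k R.Alg W →+ FB k R.Alg W')
    (hf : ∀ n, ∀ z ∈ R.freeComp (concentrated W e) n,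
      f z ∈ R.freeComp (concentrated W' e') (n + s)) {m m' : ℕ} (h : m' + e' = m + e + s)
    (z : FB k R.Alg W) : f (R.prF W m z) = R.prF W' m' (f z) := by
  refine R.mem_of_freeComp (G := concentrated W e) (concentrated_eq_top e)
    (S := (f.comp (R.prF W m).1).eqLocus ((R.prF W' m').1.comp f)) (fun n z hz => ?_) z
  change f (R.prF W m z) = R.prF W' m' (f z)
  rw [R.prF_of_mem m hz, R.prF_of_mem m' (hf n z hz)]
  by_cases hn : n = m + e
  · rw [if_pos hn, if_pos (by omega)]
  · rw [if_neg hn, if_neg (by omega)]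
    exact map_zero f

/-- Values of `f` have degree at least `e + s`, the least degree in the source being `e`. This
complements `hom_prF` in the range where no source component has the required degree. -/
private theorem prF_eq_zero {e e' s : ℕ} (f : FB k R.Alg W →+ FB k R.Alg W')
    (hf : ∀ n, ∀ z ∈ R.freeComp (concentrated W e) n,
      f z ∈ R.freeComp (concentrated W' e') (n + s)) {m' : ℕ} (h : m' + e' < e + s)
    (z : FB k R.Alg W) : R.prF W' m' (f z) = 0 := by
  refine R.mem_of_freeComp (G := concentrated W e) (concentrated_eq_top e)
    (S := ((R.prF W' m').1.comp f).ker) (fun n z hz => ?_) z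
  change R.prF W' m' (f z) = 0
  rw [R.prF_of_mem m' (hf n z hz)]
  split_ifs with hn
  · have h0 : R.freeComp (concentrated W e) n ≤ f.ker := R.freeComp_le fun i j l hd x hx w hw y hy => by
      rw [eq_zero_of_concentrated (by omega) hw, BT.zero_tmul, BT.tmul_zero]
      exact zero_mem _
    exact h0 hz
  · rfl

end Augmentation

end HomRel

end PBW

/-! ### From Koszul chains to the reduced bar complex that computes `Tor₃`. -/

namespace PBW

universe u v w

set_option linter.unusedSectionVars false

variable {k : Type u} [Ring k] {V : Type v} [AddCommGroup V] [Module k V] [Module kᵐᵒᵖ V]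
  [SMulCommClass k kᵐᵒᵖ V] {N : ℕ} (R : HomRel k V N)

namespace HomRel

private theorem b2_b3 (x : R.C3) : R.b2 (R.b3 x) = 0 := by
  refine R.C3_eq_of_tmul (R.b2.1.comp R.b3.1) 0 (fun x y a b c => ?_) x
  simp only [AddMonoidHom.comp_apply, BiHom.map_smul, BiHom.map_op_smul, AddMonoidHom.zero_apply]
  have h : R.b2 (R.b3 (gen k R.Alg _ (BT.tmul k a (BT.tmul k b c)))) = 0 := by
    have e1 : ((R.mulPlus (BT.tmul k a b) : R.plus) : R.Alg) = a * b := rfl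
    have e2 : ((R.mulPlus (BT.tmul k b c) : R.plus) : R.Alg) = b * c := rfl
    have e3 : R.mulPlus (BT.tmul k (R.mulPlus (BT.tmul k a b)) c) =
      R.mulPlus (BT.tmul k a (R.mulPlus (BT.tmul k b c))) := Subtype.ext (mul_assoc _ _ _)
    simp only [b3_gen, map_add, map_sub, BiHom.map_smul, BiHom.map_op_smul, b2_gen, e1, e2, e3,
      smul_add, smul_sub, mul_smul, op_mul, smul_comm (a : R.Alg) (op (c : R.Alg))]
    abel
  exact (congrArg (fun z => x • op y • z) h).trans ((congrArg (x • ·) (smul_zero _)).trans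
    (smul_zero _))

private theorem torD4_rearrange {X : Type*} [AddCommGroup X] (p q r s t u v w x y : X) :
    -(p - q + r - s) + (t - q + u - v) - (w - r + u - x) =
      -(p - t + w - y) - (y - s + v - x) := by abel

/-- This is the vanishing of the composite of two consecutive bar differentials, with the two outer
terms that `torD4` omits moved to the other side. -/
private theorem b3_torD4 (a b c d : R.plus) :
    R.b3 (gen k R.Alg _ (R.torD4 (BT.tmul k a (BT.tmul k b (BT.tmul k c d))))) =
      - ((a : R.Alg) • R.b3 (gen k R.Alg _ (BT.tmul k b (BT.tmul k c d)))) -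
        op (d : R.Alg) • R.b3 (gen k R.Alg _ (BT.tmul k a (BT.tmul k b c))) := by
  have e0 : R.b3 (gen k R.Alg _ (R.torD4 (BT.tmul k a (BT.tmul k b (BT.tmul k c d))))) =
    - R.b3 (gen k R.Alg _ (BT.tmul k (R.mulPlus (BT.tmul k a b)) (BT.tmul k c d))) +
      R.b3 (gen k R.Alg _ (BT.tmul k a (BT.tmul k (R.mulPlus (BT.tmul k b c)) d))) -
      R.b3 (gen k R.Alg _ (BT.tmul k a (BT.tmul k b (R.mulPlus (BT.tmul k c d))))) := by
    have e : R.torD4 (BT.tmul k a (BT.tmul k b (BT.tmul k c d))) =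
      - BT.tmul k (R.mulPlus (BT.tmul k a b)) (BT.tmul k c d) +
        BT.tmul k a (BT.tmul k (R.mulPlus (BT.tmul k b c)) d) -
        BT.tmul k a (BT.tmul k b (R.mulPlus (BT.tmul k c d))) := rfl
    simp only [e, map_add, map_sub, map_neg]
  have e1 : ((R.mulPlus (BT.tmul k a b) : R.plus) : R.Alg) = a * b := rfl
  have e2 : ((R.mulPlus (BT.tmul k c d) : R.plus) : R.Alg) = c * d := rfl
  have e3 : R.mulPlus (BT.tmul k (R.mulPlus (BT.tmul k a b)) c) =
    R.mulPlus (BT.tmul k a (R.mulPlus (BT.tmul k b c))) := Subtype.ext (mul_assoc _ _ _)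
  have e4 : R.mulPlus (BT.tmul k (R.mulPlus (BT.tmul k b c)) d) =
    R.mulPlus (BT.tmul k b (R.mulPlus (BT.tmul k c d))) := Subtype.ext (mul_assoc _ _ _)
  have h1 := R.b3_gen (R.mulPlus (BT.tmul k a b)) c d
  have h2 := R.b3_gen a (R.mulPlus (BT.tmul k b c)) d
  have h3 := R.b3_gen a b (R.mulPlus (BT.tmul k c d))
  have h4 := congrArg ((a : R.Alg) • ·) (R.b3_gen b c d)
  have h5 := congrArg (op (d : R.Alg) • ·) (R.b3_gen a b c)
  simp only [e1, e2, e3, e4, mul_smul, op_mul, smul_add, smul_sub,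
    smul_comm (a : R.Alg) (op (d : R.Alg))] at h1 h2 h3 h4 h5
  refine e0.trans ((congrArg₂ (· - ·) (congrArg₂ (- · + ·) h1 h2) h3).trans
    ((torD4_rearrange _ _ _ _ _ _ _ _ _ _).trans (congrArg₂ (- · - ·) h4.symm h5.symm)))

/-- Augmenting both sides kills the outer terms of `b̄₃`, which have a coefficient in `I₊`. -/
private theorem augLR_b3_gen (y : R.plus3) : R.augLR _ (R.b3 (gen k R.Alg _ y)) = R.torD3 y := by
  induction y using BT.induction with
  | zero => simp only [map_zero]
  | add y z hy hz => simp only [map_add, hy, hz]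
  | tmul a y =>
    induction y using BT.induction with
    | zero => simp only [BT.tmul_zero, map_zero]
    | add y z hy hz => simp only [BT.tmul_add, map_add, hy, hz]
    | tmul b c =>
      have e0 : R.torD3 (BT.tmul k a (BT.tmul k b c)) =
        - BT.tmul k (R.mulPlus (BT.tmul k a b)) c + BT.tmul k a (R.mulPlus (BT.tmul k b c)) := rfl
      simp only [b3_gen, map_add, map_sub, augLR_smul, augLR_op_smul, R.mem_plus.1 a.2,
        R.mem_plus.1 c.2, op_zero, zero_smul, augLR_gen, sub_zero, zero_sub, e0]

/-- `x|v|y ↦ x̄ ⊗ v ⊗ ȳ`. -/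
def toPlus3 : BiHom k R.K1 R.plus3 := BT.map R.bar (BT.map R.vIncl R.bar)

private theorem toPlus3_tmul (x y : R.Alg) (v : V) : R.toPlus3 (BT.tmul k x (BT.tmul k v y)) =
    BT.tmul k (R.bar x) (BT.tmul k (R.vIncl v) (R.bar y)) := rfl

private theorem toPlus3_mem {n : ℕ} {z : R.K1} (hz : z ∈ R.K1Comp n) : R.toPlus3 z ∈ R.plus3Comp n := by
  have : R.K1Comp n ≤ (R.plus3Comp n).comap R.toPlus3.1 :=
    R.freeComp_le fun i j l hd a ha v hv b hb => BT.tmul_mem_grading (j := j + l) (by omega)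
      (R.bar_mem ha) (BT.tmul_mem_grading rfl (R.vIncl_mem' hv) (R.bar_mem hb))
  exact this hz

private theorem smul_op_smul_gen {W : Type*} [AddCommGroup W] [Module k W] [Module kᵐᵒᵖ W]
    [SMulCommClass k kᵐᵒᵖ W] (a b : R.Alg) (w : W) :
    op b • a • gen k R.Alg W w = BT.tmul k a (BT.tmul k w b) :=
  (smul_comm a (op b) _).symm.trans (smul_gen a b w)

private theorem toPlus3_rearrange {X : Type*} [AddCommGroup X] (p r s t u v w : X) :
    p - r - s + t - u + (v - t - w) = p + v - (s + r) - (u + w) := by abel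

private theorem gen_cls_mul_ι (x : TV k V) (v : V) (a : R.plus) :
    gen k R.Alg R.plus2 (BT.tmulHomLeft k a (R.cls (x * TV.ι v))) =
      gen k R.Alg R.plus2 (BT.tmul k (R.mulPlus (BT.tmul k (R.cls x) (R.vIncl v))) a) +
        R.aug (R.toAlg x) • gen k R.Alg R.plus2 (BT.tmul k (R.vIncl v) a) := by
  have h : BT.tmulHomLeft k a (R.cls (x * TV.ι v)) =
      BT.tmul k (R.mulPlus (BT.tmul k (R.cls x) (R.vIncl v))) a +
        R.aug (R.toAlg x) • BT.tmul k (R.vIncl v) a := by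
    change BT.tmul k _ a = _
    rw [cls_mul_ι, BT.add_tmul]; rfl
  exact (congrArg (gen k R.Alg R.plus2).1 h).trans ((map_add _ _ _).trans
    (congrArg (_ + ·) ((gen k R.Alg R.plus2).map_smul _ _)))

private theorem sigma1_tmul (x y : R.Alg) (v : V) : R.sigma1 (BT.tmul k x (BT.tmul k v y)) =
    BT.tmul k x (BT.tmul k (R.vIncl v) y) :=
  (extend_tmul _ x y v).trans (smul_gen (k := k) x y (R.vIncl v))

private theorem hR_sigma1_tmul (x : R.Alg) (v : V) (a : R.plus) :
    R.hR (R.sigma1 (BT.tmul k x (BT.tmul k v (a : R.Alg)))) =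
      x • gen k R.Alg R.plus2 (BT.tmul k (R.vIncl v) a) :=
  (congrArg R.hR.1 (R.sigma1_tmul x a v)).trans ((R.hR_tmul _ _ _).trans
    (congrArg (fun b => x • gen k R.Alg R.plus2 (BT.tmul k (R.vIncl v) b)) (R.bar_coe a)))

/-- Up to the boundary of an explicit 3-chain and a term that vanishes for relations, this compares
`ins ∘ par`, which defines `σ̄₂`, with its counterpart made from the right contraction `hR`.
Appending a letter `v` to `x` replaces `a` by `v a`, so the induction must be carried out for all
`a` at once. -/
private theorem b3_toPlus3_par (x : TV k V) (a : R.plus) :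
    R.b3 (gen k R.Alg _ (R.toPlus3 (op (a : R.Alg) • R.par x))) =
      R.hR (R.sigma1 (op (a : R.Alg) • R.par x)) - gen k R.Alg _ (BT.tmul k (R.cls x) a) -
        op (a : R.Alg) • R.ins (R.par x) := by
  let f : R.plus → TV k V →+ R.C2 := fun a =>
    (((R.b3.1.comp (gen k R.Alg _).1).comp R.toPlus3.1).comp (smulHom (op (a : R.Alg)))).comp R.par.1
  let g : R.plus → TV k V →+ R.C2 := fun a =>
    ((R.hR.1.comp R.sigma1.1).comp (smulHom (op (a : R.Alg)))).comp R.par.1 -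
      (gen k R.Alg _).1.comp ((BT.tmulHomLeft k a).comp R.clsHom.1) -
      ((smulHom (op (a : R.Alg))).comp R.ins.1).comp R.par.1
  -- The intersection over all `a` expresses that `a` varies during the induction on `x`.
  have h : x ∈ ⨅ a, (f a).eqLocus (g a) := by
    refine TV.right_induction (fun c => ?_) (fun x hx v => ?_) x
    · rw [AddSubgroup.mem_iInf]
      intro a
      change f a _ = g a _
      simp only [f, g, AddMonoidHom.comp_apply, AddMonoidHom.sub_apply, par_unit, map_zero,
        clsHom_apply, cls_unit, sub_zero]
    · rw [AddSubgroup.mem_iInf] at hx ⊢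
      intro a
      have hx' := hx (R.mulPlus (BT.tmul k (R.vIncl v) a))
      change f _ _ = g _ _ at hx'
      change f a _ = g a _
      have e : ((R.mulPlus (BT.tmul k (R.vIncl v) a) : R.plus) : R.Alg) = R.toAlg (TV.ι v) * a := by
        rw [mulPlus_tmul, coe_vIncl]
      have ec := R.gen_cls_mul_ι x v a
      have eh := R.hR_sigma1_tmul (R.toAlg x) v a
      simp only [f, g, AddMonoidHom.comp_apply, AddMonoidHom.sub_apply, smulHom_apply, e, op_mul,
        mul_smul, clsHom_apply] at hx' ⊢
      simp only [ec, par_mul_ι, smul_add, map_add, hx', ins_smul_gen, ins_op_smul, smul_op_smul_gen,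
        toPlus3_tmul, b3_gen, bar_coe, coe_bar_smul, eh]
      exact toPlus3_rearrange _ _ _ _ _ _ _
  exact AddSubgroup.mem_iInf.1 h a

end HomRel

end PBW

/-! ### Splittings furnished by a comparison datum. -/

namespace PBW

universe u v w

set_option linter.unusedSectionVars false

variable {k : Type u} [Ring k] {V : Type v} [AddCommGroup V] [Module k V] [Module kᵐᵒᵖ V]
  [SMulCommClass k kᵐᵒᵖ V] {N : ℕ} (R : HomRel k V N)

namespace HomRel

private theorem augL_smul_gen {W : Type*} [AddCommGroup W] [Module k W] [Module kᵐᵒᵖ W]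
    [SMulCommClass k kᵐᵒᵖ W] (a : R.Alg) (w : W) :
    R.augL W (a • gen k R.Alg W w) = R.aug a • gen k R.Alg W w := by
  rw [smul_gen_left, augL_tmul, op_one, one_smul]

private theorem augL_hR (z : R.C1) : R.augL _ (R.hR z) = R.hR (R.augL _ z) := by
  refine FB.eq_of_tmul ((R.augL _).1.comp R.hR.1) (R.hR.1.comp (R.augL _).1) (fun x w y => ?_) z
  change R.augL _ (R.hR (BT.tmul k x (BT.tmul k w y))) =
    R.hR (BT.tmul k (KAlg.unit (R.aug x)) (BT.tmul k w y))
  simp only [hR_tmul, augL_smul_gen, Compat.unit_smul]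

private theorem augL_mem {W : Type*} [AddCommGroup W] [Module k W] [Module kᵐᵒᵖ W]
    [SMulCommClass k kᵐᵒᵖ W] {G : ℕ → AddSubgroup W} {n : ℕ} {z : FB k R.Alg W}
    (hz : z ∈ R.freeComp G n) : R.augL W z ∈ R.freeComp G n := by
  have : R.freeComp G n ≤ (R.freeComp G n).comap (R.augL W).1 :=
    R.freeComp_le fun i j l hd x hx w hw y hy => by
      change BT.tmul k (KAlg.unit (R.aug x) : R.Alg) (BT.tmul k w y) ∈ R.freeComp G n
      rcases eq_or_ne i 0 with rfl | hi
      · exact R.tmul_mem_freeComp hd (R.unit_mem_comp _) hw hy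
      · rw [R.aug_of_mem hi hx, map_zero, BT.zero_tmul]
        exact zero_mem _
  exact this hz

/-- Above degree `N`, in every homogeneous `x|r|y` one of `x` and `y` has positive degree, and the
two-sided augmentation kills it. -/
private theorem augLR_sigma2_augL {n : ℕ} (hn : N < n) {κ : R.K2} (hκ : κ ∈ R.K2Comp n) :
    R.augLR _ (R.sigma2 (R.augL _ κ)) = 0 := by
  have : R.K2Comp n ≤ ((R.augLR R.plus2).comp (R.sigma2.1.comp (R.augL R.rel).1)).ker :=
    R.freeComp_le fun i j l hd x hx r hr y hy => by
      change R.augLR _ (R.sigma2 (R.augL _ (BT.tmul k x (BT.tmul k r y)))) = 0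
      rcases eq_or_ne j N with rfl | hj
      · rw [augL_tmul]
        simp only [BiHom.map_base_smul, BiHom.map_op_smul]
        rw [← Compat.unit_smul (k := k) (A := R.Alg), augLR_smul, augLR_op_smul, aug_unit]
        rcases eq_or_ne l 0 with rfl | hl
        · rw [R.aug_of_mem (by omega) hx, zero_smul]
        · rw [R.aug_of_mem hl hy, op_zero, zero_smul, smul_zero]
      · rw [eq_zero_of_concentrated hj hr, BT.zero_tmul, BT.tmul_zero, map_zero, map_zero, map_zero]
  exact this hκ

/-- The failure of `σ̄₂` and `hR σ̄₁ d₂` to differ by a boundary. -/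
def toPlus3Defect : BiHom k R.K2 R.C2 :=
  ((restrict (k := k) R.b3).comp ((gen k R.Alg R.plus3).comp (R.toPlus3.comp (restrict R.d2)))) -
    (R.hR.comp ((restrict (k := k) R.sigma1).comp (restrict R.d2)) - restrict R.sigma2)

/-- The extra term `1|r̄|y|1` of `b3_toPlus3_par` vanishes because `r` is zero in `A`. -/
private theorem toPlus3Defect_op_smul_gen (y : R.plus) (r : R.rel) :
    R.toPlus3Defect (op (y : R.Alg) • gen k R.Alg _ r) = 0 := by
  have h1 : gen k R.Alg R.plus2 (BT.tmul k (R.cls r) y) = 0 := by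
    rw [R.cls_rel r.2, BT.zero_tmul, map_zero]
  have h2 : R.d2 (op (y : R.Alg) • gen k R.Alg _ r) = op (y : R.Alg) • R.par r :=
    (R.d2.map_op_smul _ _).trans (congrArg _ (R.d2_gen r))
  have h3 : R.sigma2 (op (y : R.Alg) • gen k R.Alg _ r) = op (y : R.Alg) • R.ins (R.par r) :=
    (R.sigma2.map_op_smul _ _).trans (congrArg _ (R.sigma2_gen r))
  have h := (R.b3_toPlus3_par r y).trans
    (congrArg (· - _) ((congrArg (_ - ·) h1).trans (sub_zero _)))
  refine sub_eq_zero.2 ?_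
  exact (congrArg (fun z => R.b3 (gen k R.Alg R.plus3 (R.toPlus3 z))) h2).trans
    (h.trans (congrArg₂ (fun z w => R.hR (R.sigma1 z) - w) h2 h3).symm)

/-- After `augL` the left factor is a scalar, so above degree `N` the right factor has positive
degree, or else the element is zero. Then `toPlus3Defect_op_smul_gen` applies. -/
private theorem b3_toPlus3_d2_augL {n : ℕ} (hn : N < n) {κ : R.K2} (hκ : κ ∈ R.K2Comp n) :
    R.b3 (gen k R.Alg _ (R.toPlus3 (R.d2 (R.augL _ κ)))) =
      R.hR (R.sigma1 (R.d2 (R.augL _ κ))) - R.sigma2 (R.augL _ κ) := by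
  have : R.K2Comp n ≤ (R.toPlus3Defect.comp (R.augL R.rel)).1.ker :=
    R.freeComp_le fun i j l hd x hx r hr y hy => by
      change R.toPlus3Defect (R.augL _ (BT.tmul k x (BT.tmul k r y))) = 0
      rcases eq_or_ne j N with rfl | hj
      · have h0 := R.augL_tmul x y r
        rcases eq_or_ne l 0 with rfl | hl
        · rw [R.aug_of_mem (by omega) hx, zero_smul] at h0
          exact (congrArg R.toPlus3Defect.1 h0).trans (map_zero _)
        · rw [← R.coe_bar_of_mem hl hy] at h0 ⊢
          exact (congrArg R.toPlus3Defect.1 h0).trans ((R.toPlus3Defect.map_smul _ _).trans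
            ((congrArg _ (R.toPlus3Defect_op_smul_gen _ _)).trans (smul_zero _)))
      · rw [eq_zero_of_concentrated hj hr, BT.zero_tmul, BT.tmul_zero, map_zero, map_zero]
  exact sub_eq_zero.1 (this hκ)

namespace Comparison

variable {R} (c : R.Comparison)

private theorem tau1_sigma1 (z : R.K1) : c.tau1 (R.sigma1 z) = z := by
  refine FB.hom_eq (f := c.tau1.comp R.sigma1) (g := BiHom.id R.Alg R.K1) (fun v => ?_) z
  have := c.tau_values.1 1 (by have := R.two_le; omega) (TV.ι v) (TV.ι_mem v)
  rw [par_ι] at this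
  exact (congrArg c.tau1.1 (R.sigma1_gen v)).trans this

private theorem tau2_ins_par {n : ℕ} (hn : n < N) {x : TV k V} (hx : x ∈ TV.tpow k V n) :
    c.tau2 (R.ins (R.par x)) = 0 := by
  induction n generalizing x with
  | zero => rw [R.par_of_mem_zero hx, map_zero, map_zero]
  | succ n ih =>
    have : TV.tpow k V (n + 1) ≤ (c.tau2.1.comp (R.ins.1.comp R.par.1)).ker := by
      rw [TV.tpow_succ_right, AddSubgroup.closure_le]
      rintro _ ⟨x, hx, v, rfl⟩
      change c.tau2 (R.ins (R.par (x * TV.ι v))) = 0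
      simp only [ins_par_mul_ι, map_add, BiHom.map_op_smul, ih (by omega) hx, smul_zero,
        c.tau_values.2.1 n 1 hn x hx _ (TV.ι_mem v), add_zero]
    exact this hx

/-- With `r = ∑ xᵢ vᵢ` and `xᵢ` of degree `N - 1`, `σ̄₂ (1|r|1)` is the relation decomposition `∑
1|x̄ᵢ|v̄ᵢ|1` plus terms that `τ̄₂` kills by its normalization. -/
private theorem tau2_sigma2 (z : R.K2) : c.tau2 (R.sigma2 z) = z := by
  refine FB.hom_eq (f := c.tau2.comp R.sigma2) (g := BiHom.id R.Alg R.K2) (fun r => ?_) z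
  have hN := R.two_le
  have hm : (r : TV k V) ∈ TV.tpow k V (N - 1 + 1) := by
    rw [Nat.sub_add_cancel (show 1 ≤ N by omega)]
    exact R.le r r.2
  obtain ⟨m, x, v, hx, hr⟩ := TV.exists_sum_right hm
  have h1 := c.tau_values.2.2
    { n := m, α := x, β := fun i => TV.ι (v i), p := fun _ => N - 1, q := fun _ => 1
      p_pos := fun _ => by omega
      q_pos := fun _ => le_rfl
      add_eq := fun _ => by omega
      α_mem := hx
      β_mem := fun _ => TV.ι_mem _
      mem := hr ▸ r.2 }
  have h2 : R.ins (R.par r) = ∑ i, R.bar2 (x i) (TV.ι (v i)) +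
      ∑ i, op (R.toAlg (TV.ι (v i))) • R.ins (R.par (x i)) := by
    rw [hr, ← Finset.sum_add_distrib]
    refine (map_sum (R.ins.1.comp R.par.1) _ _).trans (Finset.sum_congr rfl fun i _ => ?_)
    exact R.ins_par_mul_ι _ _
  have h3 : c.tau2 (∑ i, op (R.toAlg (TV.ι (v i))) • R.ins (R.par (x i))) = 0 := by
    refine (map_sum c.tau2.1 _ _).trans (Finset.sum_eq_zero fun i _ => ?_)
    exact (c.tau2.map_op_smul _ _).trans ((congrArg _ (c.tau2_ins_par (by omega) (hx i))).trans
      (smul_zero _))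
  refine (congrArg c.tau2.1 ((R.sigma2_gen r).trans h2)).trans ((map_add c.tau2.1 _ _).trans ?_)
  refine (congrArg₂ (· + ·) h1 h3).trans ((add_zero _).trans ?_)
  exact congrArg (gen k R.Alg R.rel).1 (Subtype.ext hr.symm)

private theorem d2_tau2_b3 (x : R.C3) : R.d2 (c.tau2 (R.b3 x)) = 0 :=
  (c.morphism.2 _).trans ((congrArg c.tau1.1 (R.b2_b3 x)).trans (map_zero c.tau1.1))

/-- A projection of `K₂` onto the kernel of `d₂` which is linear on the left. -/
def kerProj : R.K2 →+ R.K2 :=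
  AddMonoidHom.id _ - (c.tau2.1.comp R.hR.1).comp (R.sigma1.1.comp R.d2.1)

private theorem kerProj_apply (z : R.K2) : c.kerProj z = z - c.tau2 (R.hR (R.sigma1 (R.d2 z))) := rfl

private theorem kerProj_of_d2 {z : R.K2} (hz : R.d2 z = 0) : c.kerProj z = z := by
  rw [kerProj_apply, hz]
  simp only [map_zero, sub_zero]

private theorem kerProj_smul (a : R.Alg) (z : R.K2) : c.kerProj (a • z) = a • c.kerProj z := by
  simp only [kerProj_apply, BiHom.map_smul, hR_smul, smul_sub]

/-- The element `σ̄₁ d₂ z` is a `b̄₁`-cycle, because `b̄₁ σ̄₁ = d₁`; on such cycles `b̄₂ hR` is the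
identity. With `d₂ τ̄₂ = τ̄₁ b̄₂` and `τ̄₁ σ̄₁ = id`, the subtracted term has the same image under
`d₂` as `z`. -/
private theorem d2_kerProj (z : R.K2) : R.d2 (c.kerProj z) = 0 := by
  have h1 : R.hR₀ (R.b1 (R.sigma1 (R.d2 z))) = 0 := by
    rw [b1_sigma1, d1_d2, map_zero]
  have h2 : R.d2 (c.tau2 (R.hR (R.sigma1 (R.d2 z)))) = R.d2 z := by
    refine (c.morphism.2 _).trans ?_
    refine (congrArg c.tau1.1 ((R.b2_hR _).trans (congrArg (_ + ·) h1))).trans ?_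
    exact (congrArg c.tau1.1 (add_zero _)).trans (c.tau1_sigma1 _)
  rw [kerProj_apply]
  exact (map_sub R.d2.1 _ _).trans (sub_eq_zero.2 h2.symm)

end Comparison

end HomRel

end PBW

/-! ### Exactness of the Koszul complex at `K₂`. -/

namespace PBW

universe u v w

set_option linter.unusedSectionVars false

variable {k : Type u} [Ring k] {V : Type v} [AddCommGroup V] [Module k V] [Module kᵐᵒᵖ V]
  [SMulCommClass k kᵐᵒᵖ V] {N : ℕ} (R : HomRel k V N)

namespace HomRel

private theorem exists_ι_of_mem_comp_one {a : R.Alg} (ha : a ∈ R.comp 1) :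
    ∃ v : V, R.toAlg (TV.ι v) = a := by
  have : TV.tpow k V 1 ≤ ((R.toAlg.toAddMonoidHom.comp (TV.ι (k := k) (V := V)).1).range).comap
      R.toAlg.toAddMonoidHom := by
    rw [show (1 : ℕ) = 0 + 1 from rfl, TV.tpow, AddSubgroup.closure_le]
    rintro _ ⟨v, _, ⟨c, rfl⟩, rfl⟩
    exact ⟨op c • v, congrArg R.toAlg (TV.ι.map_op_smul c v)⟩
  obtain ⟨x, hx, rfl⟩ := ha
  exact this hx

/-- In degree `N + 1` one outer factor is a letter and the other a scalar, and the scalar is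
absorbed into the relation. The minus sign is chosen to match the shape of the Koszul 3-chains. -/
private theorem exists_sum_of_mem_K2Comp_succ {κ : R.K2} (hκ : κ ∈ R.K2Comp (N + 1)) :
    ∃ (m n : ℕ) (r : Fin m → R.rel) (u : Fin m → V) (v : Fin n → V) (s : Fin n → R.rel),
      κ = ∑ i, op (R.toAlg (TV.ι (u i))) • gen k R.Alg R.rel (r i) -
        ∑ i, R.toAlg (TV.ι (v i)) • gen k R.Alg R.rel (s i) := by
  let f : R.rel × V → R.K2 := fun t => op (R.toAlg (TV.ι t.2)) • gen k R.Alg R.rel t.1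
  let g : R.rel × V → R.K2 := fun t => R.toAlg (TV.ι t.2) • gen k R.Alg R.rel t.1
  have h : R.K2Comp (N + 1) ≤ AddSubgroup.closure {z | ∃ t, True ∧ z = f t} ⊔
      AddSubgroup.closure {z | ∃ t, True ∧ z = g t} := by
    refine R.freeComp_le fun i j l hd x hx r hr y hy => ?_
    rcases eq_or_ne j N with rfl | hj
    · rcases eq_or_ne l 0 with rfl | hl
      · obtain rfl : i = 1 := by omega
        obtain ⟨v, rfl⟩ := R.exists_ι_of_mem_comp_one hx
        refine AddSubgroup.mem_sup_right (AddSubgroup.subset_closure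
          ⟨(op (R.aug y) • r, v), trivial, ?_⟩)
        rw [R.eq_unit_of_mem hy, ← smul_gen, Compat.op_unit_smul, ← BiHom.map_op_smul, aug_unit]
      · obtain rfl : l = 1 := by omega
        obtain rfl : i = 0 := by omega
        obtain ⟨v, rfl⟩ := R.exists_ι_of_mem_comp_one hy
        refine AddSubgroup.mem_sup_left (AddSubgroup.subset_closure
          ⟨(R.aug x • r, v), trivial, ?_⟩)
        rw [R.eq_unit_of_mem hx, ← smul_op_smul_gen, Compat.unit_smul, ← BiHom.map_smul, aug_unit]
    · rw [eq_zero_of_concentrated hj hr, BT.zero_tmul, BT.tmul_zero]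
      exact zero_mem _
  obtain ⟨y, hy, z, hz, rfl⟩ := AddSubgroup.mem_sup.1 (h hκ)
  obtain ⟨m, t, -, rfl⟩ := TV.exists_sum_of_closure f (fun _ => True) (fun t => (-t.1, t.2))
    (fun _ _ => trivial) (fun t => by
      exact (congrArg _ (map_neg (gen k R.Alg R.rel).1 t.1)).trans (smul_neg _ _)) hy
  obtain ⟨n, s, -, rfl⟩ := TV.exists_sum_of_closure g (fun _ => True) (fun t => (-t.1, t.2))
    (fun _ _ => trivial) (fun t => by
      exact (congrArg _ (map_neg (gen k R.Alg R.rel).1 t.1)).trans (smul_neg _ _)) hz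
  refine ⟨m, n, fun i => (t i).1, fun i => (t i).2, fun i => (s i).2, fun i => -(s i).1, ?_⟩
  have h1 : ∀ i, R.toAlg (TV.ι (s i).2) • gen k R.Alg R.rel (-(s i).1) = - g (s i) := fun i =>
    (congrArg _ (map_neg (gen k R.Alg R.rel).1 (s i).1)).trans (smul_neg _ _)
  rw [Finset.sum_congr rfl fun i _ => h1 i, Finset.sum_neg_distrib, sub_neg_eq_add]

/-- An additive subgroup of `K₂`, closed under the two actions of `A` and containing the elements
`∑ 1|r_i|u_i - ∑ v_i|s_i|1` with `∑ r_i u_i = ∑ v_i s_i`. -/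
structure ContainsKoszul3 (G : AddSubgroup R.K2) : Prop where
  smul_mem : ∀ (a : R.Alg), ∀ z ∈ G, a • z ∈ G
  op_smul_mem : ∀ (a : R.Alg), ∀ z ∈ G, op a • z ∈ G
  d3_mem : ∀ (m n : ℕ) (r : Fin m → R.rel) (u : Fin m → V) (v : Fin n → V) (s : Fin n → R.rel),
    ∑ i, (r i : TV k V) * TV.ι (u i) = ∑ i, TV.ι (v i) * (s i : TV k V) →
    ∑ i, op (R.toAlg (TV.ι (u i))) • gen k R.Alg R.rel (r i) -
      ∑ i, R.toAlg (TV.ι (v i)) • gen k R.Alg R.rel (s i) ∈ G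

private theorem d2_op_smul_gen (r : R.rel) (u : V) :
    R.d2 (op (R.toAlg (TV.ι u)) • gen k R.Alg R.rel r) = R.par ((r : TV k V) * TV.ι u) := by
  have h : R.toAlg (r : TV k V) • gen k R.Alg V u = 0 := by rw [R.toAlg_rel r.2, zero_smul]
  refine (R.d2.map_op_smul _ _).trans ((congrArg _ (R.d2_gen r)).trans ?_)
  exact ((R.par_mul_ι r u).trans ((congrArg (· + _) h).trans (zero_add _))).symm

private theorem d2_smul_gen (s : R.rel) (v : V) :
    R.d2 (R.toAlg (TV.ι v) • gen k R.Alg R.rel s) = R.par (TV.ι v * (s : TV k V)) := by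
  have h : op (R.toAlg (s : TV k V)) • R.par (TV.ι v) = 0 := by
    rw [R.toAlg_rel s.2, op_zero, zero_smul]
  refine (R.d2.map_smul _ _).trans ((congrArg _ (R.d2_gen s)).trans ?_)
  exact ((R.par_mul (TV.ι v) s).trans ((congrArg (_ + ·) h).trans (add_zero _))).symm

/-- In degree `N + 1`, `d₂` is `par` of `∑ r u - ∑ v s`, and injectivity of `par` turns a cycle into
an overlap, that is, into one of the given generators. In degree `N` the same injectivity leaves
only zero, and below `N` there is nothing. -/
private theorem mem_of_d2_eq_zero_low {G : AddSubgroup R.K2} (hG : R.ContainsKoszul3 G) {n : ℕ}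
    (hn : n ≤ N + 1) {κ : R.K2} (hκ : κ ∈ R.K2Comp n) (hd : R.d2 κ = 0) : κ ∈ G := by
  have hN := R.two_le
  rcases lt_trichotomy n N with h | rfl | h
  · rw [R.eq_zero_of_mem_K2Comp h hκ]; exact zero_mem G
  · obtain ⟨r, rfl⟩ := R.exists_gen_of_mem_K2Comp hκ
    have h0 : r = 0 := R.par_injective_of_rel r 0
      ((R.d2_gen r).symm.trans (hd.trans (map_zero R.par.1).symm))
    rw [h0, map_zero]; exact zero_mem G
  · obtain rfl : n = N + 1 := by omega
    obtain ⟨m, n, r, u, v, s, rfl⟩ := R.exists_sum_of_mem_K2Comp_succ hκ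
    refine hG.d3_mem m n r u v s (sub_eq_zero.1 ?_)
    refine R.eq_zero_of_par_eq_zero 1 (N - 1) (by omega) (by omega) ?_ ?_
    · rw [show 1 + (N - 1) + 1 = N + 1 by omega]
      exact sub_mem (sum_mem fun i _ => TV.mul_mem (R.le _ (r i).2) (TV.ι_mem _))
        (sum_mem fun i _ => add_comm 1 N ▸ TV.mul_mem (TV.ι_mem _) (R.le _ (s i).2))
    · have h1 : R.par (∑ i, (r i : TV k V) * TV.ι (u i)) =
          R.d2 (∑ i, op (R.toAlg (TV.ι (u i))) • gen k R.Alg R.rel (r i)) :=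
        (map_sum R.par.1 _ _).trans ((Finset.sum_congr rfl fun i _ =>
          (R.d2_op_smul_gen (r i) (u i)).symm).trans (map_sum R.d2.1 _ _).symm)
      have h2 : R.par (∑ i, TV.ι (v i) * (s i : TV k V)) =
          R.d2 (∑ i, R.toAlg (TV.ι (v i)) • gen k R.Alg R.rel (s i)) :=
        (map_sum R.par.1 _ _).trans ((Finset.sum_congr rfl fun i _ =>
          (R.d2_smul_gen (s i) (v i)).symm).trans (map_sum R.d2.1 _ _).symm)
      exact (map_sub R.par.1 _ _).trans ((congrArg₂ (· - ·) h1 h2).trans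
        ((map_sub R.d2.1 _ _).symm.trans hd))

private theorem sub_augL_tmul {W : Type*} [AddCommGroup W] [Module k W] [Module kᵐᵒᵖ W]
    [SMulCommClass k kᵐᵒᵖ W] (x y : R.Alg) (w : W) :
    BT.tmul k x (BT.tmul k w y) - R.augL W (BT.tmul k x (BT.tmul k w y)) =
      (R.bar x : R.Alg) • op y • gen k R.Alg W w := by
  rw [coe_bar_smul, augL_tmul, smul_gen]

section Step

variable {G : AddSubgroup R.K2} (hG : R.ContainsKoszul3 G) {m : ℕ}
  (ih : ∀ l < m, ∀ z ∈ R.K2Comp (l + N), R.d2 z = 0 → z ∈ G)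
include hG ih

private theorem prF_mem_of_d2 {l : ℕ} (hl : l < m) {z : R.K2} (hz : R.d2 z = 0) : R.prF R.rel l z ∈ G := by
  have hN := R.two_le
  refine ih l hl _ (R.prF_mem N l z) ?_
  -- The index of `prF` counts the two outer factors only; replacing `R`, of degree `N`, by `V`, of
  -- degree `1`, shifts it by `N - 1`.
  refine (R.hom_prF (e := N) (e' := 1) (s := 0) R.d2.1 R.d2_mem
    (m := l) (m' := l + (N - 1)) (by omega) z).trans ?_
  exact (congrArg _ hz).trans (map_zero _)

/-- The component of index `m` of `a z` is `a` times a component of `z` of smaller index, because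
`a` has positive degree. That component is a cycle, so the induction hypothesis applies. -/
private theorem prF_smul_mem {z : R.K2} (hz : R.d2 z = 0) (a : R.plus) :
    R.prF R.rel m ((a : R.Alg) • z) ∈ G := by
  let φ : R.plus →+ R.K2 := AddMonoidHom.mk' (fun a => R.prF R.rel m ((a : R.Alg) • z))
    (fun a b => by
      refine (congrArg _ ?_).trans (map_add (R.prF R.rel m).1 _ _)
      exact add_smul (a : R.Alg) (b : R.Alg) z)
  refine R.mem_of_plusComp (S := G.comap φ) (fun j a ha => ?_) a
  change R.prF R.rel m ((a : R.Alg) • z) ∈ G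
  have hf : ∀ n, ∀ z ∈ R.freeComp (concentrated R.rel N) n,
      smulHom (a : R.Alg) z ∈ R.freeComp (concentrated R.rel N) (n + (j + 1)) :=
    fun n z hz => R.smul_mem_freeComp (by omega) ha hz
  by_cases h : j + 1 ≤ m
  · have h1 := R.hom_prF (smulHom (a : R.Alg)) hf (m := m - (j + 1)) (m' := m) (by omega) z
    have h2 := hG.smul_mem a _ (R.prF_mem_of_d2 hG ih (show m - (j + 1) < m by omega) hz)
    exact (congrArg (· ∈ G) h1).mp h2
  · have h1 := R.prF_eq_zero (smulHom (a : R.Alg)) hf (m' := m) (by omega) z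
    exact (congrArg (· ∈ G) h1.symm).mp (zero_mem G)

private theorem prF_op_smul_mem {z : R.K2} (hz : R.d2 z = 0) (a : R.plus) :
    R.prF R.rel m (op (a : R.Alg) • z) ∈ G := by
  let φ : R.plus →+ R.K2 := AddMonoidHom.mk' (fun a => R.prF R.rel m (op (a : R.Alg) • z))
    (fun a b => by
      refine (congrArg _ ?_).trans (map_add (R.prF R.rel m).1 _ _)
      exact add_smul (op (a : R.Alg)) (op (b : R.Alg)) z)
  refine R.mem_of_plusComp (S := G.comap φ) (fun j a ha => ?_) a
  change R.prF R.rel m (op (a : R.Alg) • z) ∈ G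
  have hf : ∀ n, ∀ z ∈ R.freeComp (concentrated R.rel N) n,
      smulHom (op (a : R.Alg)) z ∈ R.freeComp (concentrated R.rel N) (n + (j + 1)) :=
    fun n z hz => R.op_smul_mem_freeComp (by omega) ha hz
  by_cases h : j + 1 ≤ m
  · have h1 := R.hom_prF (smulHom (op (a : R.Alg))) hf (m := m - (j + 1)) (m' := m) (by omega) z
    have h2 := hG.op_smul_mem a _ (R.prF_mem_of_d2 hG ih (show m - (j + 1) < m by omega) hz)
    exact (congrArg (· ∈ G) h1).mp h2
  · have h1 := R.prF_eq_zero (smulHom (op (a : R.Alg))) hf (m' := m) (by omega) z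
    exact (congrArg (· ∈ G) h1.symm).mp (zero_mem G)

/-- For `u = p ⊗ q ⊗ a ⊗ b`, `b3_torD4` leaves modulo `I₊` on the left only the term multiplied by
`b`. Its image is the cycle `τ̄₂ b̄₃ (1|p|q|a|1)` times an element of `I₊`, which lies in `G` by
`prF_op_smul_mem`. -/
private theorem exists_of_plus4 (c : R.Comparison) (u : R.plus4) :
    ∃ κ : R.K2, R.prF R.rel m κ ∈ G ∧ R.d2 κ = 0 ∧
      R.augL _ κ = - R.augL _ (c.tau2 (R.b3 (gen k R.Alg _ (R.torD4 u)))) := by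
  let T : R.plus4 →+ R.K2 := ((R.augL R.rel).1.comp c.tau2.1).comp
    ((R.b3.1.comp (gen k R.Alg R.plus3).1).comp R.torD4.1)
  let S : AddSubgroup R.plus4 :=
    (((G.comap (R.prF R.rel m).1) ⊓ R.d2.1.ker).map (R.augL R.rel).1).comap (-T)
  suffices h : u ∈ S by
    obtain ⟨κ, ⟨h1, h2⟩, h3⟩ := h
    exact ⟨κ, h1, h2, h3⟩
  induction u using BT.induction with
  | zero => exact zero_mem S
  | add x y hx hy => exact add_mem hx hy
  | tmul p u =>
    induction u using BT.induction with
    | zero => rw [BT.tmul_zero]; exact zero_mem S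
    | add x y hx hy => rw [BT.tmul_add]; exact add_mem hx hy
    | tmul q u =>
      induction u using BT.induction with
      | zero => rw [BT.tmul_zero, BT.tmul_zero]; exact zero_mem S
      | add x y hx hy => rw [BT.tmul_add, BT.tmul_add]; exact add_mem hx hy
      | tmul a b =>
        have h0 := c.d2_tau2_b3 (gen k R.Alg _ (BT.tmul k p (BT.tmul k q a)))
        refine ⟨op (b : R.Alg) • c.tau2 (R.b3 (gen k R.Alg _ (BT.tmul k p (BT.tmul k q a)))),
          ⟨R.prF_op_smul_mem hG ih h0 b, ?_⟩, ?_⟩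
        · exact (R.d2.map_op_smul _ _).trans ((congrArg _ h0).trans (smul_zero _))
        · have h1 := congrArg (fun z => - R.augL _ (c.tau2 z)) (R.b3_torD4 p q a b)
          refine Eq.trans ?_ h1.symm
          simp only [map_sub, map_neg, BiHom.map_smul, BiHom.map_op_smul, augL_smul,
            R.mem_plus.1 p.2, zero_smul, neg_zero, zero_sub, neg_neg]

/-- The element `z - augL z` has its left coefficients in `I₊`, and left linearity of `kerProj`
pulls them out in front of cycles. -/
private theorem prF_kerProj_mem (c : R.Comparison) (z : R.K2) :
    R.prF R.rel m (c.kerProj (z - R.augL _ z)) ∈ G := by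
  let φ : R.K2 →+ R.K2 := (R.prF R.rel m).1.comp
    (c.kerProj.comp (AddMonoidHom.id _ - (R.augL R.rel).1))
  have hφ : ∀ z, φ z = R.prF R.rel m (c.kerProj (z - R.augL _ z)) := fun z => rfl
  rw [← hφ]
  refine FB.mem_of_tmul (S := G.comap φ) (fun x r y => AddSubgroup.mem_comap.2 ?_) z
  have h := congrArg (fun w => R.prF R.rel m (c.kerProj w)) (R.sub_augL_tmul x y r)
  have h1 := congrArg (R.prF R.rel m).1 (c.kerProj_smul (R.bar x) (op y • gen k R.Alg _ r))
  have h2 := R.prF_smul_mem hG ih (c.d2_kerProj (op y • gen k R.Alg _ r)) (R.bar x)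
  rw [(hφ _).trans (h.trans h1)]
  exact h2

end Step

/-- For a cycle `κ` the term with `hR` in `b3_toPlus3_d2_augL` vanishes modulo `I₊` on the left. So
`-σ̄₂ κ` is there the boundary of an explicit 3-chain, and augmenting on the right as well shows,
for degree reasons, that this chain is a cycle of the complex computing `Tor₃`. -/
private theorem torD3_toPlus3 {n : ℕ} (hn : N < n) {κ : R.K2} (hκ : κ ∈ R.K2Comp n) (hd : R.d2 κ = 0) :
    R.torD3 (R.toPlus3 (R.d2 (R.augL _ κ))) = 0 ∧
      R.augL _ (R.b3 (gen k R.Alg _ (R.toPlus3 (R.d2 (R.augL _ κ))))) =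
        - R.augL _ (R.sigma2 κ) := by
  have h1 := R.b3_toPlus3_d2_augL hn hκ
  have h2 : R.augL _ (R.sigma1 (R.d2 (R.augL _ κ))) = 0 := by
    refine (R.augL_hom (R.sigma1.comp R.d2) κ).trans ?_
    exact (congrArg (fun z => R.augL _ (R.sigma1 z)) hd).trans
      (map_zero ((R.augL _).1.comp R.sigma1.1))
  have h3 : R.augL _ (R.hR (R.sigma1 (R.d2 (R.augL _ κ)))) = 0 :=
    (R.augL_hR _).trans ((congrArg R.hR.1 h2).trans (map_zero R.hR.1))
  constructor
  · rw [← augLR_b3_gen, h1, map_sub, R.augLR_sigma2_augL hn hκ, sub_zero, ← augLR_augL, h3, map_zero]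
  · refine (congrArg (R.augL _).1 h1).trans ((map_sub (R.augL _).1 _ _).trans ?_)
    refine (congrArg₂ (· - ·) h3 (R.augL_hom R.sigma2 κ)).trans (zero_sub _)

/-- The Koszul complex is exact at `K₂` if `Tor₃^A(k, k)` is concentrated in degree `N + 1`. -/
private theorem mem_of_d2_eq_zero_of_mem (hTor : R.Tor3ConcentratedIn (N + 1)) (c : R.Comparison)
    {G : AddSubgroup R.K2} (hG : R.ContainsKoszul3 G) (n : ℕ) (κ : R.K2) (hκ : κ ∈ R.K2Comp n)
    (hd : R.d2 κ = 0) : κ ∈ G := by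
  induction n using Nat.strong_induction_on generalizing κ with
  | _ n ih =>
    rcases le_or_gt n (N + 1) with hn | hn
    · exact R.mem_of_d2_eq_zero_low hG hn hκ hd
    obtain ⟨m, rfl⟩ : ∃ m, n = m + N := ⟨n - N, by omega⟩
    have ih' : ∀ l < m, ∀ z ∈ R.K2Comp (l + N), R.d2 z = 0 → z ∈ G :=
      fun l hl z hz => ih (l + N) (by omega) z hz
    obtain ⟨h1, h2⟩ := R.torD3_toPlus3 (by omega) hκ hd
    -- Now `m + N > N + 1`, so the bar cycle attached to `κ` bounds some `u`.
    obtain ⟨u, hu⟩ := hTor (m + N) (by omega) _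
      (R.toPlus3_mem (R.d2_mem _ _ (R.augL_mem hκ))) h1
    obtain ⟨κ₁, h3, h4, h5⟩ := R.exists_of_plus4 hG ih' c u
    -- Applying `τ̄₂` to the boundary relation and using `τ̄₂ σ̄₂ = id` recovers `κ` modulo `I₊` on
    -- the left.
    have h6 : R.augL _ κ₁ = R.augL _ κ := by
      have e1 := congrArg (fun w => - R.augL _ (c.tau2 (R.b3 (gen k R.Alg R.plus3 w)))) hu
      refine (h5.trans e1).trans (neg_eq_iff_eq_neg.2 ((R.augL_hom c.tau2 _).symm.trans ?_))
      refine (congrArg (fun z => R.augL _ (c.tau2 z)) h2).trans ?_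
      refine (map_neg ((R.augL _).1.comp c.tau2.1) _).trans (congrArg Neg.neg ?_)
      exact (R.augL_hom c.tau2 _).trans (congrArg _ (c.tau2_sigma2 κ))
    have h7 : R.augL _ (κ - κ₁) = 0 := (map_sub (R.augL _).1 _ _).trans (sub_eq_zero.2 h6.symm)
    have h8 : R.d2 (κ - κ₁) = 0 := (map_sub R.d2.1 _ _).trans
      ((congrArg₂ (· - ·) hd h4).trans (sub_zero 0))
    -- The difference `κ - κ₁` is a cycle, hence fixed by `kerProj`, and its left augmentation is
    -- zero. Therefore `prF_kerProj_mem` puts its component of index `m` into `G`.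
    have h9 : R.prF R.rel m (c.kerProj (κ - κ₁ - R.augL _ (κ - κ₁))) = κ - R.prF R.rel m κ₁ := by
      refine (congrArg (fun w => R.prF R.rel m (c.kerProj (κ - κ₁ - w))) h7).trans ?_
      refine (congrArg (fun w => R.prF R.rel m (c.kerProj w)) (sub_zero _)).trans ?_
      refine (congrArg (R.prF R.rel m).1 (c.kerProj_of_d2 h8)).trans ?_
      refine (map_sub (R.prF R.rel m).1 _ _).trans (congrArg (· - _) ?_)
      exact (R.prF_of_mem m hκ).trans (if_pos rfl)
    have h10 := add_mem ((congrArg (· ∈ G) h9).mp (R.prF_kerProj_mem hG ih' c (κ - κ₁))) h3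
    exact (congrArg (· ∈ G) (sub_add_cancel κ _)).mp h10

end HomRel

end PBW

namespace PBW

/-! ### Formal products on `A[X]` -/

section Star

open Polynomial

variable {A : Type*} [Ring A]

/-- A family of biadditive operations on `A` that is locally finite. -/
structure StarFamily (A : Type*) [Ring A] where
  op : ℕ → A →+ A →+ A
  finite : ∀ a b, ∃ B, ∀ n, B ≤ n → op n a b = 0

namespace StarFamily

variable (m : StarFamily A)

/-- The polynomial `∑ m_n(a, b) X^n`. -/
def const (a b : A) : A[X] :=
  ∑ n ∈ Finset.range (m.finite a b).choose, monomial n (m.op n a b)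

private theorem coeff_const (a b : A) (n : ℕ) : (m.const a b).coeff n = m.op n a b := by
  rw [const, finsetSum_coeff]
  simp only [coeff_monomial]
  rw [Finset.sum_ite_eq' (Finset.range _) n]
  split_ifs with h
  · rfl
  · exact ((m.finite a b).choose_spec n (by simpa using h)).symm

private theorem const_add_left (a a' b : A) : m.const (a + a') b = m.const a b + m.const a' b := by
  ext n
  simp only [coeff_add, coeff_const, map_add, AddMonoidHom.add_apply]

private theorem const_add_right (a b b' : A) : m.const a (b + b') = m.const a b + m.const a b' := by
  ext n
  simp only [coeff_add, coeff_const, map_add]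

private theorem const_zero_left (b : A) : m.const 0 b = 0 := by
  ext n
  simp only [coeff_zero, coeff_const, map_zero, AddMonoidHom.zero_apply]

private theorem const_zero_right (a : A) : m.const a 0 = 0 := by
  ext n
  simp only [coeff_zero, coeff_const, map_zero]

/-- The `X`-bilinear product on `A[X]` extending `const`. -/
def mul (x y : A[X]) : A[X] := x.sum fun i a => y.sum fun j b => X ^ (i + j) * m.const a b

private theorem add_mul (x x' y : A[X]) : m.mul (x + x') y = m.mul x y + m.mul x' y := by
  refine sum_add_index x x' _ (fun i => ?_) (fun i a a' => ?_)
  · simp only [const_zero_left, mul_zero, Polynomial.sum, Finset.sum_const_zero]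
  · simp only [const_add_left, mul_add, Polynomial.sum, Finset.sum_add_distrib]

private theorem mul_add (x y y' : A[X]) : m.mul x (y + y') = m.mul x y + m.mul x y' := by
  have h : ∀ i a, ((y + y').sum fun j b => X ^ (i + j) * m.const a b) =
      (y.sum fun j b => X ^ (i + j) * m.const a b) +
        y'.sum fun j b => X ^ (i + j) * m.const a b := fun i a =>
    sum_add_index y y' _ (fun i => by rw [const_zero_right, mul_zero])
      (fun i b b' => by rw [const_add_right, _root_.mul_add])
  simp only [mul, h]
  simp only [Polynomial.sum, Finset.sum_add_distrib]

private theorem monomial_mul_monomial (i j : ℕ) (a b : A) :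
    m.mul (monomial i a) (monomial j b) = X ^ (i + j) * m.const a b := by
  rw [mul, sum_monomial_index, sum_monomial_index]
  · rw [const_zero_right, mul_zero]
  · simp only [const_zero_left, mul_zero, Polynomial.sum, Finset.sum_const_zero]

/-- The product as a biadditive map. -/
def mulHom : A[X] →+ A[X] →+ A[X] :=
  AddMonoidHom.mk' (fun x => AddMonoidHom.mk' (m.mul x) (m.mul_add x))
    (fun x x' => AddMonoidHom.ext fun y => m.add_mul x x' y)

private theorem mulHom_apply (x y : A[X]) : m.mulHom x y = m.mul x y := rfl

private theorem C_mul_C (a b : A) : m.mul (C a) (C b) = m.const a b := by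
  have h := m.monomial_mul_monomial 0 0 a b
  rwa [monomial_zero_left, monomial_zero_left, add_zero, pow_zero, one_mul] at h

private theorem X_mul (x y : A[X]) : m.mul (X * x) y = X * m.mul x y := by
  induction x using Polynomial.induction_on' with
  | add p q hp hq => rw [_root_.mul_add, add_mul, hp, hq, add_mul, _root_.mul_add]
  | monomial i a =>
    induction y using Polynomial.induction_on' with
    | add p q hp hq => rw [mul_add, hp, hq, mul_add, _root_.mul_add]
    | monomial j b =>
      rw [X_mul_monomial, monomial_mul_monomial, monomial_mul_monomial, Nat.add_right_comm,
        pow_succ', mul_assoc]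

private theorem mul_X (x y : A[X]) : m.mul x (X * y) = X * m.mul x y := by
  induction x using Polynomial.induction_on' with
  | add p q hp hq => rw [add_mul, hp, hq, add_mul, _root_.mul_add]
  | monomial i a =>
    induction y using Polynomial.induction_on' with
    | add p q hp hq => rw [_root_.mul_add, mul_add, hp, hq, mul_add, _root_.mul_add]
    | monomial j b =>
      rw [X_mul_monomial, monomial_mul_monomial, monomial_mul_monomial, ← add_assoc,
        pow_succ', mul_assoc]

private theorem X_pow_mul (n : ℕ) (x y : A[X]) : m.mul (X ^ n * x) y = X ^ n * m.mul x y := by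
  induction n with
  | zero => rw [pow_zero, one_mul, one_mul]
  | succ n ih => rw [pow_succ', mul_assoc, X_mul, ih, mul_assoc]

private theorem mul_X_pow (n : ℕ) (x y : A[X]) : m.mul x (X ^ n * y) = X ^ n * m.mul x y := by
  induction n with
  | zero => rw [pow_zero, one_mul, one_mul]
  | succ n ih => rw [pow_succ', mul_assoc, mul_X, ih, mul_assoc]

private theorem monomial_eq (i : ℕ) (a : A) : monomial i a = X ^ i * C a := by
  rw [X_pow_mul_C, C_mul_X_pow_eq_monomial]

private theorem coeff_C_mul (a : A) (x : A[X]) (n : ℕ) :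
    (m.mul (C a) x).coeff n =
      ∑ p ∈ Finset.HasAntidiagonal.antidiagonal n, m.op p.1 a (x.coeff p.2) := by
  induction x using Polynomial.induction_on' with
  | add p q hp hq => simp only [mul_add, coeff_add, hp, hq, map_add, Finset.sum_add_distrib]
  | monomial i b =>
    rw [monomial_eq, mul_X_pow, C_mul_C, coeff_X_pow_mul', ← monomial_eq]
    simp only [coeff_monomial, coeff_const]
    split_ifs with h
    · rw [Finset.sum_eq_single (n - i, i)]
      · rw [if_pos rfl]
      · rintro ⟨p, q⟩ hp hne
        rw [if_neg, map_zero]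
        rintro rfl
        apply hne
        have := Finset.HasAntidiagonal.mem_antidiagonal.1 hp
        ext
        · change p = n - i
          omega
        · rfl
      · intro h'
        exact absurd (Finset.HasAntidiagonal.mem_antidiagonal.2 (Nat.sub_add_cancel h)) h'
    · refine (Finset.sum_eq_zero fun p hp => ?_).symm
      have := Finset.HasAntidiagonal.mem_antidiagonal.1 hp
      rw [if_neg (by omega), map_zero]

private theorem coeff_mul_C (a : A) (x : A[X]) (n : ℕ) :
    (m.mul x (C a)).coeff n =
      ∑ p ∈ Finset.HasAntidiagonal.antidiagonal n, m.op p.1 (x.coeff p.2) a := by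
  induction x using Polynomial.induction_on' with
  | add p q hp hq =>
    simp only [add_mul, coeff_add, hp, hq, map_add, Finset.sum_add_distrib, AddMonoidHom.add_apply]
  | monomial i b =>
    rw [monomial_eq, X_pow_mul, C_mul_C, coeff_X_pow_mul', ← monomial_eq]
    simp only [coeff_monomial, coeff_const]
    split_ifs with h
    · rw [Finset.sum_eq_single (n - i, i)]
      · rw [if_pos rfl]
      · rintro ⟨p, q⟩ hp hne
        rw [if_neg, map_zero, AddMonoidHom.zero_apply]
        rintro rfl
        apply hne
        have := Finset.HasAntidiagonal.mem_antidiagonal.1 hp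
        ext
        · change p = n - i
          omega
        · rfl
      · intro h'
        exact absurd (Finset.HasAntidiagonal.mem_antidiagonal.2 (Nat.sub_add_cancel h)) h'
    · refine (Finset.sum_eq_zero fun p hp => ?_).symm
      have := Finset.HasAntidiagonal.mem_antidiagonal.1 hp
      rw [if_neg (by omega), map_zero, AddMonoidHom.zero_apply]

/-- The associator. -/
def ass (x y z : A[X]) : A[X] := m.mul x (m.mul y z) - m.mul (m.mul x y) z

/-- The coefficients of the associator of elements of `A`. -/
def assCoeff (n : ℕ) (a b c : A) : A := (m.ass (C a) (C b) (C c)).coeff n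

private theorem assCoeff_eq (n : ℕ) (a b c : A) : m.assCoeff n a b c =
    ∑ p ∈ Finset.HasAntidiagonal.antidiagonal n, (m.op p.1 a (m.op p.2 b c) -
      m.op p.1 (m.op p.2 a b) c) := by
  rw [assCoeff, ass, coeff_sub, C_mul_C, C_mul_C, coeff_C_mul, coeff_mul_C,
    ← Finset.sum_sub_distrib]
  simp only [coeff_const]

private theorem ass_monomial (i j l : ℕ) (a b c : A) :
    m.ass (monomial i a) (monomial j b) (monomial l c) =
      X ^ (i + j + l) * m.ass (C a) (C b) (C c) := by
  simp only [ass, monomial_eq, X_pow_mul, mul_X_pow, mul_sub, ← mul_assoc, ← pow_add]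
  have h1 : l + (j + i) = i + j + l := by omega
  simp only [add_assoc] at h1 ⊢
  rw [h1]

private theorem ass_eq_zero (h : ∀ n a b c, m.assCoeff n a b c = 0) (x y z : A[X]) : m.ass x y z = 0 := by
  induction x using Polynomial.induction_on' with
  | add p q hp hq =>
    simp only [ass, add_mul, sub_eq_zero] at hp hq ⊢
    rw [hp, hq]
  | monomial i a =>
    induction y using Polynomial.induction_on' with
    | add p q hp hq =>
      simp only [ass, add_mul, mul_add, sub_eq_zero] at hp hq ⊢
      rw [hp, hq]
    | monomial j b =>
      induction z using Polynomial.induction_on' with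
      | add p q hp hq =>
        simp only [ass, mul_add, sub_eq_zero] at hp hq ⊢
        rw [hp, hq]
      | monomial l c =>
        have h0 : m.ass (C a) (C b) (C c) = 0 := by
          ext n
          exact h n a b c
        rw [ass_monomial, h0, mul_zero]

private theorem sum_antidiagonal_of_lt {X : Type*} [AddCommMonoid X] (f : ℕ → ℕ → X) (n : ℕ)
    (h : ∀ i j, i + j = n → j < n → f i j = 0) :
    ∑ p ∈ Finset.HasAntidiagonal.antidiagonal n, f p.1 p.2 = f 0 n := by
  refine Finset.sum_eq_single (0, n) ?_ ?_
  · rintro ⟨p, q⟩ hp hne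
    have hpq := Finset.HasAntidiagonal.mem_antidiagonal.1 hp
    refine h p q hpq (lt_of_le_of_ne (by change p + q = n at hpq; omega) ?_)
    rintro rfl
    apply hne
    have : p = 0 := by change p + q = q at hpq; omega
    rw [this]
  · intro h'
    exact absurd (Finset.HasAntidiagonal.mem_antidiagonal.2 (Nat.zero_add n)) h'

section Pentagon

variable {m} {n : ℕ}

private theorem coeff_X_pow_mul_ass (h : ∀ j < n, ∀ a b c, m.assCoeff j a b c = 0) {i : ℕ}
    (hi : 0 < i) (a b c : A) : (X ^ i * m.ass (C a) (C b) (C c)).coeff n = 0 := by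
  rw [coeff_X_pow_mul']
  split_ifs with h2
  · exact h _ (by omega) a b c
  · rfl

/-- Associators of constants are divisible by `X ^ n`, so a term of `x` with a positive power of `X`
contributes only beyond `X ^ n`; only the constant term of `x` counts. The same holds in the other
two arguments. -/
private theorem coeff_ass_left (h : ∀ j < n, ∀ a b c, m.assCoeff j a b c = 0)
    (x : A[X]) (b c : A) :
    (m.ass x (C b) (C c)).coeff n = m.assCoeff n (x.coeff 0) b c := by
  induction x using Polynomial.induction_on' with
  | add p q hp hq =>
    simp only [ass, assCoeff, add_mul, coeff_sub, coeff_add, C_add] at hp hq ⊢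
    rw [add_sub_add_comm, hp, hq, add_sub_add_comm]
  | monomial i e =>
    have h1 := m.ass_monomial i 0 0 e b c
    rw [monomial_zero_left, monomial_zero_left] at h1
    rw [h1, coeff_monomial]
    rcases Nat.eq_zero_or_pos i with rfl | hi
    · simp [assCoeff]
    · rw [if_neg (by omega : ¬ i = 0), coeff_X_pow_mul_ass h (by omega)]
      simp only [assCoeff, ass, ← mulHom_apply, map_zero, AddMonoidHom.zero_apply, sub_zero,
        coeff_zero]

private theorem coeff_ass_mid (h : ∀ j < n, ∀ a b c, m.assCoeff j a b c = 0)
    (a : A) (x : A[X]) (c : A) :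
    (m.ass (C a) x (C c)).coeff n = m.assCoeff n a (x.coeff 0) c := by
  induction x using Polynomial.induction_on' with
  | add p q hp hq =>
    simp only [ass, assCoeff, add_mul, mul_add, coeff_sub, coeff_add, C_add] at hp hq ⊢
    rw [add_sub_add_comm, hp, hq, add_sub_add_comm]
  | monomial i e =>
    have h1 := m.ass_monomial 0 i 0 a e c
    rw [monomial_zero_left, monomial_zero_left] at h1
    rw [h1, coeff_monomial]
    rcases Nat.eq_zero_or_pos i with rfl | hi
    · simp [assCoeff]
    · rw [if_neg (by omega : ¬ i = 0), coeff_X_pow_mul_ass h (by omega)]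
      simp only [assCoeff, ass, ← mulHom_apply, map_zero, AddMonoidHom.zero_apply, sub_zero,
        coeff_zero]

private theorem coeff_ass_right (h : ∀ j < n, ∀ a b c, m.assCoeff j a b c = 0)
    (a b : A) (x : A[X]) :
    (m.ass (C a) (C b) x).coeff n = m.assCoeff n a b (x.coeff 0) := by
  induction x using Polynomial.induction_on' with
  | add p q hp hq =>
    simp only [ass, assCoeff, mul_add, coeff_sub, coeff_add, C_add] at hp hq ⊢
    rw [add_sub_add_comm, hp, hq, add_sub_add_comm]
  | monomial i e =>
    have h1 := m.ass_monomial 0 0 i a b e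
    rw [monomial_zero_left, monomial_zero_left] at h1
    rw [h1, coeff_monomial]
    rcases Nat.eq_zero_or_pos i with rfl | hi
    · simp [assCoeff]
    · rw [if_neg (by omega : ¬ i = 0), coeff_X_pow_mul_ass h (by omega)]
      simp only [assCoeff, ass, ← mulHom_apply, map_zero, sub_zero,
        coeff_zero]

/-- The lowest coefficient of the associator is a Hochschild cocycle. -/
private theorem pentagon (h0 : ∀ a b, m.op 0 a b = a * b)
    (h : ∀ j < n, ∀ a b c, m.assCoeff j a b c = 0) (a b c d : A) : a * m.assCoeff n b c d - m.assCoeff n (a * b) c d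
    + m.assCoeff n a (b * c) d - m.assCoeff n a b (c * d) + m.assCoeff n a b c * d = 0 := by
  -- The five-term identity holds for every biadditive product. In its coefficient at `X ^ n` the
  -- products outside and inside the associators reduce to the undeformed one.
  have h1 : m.mul (C a) (m.ass (C b) (C c) (C d)) - m.ass (m.mul (C a) (C b)) (C c) (C d)
      + m.ass (C a) (m.mul (C b) (C c)) (C d) - m.ass (C a) (C b) (m.mul (C c) (C d))
      + m.mul (m.ass (C a) (C b) (C c)) (C d) = 0 := by
    simp only [ass, ← mulHom_apply, map_sub, AddMonoidHom.sub_apply]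
    abel
  have h2 := congrArg (fun x => coeff x n) h1
  simp only [coeff_add, coeff_sub, coeff_zero, coeff_ass_left h, coeff_ass_mid h,
    coeff_ass_right h, coeff_C_mul, coeff_mul_C, C_mul_C, coeff_const, h0] at h2
  rw [sum_antidiagonal_of_lt (fun i j => m.op i a ((m.ass (C b) (C c) (C d)).coeff j)),
    sum_antidiagonal_of_lt (fun i j => m.op i ((m.ass (C a) (C b) (C c)).coeff j) d), h0, h0] at h2
  · exact h2
  · intro i j _ hj
    have h3 : (m.ass (C a) (C b) (C c)).coeff j = 0 := h j hj a b c
    rw [h3, map_zero, AddMonoidHom.zero_apply]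
  · intro i j _ hj
    have h3 : (m.ass (C b) (C c) (C d)).coeff j = 0 := h j hj b c d
    rw [h3, map_zero]

end Pentagon

end StarFamily

end Star

end PBW

/-! ### The recursively defined cochains: normalization and values on relations. -/

namespace PBW

universe u v w

set_option linter.unusedSectionVars false

variable {k : Type u} [Ring k] {V : Type v} [AddCommGroup V] [Module k V] [Module kᵐᵒᵖ V]
  [SMulCommClass k kᵐᵒᵖ V] {N : ℕ} (R : HomRel k V N)

section Extend

variable {A : Type*} [Ring A] [KAlg k A] {W X : Type*} [AddCommGroup W] [Module k W]
  [Module kᵐᵒᵖ W] [SMulCommClass k kᵐᵒᵖ W] [AddCommGroup X] [Module k X] [Module kᵐᵒᵖ X]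
  [Module A X] [Module Aᵐᵒᵖ X] [Compat k A X] [SMulCommClass A Aᵐᵒᵖ X]

private theorem extend_restrict_gen (g : BiHom A (FB k A W) X) (x : FB k A W) :
    extend ((restrict g).comp (gen k A W)) x = g x :=
  FB.hom_eq (fun w => extend_gen _ w) x

private theorem extend_zero (x : FB k A W) : extend (0 : BiHom k W X) x = 0 :=
  FB.hom_eq (g := (0 : BiHom A (FB k A W) X)) (fun w => extend_gen _ w) x

private theorem extend_sub_restrict_gen (f : BiHom k W X) (g : BiHom A (FB k A W) X) (x : FB k A W) :
    extend (f - (restrict g).comp (gen k A W)) x = extend f x - g x :=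
  FB.hom_eq (g := extend f - g) (fun w => (extend_gen _ w).trans
    (congrArg (· - g (gen k A W w)) (extend_gen f w).symm)) x

end Extend

namespace HomRel

variable {R}

/-- The components `φ_{N-n}`, for `1 ≤ n ≤ N`. -/
def relCochain (φ : ℕ → BiHom k R.rel R.Alg) (n : ℕ) : BiHom k R.rel R.Alg :=
  if 1 ≤ n ∧ n ≤ N then φ (N - n) else 0

private theorem relCochain_of_le (φ : ℕ → BiHom k R.rel R.Alg) {n : ℕ} (h1 : 1 ≤ n) (hn : n ≤ N) :
    relCochain φ n = φ (N - n) := if_pos ⟨h1, hn⟩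

private theorem relCochain_of_lt (φ : ℕ → BiHom k R.rel R.Alg) {n : ℕ} (hn : N < n) :
    relCochain φ n = 0 := if_neg (by omega)

private theorem extend_psi' (c : R.Comparison) (φ : ℕ → BiHom k R.rel R.Alg) (n : ℕ) (x : R.C2) :
    extend (psi' c φ n) x = extend (relCochain φ n) (c.tau2 x) := by
  by_cases h : 1 ≤ n ∧ n ≤ N
  · have h1 : psi' c φ n = (restrict ((extend (φ (N - n))).comp c.tau2)).comp
      (gen k R.Alg R.plus2) := if_pos h
    have h2 : relCochain φ n = φ (N - n) := if_pos h
    refine (congrArg (fun f => (extend f).1 x) h1).trans ((extend_restrict_gen _ x).trans ?_)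
    exact (congrArg (fun f => (extend f).1 (c.tau2 x)) h2).symm
  · have h1 : psi' c φ n = 0 := if_neg h
    have h2 : relCochain φ n = 0 := if_neg h
    refine (congrArg (fun f => (extend f).1 x) h1).trans ((extend_zero x).trans ?_)
    exact ((congrArg (fun f => (extend f).1 (c.tau2 x)) h2).trans (extend_zero _)).symm

private theorem sq_tmul (ψ : ℕ → R.Cochain2) (n : ℕ) (a b d : R.plus) :
    R.sq ψ n (BT.tmul k a (BT.tmul k b d)) = ∑ i ∈ Finset.Icc 1 n,
      (ψ i (BT.tmul k a (R.bar (ψ (n + 1 - i) (BT.tmul k b d)))) -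
        ψ i (BT.tmul k (R.bar (ψ (n + 1 - i) (BT.tmul k a b))) d)) :=
  BiHom.sum_apply _ _ _

private theorem sq_congr {ψ ψ' : ℕ → R.Cochain2} {n : ℕ} (h : ∀ i, 1 ≤ i → i ≤ n → ψ i = ψ' i) :
    R.sq ψ n = R.sq ψ' n := by
  refine Finset.sum_congr rfl fun i hi => ?_
  have hi' := Finset.mem_Icc.1 hi
  rw [h i hi'.1 hi'.2, h (n + 1 - i) (by omega) (by omega)]

/-- The map `(ψ'_n)^~ ∘ b̄₃ + sq(ψ₁, …, ψ_{n-1})^~`. -/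
def obstruction (c : R.Comparison) (φ : ℕ → BiHom k R.rel R.Alg) (n : ℕ) :
    BiHom R.Alg R.C3 R.Alg :=
  (extend (psi' c φ n)).comp R.b3 + extend (R.sq (psi c φ) (n - 1))

private theorem obstruction_apply (c : R.Comparison) (φ : ℕ → BiHom k R.rel R.Alg) (n : ℕ) (x : R.C3) :
    obstruction c φ n x = extend (relCochain φ n) (c.tau2 (R.b3 x)) +
      extend (R.sq (psi c φ) (n - 1)) x :=
  congrArg (· + extend (R.sq (psi c φ) (n - 1)) x) (extend_psi' c φ n (R.b3 x))

/-- The recursion step defining `ψ_n`, as a function of `sq(ψ₁, …, ψ_{n-1})`. -/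
def psiStep (c : R.Comparison) (φ : ℕ → BiHom k R.rel R.Alg) (n : ℕ) (f : BiHom k R.plus3 R.Alg) :
    R.Cochain2 :=
  psi' c φ n - (restrict (((extend (psi' c φ n)).comp R.b3 + extend f).comp c.s2)).comp
    (gen k R.Alg R.plus2)

/-- The recursion feeds `sq` a family cut off at the current index; the cut is harmless because `sq`
only uses smaller indices. -/
private theorem psi_add_two (c : R.Comparison) (φ : ℕ → BiHom k R.rel R.Alg) (j : ℕ) :
    psi c φ (j + 2) = psiStep c φ (j + 2) (R.sq (psi c φ) (j + 1)) :=
  (psi.eq_3 c φ j).trans (congrArg (psiStep c φ (j + 2))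
    (sq_congr fun _ _ hi => dif_pos (Nat.lt_succ_of_le hi)))

private theorem obstruction_eq_zero (c : R.Comparison) (φ : ℕ → BiHom k R.rel R.Alg) {n : ℕ} {x : R.C3}
    (h1 : c.tau2 (R.b3 x) = 0) (h2 : extend (R.sq (psi c φ) (n - 1)) x = 0) :
    obstruction c φ n x = 0 :=
  (obstruction_apply c φ n x).trans ((congrArg₂ (· + ·)
    ((congrArg (extend (relCochain φ n)).1 h1).trans (map_zero _)) h2).trans (add_zero 0))

private theorem extend_psi (c : R.Comparison) (φ : ℕ → BiHom k R.rel R.Alg) {n : ℕ} (hn : 2 ≤ n)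
    (x : R.C2) : extend (psi c φ n) x =
      extend (psi' c φ n) x - obstruction c φ n (c.s2 x) := by
  obtain ⟨j, rfl⟩ := Nat.exists_eq_add_of_le' hn
  exact (congrArg (fun f => (extend f).1 x) (psi_add_two c φ j)).trans
    (extend_sub_restrict_gen _ ((obstruction c φ (j + 2)).comp c.s2) x)

private theorem psi_of_lt_two (c : R.Comparison) (φ : ℕ → BiHom k R.rel R.Alg) {n : ℕ} (h1 : 1 ≤ n)
    (h2 : n < 2) : psi c φ n = psi' c φ n := by
  obtain rfl : n = 1 := by omega
  exact psi.eq_2 c φ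

private theorem extend_psi_of_obstruction (c : R.Comparison) (φ : ℕ → BiHom k R.rel R.Alg) {n : ℕ}
    (hn : 1 ≤ n) {x : R.C2} (h : obstruction c φ n (c.s2 x) = 0) :
    extend (psi c φ n) x = extend (psi' c φ n) x :=
  if h2 : 2 ≤ n then (extend_psi c φ h2 x).trans
    ((congrArg (extend (psi' c φ n) x - ·) h).trans (sub_zero _))
  else congrArg (fun f => (extend f).1 x) (psi_of_lt_two c φ hn (not_le.1 h2))

private theorem psi_gen (ψ : R.Cochain2) (x y : TV k V) :
    extend ψ (R.bar2 x y) = ψ (BT.tmul k (R.cls x) (R.cls y)) := extend_gen _ _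

section Ins2

variable (F : BiHom k R.plus3 R.Alg)

private theorem extend_ins2_par_mul_ι (a : R.plus) (x : TV k V) (v : V) :
    extend F (R.ins2 (BT.tmul k a (R.par (x * TV.ι v)))) =
      F (BT.tmul k a (BT.tmul k (R.cls x) (R.vIncl v))) +
        extend F (R.ins2 (BT.tmul k a (R.par x))) * R.toAlg (TV.ι v) :=
  (congrArg (extend F).1 (R.ins2_par_mul_ι a x v)).trans ((map_add (extend F).1 _ _).trans
    (congrArg₂ (· + ·) (extend_gen _ _) ((extend F).map_op_smul _ _)))

/-- Peeling off letters from the right writes `ins2 (a ⊗ par x)` as a sum of terms `1|a|x'|v|1`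
multiplied on the right, where `x'` is a proper prefix of `x`. -/
private theorem extend_ins2_par_eq_zero {a : R.plus} {q : ℕ}
    (h : ∀ j < q, ∀ x ∈ TV.tpow k V j, ∀ v,
      F (BT.tmul k a (BT.tmul k (R.cls x) (R.vIncl v))) = 0) {x : TV k V}
    (hx : x ∈ TV.tpow k V q) : extend F (R.ins2 (BT.tmul k a (R.par x))) = 0 := by
  let E : TV k V →+ R.Alg := (extend F).1.comp (R.ins2.1.comp ((BT.tmulHom k a).comp R.par.1))
  change E x = 0
  have hE : ∀ y v, E (y * TV.ι v) = F (BT.tmul k a (BT.tmul k (R.cls y) (R.vIncl v))) +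
      E y * R.toAlg (TV.ι v) := extend_ins2_par_mul_ι F a
  have h0 : ∀ y ∈ TV.tpow k V 0, E y = 0 := fun y hy =>
    (congrArg ((extend F).1.comp (R.ins2.1.comp (BT.tmulHom k a))) (R.par_of_mem_zero hy)).trans
      (map_zero _)
  clear_value E
  induction q generalizing x with
  | zero => exact h0 x hx
  | succ q ih =>
    obtain ⟨m, y, v, hy, rfl⟩ := TV.exists_sum_right hx
    rw [map_sum]
    refine Finset.sum_eq_zero fun i _ => ?_
    rw [hE, h q (by omega) _ (hy i), ih (fun j hj => h j (by omega)) (hy i), zero_mul, add_zero]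

end Ins2

/-- The cochains `ψ_j` with `1 ≤ j ≤ n` are normalized. -/
def NormalizedUpTo (ψ : ℕ → R.Cochain2) (n : ℕ) : Prop :=
  ∀ j, 1 ≤ j → j ≤ n → ∀ p q, p + q < N → ∀ a ∈ R.plusComp p, ∀ b ∈ R.plusComp q,
    ψ j (BT.tmul k a b) = 0

/-- Each inner cochain of `sq` sees two neighbouring arguments of total degree below `N`. -/
private theorem sq_tmul_eq_zero {ψ : ℕ → R.Cochain2} {n : ℕ} (hψ : NormalizedUpTo ψ n) {p j q : ℕ}
    (hp : p + j < N) (hq : j + q < N) {a b d : R.plus} (ha : a ∈ R.plusComp p)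
    (hb : b ∈ R.plusComp j) (hd : d ∈ R.plusComp q) :
    R.sq ψ n (BT.tmul k a (BT.tmul k b d)) = 0 := by
  rw [sq_tmul]
  refine Finset.sum_eq_zero fun i hi => ?_
  have hi' := Finset.mem_Icc.1 hi
  rw [hψ _ (by omega) (by omega) j q hq b hb d hd, hψ _ (by omega) (by omega) p j hp a ha b hb,
    map_zero R.bar.1, BT.tmul_zero, BT.zero_tmul, map_zero (ψ i).1, sub_zero]

/-- The prefixes of `x` that occur have degree at most `q - 1`, so `p + q = N` is allowed. This is
what makes the lemma applicable to relation decompositions. -/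
private theorem sq_ins2_par {ψ : ℕ → R.Cochain2} {n : ℕ} (hψ : NormalizedUpTo ψ n) {p q : ℕ}
    (hpq : p + q ≤ N) (hq : q < N) {a : R.plus} (ha : a ∈ R.plusComp p) {x : TV k V}
    (hx : x ∈ TV.tpow k V q) : extend (R.sq ψ n) (R.ins2 (BT.tmul k a (R.par x))) = 0 :=
  extend_ins2_par_eq_zero _ (fun _ hj _ hy v => sq_tmul_eq_zero hψ (by omega) (q := 1) (by omega) ha
    (R.cls_mem hy) (R.vIncl_mem v)) hx

namespace Comparison

variable (c : R.Comparison)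

/-- Apply `τ̄₂` to the homotopy identity; by `τ̄₂ σ̄₂ = id` the right hand side vanishes. -/
private theorem tau2_b3_s2 (x : R.C2) : c.tau2 (R.b3 (c.s2 x)) = - c.tau2 (c.s1 (R.b2 x)) := by
  have h := congrArg c.tau2.1 (c.homotopy.2 x)
  have h1 := ((map_add c.tau2.1 _ _).symm.trans h).trans ((map_sub c.tau2.1 _ _).trans
    (sub_eq_zero.2 (c.tau2_sigma2 (c.tau2 x)).symm))
  exact eq_neg_of_add_eq_zero_left h1

private theorem tau2_s1_bar1 {n : ℕ} (hn : n < N) {x : TV k V} (hx : x ∈ TV.tpow k V n) :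
    c.tau2 (c.s1 (R.bar1 x)) = 0 :=
  (congrArg c.tau2.1 (c.s_values.1 n hn x hx)).trans ((map_neg c.tau2.1 _).trans
    (neg_eq_zero.2 (c.tau2_ins_par hn hx)))

private theorem tau2_b3_s2_bar2_of_ne {p q : ℕ} (hp : p < N) (hq : q < N) (hp0 : p ≠ 0) (hq0 : q ≠ 0)
    {x y : TV k V} (hx : x ∈ TV.tpow k V p) (hy : y ∈ TV.tpow k V q) :
    c.tau2 (R.b3 (c.s2 (R.bar2 x y))) = c.tau2 (c.s1 (R.bar1 (x * y))) := by
  have h := R.b2_bar2 (TV.aug_of_mem hp0 hx) (TV.aug_of_mem hq0 hy)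
  have h1 : c.tau2 (c.s1 (R.toAlg x • R.bar1 y)) = 0 :=
    ((c.tau2.comp c.s1).map_smul _ _).trans ((congrArg _ (c.tau2_s1_bar1 hq hy)).trans (smul_zero _))
  have h2 : c.tau2 (c.s1 (op (R.toAlg y) • R.bar1 x)) = 0 :=
    ((c.tau2.comp c.s1).map_op_smul _ _).trans
      ((congrArg _ (c.tau2_s1_bar1 hp hx)).trans (smul_zero _))
  have h3 : c.tau2 (c.s1 (R.b2 (R.bar2 x y))) = - c.tau2 (c.s1 (R.bar1 (x * y))) :=
    (congrArg (c.tau2.comp c.s1).1 h).trans ((map_add (c.tau2.comp c.s1).1 _ _).trans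
      ((congrArg₂ (· + ·) ((map_sub (c.tau2.comp c.s1).1 _ _).trans
        (congrArg (· - c.tau2 (c.s1 (R.bar1 (x * y)))) h1)) h2).trans
        ((add_zero _).trans (zero_sub _))))
  exact (c.tau2_b3_s2 _).trans (neg_eq_iff_eq_neg.2 h3)

private theorem tau2_b3_s2_of_eq_zero {x : R.C2} (h : x = 0) : c.tau2 (R.b3 (c.s2 x)) = 0 :=
  (congrArg (c.tau2.1.comp (R.b3.1.comp c.s2.1)) h).trans (map_zero _)

private theorem tau2_b3_s2_bar2 {p q : ℕ} (hp : p < N) (hq : q < N) {x y : TV k V}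
    (hx : x ∈ TV.tpow k V p) (hy : y ∈ TV.tpow k V q) :
    c.tau2 (R.b3 (c.s2 (R.bar2 x y))) = c.tau2 (c.s1 (R.bar1 (x * y))) :=
  if hp0 : p = 0 then
    (c.tau2_b3_s2_of_eq_zero (R.bar2_of_mem_zero_left (hp0 ▸ hx) y)).trans
      (c.tau2_s1_bar1 (n := p + q) (by omega) (TV.mul_mem hx hy)).symm
  else if hq0 : q = 0 then
    (c.tau2_b3_s2_of_eq_zero (R.bar2_of_mem_zero_right (hq0 ▸ hy) x)).trans
      (c.tau2_s1_bar1 (n := p + q) (by omega) (TV.mul_mem hx hy)).symm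
  else c.tau2_b3_s2_bar2_of_ne hp hq hp0 hq0 hx hy

variable (φ : ℕ → BiHom k R.rel R.Alg)

/-- The prescribed value of `s₂` reduces the `sq` part to `sq_ins2_par`, and the other part is `τ̄₂
s₁` of a product of degree below `N`. Hence the correction in the recursion leaves `ψ'_n` unchanged
on these elements. -/
private theorem obstruction_s2_bar2 {n : ℕ} (hψ : NormalizedUpTo (psi c φ) (n - 1)) {p q : ℕ}
    (hpq : p + q < N) {x y : TV k V} (hx : x ∈ TV.tpow k V p) (hy : y ∈ TV.tpow k V q) :
    obstruction c φ n (c.s2 (R.bar2 x y)) = 0 := by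
  have h1 : c.tau2 (R.b3 (c.s2 (R.bar2 x y))) = 0 :=
    (c.tau2_b3_s2_bar2 (by omega) (by omega) hx hy).trans (c.tau2_s1_bar1 hpq (TV.mul_mem hx hy))
  have h2 : extend (R.sq (psi c φ) (n - 1)) (c.s2 (R.bar2 x y)) = 0 :=
    (congrArg (extend (R.sq (psi c φ) (n - 1))).1 (c.s_values.2.1 p q hpq x hx y hy)).trans
      (sq_ins2_par hψ hpq.le (by omega) (R.cls_mem hx) hy)
  exact obstruction_eq_zero c φ h1 h2

/-- The `sq` part vanishes term by term. The other part vanishes only in the sum, since `∑ αᵢ βᵢ` is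
zero in `A`. So `ψ_n` and `ψ'_n` also agree on relation decompositions. -/
private theorem obstruction_s2_relDecomp {n : ℕ} (hψ : NormalizedUpTo (psi c φ) (n - 1))
    (d : R.RelDecomp) :
    obstruction c φ n (c.s2 (∑ i, R.bar2 (d.α i) (d.β i))) = 0 := by
  have h1 : c.tau2 (R.b3 (c.s2 (∑ i, R.bar2 (d.α i) (d.β i)))) = 0 := by
    refine (map_sum (c.tau2.1.comp (R.b3.1.comp c.s2.1)) _ _).trans ?_
    refine (Finset.sum_congr rfl fun i _ => c.tau2_b3_s2_bar2 (d.p_lt i) (d.q_lt i) (d.α_mem i)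
      (d.β_mem i)).trans ?_
    refine (map_sum (c.tau2.1.comp c.s1.1) _ _).symm.trans ?_
    refine (congrArg (c.tau2.1.comp c.s1.1) ((R.bar1_sum _ _).symm.trans
      (R.bar1_eq_zero d.mem))).trans (map_zero _)
  have h2 : extend (R.sq (psi c φ) (n - 1)) (c.s2 (∑ i, R.bar2 (d.α i) (d.β i))) = 0 := by
    refine (congrArg (extend (R.sq (psi c φ) (n - 1))).1 (c.s_values.2.2 d)).trans ?_
    refine (map_sum ((extend (R.sq (psi c φ) (n - 1))).1.comp R.ins2.1) _ _).trans
      (Finset.sum_eq_zero fun i _ => ?_)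
    exact sq_ins2_par hψ (d.add_eq i).le (d.q_lt i) (R.cls_mem (d.α_mem i)) (d.β_mem i)
  exact obstruction_eq_zero c φ h1 h2

private theorem psi'_bar2 (n : ℕ) {p q : ℕ} (hpq : p + q < N) {x y : TV k V} (hx : x ∈ TV.tpow k V p)
    (hy : y ∈ TV.tpow k V q) : extend (psi' c φ n) (R.bar2 x y) = 0 :=
  (extend_psi' c φ n _).trans ((congrArg (extend (relCochain φ n)).1
    (c.tau_values.2.1 p q hpq x hx y hy)).trans (map_zero _))

/-- The cochains `ψ_j` are normalized. -/
private theorem normalized_psi : R.Normalized (psi c φ) := by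
  -- The normalization of `ψ_n` uses that of all earlier cochains, which enter through `sq`; hence
  -- an induction over initial segments.
  suffices ∀ n, NormalizedUpTo (psi c φ) n from fun j h1 => this j j h1 le_rfl
  intro n
  induction n with
  | zero => intro j h1 h2; omega
  | succ n ih =>
    intro j h1 h2 p q hpq a ha b hb
    rcases Nat.lt_or_ge n j with hj | hj
    · obtain rfl : j = n + 1 := by omega
      obtain ⟨x, hx, rfl⟩ := R.exists_cls_of_mem ha
      obtain ⟨y, hy, rfl⟩ := R.exists_cls_of_mem hb
      rw [← psi_gen]
      exact (extend_psi_of_obstruction c φ h1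
        (c.obstruction_s2_bar2 φ (n := n + 1) ih hpq hx hy)).trans (c.psi'_bar2 φ (n + 1) hpq hx hy)
    · exact ih j h1 hj p q hpq a ha b hb

private theorem normalizedUpTo_psi (n : ℕ) : NormalizedUpTo (psi c φ) n :=
  fun j h1 _ => c.normalized_psi φ j h1

/-- The values of the cochains `ψ_n` on relation decompositions. -/
private theorem psi_relDecomp {n : ℕ} (hn : 1 ≤ n) (d : R.RelDecomp) :
    psi c φ n (∑ i, BT.tmul k (R.cls (d.α i)) (R.cls (d.β i))) =
      relCochain φ n ⟨∑ i, d.α i * d.β i, d.mem⟩ := by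
  have h1 : extend (psi' c φ n) (∑ i, R.bar2 (d.α i) (d.β i)) =
      relCochain φ n ⟨∑ i, d.α i * d.β i, d.mem⟩ :=
    (extend_psi' c φ n _).trans ((congrArg (extend (relCochain φ n)).1
      (c.tau_values.2.2 d)).trans (extend_gen _ _))
  have h2 : extend (psi c φ n) (∑ i, R.bar2 (d.α i) (d.β i)) =
      psi c φ n (∑ i, BT.tmul k (R.cls (d.α i)) (R.cls (d.β i))) :=
    (congrArg (extend (psi c φ n)).1 (R.sum_bar2 _ _ _)).trans (extend_gen _ _)
  exact h2.symm.trans ((extend_psi_of_obstruction c φ hn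
    (c.obstruction_s2_relDecomp φ (c.normalizedUpTo_psi φ _) d)).trans h1)

end Comparison
end HomRel

end PBW

/-! ### Degrees of the cochains, and local finiteness of the family `ψ_n`. -/

namespace PBW

universe u v w

set_option linter.unusedSectionVars false

variable {k : Type u} [Ring k] {V : Type v} [AddCommGroup V] [Module k V] [Module kᵐᵒᵖ V]
  [SMulCommClass k kᵐᵒᵖ V] {N : ℕ} (R : HomRel k V N)

namespace HomRel

/-- The target in `A` of the elements of degree `d`, under a homomorphism of degree `-n`. -/
def dropComp (n d : ℕ) : AddSubgroup R.Alg := if n ≤ d then R.comp (d - n) else ⊥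

private theorem mem_dropComp_of_add {n d e : ℕ} (h : e + n = d) {a : R.Alg} (ha : a ∈ R.comp e) :
    a ∈ R.dropComp n d := by
  rw [dropComp, if_pos (by omega), ← h, Nat.add_sub_cancel]
  exact ha

private theorem eq_zero_of_mem_dropComp {n d : ℕ} (h : d < n) {a : R.Alg} (ha : a ∈ R.dropComp n d) :
    a = 0 := by
  rw [dropComp, if_neg (by omega)] at ha
  exact ha

private theorem mem_comp_of_mem_dropComp {n d : ℕ} (h : n ≤ d) {a : R.Alg} (ha : a ∈ R.dropComp n d) :
    a ∈ R.comp (d - n) := by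
  rwa [dropComp, if_pos h] at ha

private theorem mul_mem_dropComp (n i d : ℕ) (a : R.Alg) (ha : a ∈ R.comp i) (x : R.Alg)
    (hx : x ∈ R.dropComp n d) : a * x ∈ R.dropComp n (i + d) := by
  rcases Nat.lt_or_ge d n with h | h
  · rw [R.eq_zero_of_mem_dropComp h hx, mul_zero]; exact zero_mem _
  · exact R.mem_dropComp_of_add (e := i + (d - n)) (by omega)
      (R.mul_mem_comp ha (R.mem_comp_of_mem_dropComp h hx))

private theorem mul_mem_dropComp_right (n i d : ℕ) (a : R.Alg) (ha : a ∈ R.comp i) (x : R.Alg)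
    (hx : x ∈ R.dropComp n d) : x * a ∈ R.dropComp n (d + i) := by
  rcases Nat.lt_or_ge d n with h | h
  · rw [R.eq_zero_of_mem_dropComp h hx, zero_mul]; exact zero_mem _
  · exact R.mem_dropComp_of_add (e := d - n + i) (by omega)
      (R.mul_mem_comp (R.mem_comp_of_mem_dropComp h hx) ha)

private theorem extend_mem_dropComp {W : Type*} [AddCommGroup W] [Module k W] [Module kᵐᵒᵖ W]
    [SMulCommClass k kᵐᵒᵖ W] {G : ℕ → AddSubgroup W} {n : ℕ} (f : BiHom k W R.Alg)
    (hf : ∀ d, ∀ w ∈ G d, f w ∈ R.dropComp n d) (d : ℕ) (x : FB k R.Alg W)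
    (hx : x ∈ R.freeComp G d) : extend f x ∈ R.dropComp n d :=
  R.extend_mem (H := R.dropComp n) (R.mul_mem_dropComp n) (R.mul_mem_dropComp_right n) f hf d x hx

variable {R}

private theorem relCochain_mem {φ : ℕ → BiHom k R.rel R.Alg} (hφ : ∀ j < N, ∀ r, φ j r ∈ R.comp j) (n : ℕ)
    (r : R.rel) : relCochain φ n r ∈ R.dropComp n N := by
  by_cases h : 1 ≤ n ∧ n ≤ N
  · have h2 : relCochain φ n = φ (N - n) := if_pos h
    rw [h2]
    exact R.mem_dropComp_of_add (e := N - n) (by omega) (hφ _ (by omega) r)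
  · have h2 : relCochain φ n = 0 := if_neg h
    rw [h2]
    exact zero_mem _

private theorem extend_relCochain_mem {φ : ℕ → BiHom k R.rel R.Alg}
    (hφ : ∀ j < N, ∀ r, φ j r ∈ R.comp j) (n d : ℕ) (x : R.K2) (hx : x ∈ R.K2Comp d) :
    extend (relCochain φ n) x ∈ R.dropComp n d := by
  refine R.extend_mem_dropComp (G := concentrated R.rel N) _ (fun d r hr => ?_) d x hx
  rcases eq_or_ne d N with rfl | hd
  · exact relCochain_mem hφ n r
  · rw [eq_zero_of_concentrated hd hr, map_zero (relCochain φ n).1]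
    exact zero_mem _

/-- The cochains `ψ_j` with `1 ≤ j ≤ n` are homogeneous of degree `-j`. -/
def DropUpTo (ψ : ℕ → R.Cochain2) (n : ℕ) : Prop :=
  ∀ j, 1 ≤ j → j ≤ n → ∀ d, ∀ w ∈ R.plus2Comp d, ψ j w ∈ R.dropComp j d

/-- Degrees are natural numbers, so the cases in which the inner or the outer value would have
negative degree, and is therefore zero, are split off. -/
private theorem dropUpTo_comp_left {f g : R.Cochain2} {p q n : ℕ} (h : p + q = n)
    (hf : ∀ d, ∀ w ∈ R.plus2Comp d, f w ∈ R.dropComp p d)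
    (hg : ∀ d, ∀ w ∈ R.plus2Comp d, g w ∈ R.dropComp q d) {i d : ℕ} {a : R.plus}
    (ha : a ∈ R.plusComp i) {w : R.plus2} (hw : w ∈ R.plus2Comp d) :
    f (BT.tmul k a (R.bar (g w))) ∈ R.dropComp n (i + d) := by
  have h1 := hg d w hw
  rcases Nat.lt_or_ge d q with hd | hd
  · have h2 : BT.tmul k a (R.bar (g w)) = 0 := by
      rw [R.eq_zero_of_mem_dropComp hd h1, map_zero R.bar.1, BT.tmul_zero]
    rw [h2, map_zero f.1]
    exact zero_mem _
  · have h2 := hf (i + (d - q)) _ (BT.tmul_mem_grading rfl ha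
      (R.bar_mem (R.mem_comp_of_mem_dropComp hd h1)))
    rcases Nat.lt_or_ge (i + (d - q)) p with hp | hp
    · rw [R.eq_zero_of_mem_dropComp hp h2]
      exact zero_mem _
    · exact R.mem_dropComp_of_add (by omega) (R.mem_comp_of_mem_dropComp hp h2)

private theorem dropUpTo_comp_right {f g : R.Cochain2} {p q n : ℕ} (h : p + q = n)
    (hf : ∀ d, ∀ w ∈ R.plus2Comp d, f w ∈ R.dropComp p d)
    (hg : ∀ d, ∀ w ∈ R.plus2Comp d, g w ∈ R.dropComp q d) {i d : ℕ} {a : R.plus}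
    (ha : a ∈ R.plusComp i) {w : R.plus2} (hw : w ∈ R.plus2Comp d) :
    f (BT.tmul k (R.bar (g w)) a) ∈ R.dropComp n (d + i) := by
  have h1 := hg d w hw
  rcases Nat.lt_or_ge d q with hd | hd
  · have h2 : BT.tmul k (R.bar (g w)) a = 0 := by
      rw [R.eq_zero_of_mem_dropComp hd h1, map_zero R.bar.1, BT.zero_tmul]
    rw [h2, map_zero f.1]
    exact zero_mem _
  · have h2 := hf (d - q + i) _ (BT.tmul_mem_grading rfl
      (R.bar_mem (R.mem_comp_of_mem_dropComp hd h1)) ha)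
    rcases Nat.lt_or_ge (d - q + i) p with hp | hp
    · rw [R.eq_zero_of_mem_dropComp hp h2]
      exact zero_mem _
    · exact R.mem_dropComp_of_add (by omega) (R.mem_comp_of_mem_dropComp hp h2)

private theorem sq_mem {ψ : ℕ → R.Cochain2} {n : ℕ} (hψ : DropUpTo ψ n) (d : ℕ) (w : R.plus3)
    (hw : w ∈ R.plus3Comp d) : R.sq ψ n w ∈ R.dropComp (n + 1) d := by
  refine R.plus3_induction (S := (R.dropComp (n + 1) d).comap (R.sq ψ n).1)
    (fun i j l hd a ha b hb e he => ?_) hw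
  refine (congrArg (· ∈ R.dropComp (n + 1) d) (sq_tmul ψ n a b e)).mpr ?_
  refine sum_mem fun p hp => ?_
  have hp' := Finset.mem_Icc.1 hp
  have h1 := dropUpTo_comp_left (n := n + 1) (by omega) (hψ p hp'.1 hp'.2)
    (hψ (n + 1 - p) (by omega) (by omega)) ha (BT.tmul_mem_grading rfl hb he)
  have h2 := dropUpTo_comp_right (n := n + 1) (by omega) (hψ p hp'.1 hp'.2)
    (hψ (n + 1 - p) (by omega) (by omega)) he (BT.tmul_mem_grading rfl ha hb)
  rw [show i + (j + l) = d by omega] at h1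
  rw [show i + j + l = d by omega] at h2
  exact sub_mem h1 h2

namespace Comparison

variable (c : R.Comparison) (φ : ℕ → BiHom k R.rel R.Alg)

private theorem obstruction_mem (hφ : ∀ j < N, ∀ r, φ j r ∈ R.comp j) {n : ℕ} (hn : 1 ≤ n)
    (hψ : DropUpTo (psi c φ) (n - 1)) (d : ℕ) (x : R.C3) (hx : x ∈ R.C3Comp d) :
    obstruction c φ n x ∈ R.dropComp n d := by
  refine (congrArg (· ∈ R.dropComp n d) (obstruction_apply c φ n x)).mpr (add_mem ?_ ?_)
  · exact extend_relCochain_mem hφ n d _ (c.graded.2.1 d _ (R.b3_mem d x hx))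
  · have h := R.extend_mem_dropComp (R.sq (psi c φ) (n - 1)) (sq_mem hψ) d x hx
    rwa [Nat.sub_add_cancel hn] at h

/-- The cochains `ψ_n` are homogeneous of degree `-n`. -/
private theorem psi_mem (hφ : ∀ j < N, ∀ r, φ j r ∈ R.comp j) {n : ℕ} (hn : 1 ≤ n) (d : ℕ) (w : R.plus2)
    (hw : w ∈ R.plus2Comp d) : psi c φ n w ∈ R.dropComp n d := by
  induction n using Nat.strong_induction_on generalizing d w with
  | _ n ih =>
    have hψ : DropUpTo (psi c φ) (n - 1) := fun j h1 h2 d w hw => ih j (by omega) h1 d w hw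
    have hg : gen k R.Alg R.plus2 w ∈ R.C2Comp d := R.gen_mem_freeComp hw
    have h' : extend (psi' c φ n) (gen k R.Alg R.plus2 w) ∈ R.dropComp n d :=
      (congrArg (· ∈ R.dropComp n d) (extend_psi' c φ n _)).mpr
        (extend_relCochain_mem hφ n d _ (c.graded.2.1 d _ hg))
    refine (congrArg (· ∈ R.dropComp n d) (extend_gen (A := R.Alg) (psi c φ n) w)).mp ?_
    rcases Nat.lt_or_ge n 2 with h2 | h2
    · exact (congrArg (fun f : R.Cochain2 => extend f (gen k R.Alg R.plus2 w) ∈ R.dropComp n d)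
        (psi_of_lt_two c φ hn h2)).mpr h'
    · exact (congrArg (· ∈ R.dropComp n d) (extend_psi c φ h2 _)).mpr
        (sub_mem h' (c.obstruction_mem φ hφ hn hψ d _ (c.graded.2.2.2 d _ hg)))

/-- For given arguments, only finitely many `ψ_n` have nonzero values. -/
private theorem exists_psi_eq_zero (hφ : ∀ j < N, ∀ r, φ j r ∈ R.comp j) (w : R.plus2) :
    ∃ B, 1 ≤ B ∧ ∀ n, B ≤ n → psi c φ n w = 0 := by
  let S : AddSubgroup R.plus2 :=
    { carrier := {w | ∃ B, 1 ≤ B ∧ ∀ n, B ≤ n → psi c φ n w = 0}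
      zero_mem' := ⟨1, le_rfl, fun n _ => map_zero (psi c φ n).1⟩
      add_mem' := by
        rintro x y ⟨B, h1, hB⟩ ⟨B', h1', hB'⟩
        refine ⟨max B B', le_max_of_le_left h1, fun n hn => ?_⟩
        rw [BiHom.map_add, hB n (le_trans (le_max_left _ _) hn),
          hB' n (le_trans (le_max_right _ _) hn), add_zero]
      neg_mem' := by
        rintro x ⟨B, h1, hB⟩
        refine ⟨B, h1, fun n hn => ?_⟩
        exact (map_neg (psi c φ n).1 x).trans (neg_eq_zero.2 (hB n hn)) }
  -- On elements of degree `d`, `ψ_n` would land in degree `d - n`, so it vanishes from `n = d + 1`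
  -- on.
  have hS : S = ⊤ := R.plus2_eq_top S fun d w hw => ⟨d + 1, by omega, fun n hn =>
    R.eq_zero_of_mem_dropComp (by omega) (c.psi_mem φ hφ (by omega) d w hw)⟩
  have : w ∈ S := hS ▸ AddSubgroup.mem_top w
  exact this

end Comparison
end HomRel

end PBW

/-! ### Additive maps defined on the first or last letter of a tensor. -/

namespace PBW

universe u v w

set_option linter.unusedSectionVars false

variable {k : Type u} [Ring k] {V : Type v} [AddCommGroup V] [Module k V] [Module kᵐᵒᵖ V]
  [SMulCommClass k kᵐᵒᵖ V] {N : ℕ} (R : HomRel k V N)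

/-- The zero relations of degree `2`. -/
def HomRel.zero (k : Type u) [Ring k] (V : Type v) [AddCommGroup V] [Module k V]
    [Module kᵐᵒᵖ V] : HomRel k V 2 where
  rel :=
    { toAddSubgroup := ⊥
      smul_mem' := by
        rintro c _ rfl
        exact smul_zero c
      op_smul_mem' := by
        rintro c _ rfl
        exact smul_zero (op c) }
  two_le := le_rfl
  le := by
    rintro _ rfl
    exact zero_mem _

private theorem HomRel.zero_toAlg_bijective : Function.Bijective (HomRel.zero k V).toAlg := by
  refine ⟨(injective_iff_map_eq_zero _).2 fun x hx => ?_, pmk_surjective _⟩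
  exact map_eq_zero_of_mem_idealOf (RingHom.id _) (fun y hy => hy) x ((pmk_eq_zero_iff _ _).1 hx)

/-- Splitting off the last factor of elements of the tensor algebra. -/
private theorem TV.exists_addHom_mul_ι {X : Type*} [AddCommGroup X] (f : BT k (TV k V) V →+ X) :
    ∃ L : TV k V →+ X, ∀ x v, L (x * TV.ι v) = f (BT.tmul k x v) := by
  -- Without relations the algebra is `T_k V` itself, so `par` takes values in `T_k V ⊗ V ⊗ T_k V`.
  -- Augmenting the right factor keeps only the term whose distinguished letter is the last one,
  -- which shows that the splitting is well defined.
  let Z := HomRel.zero k V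
  let e : TV k V ≃+* Z.Alg := RingEquiv.ofBijective Z.toAlg HomRel.zero_toAlg_bijective
  have he : ∀ x, e.symm (Z.toAlg x) = x := e.symm_apply_apply
  have hu : ∀ c : k, e.symm (KAlg.unit c) = KAlg.unit c := fun c => he (KAlg.unit c)
  let g : Z.Alg → BT k V Z.Alg →+ X := fun x =>
    BT.lift (fun v b => f (BT.tmul k (e.symm x) (op (Z.aug b) • v)))
      (by intros; rw [smul_add, BT.tmul_add, map_add])
      (by intros; rw [map_add, op_add, add_smul, BT.tmul_add, map_add])
      (by intro v d b; rw [KAlg.smul_def, map_mul, Z.aug_unit, op_mul, mul_smul])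
  have hg : ∀ x v b, g x (BT.tmul k v b) = f (BT.tmul k (e.symm x) (op (Z.aug b) • v)) :=
    fun _ _ _ => rfl
  let L : FB k Z.Alg V →+ X := BT.lift (fun x y => g x y)
    (by
      intro x x' y
      refine DFunLike.congr_fun (BT.addHom_ext (f := g (x + x')) (g := g x + g x') fun v b => ?_) y
      rw [AddMonoidHom.add_apply, hg, hg, hg, map_add, BT.add_tmul, map_add])
    (by intros; rw [map_add])
    (by
      intro x d y
      refine DFunLike.congr_fun (BT.addHom_ext (f := g (op d • x))
        (g := (g x).comp (smulHom d)) fun v b => ?_) y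
      rw [AddMonoidHom.comp_apply, smulHom_apply, BT.smul_tmul_left, hg, hg, KAlg.op_smul_def,
        map_mul, hu, ← KAlg.op_smul_def, BT.smul_tmul, smul_comm])
  have hL : ∀ x v b, L (BT.tmul k x (BT.tmul k v b)) =
      f (BT.tmul k (e.symm x) (op (Z.aug b) • v)) := fun _ _ _ => rfl
  refine ⟨L.comp Z.par.1, fun x v => ?_⟩
  have h0 : L (op (Z.toAlg (TV.ι v)) • Z.par x) = 0 := by
    refine FB.eq_of_tmul (L.comp (smulHom (op (Z.toAlg (TV.ι v))))) 0 (fun a w b => ?_) (Z.par x)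
    change L (BT.tmul k a (BT.tmul k w (b * Z.toAlg (TV.ι v)))) = 0
    rw [hL, map_mul, Z.aug_toAlg, TV.aug_of_mem one_ne_zero (TV.ι_mem v), mul_zero, op_zero,
      zero_smul, BT.tmul_zero, map_zero]
  refine (congrArg L (Z.par_mul_ι x v)).trans ((map_add L _ _).trans ?_)
  refine (congrArg₂ (· + ·) (congrArg L (Z.smul_gen_left (Z.toAlg x) v)) h0).trans
    ((add_zero _).trans ?_)
  rw [hL, he, map_one, op_one, one_smul]

namespace HomRel

/-- Splitting off the first factor of elements of the tensor algebra. -/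
private theorem exists_addHom_ι_mul {X : Type*} [AddCommGroup X] [Module k X] [Module kᵐᵒᵖ X]
    [SMulCommClass k kᵐᵒᵖ X] (f : BiHom k (BT k V R.Alg) X) :
    ∃ G : TV k V →+ X, (∀ (d : k) x, G (op d • x) = op d • G x) ∧
      ∀ v x, G (TV.ι v * x) = f (BT.tmul k v (R.toAlg x)) := by
  -- Augmenting the left factor of `par` keeps only the term whose distinguished letter is the first
  -- one.
  let L : R.K1 →+ X := BT.lift (fun a y => R.aug a • f y)
    (by intros; rw [map_add, add_smul]) (by intros; rw [BiHom.map_add, smul_add])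
    (by
      intro a d y
      rw [KAlg.op_smul_def, map_mul, R.aug_unit, mul_smul, BiHom.map_smul])
  have hL : ∀ a y, L (BT.tmul k a y) = R.aug a • f y := fun _ _ => rfl
  refine ⟨L.comp R.par.1, fun d x => ?_, fun v x => ?_⟩
  · refine (congrArg L (R.par.map_op_smul d x)).trans ?_
    refine DFunLike.congr_fun (BT.addHom_ext (f := L.comp (smulHom (op d)))
      (g := (smulHom (op d)).comp L) fun a y => ?_) (R.par x)
    change L (BT.tmul k a (op d • y)) = op d • L (BT.tmul k a y)
    rw [hL, hL, BiHom.map_op_smul, smul_comm]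
  have h0 : L (R.toAlg (TV.ι v) • R.par x) = 0 := by
    refine FB.eq_of_tmul (L.comp (smulHom (R.toAlg (TV.ι v)))) 0 (fun a w b => ?_) (R.par x)
    change L (BT.tmul k (R.toAlg (TV.ι v) * a) (BT.tmul k w b)) = 0
    rw [hL, map_mul, R.aug_toAlg, TV.aug_of_mem one_ne_zero (TV.ι_mem v), zero_mul, zero_smul]
  refine (congrArg L (R.par_mul (TV.ι v) x)).trans ((map_add L _ _).trans ?_)
  refine (congrArg (· + _) h0).trans ((zero_add _).trans ?_)
  rw [par_ι, gen_apply, op_smul_tmul_tmul, hL, map_one, one_smul, one_mul]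

end HomRel

end PBW

/-! ### The weak PBW conditions, and the cochains next to a relation. -/

namespace PBW

universe u v w

set_option linter.unusedSectionVars false

variable {k : Type u} [Ring k] {V : Type v} [AddCommGroup V] [Module k V] [Module kᵐᵒᵖ V]
  [SMulCommClass k kᵐᵒᵖ V] {N : ℕ} (R : HomRel k V N)

namespace HomRel

variable {R}

/-- The compatibility of the components `φ_j : R → V^{⊗ j}` in a weak PBW-deformation. -/
structure WeakPBW (Φ : ℕ → BiHom k R.rel (TV k V)) : Prop where
  mem : ∀ j < N, ∀ r, Φ j r ∈ TV.tpow k V j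
  compat : ∀ (m n : ℕ) (r : Fin m → R.rel) (u : Fin m → V) (v : Fin n → V) (s : Fin n → R.rel),
    ∑ i, (r i : TV k V) * TV.ι (u i) = ∑ i, TV.ι (v i) * (s i : TV k V) →
    ∀ θ : ℕ → TV k V,
    (∀ j, θ j = ∑ i, Φ j (r i) * TV.ι (u i) - ∑ i, TV.ι (v i) * Φ j (s i)) →
    ∃ h : θ (N - 1) ∈ R.rel, Φ 0 ⟨θ (N - 1), h⟩ = 0 ∧
      ∀ j, 0 < j → j < N → Φ j ⟨θ (N - 1), h⟩ + θ (j - 1) = 0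

/-- The homomorphisms `R → A` given by homomorphisms `R → T_k V`. -/
abbrev algCochain (Φ : ℕ → BiHom k R.rel (TV k V)) (j : ℕ) : BiHom k R.rel R.Alg :=
  (pmkHom _).comp (Φ j)

private theorem algCochain_apply (Φ : ℕ → BiHom k R.rel (TV k V)) (j : ℕ) (r : R.rel) :
    algCochain Φ j r = R.toAlg (Φ j r) := rfl

private theorem WeakPBW.algCochain_mem {Φ : ℕ → BiHom k R.rel (TV k V)} (h : WeakPBW Φ) (j : ℕ)
    (hj : j < N) (r : R.rel) : algCochain Φ j r ∈ R.comp j := R.toAlg_mem (h.mem j hj r)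

private theorem exists_sum_right_rel (r : R.rel) : ∃ (m : ℕ) (x : Fin m → TV k V) (v : Fin m → V),
    (∀ i, x i ∈ TV.tpow k V (N - 1)) ∧ (r : TV k V) = ∑ i, x i * TV.ι (v i) := by
  have hN := R.two_le
  refine TV.exists_sum_right ?_
  rw [Nat.sub_add_cancel (show 1 ≤ N by omega)]
  exact R.le r r.2

private theorem exists_sum_left_rel (r : R.rel) : ∃ (m : ℕ) (v : Fin m → V) (x : Fin m → TV k V),
    (∀ i, x i ∈ TV.tpow k V (N - 1)) ∧ (r : TV k V) = ∑ i, TV.ι (v i) * x i := by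
  have hN := R.two_le
  refine TV.exists_sum_left ?_
  rw [Nat.sub_add_cancel (show 1 ≤ N by omega)]
  exact R.le r r.2

namespace Comparison

variable (c : R.Comparison) (φ : ℕ → BiHom k R.rel R.Alg)

private theorem psi_sum_right {n : ℕ} (hn : 1 ≤ n) {m : ℕ} {x : Fin m → TV k V} {v : Fin m → V}
    (hx : ∀ i, x i ∈ TV.tpow k V (N - 1)) {r : R.rel} (hr : (r : TV k V) = ∑ i, x i * TV.ι (v i)) :
    ∑ i, psi c φ n (BT.tmul k (R.cls (x i)) (R.vIncl (v i))) = relCochain φ n r := by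
  have hN := R.two_le
  have h := c.psi_relDecomp φ hn
    { n := m, α := x, β := fun i => TV.ι (v i), p := fun _ => N - 1, q := fun _ => 1
      p_pos := fun _ => by omega
      q_pos := fun _ => le_rfl
      add_eq := fun _ => by omega
      α_mem := hx
      β_mem := fun _ => TV.ι_mem _
      mem := hr ▸ r.2 }
  exact (map_sum (psi c φ n).1 _ _).symm.trans
    (h.trans (congrArg (relCochain φ n).1 (Subtype.ext hr.symm)))

private theorem psi_sum_left {n : ℕ} (hn : 1 ≤ n) {m : ℕ} {x : Fin m → TV k V} {v : Fin m → V}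
    (hx : ∀ i, x i ∈ TV.tpow k V (N - 1)) {r : R.rel} (hr : (r : TV k V) = ∑ i, TV.ι (v i) * x i) :
    ∑ i, psi c φ n (BT.tmul k (R.vIncl (v i)) (R.cls (x i))) = relCochain φ n r := by
  have hN := R.two_le
  have h := c.psi_relDecomp φ hn
    { n := m, α := fun i => TV.ι (v i), β := x, p := fun _ => 1, q := fun _ => N - 1
      p_pos := fun _ => le_rfl
      q_pos := fun _ => by omega
      add_eq := fun _ => by omega
      α_mem := fun _ => TV.ι_mem _
      β_mem := hx
      mem := hr ▸ r.2 }
  exact (map_sum (psi c φ n).1 _ _).symm.trans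
    (h.trans (congrArg (relCochain φ n).1 (Subtype.ext hr.symm)))

/-- The values of `ψ_n` on `∑ x_i ⊗ u_i + ∑ v_i ⊗ y_i`, where `∑ x_i u_i + ∑ v_i y_i` is a
relation. -/
private theorem psi_sum_add {n : ℕ} (hn : 1 ≤ n) {m l : ℕ} {x : Fin m → TV k V} {u : Fin m → V}
    {v : Fin l → V} {y : Fin l → TV k V} (hx : ∀ i, x i ∈ TV.tpow k V (N - 1))
    (hy : ∀ i, y i ∈ TV.tpow k V (N - 1)) {r : R.rel}
    (hr : (r : TV k V) = ∑ i, x i * TV.ι (u i) + ∑ i, TV.ι (v i) * y i) :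
    ∑ i, psi c φ n (BT.tmul k (R.cls (x i)) (R.vIncl (u i))) +
      ∑ i, psi c φ n (BT.tmul k (R.vIncl (v i)) (R.cls (y i))) = relCochain φ n r := by
  have hN := R.two_le
  have hs : ∑ i, Fin.append x (fun i => TV.ι (v i)) i * Fin.append (fun i => TV.ι (u i)) y i =
      (r : TV k V) := by
    rw [hr, Fin.sum_univ_add]
    simp only [Fin.append_left, Fin.append_right]
  have h := c.psi_relDecomp φ hn
    { n := m + l, α := Fin.append x (fun i => TV.ι (v i))
      β := Fin.append (fun i => TV.ι (u i)) y
      p := Fin.append (fun _ => N - 1) (fun _ => 1), q := Fin.append (fun _ => 1) (fun _ => N - 1)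
      p_pos := Fin.addCases (fun i => by rw [Fin.append_left]; omega)
        (fun i => by rw [Fin.append_right])
      q_pos := Fin.addCases (fun i => by rw [Fin.append_left])
        (fun i => by rw [Fin.append_right]; omega)
      add_eq := Fin.addCases (fun i => by rw [Fin.append_left, Fin.append_left]; omega)
        (fun i => by rw [Fin.append_right, Fin.append_right]; omega)
      α_mem := Fin.addCases (fun i => by rw [Fin.append_left, Fin.append_left]; exact hx i)
        (fun i => by rw [Fin.append_right, Fin.append_right]; exact TV.ι_mem _)
      β_mem := Fin.addCases (fun i => by rw [Fin.append_left, Fin.append_left]; exact TV.ι_mem _)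
        (fun i => by rw [Fin.append_right, Fin.append_right]; exact hy i)
      mem := hs ▸ r.2 }
  refine Eq.trans ?_ (h.trans (congrArg (relCochain φ n).1 (Subtype.ext hs)))
  refine Eq.symm ((map_sum (psi c φ n).1 _ _).trans ?_)
  rw [Fin.sum_univ_add]
  simp only [Fin.append_left, Fin.append_right]
  rfl

/-- For `j ≥ 2` the inner value has degree `N - j ≤ N - 2`; with one more letter the total stays
below `N`, where `ψ_n` is zero. -/
private theorem psi_tmul_psi_eq_zero (hφ : ∀ j < N, ∀ r, φ j r ∈ R.comp j)
    {n j : ℕ} (hn : 1 ≤ n) (hj : 2 ≤ j) {a : R.plus}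
    (ha : a ∈ R.plusComp 1) {w : R.plus2} (hw : w ∈ R.plus2Comp N) :
    psi c φ n (BT.tmul k a (R.bar (psi c φ j w))) = 0 := by
  have hN := R.two_le
  have h1 := c.psi_mem φ hφ (n := j) (by omega) N w hw
  rcases Nat.lt_or_ge N j with hd | hd
  · rw [R.eq_zero_of_mem_dropComp hd h1, map_zero R.bar.1, BT.tmul_zero, map_zero (psi c φ n).1]
  · exact c.normalized_psi φ n hn 1 (N - j) (by omega) a ha _
      (R.bar_mem (R.mem_comp_of_mem_dropComp hd h1))

private theorem psi_psi_tmul_eq_zero (hφ : ∀ j < N, ∀ r, φ j r ∈ R.comp j)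
    {n j : ℕ} (hn : 1 ≤ n) (hj : 2 ≤ j) {a : R.plus}
    (ha : a ∈ R.plusComp 1) {w : R.plus2} (hw : w ∈ R.plus2Comp N) :
    psi c φ n (BT.tmul k (R.bar (psi c φ j w)) a) = 0 := by
  have hN := R.two_le
  have h1 := c.psi_mem φ hφ (n := j) (by omega) N w hw
  rcases Nat.lt_or_ge N j with hd | hd
  · rw [R.eq_zero_of_mem_dropComp hd h1, map_zero R.bar.1, BT.zero_tmul, map_zero (psi c φ n).1]
  · exact c.normalized_psi φ n hn (N - j) 1 (by omega) _
      (R.bar_mem (R.mem_comp_of_mem_dropComp hd h1)) a ha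

/-- Only the summand `i = n`, with inner cochain `ψ₁`, survives; in all others the inner index `n +
1 - i` is at least two. -/
private theorem sq_psi_tmul (hφ : ∀ j < N, ∀ r, φ j r ∈ R.comp j)
    {n : ℕ} (hn : 1 ≤ n) (v u : V) {x : TV k V} (hx : x ∈ TV.tpow k V (N - 1)) :
    R.sq (psi c φ) n (BT.tmul k (R.vIncl v) (BT.tmul k (R.cls x) (R.vIncl u))) =
      psi c φ n (BT.tmul k (R.vIncl v)
        (R.bar (psi c φ 1 (BT.tmul k (R.cls x) (R.vIncl u))))) -
      psi c φ n (BT.tmul k (R.bar (psi c φ 1 (BT.tmul k (R.vIncl v) (R.cls x)))) (R.vIncl u)) := by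
  have hN := R.two_le
  refine (sq_tmul _ _ _ _ _).trans ((Finset.sum_eq_single n (fun i hi hne => ?_)
    (fun h => absurd (Finset.mem_Icc.2 ⟨hn, le_rfl⟩) h)).trans ?_)
  · have hi' := Finset.mem_Icc.1 hi
    rw [c.psi_tmul_psi_eq_zero φ hφ hi'.1 (by omega) (R.vIncl_mem v)
      (BT.tmul_mem_grading (by omega) (R.cls_mem hx) (R.vIncl_mem u)),
      c.psi_psi_tmul_eq_zero φ hφ hi'.1 (by omega) (R.vIncl_mem u)
      (BT.tmul_mem_grading (by omega) (R.vIncl_mem v) (R.cls_mem hx)), sub_zero]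
  · rw [Nat.add_sub_cancel_left]

end Comparison
end HomRel

end PBW

/-! ### The cochains `sq` on lifted overlaps. -/

namespace PBW

universe u v w

set_option linter.unusedSectionVars false

variable {k : Type u} [Ring k] {V : Type v} [AddCommGroup V] [Module k V] [Module kᵐᵒᵖ V]
  [SMulCommClass k kᵐᵒᵖ V] {N : ℕ} (R : HomRel k V N)

namespace HomRel

variable {R}

/-- The expression `χ(χ₁(v, x), u)` is realized as an additive function `L` of the single tensor `v
x u`. Its value can therefore be computed from either presentation `∑ v s = ∑ r u` of an overlap. -/
private theorem exists_addHom_comp (χ χ₁ : R.Cochain2) : ∃ G L : TV k V →+ R.Alg,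
    (∀ v x, G (TV.ι v * x) = χ₁ (BT.tmul k (R.vIncl v) (R.cls x))) ∧
      ∀ z u, L (z * TV.ι u) = χ (BT.tmul k (R.bar (G z)) (R.vIncl u)) := by
  obtain ⟨G, hG1, hG⟩ := R.exists_addHom_ι_mul (χ₁.comp (BT.map R.vIncl R.bar))
  let f : BT k (TV k V) V →+ R.plus2 := BT.lift (k := k)
    (fun x v => BT.tmul k (R.bar (G x)) (R.vIncl v))
    (by intros; rw [map_add, BiHom.map_add, BT.add_tmul])
    (by intros; rw [BiHom.map_add, BT.tmul_add])
    (by intros; rw [hG1, BiHom.map_op_smul, BT.smul_tmul, BiHom.map_smul])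
  obtain ⟨L, hL⟩ := TV.exists_addHom_mul_ι (χ.1.comp f)
  exact ⟨G, L, hG, hL⟩

namespace Comparison

variable (c : R.Comparison)

private theorem sq_ins2_par_mul_ι (φ : ℕ → BiHom k R.rel R.Alg) (hφ : ∀ j < N, ∀ r, φ j r ∈ R.comp j)
    {n : ℕ} (hn : 1 ≤ n) (v u : V) {x : TV k V} (hx : x ∈ TV.tpow k V (N - 1)) :
    extend (R.sq (psi c φ) n) (R.ins2 (BT.tmul k (R.vIncl v) (R.par (x * TV.ι u)))) =
      psi c φ n (BT.tmul k (R.vIncl v)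
        (R.bar (psi c φ 1 (BT.tmul k (R.cls x) (R.vIncl u))))) -
      psi c φ n (BT.tmul k (R.bar (psi c φ 1 (BT.tmul k (R.vIncl v) (R.cls x)))) (R.vIncl u)) := by
  have hN := R.two_le
  have h0 := sq_ins2_par (c.normalizedUpTo_psi φ n) (p := 1) (show 1 + (N - 1) ≤ N by omega)
    (by omega) (R.vIncl_mem v) hx
  refine (extend_ins2_par_mul_ι _ _ _ _).trans ?_
  refine (congrArg₂ (· + ·) (c.sq_psi_tmul φ hφ hn v u hx)
    ((congrArg (· * R.toAlg (TV.ι u)) h0).trans (zero_mul _))).trans (add_zero _)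

/-- The extension of `sq(ψ₁, …, ψ_n)` on `1|v̄|s_(1)|s̄_(2)|s_(3)`, for a relation `s`. -/
private theorem exists_sq_ins2_rel (φ : ℕ → BiHom k R.rel R.Alg) (hφ : ∀ j < N, ∀ r, φ j r ∈ R.comp j)
    {n : ℕ} (hn : 1 ≤ n) : ∃ L : TV k V →+ R.Alg,
      (∀ (v : V) (s : R.rel),
        extend (R.sq (psi c φ) n) (R.ins2 (BT.tmul k (R.vIncl v) (R.par s))) =
          psi c φ n (BT.tmul k (R.vIncl v) (R.bar (relCochain φ 1 s))) -
            L (TV.ι v * (s : TV k V))) ∧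
      ∀ (r : R.rel) (u : V), L ((r : TV k V) * TV.ι u) =
        psi c φ n (BT.tmul k (R.bar (relCochain φ 1 r)) (R.vIncl u)) := by
  obtain ⟨G, L, hG, hL⟩ := exists_addHom_comp (psi c φ n) (psi c φ 1)
  refine ⟨L, fun v s => ?_, fun r u => ?_⟩
  · let S : TV k V →+ R.Alg := (extend (R.sq (psi c φ) n)).1.comp (R.ins2.1.comp
      ((BT.tmulHom k (R.vIncl v)).comp R.par.1))
    let T : R.Alg →+ R.Alg := (psi c φ n).1.comp ((BT.tmulHom k (R.vIncl v)).comp R.bar.1)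
    let g : TV k V → V → R.Alg := fun x u => psi c φ 1 (BT.tmul k (R.cls x) (R.vIncl u))
    have hS : ∀ x ∈ TV.tpow k V (N - 1), ∀ u, S (x * TV.ι u) =
        T (g x u) - L (TV.ι v * (x * TV.ι u)) :=
      fun x hx u => (c.sq_ins2_par_mul_ι φ hφ hn v u hx).trans (congrArg (_ - ·)
        ((congrArg (fun y => psi c φ n (BT.tmul k (R.bar y) (R.vIncl u))) (hG v x).symm).trans
          ((hL _ u).symm.trans (congrArg L (mul_assoc _ _ _)))))
    have hg : ∀ y, (∀ m (x : Fin m → TV k V) (u : Fin m → V),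
        (∀ i, x i ∈ TV.tpow k V (N - 1)) → (s : TV k V) = ∑ i, x i * TV.ι (u i) →
        ∑ i, g (x i) (u i) = y) → S s = T y - L (TV.ι v * (s : TV k V)) := by
      clear hG hL
      clear_value S T g
      intro w h0
      obtain ⟨m, x, y, hx, hs⟩ := exists_sum_right_rel s
      rw [← h0 m x y hx hs, hs, map_sum, map_sum, Finset.mul_sum, map_sum, ← Finset.sum_sub_distrib]
      exact Finset.sum_congr rfl fun i _ => hS _ (hx i) _
    exact hg (relCochain φ 1 s) fun m x y hx hs => c.psi_sum_right φ le_rfl hx hs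
  · have h1 : G r = relCochain φ 1 r := by
      obtain ⟨m, v, x, hx, hr⟩ := exists_sum_left_rel r
      refine ((congrArg G hr).trans (map_sum G _ _)).trans ?_
      exact (Finset.sum_congr rfl fun i _ => hG _ _).trans (c.psi_sum_left φ le_rfl hx hr)
    exact (hL _ _).trans (congrArg (fun y => psi c φ n (BT.tmul k (R.bar y) (R.vIncl u))) h1)

section Koszul

variable {Φ : ℕ → BiHom k R.rel (TV k V)}
  {m l : ℕ} {r : Fin m → R.rel} {u : Fin m → V} {v : Fin l → V} {s : Fin l → R.rel}

/-- By `exists_sq_ins2_rel` the sum is `∑ ψ_n(v, φ_{N-1}(s)) - L (∑ v s)`. As `∑ v s = ∑ r u`, the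
second term equals `∑ ψ_n(φ_{N-1}(r), u)`. The difference is minus the value of `ψ_n` on a
decomposition of the relation `θ`, which `psi_sum_add` evaluates. -/
private theorem sq_sum_ins2_par (hΦ : WeakPBW Φ) {n : ℕ} (hn : 1 ≤ n)
    (hw : ∑ i, (r i : TV k V) * TV.ι (u i) = ∑ i, TV.ι (v i) * (s i : TV k V))
    {θ : R.rel} (hθ : (θ : TV k V) = ∑ i, Φ (N - 1) (r i) * TV.ι (u i) -
      ∑ i, TV.ι (v i) * Φ (N - 1) (s i)) :
    ∑ i, extend (R.sq (psi c (algCochain Φ)) n) (R.ins2 (BT.tmul k (R.vIncl (v i)) (R.par (s i)))) =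
      - relCochain (algCochain Φ) n θ := by
  have hN := R.two_le
  obtain ⟨L, hL1, hL2⟩ := c.exists_sq_ins2_rel (algCochain Φ) hΦ.algCochain_mem hn
  have h1 := c.psi_sum_add (algCochain Φ) hn (x := fun i => Φ (N - 1) (r i)) (u := u)
    (v := fun i => - v i) (y := fun i => Φ (N - 1) (s i)) (fun i => hΦ.mem _ (by omega) _)
    (fun i => hΦ.mem _ (by omega) _) (r := θ) (by
      rw [hθ, sub_eq_add_neg, ← Finset.sum_neg_distrib]
      refine congrArg _ (Finset.sum_congr rfl fun i _ => ?_)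
      rw [← neg_mul]
      exact congrArg (· * _) (map_neg (TV.ι (k := k) (V := V)).1 _).symm)
  refine (Finset.sum_congr rfl fun i _ => hL1 (v i) (s i)).trans ?_
  let p : R.Alg → V → R.Alg := fun a w => psi c (algCochain Φ) n (BT.tmul k (R.bar a) (R.vIncl w))
  let q : V → R.Alg → R.Alg := fun w a => psi c (algCochain Φ) n (BT.tmul k (R.vIncl w) (R.bar a))
  have hq : ∀ w a, q (- w) a = - q w a := fun w a =>
    map_neg ((psi c (algCochain Φ) n).1.comp
      ((BT.tmulHomLeft k (R.bar a)).comp R.vIncl.1)) w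
  replace h1 : ∑ i, p (R.toAlg (Φ (N - 1) (r i))) (u i) +
      ∑ i, q (- v i) (R.toAlg (Φ (N - 1) (s i))) = relCochain (algCochain Φ) n θ := h1
  have h3 : ∀ s : R.rel, relCochain (algCochain Φ) 1 s = R.toAlg (Φ (N - 1) s) := fun s =>
    congrArg (fun f : BiHom k R.rel R.Alg => f s) (relCochain_of_le _ le_rfl (by omega))
  replace hL2 : ∀ (r : R.rel) (u : V), L ((r : TV k V) * TV.ι u) =
    p (relCochain (algCochain Φ) 1 r) u := hL2
  change ∑ i, (q (v i) (relCochain (algCochain Φ) 1 (s i)) - L (TV.ι (v i) * (s i : TV k V))) = _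
  clear_value p q
  have h4 : L (∑ i, TV.ι (v i) * (s i : TV k V)) = ∑ i, p (R.toAlg (Φ (N - 1) (r i))) (u i) := by
    rw [← hw, map_sum]
    exact Finset.sum_congr rfl fun i _ => (hL2 _ _).trans (by rw [h3])
  rw [map_sum] at h4
  rw [← h1, Finset.sum_sub_distrib, h4, neg_add, add_comm, sub_eq_add_neg, add_comm, add_comm (- _)]
  congr 1
  rw [← Finset.sum_neg_distrib]
  refine Finset.sum_congr rfl fun i _ => ?_
  rw [hq, neg_neg, h3]

/-- Index `n = 0` is included, where `sq` is an empty sum and `relCochain` is zero; it is needed for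
the first obstruction. -/
private theorem sq_sum_ins2_par_pred (hΦ : WeakPBW Φ) (n : ℕ)
    (hw : ∑ i, (r i : TV k V) * TV.ι (u i) = ∑ i, TV.ι (v i) * (s i : TV k V))
    {θ : R.rel} (hθ : (θ : TV k V) = ∑ i, Φ (N - 1) (r i) * TV.ι (u i) -
      ∑ i, TV.ι (v i) * Φ (N - 1) (s i)) :
    ∑ i, extend (R.sq (psi c (algCochain Φ)) n) (R.ins2 (BT.tmul k (R.vIncl (v i)) (R.par (s i)))) =
      - relCochain (algCochain Φ) n θ :=
  if hn : 1 ≤ n then c.sq_sum_ins2_par hΦ hn hw hθ else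
    (Finset.sum_eq_zero fun i _ => (congrArg (fun f : BiHom k R.plus3 R.Alg => extend f _)
      (show R.sq (psi c (algCochain Φ)) n = 0 by
        rw [sq, Finset.Icc_eq_empty (by omega), Finset.sum_empty])).trans (extend_zero _)).trans
    (neg_zero.symm.trans (congrArg (fun f : BiHom k R.rel R.Alg => - f θ)
      (show (0 : BiHom k R.rel R.Alg) = relCochain (algCochain Φ) n from
        (if_neg (by omega)).symm)))

end Koszul

end Comparison
end HomRel

end PBW

/-! ### Vanishing of the obstructions on overlaps. -/

namespace PBW

universe u v w

set_option linter.unusedSectionVars false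

variable {k : Type u} [Ring k] {V : Type v} [AddCommGroup V] [Module k V] [Module kᵐᵒᵖ V]
  [SMulCommClass k kᵐᵒᵖ V] {N : ℕ} (R : HomRel k V N)

namespace HomRel

variable {R}

/-- The element `∑ 1|r_i|u_i - ∑ v_i|s_i|1` of `K₂`. -/
def koszul3 {m l : ℕ} (r : Fin m → R.rel) (u : Fin m → V) (v : Fin l → V) (s : Fin l → R.rel) :
    R.K2 :=
  ∑ i, op (R.toAlg (TV.ι (u i))) • gen k R.Alg R.rel (r i) -
    ∑ i, R.toAlg (TV.ι (v i)) • gen k R.Alg R.rel (s i)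

section

variable {m l : ℕ} {r : Fin m → R.rel} {u : Fin m → V} {v : Fin l → V} {s : Fin l → R.rel}

private theorem map_koszul3 {X : Type*} [AddCommGroup X] (E : R.K2 →+ X) : E (koszul3 r u v s) =
    ∑ i, E (op (R.toAlg (TV.ι (u i))) • gen k R.Alg R.rel (r i)) -
      ∑ i, E (R.toAlg (TV.ι (v i)) • gen k R.Alg R.rel (s i)) :=
  (map_sub E _ _).trans (congrArg₂ (· - ·) (map_sum E _ _) (map_sum E _ _))

private theorem d2_koszul3
    (hw : ∑ i, (r i : TV k V) * TV.ι (u i) = ∑ i, TV.ι (v i) * (s i : TV k V)) :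
    R.d2 (koszul3 r u v s) = 0 :=
  (map_koszul3 R.d2.1).trans ((congrArg₂ (· - ·)
    ((Finset.sum_congr rfl fun i _ => R.d2_op_smul_gen (r i) (u i)).trans (map_sum R.par.1 _ _).symm)
    ((Finset.sum_congr rfl fun i _ => R.d2_smul_gen (s i) (v i)).trans
      (map_sum R.par.1 _ _).symm)).trans (sub_eq_zero.2 (congrArg R.par.1 hw)))

private theorem hL_sigma2_op_smul_gen (a : R.Alg) (r : R.rel) :
    R.hL _ (R.sigma2 (op a • gen k R.Alg R.rel r)) = 0 :=
  (congrArg (R.hL _).1 (R.sigma2.map_op_smul _ _)).trans ((R.hL_op_smul _ _).trans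
    ((congrArg (op a • ·) ((congrArg (R.hL _).1 (R.sigma2_gen r)).trans (R.hL_ins _))).trans
      (smul_zero _)))

private theorem hL_sigma2_smul_gen (a : R.Alg) (s : R.rel) :
    R.hL _ (R.sigma2 (a • gen k R.Alg R.rel s)) = R.ins2 (BT.tmul k (R.bar a) (R.par s)) :=
  (congrArg (R.hL _).1 ((R.sigma2.map_smul _ _).trans (congrArg (a • ·) (R.sigma2_gen s)))).trans
    (R.hL_smul_ins a _)

/-- The terms `1|r|u` contribute nothing, as `hL` kills the image of `ins`; only the terms `v|s|1`
lift to `C̄₃`. -/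
private theorem hL_sigma2_koszul3 : R.hL _ (R.sigma2 (koszul3 r u v s)) =
    - ∑ i, R.ins2 (BT.tmul k (R.vIncl (v i)) (R.par (s i))) :=
  (map_koszul3 ((R.hL _).1.comp R.sigma2.1)).trans ((congrArg₂ (· - ·)
    (Finset.sum_eq_zero fun i _ => hL_sigma2_op_smul_gen _ (r i))
    (Finset.sum_congr rfl fun i _ => hL_sigma2_smul_gen (R.toAlg (TV.ι (v i))) (s i))).trans
      (zero_sub _))

/-- As `σ̄` commutes with the differentials, `σ̄₂ κ` is a cycle of the bar complex, and `hL`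
contracts it. -/
private theorem b3_hL_sigma2 {κ : R.K2} (hκ : R.d2 κ = 0) : R.b3 (R.hL _ (R.sigma2 κ)) = R.sigma2 κ := by
  have h : R.hL _ (R.b2 (R.sigma2 κ)) = 0 :=
    (congrArg (R.hL _).1 ((R.b2_sigma2 κ).trans ((congrArg R.sigma1.1 hκ).trans
      (map_zero R.sigma1.1)))).trans (map_zero (R.hL _).1)
  exact ((add_zero _).symm.trans (congrArg (R.b3 (R.hL _ (R.sigma2 κ)) + ·) h.symm)).trans
    (R.b3_hL_add_hL_b2 _)

private theorem extend_koszul3 (f : BiHom k R.rel R.Alg) : extend f (koszul3 r u v s) =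
    ∑ i, f (r i) * R.toAlg (TV.ι (u i)) - ∑ i, R.toAlg (TV.ι (v i)) * f (s i) := by
  refine (map_koszul3 (extend f).1).trans ?_
  refine congrArg₂ (· - ·) (Finset.sum_congr rfl fun i _ => ?_) (Finset.sum_congr rfl fun i _ => ?_)
  · exact ((extend f).map_op_smul _ _).trans (congrArg (op (R.toAlg (TV.ι (u i))) • ·)
      (extend_gen (A := R.Alg) f (r i)))
  · exact ((extend f).map_smul _ _).trans (congrArg (R.toAlg (TV.ι (v i)) • ·)
      (extend_gen (A := R.Alg) f (s i)))

private theorem extend_algCochain_koszul3 (Φ : ℕ → BiHom k R.rel (TV k V)) (j : ℕ) :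
    extend (algCochain Φ j) (koszul3 r u v s) = R.toAlg (∑ i, Φ j (r i) * TV.ι (u i) -
      ∑ i, TV.ι (v i) * Φ j (s i)) := by
  refine (extend_koszul3 (algCochain Φ j)).trans ?_
  simp only [map_sub, map_sum, map_mul, algCochain_apply]

namespace Comparison

variable (c : R.Comparison) {Φ : ℕ → BiHom k R.rel (TV k V)}

private theorem extend_sq_koszul3 (hΦ : WeakPBW Φ) (n : ℕ)
    (hw : ∑ i, (r i : TV k V) * TV.ι (u i) = ∑ i, TV.ι (v i) * (s i : TV k V))
    {θ : R.rel} (hθ : (θ : TV k V) = ∑ i, Φ (N - 1) (r i) * TV.ι (u i) -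
      ∑ i, TV.ι (v i) * Φ (N - 1) (s i)) :
    extend (R.sq (psi c (algCochain Φ)) n) (R.hL _ (R.sigma2 (koszul3 r u v s))) =
      relCochain (algCochain Φ) n θ :=
  (congrArg (extend (R.sq (psi c (algCochain Φ)) n)).1 hL_sigma2_koszul3).trans
    ((map_neg (extend (R.sq (psi c (algCochain Φ)) n)).1 _).trans
      ((congrArg (- ·) ((map_sum (extend (R.sq (psi c (algCochain Φ)) n)).1 _ _).trans
        (c.sq_sum_ins2_par_pred hΦ n hw hθ))).trans (neg_neg _)))

/-- These are the weak PBW conditions with `j = N - n + 1`. For `2 ≤ n ≤ N` they read `φ_j(θ_{N-1})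
+ θ_{j-1} = 0`; for `n = N + 1` only `φ_0(θ_{N-1}) = 0` remains; for `n = 1` the claim is that
`θ_{N-1}`, being a relation, is zero in `A`. -/
private theorem relCochain_add_eq_zero (hΦ : WeakPBW Φ) {n : ℕ} (hn : 1 ≤ n)
    (hw : ∑ i, (r i : TV k V) * TV.ι (u i) = ∑ i, TV.ι (v i) * (s i : TV k V)) :
    ∃ θ : R.rel, (θ : TV k V) = ∑ i, Φ (N - 1) (r i) * TV.ι (u i) -
      ∑ i, TV.ι (v i) * Φ (N - 1) (s i) ∧
    extend (relCochain (algCochain Φ) n) (koszul3 r u v s) +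
      relCochain (algCochain Φ) (n - 1) θ = 0 := by
  have hN := R.two_le
  obtain ⟨h, h0, hj⟩ := hΦ.compat _ _ r u v s hw _ fun j => rfl
  refine ⟨⟨_, h⟩, rfl, ?_⟩
  have hz : ∀ {i}, N < i → relCochain (algCochain Φ) i = 0 := fun hi => relCochain_of_lt _ hi
  rcases Nat.lt_or_ge N n with hn' | hn'
  · rw [hz hn']
    refine (congrArg₂ (· + ·) (extend_zero (A := R.Alg) (X := R.Alg) (koszul3 r u v s)) ?_).trans
      (add_zero 0)
    rcases Nat.lt_or_ge N (n - 1) with h2 | h2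
    · rw [hz h2]; rfl
    · rw [relCochain_of_le _ (show 1 ≤ n - 1 by omega) h2, algCochain_apply,
        show N - (n - 1) = 0 by omega, h0, map_zero]
  · rw [relCochain_of_le _ hn hn']
    refine (congrArg (· + _) (extend_algCochain_koszul3 Φ (N - n))).trans ?_
    rcases Nat.lt_or_ge 1 n with h2 | h2
    · rw [relCochain_of_le _ (show 1 ≤ n - 1 by omega) (by omega), algCochain_apply,
        ← map_add (R.toAlg), add_comm, show N - n = N - (n - 1) - 1 by omega,
        hj (N - (n - 1)) (by omega) (by omega), map_zero]
    · obtain rfl : n = 1 := by omega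
      rw [R.toAlg_rel h, zero_add]
      exact congrArg (fun f : BiHom k R.rel R.Alg => f _)
        (show relCochain (algCochain Φ) (1 - 1) = 0 from if_neg (by omega))

private theorem obstruction_eq_zero_of_add {φ : ℕ → BiHom k R.rel R.Alg} {n : ℕ} {x : R.C3} {κ : R.K2}
    {a : R.Alg} (h1 : c.tau2 (R.b3 x) = κ) (h2 : extend (R.sq (psi c φ) (n - 1)) x = a)
    (h : extend (relCochain φ n) κ + a = 0) : obstruction c φ n x = 0 :=
  (obstruction_apply c φ n x).trans ((congrArg₂ (· + ·)
    (congrArg (extend (relCochain φ n)).1 h1) h2).trans h)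

/-- The obstructions vanish on the lifts of the elements `∑ 1|r_i|u_i - ∑ v_i|s_i|1`. -/
private theorem obstruction_hL_sigma2_koszul3 (hΦ : WeakPBW Φ) {n : ℕ} (hn : 1 ≤ n)
    (hw : ∑ i, (r i : TV k V) * TV.ι (u i) = ∑ i, TV.ι (v i) * (s i : TV k V)) :
    obstruction c (algCochain Φ) n (R.hL _ (R.sigma2 (koszul3 r u v s))) = 0 := by
  obtain ⟨θ, hθ, h⟩ := relCochain_add_eq_zero hΦ hn hw
  have h0 := b3_hL_sigma2 (d2_koszul3 hw)
  have h1 := (congrArg c.tau2.1 h0).trans (c.tau2_sigma2 _)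
  exact c.obstruction_eq_zero_of_add h1 (c.extend_sq_koszul3 hΦ (n - 1) hw hθ) h

end Comparison
end
end HomRel

end PBW

/-! ### From a family of cochains to a product on `A[t]`. -/

namespace PBW

universe u v w

set_option linter.unusedSectionVars false

section Star

open Polynomial

variable {A : Type*} [Ring A]

namespace StarFamily

variable (m : StarFamily A)

private theorem addHom_ext_monomial₂ {X : Type*} [AddCommGroup X] {f g : A[X] →+ A[X] →+ X}
    (h : ∀ i j a b, f (monomial i a) (monomial j b) = g (monomial i a) (monomial j b)) : f = g :=
  Polynomial.addHom_ext fun i a => Polynomial.addHom_ext fun j b => h i j a b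

private theorem mul_left_of_op {u : A} (h : ∀ n a b, m.op n (u * a) b = u * m.op n a b) (x y : A[X]) :
    m.mul (C u * x) y = C u * m.mul x y := by
  refine DFunLike.congr_fun (DFunLike.congr_fun (addHom_ext_monomial₂
    (f := m.mulHom.comp (AddMonoidHom.mulLeft (C u)))
    (g := (AddMonoidHom.compHom (AddMonoidHom.mulLeft (C u))).comp m.mulHom)
    fun i j a b => ?_) x) y
  change m.mul (C u * monomial i a) (monomial j b) = C u * m.mul (monomial i a) (monomial j b)
  rw [C_mul_monomial, monomial_mul_monomial, monomial_mul_monomial]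
  ext n
  simp only [coeff_X_pow_mul', Polynomial.coeff_C_mul, coeff_const, h, mul_ite, mul_zero]

private theorem mul_right_of_op {u : A} (h : ∀ n a b, m.op n a (b * u) = m.op n a b * u) (x y : A[X]) :
    m.mul x (y * C u) = m.mul x y * C u := by
  refine DFunLike.congr_fun (DFunLike.congr_fun (addHom_ext_monomial₂
    (f := (AddMonoidHom.compHom' (AddMonoidHom.mulRight (C u))).comp m.mulHom)
    (g := (AddMonoidHom.compHom (AddMonoidHom.mulRight (C u))).comp m.mulHom)
    fun i j a b => ?_) x) y
  change m.mul (monomial i a) (monomial j b * C u) = m.mul (monomial i a) (monomial j b) * C u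
  rw [monomial_mul_C, monomial_mul_monomial, monomial_mul_monomial]
  ext n
  simp only [mul_assoc, coeff_X_pow_mul', Polynomial.coeff_mul_C, coeff_const, h]

private theorem balanced_of_op {u : A} (h : ∀ n a b, m.op n (a * u) b = m.op n a (u * b)) (x y : A[X]) :
    m.mul (x * C u) y = m.mul x (C u * y) := by
  refine DFunLike.congr_fun (DFunLike.congr_fun (addHom_ext_monomial₂
    (f := m.mulHom.comp (AddMonoidHom.mulRight (C u)))
    (g := (AddMonoidHom.compHom' (AddMonoidHom.mulLeft (C u))).comp m.mulHom)
    fun i j a b => ?_) x) y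
  change m.mul (monomial i a * C u) (monomial j b) = m.mul (monomial i a) (C u * monomial j b)
  rw [C_mul_monomial, monomial_mul_C, monomial_mul_monomial, monomial_mul_monomial]
  refine congrArg (X ^ (i + j) * ·) ?_
  ext n
  simp only [coeff_const, h]

private theorem one_mul_of_op (h0 : ∀ b, m.op 0 1 b = b) (h : ∀ n, n ≠ 0 → ∀ b, m.op n 1 b = 0) (x : A[X]) :
    m.mul 1 x = x := by
  refine DFunLike.congr_fun (Polynomial.addHom_ext (f := m.mulHom 1) (g := AddMonoidHom.id _)
    fun j b => ?_) x
  change m.mul (monomial 0 1) (monomial j b) = monomial j b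
  rw [monomial_mul_monomial, zero_add, monomial_eq j b]
  refine congrArg (X ^ j * ·) ?_
  ext n
  rw [coeff_const, coeff_C]
  split_ifs with hn
  · rw [hn, h0]
  · exact h n hn b

private theorem mul_one_of_op (h0 : ∀ b, m.op 0 b 1 = b) (h : ∀ n, n ≠ 0 → ∀ b, m.op n b 1 = 0) (x : A[X]) :
    m.mul x 1 = x := by
  refine DFunLike.congr_fun (Polynomial.addHom_ext (f := m.mulHom.flip 1) (g := AddMonoidHom.id _)
    fun j b => ?_) x
  change m.mul (monomial j b) (monomial 0 1) = monomial j b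
  rw [monomial_mul_monomial, add_zero, monomial_eq j b]
  refine congrArg (X ^ j * ·) ?_
  ext n
  rw [coeff_const, coeff_C]
  split_ifs with hn
  · rw [hn, h0]
  · exact h n hn b

private theorem coeff_zero_mul (h0 : ∀ a b, m.op 0 a b = a * b) (x y : A[X]) :
    (m.mul x y).coeff 0 = x.coeff 0 * y.coeff 0 := by
  refine DFunLike.congr_fun (DFunLike.congr_fun (addHom_ext_monomial₂
    (f := (AddMonoidHom.compHom (lcoeff A 0).toAddMonoidHom).comp m.mulHom)
    (g := (AddMonoidHom.compHom' (lcoeff A 0).toAddMonoidHom).comp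
      (AddMonoidHom.mul.comp (lcoeff A 0).toAddMonoidHom)) fun i j a b => ?_) x) y
  change (m.mul (monomial i a) (monomial j b)).coeff 0 =
    (monomial i a).coeff 0 * (monomial j b).coeff 0
  rw [monomial_mul_monomial, coeff_X_pow_mul', coeff_monomial, coeff_monomial, coeff_const,
    Nat.zero_sub, h0]
  by_cases hi : i = 0 <;> by_cases hj : j = 0 <;> simp [hi, hj]

private theorem mul_eq_sum (x y : A[X]) : m.mul x y = ∑ i ∈ x.support, ∑ j ∈ y.support,
    X ^ (i + j) * m.const (x.coeff i) (y.coeff j) := rfl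

end StarFamily
end Star

variable {k : Type u} [Ring k] {V : Type v} [AddCommGroup V] [Module k V] [Module kᵐᵒᵖ V]
  [SMulCommClass k kᵐᵒᵖ V] {N : ℕ} (R : HomRel k V N)

namespace HomRel

variable {R}

/-- The biadditive map `(a, b) ↦ ψ(a, b)`. -/
def cochainHom (ψ : R.Cochain2) : R.Alg →+ R.Alg →+ R.Alg :=
  AddMonoidHom.mk' (fun a => ψ.1.comp ((BT.tmulHom k (R.bar a)).comp R.bar.1)) fun a a' =>
    AddMonoidHom.ext fun b =>
      (congrArg (fun z => ψ (BT.tmul k z (R.bar b))) (map_add R.bar.1 a a')).trans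
        ((congrArg ψ.1 (BT.add_tmul _ _ _ _)).trans (map_add ψ.1 _ _))

private theorem cochainHom_apply (ψ : R.Cochain2) (a b : R.Alg) :
    cochainHom ψ a b = ψ (BT.tmul k (R.bar a) (R.bar b)) := rfl

/-- The operations `a b, ψ₁(a, b), ψ₂(a, b), …` on `A`. -/
def star (ψ : ℕ → R.Cochain2) (hfin : ∀ w, ∃ B, 1 ≤ B ∧ ∀ n, B ≤ n → ψ n w = 0) :
    StarFamily R.Alg where
  op n := if n = 0 then AddMonoidHom.mul else cochainHom (ψ n)
  finite a b := (hfin (BT.tmul k (R.bar a) (R.bar b))).imp fun _ hB n hn =>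
    (congrArg (fun f : R.Alg →+ R.Alg →+ R.Alg => f a b)
      (if_neg (Nat.one_le_iff_ne_zero.1 (hB.1.trans hn)))).trans (hB.2 n hn)

private theorem cochain_smul (ψ : R.Cochain2) (c : k) (a b : R.Alg) :
    cochainHom ψ (KAlg.unit c * a) b = KAlg.unit c * cochainHom ψ a b :=
  (congrArg (fun z => ψ (BT.tmul k z (R.bar b))) (R.bar.map_smul c a)).trans
    (ψ.map_smul c (BT.tmul k (R.bar a) (R.bar b)))

private theorem cochain_op_smul (ψ : R.Cochain2) (c : k) (a b : R.Alg) :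
    cochainHom ψ a (b * KAlg.unit c) = cochainHom ψ a b * KAlg.unit c :=
  (congrArg (fun z => ψ (BT.tmul k (R.bar a) z)) (R.bar.map_op_smul c b)).trans
    (ψ.map_op_smul c (BT.tmul k (R.bar a) (R.bar b)))

private theorem cochain_balanced (ψ : R.Cochain2) (c : k) (a b : R.Alg) :
    cochainHom ψ (a * KAlg.unit c) b = cochainHom ψ a (KAlg.unit c * b) :=
  (congrArg (fun z => ψ (BT.tmul k z (R.bar b))) (R.bar.map_op_smul c a)).trans
    ((congrArg ψ.1 (BT.smul_tmul _ _ _ _)).trans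
      (congrArg (fun z => ψ (BT.tmul k (R.bar a) z)) (R.bar.map_smul c b)).symm)

private theorem cochain_one_left (ψ : R.Cochain2) (b : R.Alg) : cochainHom ψ 1 b = 0 :=
  (congrArg (fun z => ψ (BT.tmul k z (R.bar b))) R.bar_one).trans
    ((congrArg ψ.1 (BT.zero_tmul _)).trans (map_zero ψ.1))

private theorem cochain_one_right (ψ : R.Cochain2) (b : R.Alg) : cochainHom ψ b 1 = 0 :=
  (congrArg (fun z => ψ (BT.tmul k (R.bar b) z)) R.bar_one).trans
    ((congrArg ψ.1 (BT.tmul_zero _)).trans (map_zero ψ.1))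

section

variable (ψ : ℕ → R.Cochain2) (hfin : ∀ w, ∃ B, 1 ≤ B ∧ ∀ n, B ≤ n → ψ n w = 0)

private theorem star_op_zero (a b : R.Alg) : (star ψ hfin).op 0 a b = a * b := rfl

private theorem star_op {n : ℕ} (hn : n ≠ 0) : (star ψ hfin).op n = cochainHom (ψ n) := if_neg hn

private theorem star_smul (c : k) (n : ℕ) (a b : R.Alg) :
    (star ψ hfin).op n (KAlg.unit c * a) b = KAlg.unit c * (star ψ hfin).op n a b := by
  rcases eq_or_ne n 0 with rfl | hn
  · rw [star_op_zero, star_op_zero, mul_assoc]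
  · rw [star_op _ _ hn, cochain_smul]

private theorem star_op_smul (c : k) (n : ℕ) (a b : R.Alg) :
    (star ψ hfin).op n a (b * KAlg.unit c) = (star ψ hfin).op n a b * KAlg.unit c := by
  rcases eq_or_ne n 0 with rfl | hn
  · rw [star_op_zero, star_op_zero, mul_assoc]
  · rw [star_op _ _ hn, cochain_op_smul]

private theorem star_balanced (c : k) (n : ℕ) (a b : R.Alg) :
    (star ψ hfin).op n (a * KAlg.unit c) b = (star ψ hfin).op n a (KAlg.unit c * b) := by
  rcases eq_or_ne n 0 with rfl | hn
  · rw [star_op_zero, star_op_zero, mul_assoc]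
  · rw [star_op _ _ hn, cochain_balanced]

private theorem star_one_left {n : ℕ} (hn : n ≠ 0) (b : R.Alg) : (star ψ hfin).op n 1 b = 0 := by
  rw [star_op _ _ hn, cochain_one_left]

private theorem star_one_right {n : ℕ} (hn : n ≠ 0) (b : R.Alg) : (star ψ hfin).op n b 1 = 0 := by
  rw [star_op _ _ hn, cochain_one_right]

private theorem star_one_mul (x : R.Alg[X]) : (star ψ hfin).mul 1 x = x :=
  (star ψ hfin).one_mul_of_op (fun b => one_mul b) (fun _ hn b => star_one_left ψ hfin hn b) x

private theorem star_mul_one (x : R.Alg[X]) : (star ψ hfin).mul x 1 = x :=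
  (star ψ hfin).mul_one_of_op (fun b => mul_one b) (fun _ hn b => star_one_right ψ hfin hn b) x

private theorem star_unit_mul (c : k) (x : R.Alg[X]) :
    (star ψ hfin).mul (Polynomial.C (KAlg.unit c)) x = Polynomial.C (KAlg.unit c) * x := by
  have h := (star ψ hfin).mul_left_of_op (star_smul ψ hfin c) 1 x
  rwa [mul_one, star_one_mul] at h

private theorem star_mul_unit (c : k) (x : R.Alg[X]) :
    (star ψ hfin).mul x (Polynomial.C (KAlg.unit c)) = x * Polynomial.C (KAlg.unit c) := by
  have h := (star ψ hfin).mul_right_of_op (star_op_smul ψ hfin c) x 1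
  rwa [one_mul, star_mul_one] at h

/-- The operation of index `n` lowers degrees by `n`. -/
private theorem star_mem (hdeg : ∀ n, 1 ≤ n → ∀ d, ∀ w ∈ R.plus2Comp d, ψ n w ∈ R.dropComp n d)
    (n : ℕ) {p q : ℕ} {a b : R.Alg} (ha : a ∈ R.comp p) (hb : b ∈ R.comp q) :
    (star ψ hfin).op n a b ∈ R.dropComp n (p + q) := by
  rcases eq_or_ne n 0 with rfl | hn
  · exact R.mem_dropComp_of_add (e := p + q) rfl (R.mul_mem_comp ha hb)
  · rw [star_op _ _ hn]
    exact hdeg n (Nat.one_le_iff_ne_zero.2 hn) _ _ (BT.tmul_mem_grading rfl (R.bar_mem ha)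
      (R.bar_mem hb))

private theorem isHomogeneousOfDegree_iff {n : ℕ} {x : R.Alg[X]} :
    R.IsHomogeneousOfDegree n x ↔ ∀ i, x.coeff i ∈ R.dropComp i n := by
  constructor
  · intro h i
    rcases Nat.lt_or_ge n i with hi | hi
    · rw [h.2 i hi]; exact zero_mem _
    · exact R.mem_dropComp_of_add (by omega) (h.1 i hi)
  · exact fun h => ⟨fun i hi => R.mem_comp_of_mem_dropComp hi (h i),
      fun i hi => R.eq_zero_of_mem_dropComp hi (h i)⟩

private theorem star_isHomogeneousOfDegree
    (hdeg : ∀ n, 1 ≤ n → ∀ d, ∀ w ∈ R.plus2Comp d, ψ n w ∈ R.dropComp n d)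
    {m n : ℕ} {x y : R.Alg[X]} (hx : R.IsHomogeneousOfDegree m x)
    (hy : R.IsHomogeneousOfDegree n y) :
    R.IsHomogeneousOfDegree (m + n) ((star ψ hfin).mul x y) := by
  rw [isHomogeneousOfDegree_iff]
  intro l
  rw [StarFamily.mul_eq_sum, Polynomial.finsetSum_coeff]
  refine sum_mem fun i hi => ?_
  rw [Polynomial.finsetSum_coeff]
  refine sum_mem fun j hj => ?_
  have hi' : i ≤ m := not_lt.1 fun h => Polynomial.mem_support_iff.1 hi (hx.2 i h)
  have hj' : j ≤ n := not_lt.1 fun h => Polynomial.mem_support_iff.1 hj (hy.2 j h)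
  rw [Polynomial.coeff_X_pow_mul', StarFamily.coeff_const]
  split_ifs with h
  · have h1 := star_mem ψ hfin hdeg (l - (i + j)) (hx.1 i hi') (hy.1 j hj')
    rcases Nat.lt_or_ge (m - i + (n - j)) (l - (i + j)) with h2 | h2
    · rw [R.eq_zero_of_mem_dropComp h2 h1]; exact zero_mem _
    · exact R.mem_dropComp_of_add (by omega) (R.mem_comp_of_mem_dropComp h2 h1)
  · exact zero_mem _

/-- The graded deformation with given cochains. -/
def GradedDeformation.ofCochains
    (hdeg : ∀ n, 1 ≤ n → ∀ d, ∀ w ∈ R.plus2Comp d, ψ n w ∈ R.dropComp n d)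
    (hass : ∀ n a b c, (star ψ hfin).assCoeff n a b c = 0) : R.GradedDeformation where
  mul := (star ψ hfin).mul
  add_mul := (star ψ hfin).add_mul
  mul_add := (star ψ hfin).mul_add
  mul_assoc x y z := (sub_eq_zero.1 ((star ψ hfin).ass_eq_zero hass x y z)).symm
  one_mul := star_one_mul ψ hfin
  mul_one := star_mul_one ψ hfin
  t_mul := (star ψ hfin).X_mul
  mul_t := (star ψ hfin).mul_X
  unit_mul c := (star ψ hfin).mul_left_of_op (star_smul ψ hfin c)
  mul_unit c := (star ψ hfin).mul_right_of_op (star_op_smul ψ hfin c)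
  balanced c := (star ψ hfin).balanced_of_op (star_balanced ψ hfin c)
  degree _ _ _ _ := star_isHomogeneousOfDegree ψ hfin hdeg
  mod_t := (star ψ hfin).coeff_zero_mul (star_op_zero ψ hfin)

private theorem GradedDeformation.ofCochains_isGivenBy
    (hdeg : ∀ n, 1 ≤ n → ∀ d, ∀ w ∈ R.plus2Comp d, ψ n w ∈ R.dropComp n d)
    (hass : ∀ n a b c, (star ψ hfin).assCoeff n a b c = 0) :
    (GradedDeformation.ofCochains ψ hfin hdeg hass).IsGivenBy ψ := fun j hj a b => by
  change ((star ψ hfin).mul _ _).coeff j = _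
  rw [StarFamily.C_mul_C, StarFamily.coeff_const, star_op _ _ (by omega), cochainHom_apply]

end
end HomRel

end PBW

/-! ### The coefficients of the associator as Hochschild cochains. -/

namespace PBW

universe u v w

set_option linter.unusedSectionVars false

variable {k : Type u} [Ring k] {V : Type v} [AddCommGroup V] [Module k V] [Module kᵐᵒᵖ V]
  [SMulCommClass k kᵐᵒᵖ V] {N : ℕ} (R : HomRel k V N)

namespace HomRel

/-- The two extreme terms of the convolution contain the undeformed product and will form the
Hochschild differential; the terms in the middle will form `sq`. -/
private theorem _root_.PBW.StarFamily.assCoeff_succ {A : Type*} [Ring A] (m : StarFamily A) (n : ℕ)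
    (a b c : A) : m.assCoeff (n + 1) a b c =
      ∑ i ∈ Finset.range n, (m.op (i + 1) a (m.op (n + 1 - (i + 1)) b c) -
        m.op (i + 1) (m.op (n + 1 - (i + 1)) a b) c) +
      (m.op 0 a (m.op (n + 1) b c) - m.op 0 (m.op (n + 1) a b) c) +
      (m.op (n + 1) a (m.op 0 b c) - m.op (n + 1) (m.op 0 a b) c) := by
  rw [StarFamily.assCoeff_eq, Finset.Nat.sum_antidiagonal_eq_sum_range_succ_mk,
    Finset.sum_range_succ, Finset.sum_range_succ', Nat.sub_self, Nat.sub_zero]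

variable {R}

section

variable (ψ : ℕ → R.Cochain2) (hfin : ∀ w, ∃ B, 1 ≤ B ∧ ∀ n, B ≤ n → ψ n w = 0)

private theorem star_ass_unit_left (c : k) (y z : R.Alg[X]) :
    (star ψ hfin).ass (Polynomial.C (KAlg.unit c)) y z = 0 := by
  rw [StarFamily.ass, star_unit_mul, star_unit_mul,
    (star ψ hfin).mul_left_of_op (star_smul ψ hfin c), sub_self]

private theorem star_ass_unit_mid (c : k) (x z : R.Alg[X]) :
    (star ψ hfin).ass x (Polynomial.C (KAlg.unit c)) z = 0 := by
  rw [StarFamily.ass, star_unit_mul, star_mul_unit,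
    (star ψ hfin).balanced_of_op (star_balanced ψ hfin c), sub_self]

private theorem star_ass_unit_right (c : k) (x y : R.Alg[X]) :
    (star ψ hfin).ass x y (Polynomial.C (KAlg.unit c)) = 0 := by
  rw [StarFamily.ass, star_mul_unit, star_mul_unit,
    (star ψ hfin).mul_right_of_op (star_op_smul ψ hfin c), sub_self]

private theorem eq_bar_add_unit (a : R.Alg) : a = (R.bar a : R.Alg) + KAlg.unit (R.aug a) := by
  rw [coe_bar, sub_add_cancel]

/-- The product is linear over `k` on both sides and balanced, so the associator vanishes when one
argument is a scalar; only the classes in `A / k` matter. -/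
private theorem star_ass_bar (a b c : R.Alg) :
    (star ψ hfin).ass (Polynomial.C a) (Polynomial.C b) (Polynomial.C c) =
      (star ψ hfin).ass (Polynomial.C (R.bar a : R.Alg)) (Polynomial.C (R.bar b : R.Alg))
        (Polynomial.C (R.bar c : R.Alg)) := by
  have h1 : ∀ x x' y z, (star ψ hfin).ass (x + x') y z =
      (star ψ hfin).ass x y z + (star ψ hfin).ass x' y z := fun x x' y z => by
    simp only [StarFamily.ass, StarFamily.add_mul]; abel
  have h2 : ∀ x y y' z, (star ψ hfin).ass x (y + y') z =
      (star ψ hfin).ass x y z + (star ψ hfin).ass x y' z := fun x y y' z => by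
    simp only [StarFamily.ass, StarFamily.add_mul, StarFamily.mul_add]; abel
  have h3 : ∀ x y z z', (star ψ hfin).ass x y (z + z') =
      (star ψ hfin).ass x y z + (star ψ hfin).ass x y z' := fun x y z z' => by
    simp only [StarFamily.ass, StarFamily.mul_add]; abel
  conv_lhs => rw [eq_bar_add_unit a, eq_bar_add_unit b, eq_bar_add_unit c]
  simp only [map_add, h1, h2, h3, star_ass_unit_left, star_ass_unit_mid, star_ass_unit_right,
    add_zero]

private theorem map_sub_add_sub {X Y : Type*} [AddCommGroup X] [AddCommGroup Y] (E : X →+ Y)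
    (p q r s : X) : E (p - q + r - s) = E p - E q + E r - E s := by
  rw [map_sub, map_add, map_sub]

private theorem extend_b3_gen (f : R.Cochain2) (a b c : R.plus) :
    extend f (R.b3 (gen k R.Alg _ (BT.tmul k a (BT.tmul k b c)))) =
      (a : R.Alg) * f (BT.tmul k b c) - f (BT.tmul k (R.mulPlus (BT.tmul k a b)) c) +
        f (BT.tmul k a (R.mulPlus (BT.tmul k b c))) - f (BT.tmul k a b) * (c : R.Alg) := by
  refine (congrArg (extend f).1 (R.b3_gen a b c)).trans ((map_sub_add_sub _ _ _ _ _).trans ?_)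
  have h : ∀ w, extend f (gen k R.Alg R.plus2 w) = f w := fun w => extend_gen (A := R.Alg) f w
  refine congrArg₂ (· - ·) (congrArg₂ (· + ·) (congrArg₂ (· - ·) ?_ (h _)) (h _)) ?_
  · exact ((extend f).map_smul _ _).trans (congrArg ((a : R.Alg) * ·) (h _))
  · exact ((extend f).map_op_smul _ _).trans (congrArg (· * (c : R.Alg)) (h _))

private theorem cochainHom_coe (f : R.Cochain2) (a b : R.plus) :
    cochainHom f (a : R.Alg) (b : R.Alg) = f (BT.tmul k a b) :=
  congrArg₂ (fun x y => f (BT.tmul k x y)) (R.bar_coe a) (R.bar_coe b)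

private theorem cochainHom_coe_left (f : R.Cochain2) (a : R.plus) (b : R.Alg) :
    cochainHom f (a : R.Alg) b = f (BT.tmul k a (R.bar b)) :=
  congrArg (fun x => f (BT.tmul k x (R.bar b))) (R.bar_coe a)

private theorem cochainHom_coe_right (f : R.Cochain2) (a : R.Alg) (b : R.plus) :
    cochainHom f a (b : R.Alg) = f (BT.tmul k (R.bar a) b) :=
  congrArg (fun x => f (BT.tmul k (R.bar a) x)) (R.bar_coe b)

private theorem add_sum_sub_rearrange {X : Type*} [AddCommGroup X] (p q r s t : X) :
    t + (p - s) + (r - q) = p - q + r - s + t := by abel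

private theorem sum_Icc_one_eq_sum_range {X : Type*} [AddCommMonoid X] (f : ℕ → X) (n : ℕ) :
    ∑ i ∈ Finset.Icc 1 n, f i = ∑ i ∈ Finset.range n, f (i + 1) := by
  rw [← Finset.Ico_add_one_right_eq_Icc, Finset.sum_Ico_eq_sum_range, Nat.add_sub_cancel]
  exact Finset.sum_congr rfl fun i _ => by rw [add_comm]

private theorem star_op_mid (n i : ℕ) (hi : i < n) (a b c : R.plus) :
    (star ψ hfin).op (i + 1) a ((star ψ hfin).op (n + 1 - (i + 1)) b c) -
      (star ψ hfin).op (i + 1) ((star ψ hfin).op (n + 1 - (i + 1)) a b) c =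
    ψ (i + 1) (BT.tmul k a (R.bar (ψ (n + 1 - (i + 1)) (BT.tmul k b c)))) -
      ψ (i + 1) (BT.tmul k (R.bar (ψ (n + 1 - (i + 1)) (BT.tmul k a b))) c) := by
  rw [star_op ψ hfin (Nat.succ_ne_zero i), star_op ψ hfin (show n + 1 - (i + 1) ≠ 0 by omega)]
  exact congrArg₂ (· - ·)
    ((congrArg (cochainHom _ _) (cochainHom_coe _ _ _)).trans (cochainHom_coe_left _ _ _))
    ((congrArg (fun x => cochainHom _ x (c : R.Alg)) (cochainHom_coe _ _ _)).trans
      (cochainHom_coe_right _ _ _))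

private theorem star_op_first (n : ℕ) (hn : n ≠ 0) (a b c : R.plus) :
    (star ψ hfin).op 0 a ((star ψ hfin).op n b c) - (star ψ hfin).op 0 ((star ψ hfin).op n a b) c =
      (a : R.Alg) * ψ n (BT.tmul k b c) - ψ n (BT.tmul k a b) * (c : R.Alg) := by
  rw [star_op ψ hfin hn]
  exact congrArg₂ (· - ·) (congrArg ((a : R.Alg) * ·) (cochainHom_coe _ _ _))
    (congrArg (· * (c : R.Alg)) (cochainHom_coe _ _ _))

private theorem star_op_last (n : ℕ) (hn : n ≠ 0) (a b c : R.plus) :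
    (star ψ hfin).op n a ((star ψ hfin).op 0 b c) - (star ψ hfin).op n ((star ψ hfin).op 0 a b) c =
      ψ n (BT.tmul k a (R.mulPlus (BT.tmul k b c))) -
        ψ n (BT.tmul k (R.mulPlus (BT.tmul k a b)) c) := by
  rw [star_op ψ hfin hn]
  exact congrArg₂ (· - ·) (cochainHom_coe (ψ n) a (R.mulPlus (BT.tmul k b c)))
    (cochainHom_coe (ψ n) (R.mulPlus (BT.tmul k a b)) c)

private theorem star_assCoeff_succ (n : ℕ) (a b c : R.plus) :
    (star ψ hfin).assCoeff (n + 1) a b c =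
      extend (ψ (n + 1)) (R.b3 (gen k R.Alg _ (BT.tmul k a (BT.tmul k b c)))) +
        R.sq ψ n (BT.tmul k a (BT.tmul k b c)) := by
  refine ((star ψ hfin).assCoeff_succ n a b c).trans ?_
  refine Eq.trans ?_ (congrArg₂ (· + ·) (extend_b3_gen (ψ (n + 1)) a b c) (sq_tmul ψ n a b c)).symm
  refine Eq.trans (congrArg₂ (· + ·) (congrArg₂ (· + ·) ?_ ?_) ?_) (add_sum_sub_rearrange _ _ _ _ _)
  · exact (Finset.sum_congr rfl fun i hi => star_op_mid ψ hfin n i (Finset.mem_range.1 hi) a b c).trans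
      (sum_Icc_one_eq_sum_range (fun i => ψ i (BT.tmul k a (R.bar (ψ (n + 1 - i) (BT.tmul k b c)))) -
        ψ i (BT.tmul k (R.bar (ψ (n + 1 - i) (BT.tmul k a b))) c)) n).symm
  · exact star_op_first ψ hfin (n + 1) n.succ_ne_zero a b c
  · exact star_op_last ψ hfin (n + 1) n.succ_ne_zero a b c

private theorem star_assCoeff_zero (a b c : R.Alg) : (star ψ hfin).assCoeff 0 a b c = 0 := by
  rw [StarFamily.assCoeff_eq, Finset.Nat.antidiagonal_zero, Finset.sum_singleton]
  simp only [star_op_zero, mul_assoc, sub_self]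

end
end HomRel

end PBW

/-! ### Associativity of the recursively defined product. -/

namespace PBW

universe u v w

set_option linter.unusedSectionVars false

variable {k : Type u} [Ring k] {V : Type v} [AddCommGroup V] [Module k V] [Module kᵐᵒᵖ V]
  [SMulCommClass k kᵐᵒᵖ V] {N : ℕ} (R : HomRel k V N)

namespace HomRel

variable {R}

private theorem plus3_eq_top (S : AddSubgroup R.plus3) (h : ∀ n, R.plus3Comp n ≤ S) : S = ⊤ := by
  rw [eq_top_iff]
  intro w _
  induction w using BT.induction with
  | zero => exact zero_mem _
  | add x y hx hy => exact add_mem (hx trivial) (hy trivial)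
  | tmul a b =>
    refine R.mem_of_plusComp (S := S.comap (BT.tmulHomLeft k b)) (fun i a ha => ?_) a
    have hS := R.plus2_eq_top (S.comap (BT.tmulHom k a)) fun j b hb =>
      h _ (BT.tmul_mem_grading rfl ha hb)
    exact (hS ▸ AddSubgroup.mem_top b : b ∈ S.comap (BT.tmulHom k a))

/-- The map `ψ_n^~ ∘ b̄₃ + sq(ψ₁, …, ψ_{n-1})^~`. -/
def assocCochain (ψ : ℕ → R.Cochain2) (n : ℕ) : BiHom R.Alg R.C3 R.Alg :=
  (extend (ψ n)).comp R.b3 + extend (R.sq ψ (n - 1))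

private theorem assocCochain_apply (ψ : ℕ → R.Cochain2) (n : ℕ) (x : R.C3) :
    assocCochain ψ n x = extend (ψ n) (R.b3 x) + extend (R.sq ψ (n - 1)) x := rfl

section

variable (ψ : ℕ → R.Cochain2) (hfin : ∀ w, ∃ B, 1 ≤ B ∧ ∀ n, B ≤ n → ψ n w = 0)

private theorem star_assCoeff {n : ℕ} (hn : 1 ≤ n) (a b c : R.plus) :
    (star ψ hfin).assCoeff n a b c =
      assocCochain ψ n (gen k R.Alg _ (BT.tmul k a (BT.tmul k b c))) := by
  obtain ⟨m, rfl⟩ := Nat.exists_eq_add_of_le' hn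
  exact (star_assCoeff_succ ψ hfin m a b c).trans
    (congrArg (_ + ·) (extend_gen (A := R.Alg) (R.sq ψ m) _).symm)

private theorem assCoeff_eq_zero {n : ℕ} (hn : 1 ≤ n) (h : ∀ x, assocCochain ψ n x = 0) (a b c : R.Alg) :
    (star ψ hfin).assCoeff n a b c = 0 :=
  (congrArg (fun x => x.coeff n) (star_ass_bar ψ hfin a b c)).trans
    ((star_assCoeff ψ hfin hn (R.bar a) (R.bar b) (R.bar c)).trans (h _))

/-- When the product is associative in lower orders, the pentagon identity makes the associator in
order `n` a Hochschild cocycle, which is the hypothesis of `eq_hL_b3`. -/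
private theorem assocCochain_hL_b3 {n : ℕ} (hn : 1 ≤ n)
    (h : ∀ j < n, ∀ a b c, (star ψ hfin).assCoeff j a b c = 0) (x : R.C3) :
    assocCochain ψ n (R.hL _ (R.b3 x)) = assocCochain ψ n x := by
  refine R.eq_hL_b3 (assocCochain ψ n) (fun a b c d => ?_) x
  have hp := (star ψ hfin).pentagon (star_op_zero ψ hfin) h (a : R.Alg) b c d
  have e := fun a b c => star_assCoeff ψ hfin hn a b c
  have e1 := e b c d
  have e2 := e (R.mulPlus (BT.tmul k a b)) c d
  have e3 := e a (R.mulPlus (BT.tmul k b c)) d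
  have e4 := e a b (R.mulPlus (BT.tmul k c d))
  have e5 := e a b c
  exact (congrArg₂ (· + ·) (congrArg₂ (· - ·) (congrArg₂ (· + ·) (congrArg₂ (· - ·)
    (congrArg ((a : R.Alg) * ·) e1) e2) e3) e4) (congrArg (· * (d : R.Alg)) e5)).symm.trans hp

end

private theorem b3_hL_b3 (x : R.C3) : R.b3 (R.hL _ (R.b3 x)) = R.b3 x := by
  have h : R.hL _ (R.b2 (R.b3 x)) = 0 :=
    (congrArg (R.hL _).1 (R.b2_b3 x)).trans (map_zero (R.hL _).1)
  exact ((add_zero _).symm.trans (congrArg (R.b3 (R.hL _ (R.b3 x)) + ·) h.symm)).trans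
    (R.b3_hL_add_hL_b2 _)

namespace Comparison

variable (c : R.Comparison) {φ : ℕ → BiHom k R.rel R.Alg}

private theorem tau2_b3_s2_b3 (x : R.C3) : c.tau2 (R.b3 (c.s2 (R.b3 x))) = 0 :=
  (c.tau2_b3_s2 (R.b3 x)).trans (neg_eq_zero.2 ((congrArg (fun y => c.tau2 (c.s1 y))
    (R.b2_b3 x)).trans (map_zero (c.tau2.1.comp c.s1.1))))

/-- The homotopy identity at the boundary `b̄₃ x`, where the term `s₁ b̄₂` is zero. -/
private theorem sigma2_tau2_b3 (x : R.C3) : R.sigma2 (c.tau2 (R.b3 x)) = R.b3 (x - c.s2 (R.b3 x)) := by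
  have h := c.homotopy.2 (R.b3 x)
  have h1 : c.s1 (R.b2 (R.b3 x)) = 0 := (congrArg c.s1.1 (R.b2_b3 x)).trans (map_zero c.s1.1)
  have h2 := (congrArg (R.b3 (c.s2 (R.b3 x)) + ·) h1).symm.trans h
  have h3 := (add_zero _).symm.trans h2
  exact (sub_sub_cancel _ _).symm.trans ((congrArg (R.b3 x - ·) h3.symm).trans
    (map_sub R.b3.1 _ _).symm)

private theorem obstruction_s2_b3_of_lt_two {n : ℕ} (hn : n < 2) (x : R.C3) :
    obstruction c φ n (c.s2 (R.b3 x)) = 0 :=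
  obstruction_eq_zero c φ (c.tau2_b3_s2_b3 x)
    ((congrArg (fun f : BiHom k R.plus3 R.Alg => extend f (c.s2 (R.b3 x)))
      (show R.sq (psi c φ) (n - 1) = 0 by rw [Nat.sub_eq_zero_of_le (by omega)]; rfl)).trans
        (extend_zero _))

private theorem _root_.PBW.eq_sub_of_eq_of_eq_zero {X : Type*} [AddCommGroup X] {p q r : X} (h : p = q)
    (h' : r = 0) : p = q - r := by
  rw [h, h', sub_zero]

private theorem _root_.PBW.add_eq_sub_of_eq {X : Type*} [AddCommGroup X] {p q r s t : X} (h : p = q - r)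
    (h' : t = q + s) : p + s = t - r := by
  rw [h, h']; abel

/-- `ψ_n^~ ∘ b̄₃ = (ψ'_n)^~ ∘ b̄₃ - ω_n ∘ s₂ ∘ b̄₃`, where `ω_n` is the obstruction. -/
private theorem extend_psi_b3 {n : ℕ} (hn : 1 ≤ n) (x : R.C3) :
    extend (psi c φ n) (R.b3 x) =
      extend (psi' c φ n) (R.b3 x) - obstruction c φ n (c.s2 (R.b3 x)) :=
  if h2 : 2 ≤ n then extend_psi c φ h2 (R.b3 x) else
    have h := c.obstruction_s2_b3_of_lt_two (φ := φ) (not_le.1 h2) x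
    eq_sub_of_eq_of_eq_zero (extend_psi_of_obstruction c φ hn h) h

private theorem obstruction_eq_add (φ : ℕ → BiHom k R.rel R.Alg) (n : ℕ) (x : R.C3) :
    obstruction c φ n x = extend (psi' c φ n) (R.b3 x) + extend (R.sq (psi c φ) (n - 1)) x := rfl

private theorem assocCochain_psi {n : ℕ} (hn : 1 ≤ n) (x : R.C3) :
    assocCochain (psi c φ) n x = obstruction c φ n x - obstruction c φ n (c.s2 (R.b3 x)) := by
  have h1 := assocCochain_apply (psi c φ) n x
  have h2 := obstruction_eq_add c φ n x
  have h3 := c.extend_psi_b3 (φ := φ) hn x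
  exact h1.trans (add_eq_sub_of_eq h3 h2)

/-- The chains `x` and `hL (b̄₃ x)` have the same boundary, so the correction `ω_n s₂ b̄₃` is the
same for both and cancels: the obstruction inherits from the associator that it depends only on the
boundary. -/
private theorem obstruction_hL_b3 {n : ℕ} (hn : 1 ≤ n)
    (h : ∀ x, assocCochain (psi c φ) n (R.hL _ (R.b3 x)) = assocCochain (psi c φ) n x) (x : R.C3) :
    obstruction c φ n (R.hL _ (R.b3 x)) = obstruction c φ n x := by
  have h1 := (c.assocCochain_psi hn (R.hL _ (R.b3 x))).symm.trans
    ((h x).trans (c.assocCochain_psi hn x))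
  have h2 := congrArg (fun y => obstruction c φ n (c.s2 y)) (b3_hL_b3 x)
  exact sub_left_inj.1 (h1.trans (congrArg (obstruction c φ n x - ·) h2.symm))

/-- The cycles of `K₂` on which the obstruction vanishes. -/
def unobstructed (φ : ℕ → BiHom k R.rel R.Alg) (n : ℕ) : AddSubgroup R.K2 :=
  R.d2.1.ker ⊓ ((obstruction c φ n).1.comp ((R.hL _).1.comp R.sigma2.1)).ker

/-- The contraction `hL` is not left linear, but `a hL (σ̄₂ κ)` and `hL (σ̄₂ (a κ))` have the same
boundary, and by `h` the obstruction sees only the boundary. -/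
private theorem unobstructed_smul_mem {n : ℕ}
    (h : ∀ x, obstruction c φ n (R.hL _ (R.b3 x)) = obstruction c φ n x) (a : R.Alg)
    {κ : R.K2} (hκ : κ ∈ c.unobstructed φ n) : a • κ ∈ c.unobstructed φ n := by
  have h1 : R.d2 κ = 0 := hκ.1
  have h2 : obstruction c φ n (R.hL _ (R.sigma2 κ)) = 0 := hκ.2
  refine ⟨(R.d2.map_smul a κ).trans ((congrArg (a • ·) h1).trans (smul_zero a)), ?_⟩
  have h3 : R.sigma2 (a • κ) = R.b3 (a • R.hL _ (R.sigma2 κ)) :=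
    (R.sigma2.map_smul a κ).trans ((congrArg (a • ·) (b3_hL_sigma2 h1).symm).trans
      (R.b3.map_smul a _).symm)
  exact (congrArg (fun y => obstruction c φ n (R.hL _ y)) h3).trans ((h _).trans
    (((obstruction c φ n).map_smul a _).trans ((congrArg (a • ·) h2).trans (smul_zero a))))

private theorem unobstructed_op_smul_mem {n : ℕ} (a : R.Alg)
    {κ : R.K2} (hκ : κ ∈ c.unobstructed φ n) : op a • κ ∈ c.unobstructed φ n := by
  have h1 : R.d2 κ = 0 := hκ.1
  have h2 : obstruction c φ n (R.hL _ (R.sigma2 κ)) = 0 := hκ.2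
  refine ⟨(R.d2.map_op_smul a κ).trans ((congrArg (op a • ·) h1).trans (smul_zero (op a))), ?_⟩
  exact (congrArg (fun y => obstruction c φ n (R.hL _ y)) (R.sigma2.map_op_smul a κ)).trans
    ((congrArg (obstruction c φ n).1 (R.hL_op_smul a (R.sigma2 κ))).trans
    (((obstruction c φ n).map_op_smul a _).trans ((congrArg (op a • ·) h2).trans
      (smul_zero (op a)))))

variable {Φ : ℕ → BiHom k R.rel (TV k V)}

private theorem containsKoszul3_unobstructed (hΦ : WeakPBW Φ) {n : ℕ} (hn : 1 ≤ n)
    (h : ∀ x, obstruction c (algCochain Φ) n (R.hL _ (R.b3 x)) = obstruction c (algCochain Φ) n x) :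
    R.ContainsKoszul3 (c.unobstructed (algCochain Φ) n) where
  smul_mem a _ := c.unobstructed_smul_mem h a
  op_smul_mem a _ := c.unobstructed_op_smul_mem a
  d3_mem _ _ _ _ _ _ hw := ⟨d2_koszul3 hw, c.obstruction_hL_sigma2_koszul3 hΦ hn hw⟩

/-- The associator at `x` is the obstruction at `x - s₂ b̄₃ x`, whose boundary is `σ̄₂` of the
Koszul cycle `τ̄₂ b̄₃ x`. Exactness at `K₂` puts that cycle into every sub-bimodule containing the
overlaps, in particular into the one on which the obstruction vanishes. -/
private theorem assocCochain_psi_eq_zero_of (hTor : R.Tor3ConcentratedIn (N + 1)) (hΦ : WeakPBW Φ) {n : ℕ}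
    (hn : 1 ≤ n) (h : ∀ x, assocCochain (psi c (algCochain Φ)) n (R.hL _ (R.b3 x)) =
      assocCochain (psi c (algCochain Φ)) n x) (x : R.C3) :
    assocCochain (psi c (algCochain Φ)) n x = 0 := by
  have h1 := c.obstruction_hL_b3 hn h
  have hG := c.containsKoszul3_unobstructed hΦ hn h1
  refine R.mem_of_freeComp (G := R.plus3Comp) plus3_eq_top
    (S := (assocCochain (psi c (algCochain Φ)) n).1.ker) (fun d x hx => ?_) x
  have h2 := R.mem_of_d2_eq_zero_of_mem hTor c hG d _ (c.graded.2.1 d _ (R.b3_mem d x hx))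
    (c.d2_tau2_b3 x)
  have h3 : obstruction c (algCochain Φ) n (R.hL _ (R.sigma2 (c.tau2 (R.b3 x)))) = 0 := h2.2
  have h4 := (congrArg (fun y => obstruction c (algCochain Φ) n (R.hL _ y))
    (c.sigma2_tau2_b3 x)).symm.trans h3
  exact (c.assocCochain_psi hn x).trans ((map_sub (obstruction c (algCochain Φ) n).1 _ _).symm.trans
    ((h1 _).symm.trans h4))

private theorem assCoeff_psi_eq_zero (hTor : R.Tor3ConcentratedIn (N + 1)) (hΦ : WeakPBW Φ) (n : ℕ)
    (x y z : R.Alg) : (star (psi c (algCochain Φ))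
      (c.exists_psi_eq_zero (algCochain Φ) hΦ.algCochain_mem)).assCoeff n x y z = 0 := by
  induction n using Nat.strong_induction_on generalizing x y z with
  | _ n ih =>
    rcases Nat.eq_zero_or_pos n with rfl | hn
    · exact star_assCoeff_zero _ _ x y z
    · exact assCoeff_eq_zero _ _ hn (c.assocCochain_psi_eq_zero_of hTor hΦ hn
        (assocCochain_hL_b3 _ _ hn ih)) x y z

/-- The graded deformation of `A` constructed from a weak PBW-deformation. -/
def deformation (hTor : R.Tor3ConcentratedIn (N + 1)) (hΦ : WeakPBW Φ) : R.GradedDeformation :=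
  GradedDeformation.ofCochains (psi c (algCochain Φ))
    (c.exists_psi_eq_zero (algCochain Φ) hΦ.algCochain_mem)
    (fun _ hn d w hw => c.psi_mem (algCochain Φ) hΦ.algCochain_mem hn d w hw)
    (c.assCoeff_psi_eq_zero hTor hΦ)

private theorem deformation_isGivenBy (hTor : R.Tor3ConcentratedIn (N + 1)) (hΦ : WeakPBW Φ) :
    (c.deformation hTor hΦ).IsGivenBy (psi c (algCochain Φ)) :=
  GradedDeformation.ofCochains_isGivenBy _ _ _ _

end Comparison
end HomRel

end PBW

/-! ### Homogenization of elements of the tensor algebra. -/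

namespace PBW

universe u v w

set_option linter.unusedSectionVars false

variable {k : Type u} [Ring k] {V : Type v} [AddCommGroup V] [Module k V] [Module kᵐᵒᵖ V]

namespace TV

private theorem gr_mul_of_mem_left {p : ℕ} {a : TV k V} (ha : a ∈ tpow k V p) (n : ℕ) (x : TV k V) :
    proj n (a * x) = if p ≤ n then a * proj (n - p) x else 0 := by
  rw [proj, map_mul, gr_of_mem ha, ← Polynomial.C_mul_X_pow_eq_monomial, mul_assoc,
    Polynomial.coeff_C_mul, Polynomial.coeff_X_pow_mul', mul_ite, mul_zero]
  rfl

private theorem gr_mul_of_mem_right {p : ℕ} {a : TV k V} (ha : a ∈ tpow k V p) (n : ℕ) (x : TV k V) :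
    proj n (x * a) = if p ≤ n then proj (n - p) x * a else 0 := by
  rw [proj, map_mul, gr_of_mem ha, ← Polynomial.C_mul_X_pow_eq_monomial, ← Polynomial.X_pow_mul_C,
    ← mul_assoc, Polynomial.coeff_mul_C, Polynomial.coeff_mul_X_pow', ite_mul, zero_mul]
  rfl

/-- An additive subgroup containing `P` which is stable under multiplication by homogeneous
elements contains the ideal generated by `P`. -/
private theorem mem_of_mem_idealOf {P : Set (TV k V)} {G : AddSubgroup (TV k V)} (hP : ∀ x ∈ P, x ∈ G)
    (hl : ∀ p, ∀ a ∈ tpow k V p, ∀ x ∈ G, a * x ∈ G)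
    (hr : ∀ p, ∀ a ∈ tpow k V p, ∀ x ∈ G, x * a ∈ G) {x : TV k V} (hx : x ∈ idealOf P) : x ∈ G := by
  rw [mem_idealOf_iff] at hx
  refine (AddSubgroup.closure_le G).2 ?_ hx
  rintro _ ⟨a, p, hp, b, rfl⟩
  have h1 : a * p ∈ G := mem_of_tpow (S := G.comap (AddMonoidHom.mulRight p))
    (fun n a ha => hl n a ha p (hP p hp)) a
  exact mem_of_tpow (S := G.comap (AddMonoidHom.mulLeft (a * p)))
    (fun n b hb => hr n b hb _ h1) b

/-- The homogenization `∑_{j ≤ n} x_j t^{n - j}` of the truncation of `x` to degrees `≤ n`. -/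
def homogenize (n : ℕ) : TV k V →+ (TV k V)[X] :=
  ∑ j ∈ Finset.range (n + 1),
    (Polynomial.monomial (n - j)).toAddMonoidHom.comp (projHom (k := k) (V := V) j).1

private theorem homogenize_apply (n : ℕ) (x : TV k V) : homogenize n x =
    ∑ j ∈ Finset.range (n + 1), Polynomial.monomial (n - j) (proj j x) :=
  AddMonoidHom.finsetSum_apply _ _ _

private theorem coeff_homogenize (n : ℕ) (x : TV k V) (i : ℕ) :
    (homogenize n x).coeff i = if i ≤ n then proj (n - i) x else 0 := by
  rw [homogenize_apply, Polynomial.finsetSum_coeff]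
  simp only [Polynomial.coeff_monomial]
  split_ifs with h
  · refine (Finset.sum_eq_single (n - i) (fun j hj hne => if_neg ?_) fun h' => ?_).trans
      (if_pos (by omega))
    · have := Finset.mem_range.1 hj
      omega
    · exact absurd (Finset.mem_range.2 (by omega)) h'
  · exact Finset.sum_eq_zero fun j _ => if_neg (by omega)

private theorem homogenize_mul_left {p : ℕ} {a : TV k V} (ha : a ∈ tpow k V p) (n : ℕ) (x : TV k V) :
    homogenize (p + n) (a * x) = Polynomial.C a * homogenize n x := by
  ext i
  rw [Polynomial.coeff_C_mul, coeff_homogenize, coeff_homogenize, gr_mul_of_mem_left ha]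
  split_ifs
  · rw [show p + n - i - p = n - i by omega]
  all_goals first | omega | simp

private theorem homogenize_mul_right {p : ℕ} {a : TV k V} (ha : a ∈ tpow k V p) (n : ℕ) (x : TV k V) :
    homogenize (n + p) (x * a) = homogenize n x * Polynomial.C a := by
  ext i
  rw [Polynomial.coeff_mul_C, coeff_homogenize, coeff_homogenize, gr_mul_of_mem_right ha]
  split_ifs
  · rw [show n + p - i - p = n - i by omega]
  all_goals first | omega | simp

private theorem homogenize_of_mem {n : ℕ} {x : TV k V} (hx : x ∈ tpow k V n) (i : ℕ) :
    homogenize (n + i) x = Polynomial.monomial i x := by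
  ext j
  rw [coeff_homogenize, Polynomial.coeff_monomial, proj_of_mem hx]
  split_ifs <;> first | rfl | omega

private theorem homogenize_succ {n : ℕ} {x : TV k V} (hx : x ∈ fil k V n) :
    homogenize (n + 1) x = Polynomial.X * homogenize n x := by
  ext i
  rw [coeff_homogenize]
  cases i with
  | zero => rw [if_pos (by omega), mem_fil_iff.1 hx _ (by omega), Polynomial.coeff_X_mul_zero]
  | succ i =>
    rw [Polynomial.coeff_X_mul, coeff_homogenize, Nat.add_sub_add_right]
    simp only [Nat.add_le_add_iff_right]

/-- A monomial `x tⁱ` with `x` of degree `n` is the homogenization of `x` at level `n + i`. -/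
private theorem exists_eq_sum_homogenize (z : (TV k V)[X]) : ∃ f : ℕ →₀ TV k V,
    (∀ n, f n ∈ fil k V n) ∧ z = f.sum fun n x => homogenize n x := by
  let S : AddSubmonoid (TV k V)[X] :=
    { carrier := {z | ∃ f : ℕ →₀ TV k V, (∀ n, f n ∈ fil k V n) ∧
        z = f.sum fun n x => homogenize n x}
      zero_mem' := ⟨0, fun n => zero_mem _, Finsupp.sum_zero_index.symm⟩
      add_mem' := by
        rintro _ _ ⟨f, hf, rfl⟩ ⟨g, hg, rfl⟩
        exact ⟨f + g, fun n => add_mem (hf n) (hg n), (Finsupp.sum_add_index'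
          (fun n => map_zero _) fun n => map_add _).symm⟩ }
  change z ∈ S
  have h : ∀ n, ∀ x ∈ tpow k V n, ∀ i, Polynomial.monomial i x ∈ S := fun n x hx i =>
    ⟨Finsupp.single (n + i) x, fun m => by
      rw [Finsupp.single_apply]
      split_ifs with hm
      · exact mem_fil_of_mem (by omega) hx
      · exact zero_mem _, ((Finsupp.sum_single_index (h := fun n x => homogenize n x)
        (map_zero (homogenize (n + i)))).trans
        (homogenize_of_mem hx i)).symm⟩
  induction z using Polynomial.induction_on' with
  | add p q hp hq => exact add_mem hp hq
  | monomial i x =>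
    obtain ⟨d, hd⟩ := exists_mem_fil x
    rw [eq_sum_proj hd, map_sum]
    exact sum_mem fun j _ => h j _ (proj_mem j x) i

end TV

variable [SMulCommClass k kᵐᵒᵖ V] {N : ℕ} {R : HomRel k V N}

namespace HomRel

private theorem prA_of_mem_dropComp {i m : ℕ} {a : R.Alg} (ha : a ∈ R.dropComp i m) {d : ℕ}
    (hd : d + i ≠ m) : R.prA d a = 0 := by
  rcases Nat.lt_or_ge m i with h | h
  · rw [R.eq_zero_of_mem_dropComp h ha]; exact map_zero (R.prA d).1
  · rw [R.prA_of_mem (R.mem_comp_of_mem_dropComp h ha), if_neg (by omega)]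

/-- In the coefficient of `tⁱ` the summand of index `n` lies in `A_{n-i}`, and the components of `A`
are independent. -/
private theorem eq_zero_of_sum_isHomogeneousOfDegree {s : Finset ℕ} {y : ℕ → R.Alg[X]}
    (hy : ∀ n ∈ s, R.IsHomogeneousOfDegree n (y n)) {m : ℕ}
    (h : R.IsHomogeneousOfDegree m (∑ n ∈ s, y n)) {n : ℕ} (hn : n ∈ s) (hne : n ≠ m) : y n = 0 := by
  ext i
  rw [Polynomial.coeff_zero]
  have h1 := isHomogeneousOfDegree_iff.1 (hy n hn) i
  rcases Nat.lt_or_ge n i with hi | hi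
  · exact R.eq_zero_of_mem_dropComp hi h1
  have h2 := prA_of_mem_dropComp (isHomogeneousOfDegree_iff.1 h i) (d := n - i) (by omega)
  rw [Polynomial.finsetSum_coeff] at h2
  have h3 : ∑ l ∈ s, R.prA (n - i) ((y l).coeff i) = R.prA (n - i) ((y n).coeff i) :=
    Finset.sum_eq_single n (fun l hl hln => prA_of_mem_dropComp
      (isHomogeneousOfDegree_iff.1 (hy l hl) i) (by omega)) (fun h' => absurd hn h')
  have h4 := ((map_sum (R.prA (n - i)).1 _ _).trans h3).symm.trans h2
  rwa [R.prA_of_mem (R.mem_comp_of_mem_dropComp hi h1), if_pos rfl] at h4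

private theorem IsHomogeneousOfDegree.zero (n : ℕ) : R.IsHomogeneousOfDegree n (0 : R.Alg[X]) :=
  isHomogeneousOfDegree_iff.2 fun _ => zero_mem _

private theorem IsHomogeneousOfDegree.add {n : ℕ} {x y : R.Alg[X]} (hx : R.IsHomogeneousOfDegree n x)
    (hy : R.IsHomogeneousOfDegree n y) : R.IsHomogeneousOfDegree n (x + y) :=
  isHomogeneousOfDegree_iff.2 fun i => Polynomial.coeff_add x y i ▸
    add_mem (isHomogeneousOfDegree_iff.1 hx i) (isHomogeneousOfDegree_iff.1 hy i)

private theorem IsHomogeneousOfDegree.monomial {n i : ℕ} {a : R.Alg} (ha : a ∈ R.comp n) :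
    R.IsHomogeneousOfDegree (n + i) (Polynomial.monomial i a) :=
  isHomogeneousOfDegree_iff.2 fun j => by
    rw [Polynomial.coeff_monomial]
    split_ifs with h
    · exact R.mem_dropComp_of_add (by omega) ha
    · exact zero_mem _

end HomRel

end PBW

/-! ### The deformed algebra `A_t` as a quotient of `(T_k V)[t]`. -/

namespace PBW

universe u v w

set_option linter.unusedSectionVars false

variable {k : Type u} [Ring k] {V : Type v} [AddCommGroup V] [Module k V] [Module kᵐᵒᵖ V]
  [SMulCommClass k kᵐᵒᵖ V] {N : ℕ} {R : HomRel k V N}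

namespace HomRel.GradedDeformation

variable (D : R.GradedDeformation)

private theorem X_mul (x : R.Alg[X]) : D.ofPoly Polynomial.X * D.ofPoly x = D.ofPoly (Polynomial.X * x) := by
  have h := D.t_mul 1 x
  rwa [_root_.mul_one, D.one_mul] at h

private theorem mul_X (x : R.Alg[X]) : D.ofPoly x * D.ofPoly Polynomial.X = D.ofPoly (Polynomial.X * x) := by
  have h := D.mul_t x 1
  rwa [_root_.mul_one, D.mul_one] at h

private theorem commute_X (x : D.At) : Commute x (D.ofPoly Polynomial.X) :=
  (D.mul_X x).trans (D.X_mul x).symm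

private theorem X_pow_mul (n : ℕ) (x : R.Alg[X]) :
    D.ofPoly Polynomial.X ^ n * D.ofPoly x = D.ofPoly (Polynomial.X ^ n * x) := by
  induction n with
  | zero => rw [pow_zero, pow_zero, _root_.one_mul, _root_.one_mul]
  | succ n ih => rw [pow_succ', _root_.mul_assoc, ih, X_mul, pow_succ', _root_.mul_assoc]

/-- As a module over `k[t]`, `A_t` is `A[t]`, so it has no `t`-torsion. The identification of the
kernel of `hom` rests on this. -/
private theorem eq_zero_of_X_mul {x : D.At} (h : D.ofPoly Polynomial.X * x = 0) : x = 0 := by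
  have h1 : (Polynomial.X : R.Alg[X]) * D.toPoly x = 0 := (D.X_mul x).symm.trans h
  refine Polynomial.ext fun n => ?_
  have h2 := congrArg (fun p => Polynomial.coeff p (n + 1)) h1
  exact (Polynomial.coeff_X_mul _ _).symm.trans h2

private theorem unit_mul' (c : k) (x : R.Alg[X]) : D.ofPoly (Polynomial.C (KAlg.unit c)) * D.ofPoly x =
    D.ofPoly (Polynomial.C (KAlg.unit c) * x) := by
  have h := D.unit_mul c 1 x
  rwa [_root_.mul_one, D.one_mul] at h

private theorem mul_unit' (c : k) (x : R.Alg[X]) : D.ofPoly x * D.ofPoly (Polynomial.C (KAlg.unit c)) =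
    D.ofPoly (x * Polynomial.C (KAlg.unit c)) := by
  have h := D.mul_unit c x 1
  rwa [_root_.one_mul, D.mul_one] at h

/-- The structure map from `k` to `A_t`. -/
def const : k →+* D.At where
  toFun c := D.ofPoly (Polynomial.C (KAlg.unit c))
  map_one' := by rw [map_one, map_one]; rfl
  map_mul' c d := by rw [unit_mul', map_mul, map_mul]
  map_zero' := by rw [map_zero, map_zero]; rfl
  map_add' c d := by rw [map_add, map_add]; rfl

/-- The ring homomorphism `T_k V → A_t` extending `V → A`. -/
def base : TV k V →+* D.At :=
  TV.lift D.const (AddMonoidHom.mk' (fun v => D.ofPoly (Polynomial.C (R.toAlg (TV.ι v))))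
      (fun v w => by rw [BiHom.map_add, map_add, map_add]; rfl))
    (fun c v => by
      change D.ofPoly (Polynomial.C (R.toAlg (TV.ι (c • v)))) =
        D.ofPoly (Polynomial.C (KAlg.unit c)) * D.ofPoly (Polynomial.C (R.toAlg (TV.ι v)))
      rw [unit_mul', BiHom.map_smul, KAlg.smul_def, map_mul, map_mul]
      rfl)
    (fun c v => by
      change D.ofPoly (Polynomial.C (R.toAlg (TV.ι (op c • v)))) =
        D.ofPoly (Polynomial.C (R.toAlg (TV.ι v))) * D.ofPoly (Polynomial.C (KAlg.unit c))
      rw [mul_unit', BiHom.map_op_smul, KAlg.op_smul_def, map_mul, map_mul]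
      rfl)

private theorem base_unit (c : k) : D.base (KAlg.unit c) = D.ofPoly (Polynomial.C (KAlg.unit c)) :=
  TV.lift_unit _ _ _ _ c

private theorem base_ι (v : V) : D.base (TV.ι v) = D.ofPoly (Polynomial.C (R.toAlg (TV.ι v))) :=
  TV.lift_ι _ _ _ _ v

private theorem special_base (x : TV k V) : D.special (D.base x) = R.toAlg x := by
  induction x using TV.induction with
  | unit c => rw [base_unit]; exact Polynomial.coeff_C_zero
  | ι v => rw [base_ι]; exact Polynomial.coeff_C_zero
  | add x y hx hy => rw [map_add, map_add, map_add, hx, hy]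
  | mul x y hx hy => rw [map_mul, map_mul, map_mul, hx, hy]

private theorem base_isHomogeneousOfDegree {n : ℕ} {x : TV k V} (hx : x ∈ TV.tpow k V n) :
    R.IsHomogeneousOfDegree n (D.toPoly (D.base x)) := by
  induction n generalizing x with
  | zero =>
    obtain ⟨c, rfl⟩ := hx
    change R.IsHomogeneousOfDegree 0 (D.toPoly (D.base (KAlg.unit c)))
    rw [base_unit]
    exact IsHomogeneousOfDegree.monomial (n := 0) (i := 0) (R.toAlg_mem (x := KAlg.unit c) ⟨c, rfl⟩)
  | succ n ih =>
    obtain ⟨m, v, y, hy, rfl⟩ := TV.exists_sum_left hx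
    rw [map_sum]
    refine Finset.sum_induction _ (fun x => R.IsHomogeneousOfDegree (n + 1) (D.toPoly x))
      (fun _ _ h1 h2 => h1.add h2) (.zero _) fun i _ => ?_
    rw [map_mul, base_ι, add_comm]
    exact D.degree 1 n _ _ (IsHomogeneousOfDegree.monomial (n := 1) (i := 0)
      (R.toAlg_mem (TV.ι_mem _))) (ih (hy i))

/-- The ring homomorphism `(T_k V)[t] → A_t` extending `base`. -/
def hom : (TV k V)[X] →+* D.At :=
  Polynomial.eval₂RingHom' D.base (D.ofPoly Polynomial.X) fun _ => D.commute_X _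

private theorem hom_C (x : TV k V) : D.hom (Polynomial.C x) = D.base x := Polynomial.eval₂_C _ _

private theorem hom_X : D.hom Polynomial.X = D.ofPoly Polynomial.X := Polynomial.eval₂_X _ _

private theorem X_mem_range_hom : D.ofPoly Polynomial.X ∈ D.hom.range := ⟨_, D.hom_X⟩

private theorem hom_monomial (n : ℕ) (x : TV k V) : D.hom (Polynomial.monomial n x) =
    D.ofPoly (Polynomial.X ^ n * D.toPoly (D.base x)) := by
  rw [← Polynomial.C_mul_X_pow_eq_monomial, ← Polynomial.X_pow_mul_C, map_mul, map_pow, hom_X, hom_C]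
  exact D.X_pow_mul n _

private theorem hom_homogenize_isHomogeneousOfDegree (n : ℕ) (x : TV k V) :
    R.IsHomogeneousOfDegree n (D.toPoly (D.hom (TV.homogenize n x))) := by
  rw [TV.homogenize_apply, map_sum]
  refine Finset.sum_induction _ (fun x => R.IsHomogeneousOfDegree n (D.toPoly x))
    (fun _ _ h1 h2 => h1.add h2) (.zero _) fun i hi => ?_
  rw [hom_monomial]
  refine isHomogeneousOfDegree_iff.2 fun j => ?_
  have h := isHomogeneousOfDegree_iff.1 (D.base_isHomogeneousOfDegree (TV.proj_mem i x))
  have hi' := Finset.mem_range.1 hi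
  change (Polynomial.X ^ (n - i) * D.toPoly (D.base (TV.proj i x))).coeff j ∈ _
  rw [Polynomial.coeff_X_pow_mul']
  split_ifs with hj
  · rcases Nat.lt_or_ge i (j - (n - i)) with h2 | h2
    · rw [R.eq_zero_of_mem_dropComp h2 (h _)]; exact zero_mem _
    · exact R.mem_dropComp_of_add (by omega) (R.mem_comp_of_mem_dropComp h2 (h _))
  · exact zero_mem _

private theorem special_hom_homogenize (n : ℕ) (x : TV k V) :
    D.special (D.hom (TV.homogenize n x)) = R.toAlg (TV.proj n x) := by
  have h : ∀ z, D.special (D.hom z) = R.toAlg (z.coeff 0) := fun z => by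
    refine RingHom.congr_fun (Polynomial.ringHom_ext (f := D.special.comp D.hom)
      (g := R.toAlg.comp Polynomial.constantCoeff) (fun a => ?_) ?_) z
    · change D.special (D.hom (Polynomial.C a)) = R.toAlg ((Polynomial.C a).coeff 0)
      rw [hom_C, special_base, Polynomial.coeff_C_zero]
    · change D.special (D.hom Polynomial.X) = R.toAlg (Polynomial.X.coeff 0)
      rw [hom_X, Polynomial.coeff_X_zero, map_zero]
      exact Polynomial.coeff_X_zero
  rw [h, TV.coeff_homogenize, if_pos (Nat.zero_le n), Nat.sub_zero]

/-- The element `base x` has constant coefficient the class of `x`, while its higher coefficients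
have smaller degree because `t` has degree one. Those are in the range by induction and can be
subtracted. -/
private theorem C_mem_range_hom (n : ℕ) (a : R.Alg) (ha : a ∈ R.comp n) :
    D.ofPoly (Polynomial.C a) ∈ D.hom.range := by
  induction n using Nat.strong_induction_on generalizing a with
  | _ n ih =>
    obtain ⟨x, hx, rfl⟩ := ha
    change D.ofPoly (Polynomial.C (R.toAlg x)) ∈ D.hom.range
    have h := isHomogeneousOfDegree_iff.1 (D.base_isHomogeneousOfDegree hx)
    have h1 : D.ofPoly (D.toPoly (D.base x)).divX ∈ D.hom.range := by
      have e := Polynomial.as_sum_range (D.toPoly (D.base x)).divX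
      have e2 : D.ofPoly (D.toPoly (D.base x)).divX = ∑ i ∈ Finset.range
          ((D.toPoly (D.base x)).divX.natDegree + 1),
          D.ofPoly (Polynomial.monomial i ((D.toPoly (D.base x)).divX.coeff i)) := e
      rw [e2]
      refine sum_mem fun i _ => ?_
      have h2 := h (i + 1)
      rw [← Polynomial.coeff_divX] at h2
      rw [← Polynomial.C_mul_X_pow_eq_monomial, ← Polynomial.X_pow_mul_C, ← X_pow_mul]
      refine mul_mem (pow_mem D.X_mem_range_hom i) ?_
      rcases Nat.lt_or_ge n (i + 1) with h3 | h3
      · rw [R.eq_zero_of_mem_dropComp h3 h2, map_zero]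
        exact zero_mem _
      · exact ih _ (by omega) _ (R.mem_comp_of_mem_dropComp h3 h2)
    have h2 : D.ofPoly (Polynomial.C (R.toAlg x)) = D.base x -
        D.ofPoly Polynomial.X * D.ofPoly (D.toPoly (D.base x)).divX := by
      rw [X_mul]
      have e := Polynomial.X_mul_divX_add (D.toPoly (D.base x))
      have e3 : (D.toPoly (D.base x)).coeff 0 = R.toAlg x := D.special_base x
      rw [e3] at e
      exact eq_sub_of_add_eq' e
    rw [h2]
    exact sub_mem ⟨Polynomial.C x, D.hom_C x⟩ (mul_mem D.X_mem_range_hom h1)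

private theorem hom_surjective : Function.Surjective D.hom := by
  intro y
  change y ∈ D.hom.range
  have h : ∀ a : R.Alg, D.ofPoly (Polynomial.C a) ∈ D.hom.range := fun a =>
    R.mem_of_comp (S := D.hom.range.toAddSubgroup.comap (Polynomial.C (R := R.Alg)).toAddMonoidHom)
      (fun n a ha => D.C_mem_range_hom n a ha) a
  have e : y = ∑ i ∈ Finset.range ((D.toPoly y).natDegree + 1),
      D.ofPoly (Polynomial.monomial i ((D.toPoly y).coeff i)) :=
    Polynomial.as_sum_range (D.toPoly y)
  rw [e]
  refine sum_mem fun i _ => ?_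
  rw [← Polynomial.C_mul_X_pow_eq_monomial, ← Polynomial.X_pow_mul_C, ← X_pow_mul]
  exact mul_mem (pow_mem D.X_mem_range_hom i) (h _)

end HomRel.GradedDeformation

end PBW

/-! ### Relations of a normalized deformation, and the kernel of `(T_k V)[t] → A_t`. -/

namespace PBW

universe u v w

set_option linter.unusedSectionVars false

variable {k : Type u} [Ring k] {V : Type v} [AddCommGroup V] [Module k V] [Module kᵐᵒᵖ V]
  [SMulCommClass k kᵐᵒᵖ V] {N : ℕ} {R : HomRel k V N}

namespace HomRel

private theorem extend_ins_par_mul_ι (f : R.Cochain2) (x : TV k V) (v : V) :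
    extend f (R.ins (R.par (x * TV.ι v))) =
      f (BT.tmul k (R.cls x) (R.vIncl v)) + extend f (R.ins (R.par x)) * R.toAlg (TV.ι v) :=
  (congrArg (extend f).1 (R.ins_par_mul_ι x v)).trans ((map_add (extend f).1 _ _).trans
    (congrArg₂ (· + ·) (psi_gen f x (TV.ι v)) ((extend f).map_op_smul _ _)))

private theorem extend_ins_par_eq_zero (f : R.Cochain2) {q : ℕ}
    (h : ∀ j < q, ∀ x ∈ TV.tpow k V j, ∀ v, f (BT.tmul k (R.cls x) (R.vIncl v)) = 0) {x : TV k V}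
    (hx : x ∈ TV.tpow k V q) : extend f (R.ins (R.par x)) = 0 := by
  let E : TV k V →+ R.Alg := (extend f).1.comp (R.ins.1.comp R.par.1)
  change E x = 0
  have hE : ∀ y v, E (y * TV.ι v) = f (BT.tmul k (R.cls y) (R.vIncl v)) +
      E y * R.toAlg (TV.ι v) := extend_ins_par_mul_ι f
  have h0 : ∀ y ∈ TV.tpow k V 0, E y = 0 := fun y hy =>
    (congrArg ((extend f).1.comp R.ins.1) (R.par_of_mem_zero hy)).trans (map_zero _)
  clear_value E
  induction q generalizing x with
  | zero => exact h0 x hx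
  | succ q ih =>
    obtain ⟨m, y, v, hy, rfl⟩ := TV.exists_sum_right hx
    rw [map_sum]
    refine Finset.sum_eq_zero fun i _ => ?_
    rw [hE, h q (by omega) _ (hy i), ih (fun j hj => h j (by omega)) (hy i), zero_mul, add_zero]

/-- The values of a normalized cochain on the relations. -/
private theorem extend_sigma2_gen {f : R.Cochain2} (hf : ∀ p q, p + q < N → ∀ a ∈ R.plusComp p,
    ∀ b ∈ R.plusComp q, f (BT.tmul k a b) = 0) {m : ℕ} {x : Fin m → TV k V} {v : Fin m → V}
    (hx : ∀ i, x i ∈ TV.tpow k V (N - 1)) {r : R.rel}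
    (hr : (r : TV k V) = ∑ i, x i * TV.ι (v i)) :
    extend f (R.sigma2 (gen k R.Alg R.rel r)) =
      ∑ i, f (BT.tmul k (R.cls (x i)) (R.vIncl (v i))) := by
  have hN := R.two_le
  have h1 : extend f (R.sigma2 (gen k R.Alg R.rel r)) = extend f (R.ins (R.par r)) :=
    congrArg (extend f).1 (R.sigma2_gen r)
  refine h1.trans ?_
  let E : TV k V →+ R.Alg := (extend f).1.comp (R.ins.1.comp R.par.1)
  change E r = _
  have hE : ∀ i, E (x i * TV.ι (v i)) = f (BT.tmul k (R.cls (x i)) (R.vIncl (v i))) := fun i =>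
    (extend_ins_par_mul_ι f (x i) (v i)).trans ((congrArg (_ + ·)
      ((congrArg (· * R.toAlg (TV.ι (v i))) (extend_ins_par_eq_zero f (fun j hj y hy w =>
        hf j 1 (by omega) _ (R.cls_mem hy) _ (R.vIncl_mem w)) (hx i))).trans (zero_mul _))).trans
          (add_zero _))
  clear_value E
  rw [hr, map_sum]
  exact Finset.sum_congr rfl fun i _ => hE i

namespace GradedDeformation

variable {D : R.GradedDeformation} {ψ : ℕ → R.Cochain2}

private theorem coeff_base_mul_ι (hD : D.IsGivenBy ψ) {x : TV k V}
    (hx : D.base x = D.ofPoly (Polynomial.C (R.toAlg x))) (v : V) {j : ℕ} (hj : 1 ≤ j) :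
    (D.toPoly (D.base (x * TV.ι v))).coeff j = ψ j (BT.tmul k (R.cls x) (R.vIncl v)) := by
  rw [map_mul, hx, base_ι]
  exact hD j hj _ _

/-- Building a word of length below `N` letter by letter only multiplies elements of total degree
below `N`, where the normalized `ψ_j` add nothing. -/
private theorem base_of_lt (hD : D.IsGivenBy ψ) (hψ : R.Normalized ψ) {n : ℕ} (hn : n < N) {x : TV k V}
    (hx : x ∈ TV.tpow k V n) : D.base x = D.ofPoly (Polynomial.C (R.toAlg x)) := by
  induction n generalizing x with
  | zero =>
    obtain ⟨c, rfl⟩ := hx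
    exact D.base_unit c
  | succ n ih =>
    obtain ⟨m, y, v, hy, rfl⟩ := TV.exists_sum_right hx
    have h : ∀ i, D.base (y i * TV.ι (v i)) =
        D.ofPoly (Polynomial.C (R.toAlg (y i * TV.ι (v i)))) := fun i => by
      refine Polynomial.ext fun j => ?_
      rcases Nat.eq_zero_or_pos j with rfl | hj
      · exact (D.special_base _).trans Polynomial.coeff_C_zero.symm
      · refine (coeff_base_mul_ι hD (ih (by omega) (hy i)) (v i) hj).trans
          ((hψ j hj n 1 (by omega) _ (R.cls_mem (hy i)) _ (R.vIncl_mem (v i))).trans ?_)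
        exact (Polynomial.coeff_C_of_ne_zero (by omega)).symm
    rw [map_sum, map_sum, map_sum]
    exact Finset.sum_congr rfl fun i _ => h i

/-- Write `r = ∑ xᵢ vᵢ` with `xᵢ` of degree `N - 1`. Only the last multiplication is deformed, with
corrections `ψ_j(xᵢ, vᵢ)`, and normalization reduces `ψ_j^~ σ̄₂` on `r` to the same sum. -/
private theorem coeff_base_rel (hD : D.IsGivenBy ψ) (hψ : R.Normalized ψ) (r : R.rel) {j : ℕ} (hj : 1 ≤ j) :
    (D.toPoly (D.base r)).coeff j = extend (ψ j) (R.sigma2 (gen k R.Alg R.rel r)) := by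
  have hN := R.two_le
  obtain ⟨m, y, v, hy, hr⟩ := exists_sum_right_rel r
  refine Eq.trans ?_ (extend_sigma2_gen (fun p q h a ha b hb => hψ j hj p q h a ha b hb) hy hr).symm
  let L : TV k V →+ R.Alg := (Polynomial.lcoeff R.Alg j).toAddMonoidHom.comp D.base.toAddMonoidHom
  change L r = _
  rw [hr, map_sum]
  exact Finset.sum_congr rfl fun i _ =>
    coeff_base_mul_ι hD (base_of_lt hD hψ (by omega) (hy i)) (v i) hj

private theorem mem_fil_of_mem_relationsOf {p : TV k V} (hp : p ∈ relationsOf R ψ) :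
    p ∈ TV.fil k V N ∧ TV.proj N p ∈ R.rel := by
  obtain ⟨r, y, hy, rfl⟩ := hp
  refine ⟨sub_mem (tpow_le_fil N (R.le r r.2)) (sum_mem fun j hj =>
    TV.mem_fil_of_mem (Finset.mem_range.1 hj).le (hy j (Finset.mem_range.1 hj)).1), ?_⟩
  rw [TV.proj_sub, TV.proj_sum, Finset.sum_eq_zero fun j hj =>
    TV.proj_eq_zero (Finset.mem_range.1 hj).ne (hy j (Finset.mem_range.1 hj)).1, sub_zero,
    TV.proj_eq_self (R.le r r.2)]
  exact r.2

private theorem sum_X_pow_mul_C {A : Type*} [Ring A] {p : A[X]} {n : ℕ} (h0 : p.coeff 0 = 0)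
    (hn : ∀ i, n < i → p.coeff i = 0) :
    ∑ j ∈ Finset.range n, Polynomial.X ^ (n - j) * Polynomial.C (p.coeff (n - j)) = p := by
  ext i
  rw [Polynomial.finsetSum_coeff]
  simp only [Polynomial.coeff_X_pow_mul', Polynomial.coeff_C]
  rcases Nat.eq_zero_or_pos i with rfl | hi
  · rw [h0]
    refine Finset.sum_eq_zero fun j hj => if_neg ?_
    have := Finset.mem_range.1 hj
    omega
  rcases Nat.lt_or_ge n i with h | h
  · rw [hn i h]
    refine Finset.sum_eq_zero fun j hj => ?_
    split_ifs <;> first | rfl | omega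
  · refine (Finset.sum_eq_single (n - i) (fun j hj hne => ?_) fun h' =>
      absurd (Finset.mem_range.2 (by omega)) h').trans ?_
    · have := Finset.mem_range.1 hj
      split_ifs <;> first | rfl | omega
    · rw [if_pos (by omega), if_pos (by omega), show n - (n - i) = i by omega]

/-- In `A_t` the relation `r` equals `∑ φ_j(r) t^(N-j)`: its constant coefficient is its class in
`A`, which is zero, and by homogeneity there are no powers beyond `t^N`. The `φ_j(r)`, of degree
below `N`, are not deformed. -/
private theorem hom_homogenize_relationsOf (hD : D.IsGivenBy ψ) (hψ : R.Normalized ψ) {p : TV k V}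
    (hp : p ∈ relationsOf R ψ) : D.hom (TV.homogenize N p) = 0 := by
  obtain ⟨r, y, hy, rfl⟩ := hp
  have hr : D.hom (TV.homogenize N (r : TV k V)) = D.base r := by
    have h := TV.homogenize_of_mem (R.le r r.2) 0
    rw [add_zero, Polynomial.monomial_zero_left] at h
    rw [h, hom_C]
  have hj : ∀ j ∈ Finset.range N, D.hom (TV.homogenize N (y j)) =
      D.ofPoly (Polynomial.X ^ (N - j) *
        Polynomial.C ((D.toPoly (D.base r)).coeff (N - j))) := fun j hj => by
    have hj' := Finset.mem_range.1 hj
    have h := TV.homogenize_of_mem (hy j hj').1 (N - j)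
    rw [Nat.add_sub_cancel' hj'.le] at h
    rw [h, hom_monomial, base_of_lt hD hψ hj' (hy j hj').1, coeff_base_rel hD hψ r (by omega),
      ← (hy j hj').2]
    rfl
  have h := D.base_isHomogeneousOfDegree (R.le r r.2)
  rw [map_sub, map_sub, map_sum, map_sum, hr, Finset.sum_congr rfl hj]
  refine sub_eq_zero.2 (sum_X_pow_mul_C (p := D.toPoly (D.base r)) ?_ h.2).symm
  exact (D.special_base r).trans (R.toAlg_rel r.2)

/-- Homogeneity of `A_t` places the values of the cochains in the components `A_j`, so they can be
lifted to `V^{⊗ j}`. -/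
private theorem exists_relationsOf (hD : D.IsGivenBy ψ) (hψ : R.Normalized ψ) (r : R.rel) :
    ∃ p ∈ relationsOf R ψ, TV.proj N p = r := by
  have h := D.base_isHomogeneousOfDegree (R.le r r.2)
  have h1 : ∀ j, ∃ y : TV k V, j < N → y ∈ TV.tpow k V j ∧
      R.toAlg y = extend (ψ (N - j)) (R.sigma2 (gen k R.Alg R.rel r)) := fun j => by
    by_cases hj : j < N
    · obtain ⟨y, hy, hy'⟩ := h.1 (N - j) (by omega)
      rw [show N - (N - j) = j by omega] at hy
      exact ⟨y, fun _ => ⟨hy, Eq.trans hy' (coeff_base_rel hD hψ r (by omega))⟩⟩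
    · exact ⟨0, fun h => absurd h hj⟩
  choose y hy using h1
  refine ⟨_, ⟨r, y, hy, rfl⟩, ?_⟩
  rw [TV.proj_sub, TV.proj_sum, Finset.sum_eq_zero fun j hj =>
    TV.proj_eq_zero (Finset.mem_range.1 hj).ne (hy j (Finset.mem_range.1 hj)).1, sub_zero,
    TV.proj_eq_self (R.le r r.2)]

/-! The kernel of `(T_k V)[t] → A_t` -/

section Kernel

variable {P : Set (TV k V)}

/-- An element of `⟨P⟩` is a sum of products whose filtration degrees may exceed its own, so the
vanishing is first obtained only at large levels. -/
private theorem eventually_hom_homogenize_eq_zero (hP : ∀ p ∈ P, p ∈ TV.fil k V N)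
    (hP0 : ∀ p ∈ P, D.hom (TV.homogenize N p) = 0) {x : TV k V} (hx : x ∈ idealOf P) :
    ∃ M, ∀ m, M ≤ m → D.hom (TV.homogenize m x) = 0 := by
  let G : AddSubgroup (TV k V) :=
    { carrier := {x | ∃ M, ∀ m, M ≤ m → D.hom (TV.homogenize m x) = 0}
      zero_mem' := ⟨0, fun m _ => by rw [map_zero, map_zero]⟩
      add_mem' := by
        rintro x y ⟨M, hM⟩ ⟨M', hM'⟩
        exact ⟨max M M', fun m hm => by
          rw [map_add, map_add, hM m (le_trans (le_max_left _ _) hm),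
            hM' m (le_trans (le_max_right _ _) hm), add_zero]⟩
      neg_mem' := by
        rintro x ⟨M, hM⟩
        exact ⟨M, fun m hm => by rw [map_neg, map_neg, hM m hm, neg_zero]⟩ }
  refine TV.mem_of_mem_idealOf (P := P) (G := G) (fun p hp => ⟨N, fun m hm => ?_⟩) ?_ ?_ hx
  · induction m, hm using Nat.le_induction with
    | base => exact hP0 p hp
    | succ m hm ih => rw [TV.homogenize_succ (TV.fil_mono hm (hP p hp)), map_mul, ih, mul_zero]
  · rintro l a ha x ⟨M, hM⟩
    refine ⟨l + M, fun m hm => ?_⟩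
    obtain ⟨m, rfl⟩ := Nat.exists_eq_add_of_le (le_trans (Nat.le_add_right l M) hm)
    rw [TV.homogenize_mul_left ha, map_mul, hM m (by omega), mul_zero]
  · rintro l a ha x ⟨M, hM⟩
    refine ⟨l + M, fun m hm => ?_⟩
    obtain ⟨m, rfl⟩ := Nat.exists_eq_add_of_le' (le_trans (Nat.le_add_right l M) hm)
    rw [TV.homogenize_mul_right ha, map_mul, hM m (by omega), zero_mul]

/-- Raising the level of homogenization multiplies by `t`. Since `A_t` has no `t`-torsion, the
vanishing descends from a large level to the level `n` of `x`. -/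
private theorem hom_homogenize_eq_zero (hP : ∀ p ∈ P, p ∈ TV.fil k V N)
    (hP0 : ∀ p ∈ P, D.hom (TV.homogenize N p) = 0) {x : TV k V} (hx : x ∈ idealOf P) {n : ℕ}
    (hn : x ∈ TV.fil k V n) : D.hom (TV.homogenize n x) = 0 := by
  obtain ⟨M, hM⟩ := eventually_hom_homogenize_eq_zero hP hP0 hx
  have h : ∀ i, D.hom (TV.homogenize (n + i) x) = 0 → D.hom (TV.homogenize n x) = 0 := by
    intro i
    induction i with
    | zero => exact id
    | succ i ih =>
      intro h
      rw [← add_assoc, TV.homogenize_succ (TV.fil_mono (Nat.le_add_right n i) hn), map_mul,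
        hom_X] at h
      exact ih (D.eq_zero_of_X_mul h)
  exact h M (hM _ (Nat.le_add_left M n))

/-- Relations of `A` lift to relations of `U`. -/
private theorem exists_lift_of_mem_idealOf (hP : ∀ p ∈ P, p ∈ TV.fil k V N) (hR : ∀ r : R.rel, ∃ p ∈ P, TV.proj N p = r)
    {y : TV k V} (hy : y ∈ idealOf (R.rel : Set (TV k V))) (n : ℕ) :
    ∃ x ∈ TV.fil k V n, x ∈ idealOf P ∧ TV.proj n x = TV.proj n y := by
  let G : AddSubgroup (TV k V) :=
    { carrier := {y | ∀ n, ∃ x ∈ TV.fil k V n, x ∈ idealOf P ∧ TV.proj n x = TV.proj n y}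
      zero_mem' := fun n => ⟨0, zero_mem _, zero_mem _, rfl⟩
      add_mem' := fun hy hy' n => by
        obtain ⟨x, h1, h2, h3⟩ := hy n
        obtain ⟨x', h1', h2', h3'⟩ := hy' n
        exact ⟨x + x', add_mem h1 h1', add_mem h2 h2', by rw [TV.proj_add, TV.proj_add, h3, h3']⟩
      neg_mem' := fun hy n => by
        obtain ⟨x, h1, h2, h3⟩ := hy n
        exact ⟨-x, neg_mem h1, neg_mem h2, by rw [TV.proj_neg, TV.proj_neg, h3]⟩ }
  refine TV.mem_of_mem_idealOf (G := G) (fun r hr n => ?_) ?_ ?_ hy n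
  · rcases eq_or_ne N n with rfl | hn
    · obtain ⟨p, hp, h⟩ := hR ⟨r, hr⟩
      exact ⟨p, hP p hp, subset_idealOf P hp, h.trans (TV.proj_eq_self (R.le r hr)).symm⟩
    · exact ⟨0, zero_mem _, zero_mem _, by rw [TV.proj_zero, TV.proj_eq_zero hn (R.le r hr)]⟩
  · intro l a ha y hy n
    rw [TV.gr_mul_of_mem_left ha]
    split_ifs with h
    · obtain ⟨x, h1, h2, h3⟩ := hy (n - l)
      have h4 := fil_mul (tpow_le_fil l ha) h1
      rw [Nat.add_sub_cancel' h] at h4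
      exact ⟨a * x, h4, Ideal.mul_mem_left _ a h2, by
        rw [TV.gr_mul_of_mem_left ha, if_pos h, h3]⟩
    · exact ⟨0, zero_mem _, zero_mem _, TV.proj_zero n⟩
  · intro l a ha y hy n
    rw [TV.gr_mul_of_mem_right ha]
    split_ifs with h
    · obtain ⟨x, h1, h2, h3⟩ := hy (n - l)
      have h4 := fil_mul h1 (tpow_le_fil l ha)
      rw [Nat.sub_add_cancel h] at h4
      exact ⟨x * a, h4, Ideal.mul_mem_right a _ h2, by
        rw [TV.gr_mul_of_mem_right ha, if_pos h, h3]⟩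
    · exact ⟨0, zero_mem _, zero_mem _, TV.proj_zero n⟩

/-- Modulo `t` the leading component of `x` is zero in `A`, so some element of `⟨P⟩` has the same
leading component. The difference lies one step lower in the filtration, and the factor `t` gained
there cancels. -/
private theorem mem_idealOf_of_hom_homogenize_eq_zero (hP : ∀ p ∈ P, p ∈ TV.fil k V N)
    (hP0 : ∀ p ∈ P, D.hom (TV.homogenize N p) = 0) (hR : ∀ r : R.rel, ∃ p ∈ P, TV.proj N p = r)
    {n : ℕ} {x : TV k V} (hn : x ∈ TV.fil k V n) (hx : D.hom (TV.homogenize n x) = 0) :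
    x ∈ idealOf P := by
  induction n generalizing x with
  | zero =>
    have h := (D.special_hom_homogenize 0 x).symm.trans ((congrArg D.special hx).trans (map_zero _))
    obtain ⟨y, h1, h2, h3⟩ := exists_lift_of_mem_idealOf hP hR ((pmk_eq_zero_iff _ _).1 h) 0
    have e : x = y := by
      rw [TV.eq_sum_proj hn, TV.eq_sum_proj h1, Finset.sum_range_one, Finset.sum_range_one, h3,
        TV.proj_proj, if_pos rfl]
    rw [e]; exact h2
  | succ n ih =>
    have h := (D.special_hom_homogenize (n + 1) x).symm.trans
      ((congrArg D.special hx).trans (map_zero _))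
    obtain ⟨y, h1, h2, h3⟩ := exists_lift_of_mem_idealOf hP hR ((pmk_eq_zero_iff _ _).1 h)
      (n + 1)
    rw [TV.proj_proj, if_pos rfl] at h3
    have h4 : x - y ∈ TV.fil k V n := TV.mem_fil_iff.2 fun m hm => by
      rcases eq_or_ne m (n + 1) with rfl | hne
      · rw [TV.proj_sub, h3, sub_self]
      · exact TV.mem_fil_iff.1 (sub_mem hn h1) m (by omega)
    have h5 : D.hom (TV.homogenize (n + 1) (x - y)) = 0 := by
      rw [map_sub, map_sub, hx, hom_homogenize_eq_zero hP hP0 h2 h1, sub_zero]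
    rw [TV.homogenize_succ h4, map_mul, hom_X] at h5
    rw [← sub_add_cancel x y]
    exact add_mem (ih h4 (D.eq_zero_of_X_mul h5)) h2

end Kernel

end GradedDeformation
end HomRel

end PBW

/-! ### The Rees algebra as a quotient of `(T_k V)[t]`, and its comparison with `A_t`. -/

namespace PBW

universe u v w

set_option linter.unusedSectionVars false

variable {k : Type u} [Ring k] {V : Type v} [AddCommGroup V] [Module k V] [Module kᵐᵒᵖ V]

namespace Rees

variable (P : Set (TV k V))

private theorem coe_t : ((t P : Rees P) : (PresAlg P)[X]) = Polynomial.X := by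
  change Polynomial.monomial 1 (pmk P 1) = _
  rw [map_one]; rfl

private theorem commute_t (x : Rees P) : Commute x (t P) := Subtype.ext <| by
  rw [Subring.coe_mul, Subring.coe_mul, coe_t]
  exact (Polynomial.X_mul (p := (x : (PresAlg P)[X]))).symm

/-- The ring homomorphism `(T_k V)[t] → R(U)`. -/
def polyHom : (TV k V)[X] →+* Rees P :=
  Polynomial.eval₂RingHom' (hom P) (t P) fun _ => commute_t P _

private theorem polyHom_C (x : TV k V) : polyHom P (Polynomial.C x) = hom P x := Polynomial.eval₂_C _ _

private theorem polyHom_X : polyHom P Polynomial.X = t P := Polynomial.eval₂_X _ _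

private theorem coe_polyHom_monomial {n : ℕ} {x : TV k V} (hx : x ∈ TV.tpow k V n) (i : ℕ) :
    (polyHom P (Polynomial.monomial i x) : (PresAlg P)[X]) =
      Polynomial.monomial (n + i) (pmk P x) := by
  rw [← Polynomial.C_mul_X_pow_eq_monomial, map_mul, map_pow, polyHom_C, polyHom_X, hom_of_mem P hx,
    Subring.coe_mul, Subring.coe_pow, coe_t]
  exact Polynomial.monomial_mul_X_pow _ _ _

private theorem coe_polyHom_homogenize {n : ℕ} {x : TV k V} (hx : x ∈ TV.fil k V n) :
    (polyHom P (TV.homogenize n x) : (PresAlg P)[X]) = Polynomial.monomial n (pmk P x) := by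
  conv_rhs => rw [TV.eq_sum_proj hx, map_sum, map_sum]
  rw [TV.homogenize_apply, map_sum, AddSubmonoidClass.coe_finsetSum]
  refine Finset.sum_congr rfl fun j hj => ?_
  have := Finset.mem_range.1 hj
  rw [coe_polyHom_monomial P (TV.proj_mem j x), show j + (n - j) = n by omega]

private theorem polyHom_surjective : Function.Surjective (polyHom P) := by
  intro y
  have h : ∀ i, ∃ x ∈ TV.fil k V i, pmk P x = (y : (PresAlg P)[X]).coeff i := fun i => y.2 i
  choose x hx hxy using h
  refine ⟨∑ i ∈ Finset.range ((y : (PresAlg P)[X]).natDegree + 1), TV.homogenize i (x i),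
    Subtype.ext ?_⟩
  rw [map_sum, AddSubmonoidClass.coe_finsetSum]
  conv_rhs => rw [Polynomial.as_sum_range (y : (PresAlg P)[X])]
  exact Finset.sum_congr rfl fun i _ => by rw [coe_polyHom_homogenize P (hx i), hxy]

private theorem coe_polyHom_sum {f : ℕ →₀ TV k V} (hf : ∀ n, f n ∈ TV.fil k V n) :
    (polyHom P (f.sum fun n x => TV.homogenize n x) : (PresAlg P)[X]) =
      ∑ n ∈ f.support, Polynomial.monomial n (pmk P (f n)) := by
  rw [Finsupp.sum, map_sum, AddSubmonoidClass.coe_finsetSum]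
  exact Finset.sum_congr rfl fun n _ => coe_polyHom_homogenize P (hf n)

private theorem mem_idealOf_of_polyHom_sum_eq_zero {f : ℕ →₀ TV k V} (hf : ∀ n, f n ∈ TV.fil k V n)
    (h : polyHom P (f.sum fun n x => TV.homogenize n x) = 0) {n : ℕ} (hn : n ∈ f.support) :
    f n ∈ idealOf P := by
  have h1 := congrArg (fun p => Polynomial.coeff p n)
    ((coe_polyHom_sum P hf).symm.trans (congrArg Subtype.val h))
  rw [Polynomial.finsetSum_coeff] at h1
  simp only [Polynomial.coeff_monomial] at h1
  rw [Finset.sum_ite_eq' f.support n, if_pos hn] at h1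
  exact (pmk_eq_zero_iff P _).1 (h1.trans (Polynomial.coeff_zero n))

end Rees

private theorem exists_ringEquiv_of_ker_eq {A B C : Type*} [Ring A] [Ring B] [Ring C] (f : A →+* B)
    (g : A →+* C) (hf : Function.Surjective f) (hg : Function.Surjective g)
    (h : ∀ z, f z = 0 ↔ g z = 0) : ∃ e : B ≃+* C, ∀ z, e (f z) = g z := by
  have h' : ∀ x y, f x = f y ↔ g x = g y := fun x y => by
    rw [← sub_eq_zero, ← map_sub, h, map_sub, sub_eq_zero]
  have hi := Function.surjInv_eq hf
  let s : B →+* C :=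
    { toFun := fun b => g (Function.surjInv hf b)
      map_one' := ((h' _ 1).1 (by rw [hi, map_one])).trans (map_one g)
      map_mul' := fun x y => ((h' _ (_ * _)).1 (by rw [hi, map_mul, hi, hi])).trans (map_mul g _ _)
      map_zero' := ((h' _ 0).1 (by rw [hi, map_zero])).trans (map_zero g)
      map_add' := fun x y =>
        ((h' _ (_ + _)).1 (by rw [hi, map_add, hi, hi])).trans (map_add g _ _) }
  refine ⟨RingEquiv.ofBijective s ⟨fun x y hxy => ?_, fun y => ?_⟩, fun z => (h' _ _).1 (hi (f z))⟩
  · have := (h' _ _).2 hxy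
    rwa [hi, hi] at this
  · obtain ⟨z, rfl⟩ := hg y
    exact ⟨f z, (h' _ _).1 (hi (f z))⟩

variable [SMulCommClass k kᵐᵒᵖ V] {N : ℕ} {R : HomRel k V N} {P : Set (TV k V)}

namespace HomRel.GradedDeformation

variable {D : R.GradedDeformation}

/-- Homogenizations at different levels are independent in both targets, so it suffices to treat one
level, where either map kills the homogenization of `x` exactly when `x ∈ ⟨P⟩`. -/
private theorem polyHom_eq_zero_iff (hP : ∀ p ∈ P, p ∈ TV.fil k V N)
    (hP0 : ∀ p ∈ P, D.hom (TV.homogenize N p) = 0) (hR : ∀ r : R.rel, ∃ p ∈ P, TV.proj N p = r)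
    (z : (TV k V)[X]) : Rees.polyHom P z = 0 ↔ D.hom z = 0 := by
  obtain ⟨f, hf, rfl⟩ := TV.exists_eq_sum_homogenize z
  constructor
  · intro h
    rw [Finsupp.sum, map_sum]
    exact Finset.sum_eq_zero fun n hn => hom_homogenize_eq_zero hP hP0
      (Rees.mem_idealOf_of_polyHom_sum_eq_zero P hf h hn) (hf n)
  · intro h
    rw [Finsupp.sum, map_sum] at h
    refine Subtype.ext ((Rees.coe_polyHom_sum P hf).trans (Finset.sum_eq_zero fun n hn => ?_))
    -- Zero is homogeneous of every degree, so any `m ≠ n` separates the summand of index `n`; below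
    -- `m = n + 1` is taken.
    have h0 : ∀ m, n ≠ m → D.hom (TV.homogenize n (f n)) = 0 := fun m hm =>
      eq_zero_of_sum_isHomogeneousOfDegree (s := f.support) (m := m)
        (y := fun n => D.toPoly (D.hom (TV.homogenize n (f n))))
        (fun n _ => D.hom_homogenize_isHomogeneousOfDegree n (f n))
        ((congrArg (R.IsHomogeneousOfDegree m) h).mpr (.zero m)) hn hm
    rw [(pmk_eq_zero_iff P _).2 (mem_idealOf_of_hom_homogenize_eq_zero hP hP0 hR (hf n)
      (h0 (n + 1) (Nat.succ_ne_self n).symm)), map_zero]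

/-- An element of `A_t` with zero constant coefficient is divisible by `t`, so the kernel of
`special ∘ Φ` is exactly `⟨t⟩`; the isomorphism `e` is the inverse of the induced map. -/
private theorem exists_modT_equiv (Φ : Rees P ≃+* D.At) (ht : Φ (Rees.t P) = D.ofPoly Polynomial.X)
    (hΦ : ∀ x, D.special (Φ (Rees.hom P x)) = R.toAlg x) :
    ∃ e : R.Alg ≃+* Rees.modT P,
      (∀ x : TV k V, e (R.toAlg x) = Ideal.Quotient.mk _ (Rees.hom P x)) ∧
      ∀ (a : R.Alg) (y : Rees P), Ideal.Quotient.mk _ y = e a → D.special (Φ y) = a := by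
  let s : Rees P →+* R.Alg := D.special.comp Φ.toRingHom
  have hs0 : ∀ y, y ∈ idealOf {Rees.t P} → s y = 0 := map_eq_zero_of_mem_idealOf s fun x hx => by
    rw [Set.mem_singleton_iff.1 hx]
    exact (congrArg D.special ht).trans Polynomial.coeff_X_zero
  let f : Rees.modT P →+* R.Alg := Ideal.Quotient.lift _ s hs0
  have hf : ∀ y, f (Ideal.Quotient.mk _ y) = s y := fun y => Ideal.Quotient.lift_mk _ _ _
  have hb : Function.Bijective f := by
    constructor
    · rw [injective_iff_map_eq_zero]
      intro q hq
      obtain ⟨y, rfl⟩ := Ideal.Quotient.mk_surjective q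
      have h1 : (D.toPoly (Φ y)).coeff 0 = 0 := (hf y).symm.trans hq
      have h2 := Polynomial.X_mul_divX_add (D.toPoly (Φ y))
      rw [h1, map_zero, add_zero] at h2
      have h3 : Φ y = D.ofPoly Polynomial.X * D.ofPoly (D.toPoly (Φ y)).divX :=
        (D.X_mul _).trans h2 |>.symm
      have h4 : y = Rees.t P * Φ.symm (D.ofPoly (D.toPoly (Φ y)).divX) :=
        Φ.injective (by rw [map_mul, ht, RingEquiv.apply_symm_apply]; exact h3)
      rw [Ideal.Quotient.eq_zero_iff_mem, h4]
      exact Ideal.mul_mem_right _ _ (subset_idealOf _ rfl)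
    · intro a
      obtain ⟨x, rfl⟩ := pmk_surjective _ a
      exact ⟨Ideal.Quotient.mk _ (Rees.hom P x), (hf _).trans (hΦ x)⟩
  refine ⟨(RingEquiv.ofBijective f hb).symm, fun x => ?_, fun a y h => ?_⟩
  · rw [RingEquiv.symm_apply_eq]
    exact ((hf _).trans (hΦ x)).symm
  · rw [RingEquiv.eq_symm_apply] at h
    exact (hf y).symm.trans h

/-- The Rees algebra of `U = T_k V / ⟨P⟩` is isomorphic to `A_t`, if the homogenizations of the
elements of `P` vanish in `A_t`. -/
private theorem reesIsomorphic (hP : ∀ p ∈ P, p ∈ TV.fil k V N)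
    (hP0 : ∀ p ∈ P, D.hom (TV.homogenize N p) = 0) (hR : ∀ r : R.rel, ∃ p ∈ P, TV.proj N p = r) :
    ReesIsomorphic R P D := by
  obtain ⟨Φ, hΦ⟩ := exists_ringEquiv_of_ker_eq (Rees.polyHom P) D.hom (Rees.polyHom_surjective P)
    D.hom_surjective (polyHom_eq_zero_iff hP hP0 hR)
  have ht : Φ (Rees.t P) = D.ofPoly Polynomial.X := by rw [← Rees.polyHom_X, hΦ, hom_X]
  refine ⟨Φ, fun c => ?_, ht, fun n x => ⟨?_, fun h => ?_⟩, exists_modT_equiv Φ ht fun x => ?_⟩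
  · have h : Rees.const P c = Rees.polyHom P (Polynomial.C (KAlg.unit c)) := by
      rw [Rees.polyHom_C]
      exact (Rees.hom_of_mem P (n := 0) ⟨c, rfl⟩).symm
    rw [h, hΦ, hom_C, base_unit]
  · rintro ⟨_, ⟨y, hy, rfl⟩, hx⟩
    have h : x = Rees.polyHom P (TV.homogenize n y) :=
      Subtype.ext (hx.trans (Rees.coe_polyHom_homogenize P hy).symm)
    rw [h, hΦ]
    exact D.hom_homogenize_isHomogeneousOfDegree n y
  · obtain ⟨z, rfl⟩ := Rees.polyHom_surjective P x
    obtain ⟨f, hf, rfl⟩ := TV.exists_eq_sum_homogenize z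
    rw [hΦ, Finsupp.sum, map_sum] at h
    have h0 : ∀ m ∈ f.support, m ≠ n → D.hom (TV.homogenize m (f m)) = 0 := fun m hm hmn =>
      eq_zero_of_sum_isHomogeneousOfDegree (s := f.support) (m := n)
        (y := fun n => D.toPoly (D.hom (TV.homogenize n (f n))))
        (fun n _ => D.hom_homogenize_isHomogeneousOfDegree n (f n)) h hm hmn
    refine ⟨pmk P (f n), ⟨f n, hf n, rfl⟩, ?_⟩
    rw [Rees.coe_polyHom_sum P hf]
    refine Finset.sum_eq_single n (fun m hm hmn => ?_) fun hn => ?_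
    · rw [(pmk_eq_zero_iff P _).2 (mem_idealOf_of_hom_homogenize_eq_zero hP hP0 hR (hf m)
        (h0 m hm hmn)), map_zero]
    · rw [Finsupp.notMem_support_iff.1 hn, map_zero, map_zero]
  · rw [← Rees.polyHom_C, hΦ, hom_C, special_base]

private theorem reesIsomorphic_relationsOf {ψ : ℕ → R.Cochain2} (hD : D.IsGivenBy ψ)
    (hψ : R.Normalized ψ) : ReesIsomorphic R (relationsOf R ψ) D :=
  reesIsomorphic (fun _ hp => (mem_fil_of_mem_relationsOf hp).1)
    (fun _ hp => hom_homogenize_relationsOf hD hψ hp) (exists_relationsOf hD hψ)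

end HomRel.GradedDeformation

/-! ### Weak PBW-deformations -/

section Weak

variable {S : SubBimod k (TV k V)} {hN : 2 ≤ N} (h : IsWeakPBW S hN)

private theorem phi_mem (j : ℕ) (r : (topPart S hN).rel) :
    phi S hN h.le_fil h.inf_fil j r ∈ TV.tpow k V j := neg_mem (TV.proj_mem j _)

private theorem weakPBW_phi : HomRel.WeakPBW (R := topPart S hN) (phi S hN h.le_fil h.inf_fil) where
  mem j _ r := phi_mem h j r
  compat := h.compat

/-- Two elements of the sub-bimodule with the same component of degree `N` differ by an element of
its intersection with `F^{N-1}`, which is zero. -/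
private theorem eq_sub_sum_phi {p : TV k V} (hp : p ∈ S) (r : (topPart S hN).rel)
    (hr : (r : TV k V) = TV.proj N p) :
    p = r - ∑ j ∈ Finset.range N, phi S hN h.le_fil h.inf_fil j r := by
  refine sub_eq_zero.1 (h.inf_fil _ (sub_mem hp (sub_phi_mem S hN h.le_fil h.inf_fil r)) ?_)
  refine TV.mem_fil_iff.2 fun m hm => ?_
  rw [TV.proj_sub, TV.proj_sub, TV.proj_sum, Finset.sum_eq_zero fun j hj =>
    TV.proj_eq_zero (by have := Finset.mem_range.1 hj; omega) (phi_mem h j r), sub_zero]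
  rcases eq_or_ne m N with rfl | hne
  · rw [TV.proj_eq_self ((topPart S hN).le r r.2), hr, sub_self]
  · rw [TV.mem_fil_iff.1 (h.le_fil p hp) m (by omega),
      TV.proj_eq_zero hne.symm ((topPart S hN).le r r.2), sub_zero]

/-- Splitting off the last letter of `r` gives a relation decomposition, on which the recursive
corrections vanish. So the constructed cochains return the maps `φ_j` they were built from, and part
(1)'s relations are those of the given weak PBW-deformation. -/
private theorem extend_psi_sigma2_gen (c : (topPart S hN).Comparison) {j : ℕ} (hj : j < N)
    (r : (topPart S hN).rel) :
    extend (HomRel.psi c h.phi (N - j)) ((topPart S hN).sigma2 (gen k _ _ r)) =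
      (topPart S hN).toAlg (phi S hN h.le_fil h.inf_fil j r) := by
  obtain ⟨m, x, v, hx, hr⟩ := HomRel.exists_sum_right_rel r
  have h1 := HomRel.extend_sigma2_gen (f := HomRel.psi c h.phi (N - j))
    (c.normalized_psi h.phi (N - j) (by omega)) hx hr
  have h2 := c.psi_sum_right h.phi (n := N - j) (by omega) hx hr
  have h3 := HomRel.relCochain_of_le h.phi (n := N - j) (by omega) (by omega)
  rw [show N - (N - j) = j by omega] at h3
  exact h1.trans (h2.trans (congrArg
    (fun f : BiHom k (topPart S hN).rel (topPart S hN).Alg => f r) h3))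

private theorem mem_relationsOf_psi (c : (topPart S hN).Comparison) {p : TV k V} (hp : p ∈ S) :
    p ∈ relationsOf (topPart S hN) (HomRel.psi c h.phi) :=
  ⟨⟨TV.proj N p, p, hp, rfl⟩, fun j => phi S hN h.le_fil h.inf_fil j _,
    fun j hj => ⟨phi_mem h j _, (extend_psi_sigma2_gen h c hj _).symm⟩,
    eq_sub_sum_phi h hp ⟨TV.proj N p, p, hp, rfl⟩ rfl⟩

private theorem reesIsomorphic_of_isWeakPBW (c : (topPart S hN).Comparison)
    {D : (topPart S hN).GradedDeformation} (hD : D.IsGivenBy (HomRel.psi c h.phi)) :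
    ReesIsomorphic (topPart S hN) S D :=
  HomRel.GradedDeformation.reesIsomorphic h.le_fil
    (fun _ hp => HomRel.GradedDeformation.hom_homogenize_relationsOf hD (c.normalized_psi h.phi)
      (mem_relationsOf_psi h c hp))
    (fun r => r.2)

end Weak

end PBW

open PBW in
theorem mainTheorem2 {F k V : Type*} [Field F] [CharZero F] [Ring k] [Nontrivial k] [Algebra F k]
    [IsSemisimpleRing k] [IsSemisimpleRing (k ⊗[F] kᵐᵒᵖ)]
    [AddCommGroup V] [Module k V] [Module kᵐᵒᵖ V] [SMulCommClass k kᵐᵒᵖ V]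
    (hV : ∀ (c : F) (v : V), algebraMap F k c • v = op (algebraMap F k c) • v)
    (N : ℕ) (hN : 2 ≤ N) :
    (∀ R : HomRel k V N, R.Tor3ConcentratedIn (N + 1) →
      ∀ (D : R.GradedDeformation) (ψ : ℕ → R.Cochain2), D.IsGivenBy ψ → R.Normalized ψ →
        ReesIsomorphic R (relationsOf R ψ) D) ∧
    (∀ (P : SubBimod k (TV k V)) (h : IsWeakPBW P hN),
      (topPart P hN).Tor3ConcentratedIn (N + 1) →
        Nonempty (topPart P hN).Comparison ∧
        ∀ c : (topPart P hN).Comparison,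
          ∃ D : (topPart P hN).GradedDeformation,
            D.IsGivenBy (HomRel.psi c h.phi) ∧ (topPart P hN).Normalized (HomRel.psi c h.phi) ∧
            ReesIsomorphic (topPart P hN) P D) := by
  refine ⟨fun R _ D ψ hD hψ => HomRel.GradedDeformation.reesIsomorphic_relationsOf hD hψ,
    fun P h hTor => ⟨HomRel.nonempty_comparison (F := F) _ hV, fun c => ?_⟩⟩
  have hD := c.deformation_isGivenBy hTor (weakPBW_phi h)
  exact ⟨c.deformation hTor (weakPBW_phi h), hD, c.normalized_psi h.phi,
    reesIsomorphic_of_isWeakPBW h c hD⟩
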